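/- **Theorem (PQ learning via TDS learning: the agnostic case).** Let $\mathcal X$ be a domain and $\mathcal C$ a nonempty class of functions $\mathcal X\to\{\pm1\}$. For distributions $\bar D^{\rm train},\bar D^{\rm test}$ on $\mathcal X\times\{\pm1\}$ with $\mathcal X$-marginals $D^{\rm train},D^{\rm test}$ put $$\lambda=\inf_{f\in\mathcal C}\Bigl(\Pr_{(x,y)\sim\bar D^{\rm train}}[f(x)\ne y]+\Pr_{(x,y)\sim\bar D^{\rm test}}[f(x)\ne y]\Bigr).$$ Let $\mathcal A$ be an agnostic TDS learner for $\mathcal C$ with error $O(\lambda)+\varepsilon$: there is a constant $A\ge1$ such that for every $\varepsilon\in(0,1)$ and all $\bar D^{\rm train},\bar D^{\rm test}$ the randomized algorithm $\mathcal A=\mathcal A_\varepsilon$, given independent labeled examples from $\bar D^{\rm train}$ and independent unlabeled points from $D^{\rm test}$, either rejects or accepts and returns a hypothesis $h:\mathcal X\to\{\pm1\}$, so that with probability at least $0.99$ both of the following hold: if it accepts, then $\Pr_{(x,y)\sim\bar D^{\rm test}}[y\ne h(x)]\le A\lambda+\varepsilon$; and if $D^{\rm train}=D^{\rm test}$, then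 it accepts. Let $m_{\mathcal A}=m_{\mathcal A}(\varepsilon)\ge 1$ be (an upper bound on) the total number of training and test samples that it uses and $T_{\mathcal A}=T_{\mathcal A}(\varepsilon)$ a bound on the time for one run (including its random bits) and for evaluating a returned hypothesis at a point. Then there is a PQ learner for $\mathcal C$, which uses $\mathcal A_\varepsilon$ as a black box, with the following properties for all inputs $\varepsilon,\eta,\delta\in(0,1)$. It receives independent labeled examples from an arbitrary $\bar D^{\rm train}$ and independent unlabeled points from the marginal of an arbitrary $\bar D^{\rm test}$, and with probability at least $1-\delta$ it outputs a hypothesis $h:\mathcal X\to\{\pm1\}$ and a selector $g:\mathcal X\to\{0,1\}$ with $$\Pr_{(x,y)\sim\bar D^{\rm test}}[y\ne h(x)\text{ and }g(x)=1]\le O\Bigl(\frac{\lambda}{\eta}+\varepsilon\Bigr),\qquad \Pr_{x\sim D^{\rm train}}[g(x)=0]\le O(\eta+\varepsilon).$$ It runs in time $$T_{\mathcal A}\cdot\widetilde O_{\varepsilon,\delta}(m_{\mathcal A}^6)+\mathrm{poly}\bigl(m_{\mathcal A},\tfrac1\varepsilon,\tfrac1\eta,\log\tfrac1\delta\bigr)$$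 and uses $\mathrm{poly}(m_{\mathcal A},\frac1\varepsilon,\frac1\eta,\log\frac1\delta)$ samples from the training and test distributions. The pair $(h,g)$ is represented so that it can be evaluated at a point, with black-box access to $\mathcal A_\varepsilon$, within the same time bound. Here $\widetilde O_{\varepsilon,\delta}$ hides factors polynomial in $\frac1\varepsilon$, $\log\frac1\delta$ and $\log m_{\mathcal A}$; $\log\frac1\delta$ and $\log m_{\mathcal A}$ in the bounds are read as $1+\log\frac1\delta$ and $1+\log m_{\mathcal A}$; and all implied constants and exponents depend on $A$ only. Time is counted on a randomized random access machine with logarithmic cost for numbers, in which a point of $\mathcal X$ occupies one memory cell and drawing a sample or a uniform random number below $n$ takes time $O(1)$ plus the cost of the operands. Every operation that involves $\mathcal A$ (a run, the evaluation of a returned hypothesis, the choice of the random bits for a run) is charged $T_{\mathcal A}$ in addition. -/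

import Mathlib

open MeasureTheory Set

universe u

noncomputable section

/-!
Labels are Booleans (`true` is `+1`, `false` is `-1`).  A labeled distribution on a domain `X` is a
probability measure on `X × Bool`; its `X`-marginal is `D.fst`.
-/

/-! ## Agnostic TDS learning -/

/-- A randomized algorithm of the TDS type (at one value of its accuracy parameter).  It reads
`nTrain` labeled examples, `nTest` unlabeled points and its internal randomness (a uniform element
of `[0,1]`, whose binary digits are an infinite sequence of fair coins).  It rejects (`none`) or
accepts and returns a hypothesis (`some h`).  The number `time` bounds the running time of the
algorithm, which includes the time for reading its random bits and for evaluating, at one point,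
a hypothesis that it has returned.  The last two fields are joint measurability of the decision
and of the prediction. -/
structure TDSAlgorithm (X : Type*) [MeasurableSpace X] where
  nTrain : ℕ
  nTest : ℕ
  time : ℕ
  run : (Fin nTrain → X × Bool) → (Fin nTest → X) → unitInterval → Option (X → Bool)
  measurable_accept : MeasurableSet
    {ω : (Fin nTrain → X × Bool) × (Fin nTest → X) × unitInterval |
      (run ω.1 ω.2.1 ω.2.2).isSome}
  measurable_predict : MeasurableSet
    {p : ((Fin nTrain → X × Bool) × (Fin nTest → X) × unitInterval) × X |
      ∃ h, run p.1.1 p.1.2.1 p.1.2.2 = some h ∧ h p.2 = true}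

/-- The total (training plus test) sample complexity, read as at least `1`. -/
def TDSAlgorithm.sampleSize {X : Type*} [MeasurableSpace X] (A : TDSAlgorithm X) : ℕ :=
  max 1 (A.nTrain + A.nTest)

/-- The law of the input and the internal randomness of a TDS algorithm. -/
def TDSAlgorithm.inputLaw {X : Type*} [MeasurableSpace X] (A : TDSAlgorithm X)
    (Dtrain Dtest : Measure (X × Bool)) :
    Measure ((Fin A.nTrain → X × Bool) × (Fin A.nTest → X) × unitInterval) :=
  (Measure.pi fun _ => Dtrain).prod ((Measure.pi fun _ => Dtest.fst).prod volume)

/-- The benchmark `λ`: the best joint training-plus-test error of a concept in `C`. -/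
def jointError {X : Type*} [MeasurableSpace X] (C : Set (X → Bool))
    (Dtrain Dtest : Measure (X × Bool)) : ℝ :=
  ⨅ f : C, (Dtrain.real {p | f.1 p.1 ≠ p.2} + Dtest.real {p | f.1 p.1 ≠ p.2})

/-- `A` is an agnostic TDS learner for `C` up to error `B * λ + ε` with probability of failure `δ`:
for all training and test distributions, with probability at least `1 - δ`, the test error is at
most `B * λ + ε` upon acceptance, and the algorithm accepts if the two marginals coincide. -/
def IsAgnosticTDSLearner {X : Type*} [MeasurableSpace X] (A : TDSAlgorithm X)
    (C : Set (X → Bool)) (B ε δ : ℝ) : Prop :=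
  ∀ (Dtrain Dtest : Measure (X × Bool)) [IsProbabilityMeasure Dtrain]
    [IsProbabilityMeasure Dtest],
    A.inputLaw Dtrain Dtest
      {ω | ¬ ((∀ h, A.run ω.1 ω.2.1 ω.2.2 = some h →
                Dtest.real {p | p.2 ≠ h p.1} ≤ B * jointError C Dtrain Dtest + ε) ∧
              (Dtrain.fst = Dtest.fst → (A.run ω.1 ω.2.1 ω.2.2).isSome))}
      ≤ ENNReal.ofReal δ

/-! ## The machine model

A random access machine with arrays of natural numbers (logarithmic cost), arrays of points of the
domain (points are atomic), hypotheses and random seeds, which can draw samples and random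
numbers and can call a TDS algorithm as a subroutine.  Its programs are built with bounded loops
only, so every program halts. -/

/-- Arithmetic expressions over the number memory: `cell a i` is the `i`-th entry of the array `a`;
subtraction is truncated and division is rounded down. -/
inductive RExpr : Type
  | const (n : ℕ) : RExpr
  | cell (a : ℕ) (i : RExpr) : RExpr
  | plus (e f : RExpr) : RExpr
  | minus (e f : RExpr) : RExpr
  | times (e f : RExpr) : RExpr
  | quot (e f : RExpr) : RExpr

/-- The value of an expression. -/
def RExpr.val (M : ℕ → ℕ → ℕ) : RExpr → ℕ
  | .const n => n
  | .cell a i => M a (i.val M)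
  | .plus e f => e.val M + f.val M
  | .minus e f => e.val M - f.val M
  | .times e f => e.val M * f.val M
  | .quot e f => e.val M / f.val M

/-- The logarithmic cost of evaluating an expression: one step plus the bit length of the value,
for each subexpression. -/
def RExpr.cost (M : ℕ → ℕ → ℕ) : RExpr → ℕ
  | .const n => 1 + n.size
  | .cell a i => 1 + (M a (i.val M)).size + i.cost M
  | .plus e f => 1 + (e.val M + f.val M).size + e.cost M + f.cost M
  | .minus e f => 1 + (e.val M - f.val M).size + e.cost M + f.cost M
  | .times e f => 1 + (e.val M * f.val M).size + e.cost M + f.cost M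
  | .quot e f => 1 + (e.val M / f.val M).size + e.cost M + f.cost M

/-- Programs.
* `assign a i e`: number cell `a[i]` becomes `e`.
* `copy a i b j`: point cell `a[i]` becomes point cell `b[j]`.
* `drawTrain a b i`: a fresh training example; its point goes to point cell `a[i]`, its label
  (as `0` or `1`) to number cell `b[i]`.
* `drawTest a i`: a fresh unlabeled test point goes to point cell `a[i]`.
* `uniform a i e`: number cell `a[i]` becomes a fresh uniformly random element of `{0, …, e - 1}`
  (and `0` if `e = 0`).
* `drawSeed i`: seed cell `i` becomes a fresh random seed for the TDS algorithm.
* `callTDS a b c s i d`: run the TDS algorithm with the training points `a[0], a[1], …`, their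
  labels `b[0], b[1], …` (nonzero is `true`), the test points `c[0], c[1], …` and the seed in seed
  cell `s`.  If it accepts, its hypothesis goes to hypothesis cell `i`, and number cell `d[i]`
  becomes `1`; if it rejects, `d[i]` becomes `0`.
* `applyHyp i a j d k`: number cell `d[k]` becomes the value (`0` or `1`) of the hypothesis in
  cell `i` at point cell `a[j]`.
* `ite e c c'`: `c` if `e` is nonzero, `c'` otherwise.
* `loop a e c`: with `n` the value of `e` at the start, run `c` exactly `n` times, where number cell
  `a[0]` is set to `0, 1, …, n - 1` before the successive rounds. -/
inductive Cmd : Type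
  | skip : Cmd
  | assign (a : ℕ) (i e : RExpr) : Cmd
  | copy (a : ℕ) (i : RExpr) (b : ℕ) (j : RExpr) : Cmd
  | drawTrain (a b : ℕ) (i : RExpr) : Cmd
  | drawTest (a : ℕ) (i : RExpr) : Cmd
  | uniform (a : ℕ) (i e : RExpr) : Cmd
  | drawSeed (i : RExpr) : Cmd
  | callTDS (a b c : ℕ) (s i : RExpr) (d : ℕ) : Cmd
  | applyHyp (i : RExpr) (a : ℕ) (j : RExpr) (d : ℕ) (k : RExpr) : Cmd
  | seq (c c' : Cmd) : Cmd
  | ite (e : RExpr) (c c' : Cmd) : Cmd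
  | loop (a : ℕ) (e : RExpr) (c : Cmd) : Cmd

/-- Programs that neither draw samples nor use randomness. -/
def Cmd.Deterministic : Cmd → Prop
  | .skip => True
  | .assign _ _ _ => True
  | .copy _ _ _ _ => True
  | .drawTrain _ _ _ => False
  | .drawTest _ _ => False
  | .uniform _ _ _ => False
  | .drawSeed _ => False
  | .callTDS _ _ _ _ _ _ => True
  | .applyHyp _ _ _ _ _ => True
  | .seq c c' => c.Deterministic ∧ c'.Deterministic
  | .ite _ c c' => c.Deterministic ∧ c'.Deterministic
  | .loop _ _ c => c.Deterministic

/-- The state of the machine: its memory, the number of samples and random numbers drawn so far, the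
number `steps` of elementary steps, and the number `calls` of operations that involve the TDS
algorithm (a run, the evaluation of one of its hypotheses, the choice of a random seed for it). -/
structure MState (X : Type*) where
  num : ℕ → ℕ → ℕ
  pt : ℕ → ℕ → X
  hyp : ℕ → X → Bool
  seed : ℕ → unitInterval
  trainDrawn : ℕ
  testDrawn : ℕ
  coinsDrawn : ℕ
  seedsDrawn : ℕ
  steps : ℕ
  calls : ℕ

/-- Write a number cell. -/
def MState.setNum {X : Type*} (s : MState X) (a i v : ℕ) : MState X :=
  { s with num := Function.update s.num a (Function.update (s.num a) i v) }

/-- Write a point cell. -/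
def MState.setPt {X : Type*} (s : MState X) (a i : ℕ) (x : X) : MState X :=
  { s with pt := Function.update s.pt a (Function.update (s.pt a) i x) }

/-- Write a hypothesis cell. -/
def MState.setHyp {X : Type*} (s : MState X) (i : ℕ) (h : X → Bool) : MState X :=
  { s with hyp := Function.update s.hyp i h }

/-- Write a seed cell. -/
def MState.setSeed {X : Type*} (s : MState X) (i : ℕ) (u : unitInterval) : MState X :=
  { s with seed := Function.update s.seed i u }

/-- Charge `n` elementary steps. -/
def MState.charge {X : Type*} (s : MState X) (n : ℕ) : MState X :=
  { s with steps := s.steps + n }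

/-- Everything that the machine draws: the training examples, the test points, the random numbers
and the seeds. -/
abbrev Tape (X : Type*) : Type _ :=
  (ℕ → X × Bool) × (ℕ → X) × (ℕ → unitInterval) × (ℕ → unitInterval)

/-- All draws are independent: training examples from `Dtrain`, test points from the marginal of
`Dtest`, random numbers and seeds uniform. -/
def tapeLaw {X : Type*} [MeasurableSpace X] (Dtrain Dtest : Measure (X × Bool))
    [IsProbabilityMeasure Dtrain] [IsProbabilityMeasure Dtest] : Measure (Tape X) :=
  (Measure.infinitePi fun _ : ℕ => Dtrain).prod
    ((Measure.infinitePi fun _ : ℕ => Dtest.fst).prod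
      ((Measure.infinitePi fun _ : ℕ => (volume : Measure unitInterval)).prod
        (Measure.infinitePi fun _ : ℕ => (volume : Measure unitInterval))))

/-- The semantics of programs, with the TDS algorithm `A` as the subroutine. -/
def Cmd.run {X : Type*} [MeasurableSpace X] (A : TDSAlgorithm X) (ω : Tape X) :
    Cmd → MState X → MState X
  | .skip => fun s => s
  | .assign a i e => fun s =>
      (s.setNum a (i.val s.num) (e.val s.num)).charge (1 + i.cost s.num + e.cost s.num)
  | .copy a i b j => fun s =>
      (s.setPt a (i.val s.num) (s.pt b (j.val s.num))).charge (1 + i.cost s.num + j.cost s.num)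
  | .drawTrain a b i => fun s =>
      { ((s.setPt a (i.val s.num) (ω.1 s.trainDrawn).1).setNum b (i.val s.num)
          (ω.1 s.trainDrawn).2.toNat).charge (1 + i.cost s.num) with
        trainDrawn := s.trainDrawn + 1 }
  | .drawTest a i => fun s =>
      { (s.setPt a (i.val s.num) (ω.2.1 s.testDrawn)).charge (1 + i.cost s.num) with
        testDrawn := s.testDrawn + 1 }
  | .uniform a i e => fun s =>
      { (s.setNum a (i.val s.num)
          (⌊(ω.2.2.1 s.coinsDrawn : ℝ) * (e.val s.num : ℝ)⌋₊ % e.val s.num)).charge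
            (1 + i.cost s.num + e.cost s.num) with
        coinsDrawn := s.coinsDrawn + 1 }
  | .drawSeed i => fun s =>
      { (s.setSeed (i.val s.num) (ω.2.2.2 s.seedsDrawn)).charge (1 + i.cost s.num) with
        seedsDrawn := s.seedsDrawn + 1
        calls := s.calls + 1 }
  | .callTDS a b c t i d => fun s =>
      let s' := { s.charge (1 + A.nTrain + A.nTest + t.cost s.num + i.cost s.num) with
        calls := s.calls + 1 }
      match A.run (fun k => (s.pt a k, decide (s.num b k ≠ 0))) (fun k => s.pt c k)
          (s.seed (t.val s.num)) with
      | some h => (s'.setHyp (i.val s.num) h).setNum d (i.val s.num) 1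
      | none => s'.setNum d (i.val s.num) 0
  | .applyHyp i a j d k => fun s =>
      { (s.setNum d (k.val s.num) (s.hyp (i.val s.num) (s.pt a (j.val s.num))).toNat).charge
          (1 + i.cost s.num + j.cost s.num + k.cost s.num) with
        calls := s.calls + 1 }
  | .seq c c' => fun s => c'.run A ω (c.run A ω s)
  | .ite e c c' => fun s =>
      if e.val s.num ≠ 0 then c.run A ω (s.charge (1 + e.cost s.num))
      else c'.run A ω (s.charge (1 + e.cost s.num))
  | .loop a e c => fun s =>
      (List.range (e.val s.num)).foldl
        (fun s k => c.run A ω ((s.setNum a 0 k).charge (1 + k.size)))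
        (s.charge (1 + e.cost s.num))

/-- The total running time: every operation that involves the TDS algorithm takes `A.time`. -/
def MState.totalTime {X : Type*} [MeasurableSpace X] (A : TDSAlgorithm X) (s : MState X) : ℕ :=
  A.time * s.calls + s.steps

/-! ## Agnostic PQ learning -/

/-- The initial state.  The array `0` of the number memory holds the two sample sizes of the TDS
algorithm and the parameters `(ε, η, δ)`, in the form `⌈1/ε⌉`, `⌈1/η⌉`, `⌈log (1/δ)⌉`; all the other
cells have default contents. -/
def startState {X : Type*} [MeasurableSpace X] [Nonempty X] (A : TDSAlgorithm X) (ε η δ : ℝ) :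
    MState X where
  num := fun a i => if a = 0 then
      ([A.nTrain, A.nTest, ⌈1 / ε⌉₊, ⌈1 / η⌉₊, ⌈Real.log (1 / δ)⌉₊] : List ℕ).getD i 0
    else 0
  pt := fun _ _ => Classical.arbitrary X
  hyp := fun _ _ => true
  seed := fun _ => 0
  trainDrawn := 0
  testDrawn := 0
  coinsDrawn := 0
  seedsDrawn := 0
  steps := 0
  calls := 0

/-- The state in which the learning program has halted. -/
def learnedState {X : Type*} [MeasurableSpace X] [Nonempty X] (learner : Cmd)
    (A : TDSAlgorithm X) (ε η δ : ℝ) (ω : Tape X) : MState X :=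
  learner.run A ω (startState A ε η δ)

/-- What a learning program outputs is its memory, which a second program interprets: to evaluate
the output at `x`, the point `x` is put into point cell `0[0]` and this program is run.  The
counters of time start anew. -/
def predictedState {X : Type*} [MeasurableSpace X] [Nonempty X] (learner predictor : Cmd)
    (A : TDSAlgorithm X) (ε η δ : ℝ) (ω : Tape X) (x : X) : MState X :=
  predictor.run A ω
    { (learnedState learner A ε η δ ω).setPt 0 0 x with steps := 0, calls := 0 }

/-- The hypothesis that has been learned: number cell `0[0]` after the evaluation. -/
def outHyp {X : Type*} [MeasurableSpace X] [Nonempty X] (learner predictor : Cmd)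
    (A : TDSAlgorithm X) (ε η δ : ℝ) (ω : Tape X) (x : X) : Bool :=
  decide ((predictedState learner predictor A ε η δ ω x).num 0 0 ≠ 0)

/-- The selector that has been learned: number cell `0[1]` after the evaluation. -/
def outSel {X : Type*} [MeasurableSpace X] [Nonempty X] (learner predictor : Cmd)
    (A : TDSAlgorithm X) (ε η δ : ℝ) (ω : Tape X) (x : X) : Bool :=
  decide ((predictedState learner predictor A ε η δ ω x).num 0 1 ≠ 0)

/-- On input `(ε, η, δ)` and with access to `A`, the pair of programs is an agnostic PQ learner for
`C` up to error `a * λ + b` and rejection rate `r`, with probability of failure `δ`: for all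
training and test distributions, with probability at least `1 - δ` it outputs a hypothesis `h` and a
selector `g` with `Pr_test [y ≠ h x and g x = 1] ≤ a * λ + b` and `Pr_train [g x = 0] ≤ r`. -/
def IsAgnosticPQLearner {X : Type*} [MeasurableSpace X] [Nonempty X] (learner predictor : Cmd)
    (A : TDSAlgorithm X) (ε η δ : ℝ) (C : Set (X → Bool)) (a b r : ℝ) : Prop :=
  ∀ (Dtrain Dtest : Measure (X × Bool)) [IsProbabilityMeasure Dtrain]
    [IsProbabilityMeasure Dtest],
    tapeLaw Dtrain Dtest
      {ω | ¬ (Dtest {p | p.2 ≠ outHyp learner predictor A ε η δ ω p.1 ∧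
                  outSel learner predictor A ε η δ ω p.1 = true}
                ≤ ENNReal.ofReal (a * jointError C Dtrain Dtest + b) ∧
              Dtrain.fst {x | outSel learner predictor A ε η δ ω x = false}
                ≤ ENNReal.ofReal r)}
      ≤ ENNReal.ofReal δ

/-- A bound of the form `Õ(m ^ 6)`, where the hidden factor is polynomial in `1/ε`, `log (1/δ)` and
`log m`. -/
def softSixth (K m : ℕ) (ε δ : ℝ) : ℝ :=
  K * (1 / ε * (1 + Real.log (1 / δ))) ^ K * (1 + Real.log m) ^ K * (m : ℝ) ^ 6

/-- A bound of the form `poly(m, 1/ε, 1/η, log (1/δ))`. -/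
def polyBound (K m : ℕ) (ε η δ : ℝ) : ℝ :=
  K * (m * (1 / ε) * (1 / η) * (1 + Real.log (1 / δ))) ^ K

end

/-!
The learner looks for a weight `w : X → [0, 1]` such that the training distribution reweighted by `w`
and the test distribution reweighted by `1 - w`, called `P` and `Q` here, satisfy two conditions: the
masses are balanced, `H * E_train w ≈ E_test (1 - w)` with `H ≈ min (1 / ε) (1 / η)`, and the TDS
algorithm accepts on samples from `P` and `Q`. The hypothesis `h` that it then returns has error at
most `B * λ(P, Q) + ε` under `Q`, where `λ` is the benchmark `jointError`. If `μ` is the mass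
`E_test (1 - w)`, then `μ * λ(P, Q)` is at most a multiple of `H * λ` by the balance
(`testMass_mul_jointError_le`). With the selector `g = {w < 1 / 2}` this bounds the error of `h` on
the selected part of the test distribution (`selected_error_le`). Since `E_train w` is at most about
`1 / H`, Markov's inequality bounds the rejection rate of `g`. The hypothesis does not matter if `μ`
is below `ε`, for then the selected part has mass `O(ε)` (`finalGood_prob`).

The weight is `min 1 (max 0 (V / q))` for an integral score `V` that changes in rounds. Progress is
measured by a convex potential with values `≥ 0` and initial value `1 / 2`, whose gradient in the
direction `e` is `H * E_train (w * e) - E_test ((1 - w) * e)`. In one round, let `a x` tell whether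
the algorithm accepts a random hybrid of samples from `P` and `Q` with `x` inserted at a random
position. The score grows by `n * (a z - a x)`, where `z` is drawn from `P` and `n` is the number of
tries that the rejection sampler for `Q` needs; its mean is `1 / μ`, so that `n` normalizes the mean
over `Q`. A second part of the update, from single tries of the two samplers, pushes the masses
towards balance. By the hybrid argument the changes of the acceptance probability telescope over the
position (`sum_acceptProbAt_sub`), so that the expected decrease of the potential is proportional to
the amount by which the acceptance probability on `(P, Q)` falls short of that on `(P, P)`, plus a
square term for the imbalance (`potential_drift`). The algorithm accepts with probability at least
`0.99` on `(P, P)` (`acceptProb_self_ge`). As the potential stays nonnegative, at a uniformly random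
time the expected drift is small, and so both conditions fail rarely (`repLaw_not_repGood_le`,
`repLaw_std_not_repGood_le`). No estimate of a probability is needed. Independent repetitions with a
majority vote bring the failure probability down to `δ` (`pi_many_bad_le`, `vote_good`).

The programs store no function on `X` except the hypotheses that the algorithm returns. A score is
recomputed from the samples and the seeds of the earlier rounds, with a run of the algorithm for each
of them (`eval_spec`); this is also how the predictor evaluates the learned pair (`predictor_spec`).
All draws are made in lockstep, so that the tape is a sequence of independent cells, of which each
sample and each round reads a block (`IsReader`, `map_repAt`). The cost rests on a syntactic bound
for the loops, the addresses and the numbers (`run_cost`). With `m` the sample size of the algorithm,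
and up to factors in `1 / ε` and `log (1 / δ)`, there are `m ^ 2` rounds of `m` samples of at most
`m` tries, and each try evaluates a score by at most `m ^ 2` runs; this makes `m ^ 6` runs in all
(`callBound_learner_le`, `callTotal_le`).
-/

noncomputable section

set_option synthInstance.maxSize 1000
set_option linter.unusedSectionVars false


/-! ### Reading independent blocks off the tape -/

/-- The sequence that starts with the first `l` terms of `a` and goes on with `b`. -/
def glueSeq {Z : Type*} (l : ℕ) (a b : ℕ → Z) : ℕ → Z :=
  fun k => if k < l then a k else b (k - l)

lemma measurable_glueSeq {Z : Type*} [MeasurableSpace Z] (l : ℕ) :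
    Measurable fun p : (ℕ → Z) × (ℕ → Z) => glueSeq l p.1 p.2 := by
  refine measurable_pi_lambda _ fun k => ?_
  by_cases h : k < l <;> simp only [glueSeq, h, if_true, if_false] <;> fun_prop

/-- The first terms of one sequence of independent draws, followed by another such sequence, again
form a sequence of independent draws. -/
lemma measurePreserving_glueSeq {Z : Type*} [MeasurableSpace Z] (ν : Measure Z)
    [IsProbabilityMeasure ν] (l : ℕ) :
    MeasurePreserving (fun p : (ℕ → Z) × (ℕ → Z) => glueSeq l p.1 p.2)
      ((Measure.infinitePi fun _ : ℕ => ν).prod (Measure.infinitePi fun _ : ℕ => ν))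
      (Measure.infinitePi fun _ : ℕ => ν) := by
  refine ⟨measurable_glueSeq l, Measure.eq_infinitePi (μ := fun _ : ℕ => ν) fun s t ht => ?_⟩
  rw [Measure.map_apply (measurable_glueSeq l)
    (MeasurableSet.pi s.countable_toSet fun i _ => ht i)]
  have hpre : (fun p : (ℕ → Z) × (ℕ → Z) => glueSeq l p.1 p.2) ⁻¹' Set.pi (s : Set ℕ) t =
      (Set.pi ((s.filter (· < l) : Finset ℕ) : Set ℕ) t) ×ˢ
      (Set.pi (((s.filter (¬ · < l)).image (· - l) : Finset ℕ) : Set ℕ) fun k => t (k + l)) := by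
    ext p
    simp only [mem_preimage, Set.mem_pi, Finset.mem_coe, mem_prod, Finset.mem_filter,
      Finset.mem_image, glueSeq]
    constructor
    · intro h
      refine ⟨fun i hi => by simpa [hi.2] using h i hi.1, ?_⟩
      rintro _ ⟨i, ⟨his, hil⟩, rfl⟩
      have := h i his
      rw [if_neg hil] at this
      rwa [Nat.sub_add_cancel (not_lt.1 hil)]
    · rintro ⟨h1, h2⟩ i hi
      split_ifs with hil
      · exact h1 i ⟨hi, hil⟩
      · have := h2 (i - l) ⟨i, ⟨hi, hil⟩, rfl⟩
        rwa [Nat.sub_add_cancel (not_lt.1 hil)] at this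
  rw [hpre, Measure.prod_prod, Measure.infinitePi_pi _ fun i _ => ht i,
    Measure.infinitePi_pi _ fun i _ => ht _, Finset.prod_image,
    ← Finset.prod_filter_mul_prod_filter_not s (· < l)]
  · congr 1
    refine Finset.prod_congr rfl fun i hi => ?_
    rw [Nat.sub_add_cancel (not_lt.1 (Finset.mem_filter.1 hi).2)]
  · intro i hi j hj h
    have hi := not_lt.1 (Finset.mem_filter.1 hi).2
    have hj := not_lt.1 (Finset.mem_filter.1 hj).2
    simp only at h
    omega

lemma measurePreserving_prodProdProdComm {α β α' β' : Type*} [MeasurableSpace α]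
    [MeasurableSpace β] [MeasurableSpace α'] [MeasurableSpace β'] (a : Measure α) (b : Measure β)
    (a' : Measure α') (b' : Measure β') [SFinite a] [SFinite b] [SFinite a'] [SFinite b'] :
    MeasurePreserving (fun p : (α × β) × (α' × β') => ((p.1.1, p.2.1), (p.1.2, p.2.2)))
      ((a.prod b).prod (a'.prod b')) ((a.prod a').prod (b.prod b')) := by
  have h1 := measurePreserving_prodAssoc a b (a'.prod b')
  have h2 := (measurePreserving_prodAssoc b a' b').symm
  have h3 : MeasurePreserving (Prod.map Prod.swap id) ((b.prod a').prod b')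
      ((a'.prod b).prod b') := Measure.measurePreserving_swap.prod (.id b')
  have h4 := measurePreserving_prodAssoc a' b b'
  have h5 := (measurePreserving_prodAssoc a a' (b.prod b')).symm
  exact h5.comp (((MeasurePreserving.id a).prod (h4.comp (h3.comp h2))).comp h1)

variable {X : Type*} [MeasurableSpace X]

/-- The tape whose first `l` draws of each kind are those of `a`, followed by those of `b`. -/
def glueTape (l : ℕ) (a b : Tape X) : Tape X :=
  (glueSeq l a.1 b.1, glueSeq l a.2.1 b.2.1, glueSeq l a.2.2.1 b.2.2.1, glueSeq l a.2.2.2 b.2.2.2)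

/-- The tape without its first `l` draws of each kind. -/
def shiftTape (l : ℕ) (a : Tape X) : Tape X :=
  (fun k => a.1 (l + k), fun k => a.2.1 (l + k), fun k => a.2.2.1 (l + k),
    fun k => a.2.2.2 (l + k))

omit [MeasurableSpace X] in
@[simp] lemma shiftTape_glueTape (l : ℕ) (a b : Tape X) : shiftTape l (glueTape l a b) = b := by
  simp [shiftTape, glueTape, glueSeq]

omit [MeasurableSpace X] in
lemma shiftTape_shiftTape (l l' : ℕ) (a : Tape X) :
    shiftTape l (shiftTape l' a) = shiftTape (l' + l) a := by
  simp [shiftTape, add_assoc]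

lemma measurable_shiftTape (l : ℕ) : Measurable (shiftTape (X := X) l) := by
  unfold shiftTape; fun_prop

lemma measurePreserving_glueTape (Dtrain Dtest : Measure (X × Bool)) [IsProbabilityMeasure Dtrain]
    [IsProbabilityMeasure Dtest] (l : ℕ) :
    MeasurePreserving (fun p : Tape X × Tape X => glueTape l p.1 p.2)
      ((tapeLaw Dtrain Dtest).prod (tapeLaw Dtrain Dtest)) (tapeLaw Dtrain Dtest) := by
  have g3 := ((measurePreserving_glueSeq (volume : Measure unitInterval) l).prod
    (measurePreserving_glueSeq (volume : Measure unitInterval) l)).comp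
      (measurePreserving_prodProdProdComm _ _ _ _)
  have g2 := ((measurePreserving_glueSeq Dtest.fst l).prod g3).comp
      (measurePreserving_prodProdProdComm _ _ _ _)
  exact ((measurePreserving_glueSeq Dtrain l).prod g2).comp
      (measurePreserving_prodProdProdComm _ _ _ _)

/-- One draw of each of the four kinds: a training example, a test point, a random number and a seed.
The programs draw in lockstep, so that the tape is to them a sequence of independent cells. -/
abbrev Cell (X : Type*) : Type _ := (X × Bool) × X × unitInterval × unitInterval

/-- The law of a cell. -/
def cellLaw (Dtrain Dtest : Measure (X × Bool)) : Measure (Cell X) :=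
  Dtrain.prod (Dtest.fst.prod ((volume : Measure unitInterval).prod
    (volume : Measure unitInterval)))

instance (Dtrain Dtest : Measure (X × Bool)) [IsProbabilityMeasure Dtrain]
    [IsProbabilityMeasure Dtest] : IsProbabilityMeasure (cellLaw Dtrain Dtest) := by
  unfold cellLaw; infer_instance

instance (Dtrain Dtest : Measure (X × Bool)) [IsProbabilityMeasure Dtrain]
    [IsProbabilityMeasure Dtest] : IsProbabilityMeasure (tapeLaw Dtrain Dtest) := by
  unfold tapeLaw; infer_instance

/-- The `k`-th cell of a tape. -/
def tapeCell (ω : Tape X) (k : ℕ) : Cell X := (ω.1 k, ω.2.1 k, ω.2.2.1 k, ω.2.2.2 k)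

omit [MeasurableSpace X] in
lemma tapeCell_shiftTape (ω : Tape X) (l k : ℕ) :
    tapeCell (shiftTape l ω) k = tapeCell ω (l + k) := rfl

/-- `r` is a function of the first `l` cells of the tape, and its law is `ν`. -/
structure IsReader {Y : Type*} [MeasurableSpace Y] (μ : Measure (Tape X)) (r : Tape X → Y) (l : ℕ)
    (ν : Measure Y) : Prop where
  measurable : Measurable r
  congr : ∀ a b : Tape X, (∀ k < l, tapeCell a k = tapeCell b k) → r a = r b
  map_eq : μ.map r = ν

variable {Dtrain Dtest : Measure (X × Bool)} [IsProbabilityMeasure Dtrain]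
  [IsProbabilityMeasure Dtest]

lemma isReader_tapeCell :
    IsReader (tapeLaw Dtrain Dtest) (fun ω => tapeCell ω 0) 1 (cellLaw Dtrain Dtest) where
  measurable := by unfold tapeCell; fun_prop
  congr a b h := h 0 one_pos
  map_eq := ((measurePreserving_eval_infinitePi (fun _ : ℕ => Dtrain) 0).prod
    ((measurePreserving_eval_infinitePi (fun _ : ℕ => Dtest.fst) 0).prod
    ((measurePreserving_eval_infinitePi (fun _ : ℕ => (volume : Measure unitInterval)) 0).prod
    (measurePreserving_eval_infinitePi (fun _ : ℕ => (volume : Measure unitInterval)) 0)))).map_eq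

omit [MeasurableSpace X] in
lemma tapeCell_glueTape_of_lt {l k : ℕ} (h : k < l) (a b : Tape X) :
    tapeCell (glueTape l a b) k = tapeCell a k := by
  simp [tapeCell, glueTape, glueSeq, h]

/-- Two readers that read disjoint parts of the tape are independent. -/
lemma IsReader.pair {Y Y' : Type*} [MeasurableSpace Y] [MeasurableSpace Y'] {r : Tape X → Y}
    {r' : Tape X → Y'} {l l' : ℕ} {ν : Measure Y} {ν' : Measure Y'}
    (h : IsReader (tapeLaw Dtrain Dtest) r l ν) (h' : IsReader (tapeLaw Dtrain Dtest) r' l' ν') :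
    IsReader (tapeLaw Dtrain Dtest) (fun ω => (r ω, r' (shiftTape l ω))) (l + l') (ν.prod ν') where
  measurable := h.measurable.prodMk (h'.measurable.comp (measurable_shiftTape l))
  congr a b hab := by
    refine Prod.ext (h.congr _ _ fun k hk => hab k (by omega)) (h'.congr _ _ fun k hk => ?_)
    simpa only [tapeCell_shiftTape] using hab (l + k) (by omega)
  map_eq := by
    rw [← (measurePreserving_glueTape Dtrain Dtest l).map_eq, Measure.map_map
      (f := fun p : Tape X × Tape X => glueTape l p.1 p.2)
      (g := fun ω => (r ω, r' (shiftTape l ω))) (h.measurable.prodMk (h'.measurable.comp (measurable_shiftTape l)))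
      (measurePreserving_glueTape Dtrain Dtest l).measurable, ← h.map_eq, ← h'.map_eq,
      Measure.map_prod_map _ _ h.measurable h'.measurable]
    congr 1
    funext p
    simp only [Function.comp_apply, shiftTape_glueTape, Prod.map]
    rw [h.congr _ p.1 fun k hk => tapeCell_glueTape_of_lt hk _ _]

/-- Reading consecutive blocks of the tape in the same way yields independent, identically
distributed results. -/
lemma IsReader.iterate {Y : Type*} [MeasurableSpace Y] {r : Tape X → Y} {l : ℕ} {ν : Measure Y}
    [IsProbabilityMeasure ν] (h : IsReader (tapeLaw Dtrain Dtest) r l ν) (n : ℕ) :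
    IsReader (tapeLaw Dtrain Dtest) (fun ω (k : Fin n) => r (shiftTape (k * l) ω)) (n * l)
      (Measure.pi fun _ => ν) := by
  induction n with
  | zero =>
    refine ⟨measurable_pi_lambda _ fun k => k.elim0, fun a b _ => funext fun k => k.elim0, ?_⟩
    refine (Measure.pi_eq fun s _ => ?_).symm
    rw [Measure.map_apply (measurable_pi_lambda _ fun k => k.elim0)
      (MeasurableSet.univ_pi fun k => k.elim0)]
    have huniv : univ.pi s = univ := eq_univ_of_forall fun f k => k.elim0
    simp [huniv]
  | succ n ih =>
    have hp := h.pair ih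
    have hm := (measurePreserving_piFinSuccAbove (fun _ : Fin (n + 1) => ν) 0).symm
    have hfun : (fun ω (k : Fin (n + 1)) => r (shiftTape (k * l) ω)) =
        (MeasurableEquiv.piFinSuccAbove (fun _ : Fin (n + 1) => Y) 0).symm ∘
          fun ω => (r ω, fun k : Fin n => r (shiftTape (k * l) (shiftTape l ω))) := by
      funext ω k
      refine Fin.cases ?_ (fun k => ?_) k
      · simp [shiftTape]
      · simp [shiftTape_shiftTape, add_mul, add_comm]
    rw [hfun]
    refine ⟨hm.measurable.comp hp.measurable, fun a b hab => ?_, ?_⟩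
    · simp only [Function.comp_apply]
      rw [hp.congr a b fun k hk => hab k (by linarith [add_mul n 1 l])]
    · rw [← Measure.map_map hm.measurable hp.measurable, hp.map_eq]
      exact hm.map_eq


/-! ### Rejection sampling -/

open Classical in
/-- The first index at which `p` holds, or the last index if `p` holds nowhere. -/
def pick {n : ℕ} (p : Fin (n + 1) → Prop) : Fin (n + 1) :=
  if h : (Finset.univ.filter p).Nonempty then (Finset.univ.filter p).min' h else Fin.last n

lemma pick_eq_iff {n : ℕ} (p : Fin (n + 1) → Prop) (i : Fin (n + 1)) :
    pick p = i ↔ (∀ j < i, ¬ p j) ∧ (p i ∨ i = Fin.last n) := by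
  classical
  have key : (∀ j < pick p, ¬ p j) ∧ (p (pick p) ∨ pick p = Fin.last n) := by
    by_cases h : (Finset.univ.filter p).Nonempty
    · have hp : pick p = (Finset.univ.filter p).min' h := by
        simp only [pick]; rw [dif_pos h]
      rw [hp]
      refine ⟨fun j hj hpj => ?_, Or.inl ?_⟩
      · exact absurd (Finset.min'_le _ j (by simpa using hpj)) (not_le.2 hj)
      · simpa using Finset.min'_mem _ h
    · have hp : pick p = Fin.last n := by simp only [pick]; rw [dif_neg h]
      rw [hp]
      exact ⟨fun j _ hpj => h ⟨j, by simpa using hpj⟩, Or.inr rfl⟩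
  constructor
  · rintro rfl
    exact key
  · rintro ⟨h1, h2⟩
    rcases lt_trichotomy (pick p) i with h | h | h
    · rcases key.2 with hp | hl
      · exact absurd hp (h1 _ h)
      · rw [hl] at h
        exact absurd (Fin.le_last i) (not_le.2 h)
    · exact h
    · rcases h2 with hp | hl
      · exact absurd hp (key.1 _ h)
      · rw [hl] at h
        exact absurd (Fin.le_last _) (not_le.2 h)

lemma le_pick_iff {n l : ℕ} (hl : l ≤ n) (p : Fin (n + 1) → Prop) :
    l ≤ (pick p : ℕ) ↔ ∀ j : Fin (n + 1), (j : ℕ) < l → ¬ p j := by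
  obtain ⟨h1, h2⟩ := (pick_eq_iff p _).1 rfl
  constructor
  · intro h j hj
    exact h1 j (Fin.lt_def.2 (by omega))
  · intro h
    by_contra hlt
    push Not at hlt
    rcases h2 with hp | hp
    · exact h _ hlt hp
    · rw [hp] at hlt
      simp at hlt
      omega

variable {Z : Type*} [MeasurableSpace Z]

lemma measurableSet_pick_eq {n : ℕ} {Ω : Type*} [MeasurableSpace Ω] {p : Ω → Fin (n + 1) → Prop}
    (hp : ∀ i, MeasurableSet {ω | p ω i}) (i : Fin (n + 1)) :
    MeasurableSet {ω | pick (p ω) = i} := by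
  simp only [pick_eq_iff]
  have h1 : MeasurableSet {ω | ∀ j < i, ¬ p ω j} := by
    simp only [ofPred_forall]
    exact MeasurableSet.iInter fun j => MeasurableSet.iInter fun _ => (hp j).compl
  exact h1.inter ((hp i).union (MeasurableSet.const _))

lemma measurable_pick {n : ℕ} {Ω : Type*} [MeasurableSpace Ω] {p : Ω → Fin (n + 1) → Prop}
    (hp : ∀ i, MeasurableSet {ω | p ω i}) : Measurable fun ω => pick (p ω) :=
  measurable_to_countable' fun i => measurableSet_pick_eq hp i

/-- The law of the first of independent draws from `ν` that passes a test which accepts `y` with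
probability `w y`, when the `n + 1`-st draw is taken regardless of the test. -/
def rejLaw {Y : Type*} [MeasurableSpace Y] (ν : Measure Y) (w : Y → ENNReal) (n : ℕ) :
    Measure Y :=
  (∑ l ∈ Finset.range n, (1 - ∫⁻ y, w y ∂ν) ^ l) • ν.withDensity w +
    (1 - ∫⁻ y, w y ∂ν) ^ n • ν

lemma prod_ite_lt_eq {n : ℕ} (i : Fin (n + 1)) (a b : ENNReal) :
    ∏ k : Fin (n + 1), (if k < i then a else if k = i then b else 1) = a ^ (i : ℕ) * b := by
  have h : ∀ k : Fin (n + 1), (if k < i then a else if k = i then b else 1) =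
      (if k < i then a else 1) * (if k = i then b else 1) := by
    intro k
    by_cases h1 : k < i
    · simp [h1, h1.ne]
    · simp [h1]
  simp_rw [h]
  rw [Finset.prod_mul_distrib, Finset.prod_ite, Finset.prod_ite_eq']
  simp [Finset.filter_gt_eq_Iio]

lemma pi_pick_eq {n : ℕ} (ζ : Measure Z) [IsProbabilityMeasure ζ] (Acc : Set Z)
    (hAcc : MeasurableSet Acc) (i : Fin (n + 1)) (B : Set Z) :
    Measure.pi (fun _ : Fin (n + 1) => ζ) {s | pick (fun k => s k ∈ Acc) = i ∧ s i ∈ B} =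
      (1 - ζ Acc) ^ (i : ℕ) * (if i = Fin.last n then ζ B else ζ (Acc ∩ B)) := by
  have h : {s : Fin (n + 1) → Z | pick (fun k => s k ∈ Acc) = i ∧ s i ∈ B} =
      Set.pi univ fun k => if k < i then Accᶜ else if k = i then
        (if i = Fin.last n then B else Acc ∩ B) else univ := by
    ext s
    simp only [pick_eq_iff, mem_ofPred_eq, Set.mem_pi, mem_univ, true_implies]
    constructor
    · rintro ⟨⟨h1, h2⟩, h3⟩ k
      split_ifs with hk hk' hl
      · exact h1 k hk
      · exact hk' ▸ h3
      · subst hk'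
        exact ⟨h2.resolve_right hl, h3⟩
      · trivial
    · intro h
      have hi := h i
      simp only [lt_irrefl, if_false, if_true] at hi
      refine ⟨⟨fun j hj => by simpa [hj] using h j, ?_⟩, ?_⟩
      · split_ifs at hi with hl
        · exact Or.inr hl
        · exact Or.inl hi.1
      · split_ifs at hi with hl
        · exact hi
        · exact hi.2
  rw [h, Measure.pi_pi, ← prod_ite_lt_eq]
  refine Finset.prod_congr rfl fun k _ => ?_
  rw [← prob_compl_eq_one_sub hAcc]
  split_ifs <;> simp

/-- The law of (a function of) the first of `n + 1` independent draws that falls into `Acc`, or of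
the last draw if none does. -/
lemma map_pick {n : ℕ} {Y : Type*} [MeasurableSpace Y] (ζ : Measure Z) [IsProbabilityMeasure ζ]
    {Acc : Set Z} (hAcc : MeasurableSet Acc) {g : Z → Y} (hg : Measurable g) :
    (Measure.pi fun _ : Fin (n + 1) => ζ).map (fun s => g (s (pick fun k => s k ∈ Acc))) =
      (∑ l ∈ Finset.range n, (1 - ζ Acc) ^ l) • (ζ.restrict Acc).map g +
        (1 - ζ Acc) ^ n • ζ.map g := by
  have hmeas : Measurable fun s : Fin (n + 1) → Z => g (s (pick fun k => s k ∈ Acc)) := by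
    refine hg.comp ?_
    exact (measurable_from_prod_countable_right (f := fun q : Fin (n + 1) × (Fin (n + 1) → Z) => q.2 q.1)
      fun i => measurable_pi_apply i).comp
      ((measurable_pick fun i => (measurable_pi_apply i) hAcc).prodMk measurable_id)
  ext B hB
  rw [Measure.map_apply hmeas hB]
  have hunion : (fun s : Fin (n + 1) → Z => g (s (pick fun k => s k ∈ Acc))) ⁻¹' B =
      ⋃ i : Fin (n + 1), {s | pick (fun k => s k ∈ Acc) = i ∧ s i ∈ g ⁻¹' B} := by
    ext s
    simp
  rw [hunion, measure_iUnion]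
  · simp_rw [pi_pick_eq ζ Acc hAcc, tsum_fintype, Fin.sum_univ_castSucc]
    have hne : ∀ i : Fin n, (Fin.castSucc i = Fin.last n) = False := fun i =>
      eq_false (Fin.castSucc_lt_last i).ne
    simp only [hne, if_false, if_true, Fin.val_castSucc, Fin.val_last, Measure.add_apply,
      Measure.smul_apply, smul_eq_mul]
    rw [Measure.map_apply hg hB, Measure.map_apply hg hB, Measure.restrict_apply (hg hB),
      ← Finset.sum_mul, Fin.sum_univ_eq_sum_range (fun l => (1 - ζ Acc) ^ l), inter_comm Acc]
  · intro i j hij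
    refine Set.disjoint_left.2 fun s hi hj => hij ?_
    exact hi.1.symm.trans hj.1
  · intro i
    exact (measurableSet_pick_eq (fun k => (measurable_pi_apply k) hAcc) i).inter
      (show MeasurableSet {s : Fin (n + 1) → Z | s i ∈ g ⁻¹' B} from measurable_pi_apply i (hg hB))

lemma pi_le_pick {n l : ℕ} (hl : l ≤ n) (ζ : Measure Z) [IsProbabilityMeasure ζ] {Acc : Set Z}
    (hAcc : MeasurableSet Acc) :
    Measure.pi (fun _ : Fin (n + 1) => ζ) {s | l ≤ (pick (fun k => s k ∈ Acc) : ℕ)} =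
      (1 - ζ Acc) ^ l := by
  have h : {s : Fin (n + 1) → Z | l ≤ (pick (fun k => s k ∈ Acc) : ℕ)} =
      Set.pi univ fun k : Fin (n + 1) => if (k : ℕ) < l then Accᶜ else univ := by
    ext s
    simp only [le_pick_iff hl, mem_ofPred_eq, Set.mem_pi, mem_univ, true_implies]
    refine forall_congr' fun k => ?_
    split_ifs with hk <;> simp [hk]
  rw [h, Measure.pi_pi]
  have : ∀ k : Fin (n + 1), ζ (if (k : ℕ) < l then Accᶜ else univ) =
      if (k : ℕ) < l then 1 - ζ Acc else 1 := by
    intro k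
    split_ifs
    · exact prob_compl_eq_one_sub hAcc
    · exact measure_univ
  simp_rw [this]
  rw [Fin.prod_univ_eq_prod_range (fun k => if k < l then 1 - ζ Acc else 1), Finset.prod_ite]
  have hf : (Finset.range (n + 1)).filter (· < l) = Finset.range l := by
    ext k; simp; omega
  simp [hf]


/-- The random element of `{0, …, n - 1}` that the machine derives from a uniform `u ∈ [0,1]`. -/
def coinVal (u : unitInterval) (n : ℕ) : ℕ := ⌊(u : ℝ) * (n : ℝ)⌋₊ % n

lemma measurable_coinVal (n : ℕ) : Measurable fun u => coinVal u n := by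
  unfold coinVal
  have h : Measurable fun u : unitInterval => ⌊(u : ℝ) * (n : ℝ)⌋₊ := by fun_prop
  exact (measurable_of_countable (fun k : ℕ => k % n)).comp h

/-- A coin with `q` sides shows a number less than `k` with probability `k / q`; only `u = 1` has to
be excluded, where the remainder in `coinVal` matters. -/
lemma volume_coinVal_lt {q k : ℕ} (hk : k ≤ q) (hq : 0 < q) :
    (volume : Measure unitInterval) {u | coinVal u q < k} = ENNReal.ofReal (k / q) := by
  have hq' : (0 : ℝ) < q := by exact_mod_cast hq
  have hk' : (k : ℝ) / q ∈ unitInterval :=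
    ⟨by positivity, by rw [div_le_one hq']; exact_mod_cast hk⟩
  rw [← unitInterval.volume_Iio (x := ⟨k / q, hk'⟩)]
  refine measure_congr ?_
  have h1 : ∀ᵐ u : unitInterval, u ≠ 1 := by
    rw [ae_iff]
    simp
  filter_upwards [h1] with u hu
  refine propext ?_
  change coinVal u q < k ↔ u < ⟨k / q, hk'⟩
  have hu1 : (u : ℝ) < 1 := lt_of_le_of_ne u.2.2 fun h => hu (Subtype.ext h)
  have hfl : ⌊(u : ℝ) * (q : ℝ)⌋₊ < q := by
    rw [Nat.floor_lt (by have := u.2.1; positivity)]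
    nlinarith
  rw [coinVal, Nat.mod_eq_of_lt hfl, Nat.floor_lt (by have := u.2.1; positivity),
    ← Subtype.coe_lt_coe, lt_div_iff₀ hq']

lemma volume_coinVal_eq {q k : ℕ} (hk : k < q) :
    (volume : Measure unitInterval) {u | coinVal u q = k} = ENNReal.ofReal (1 / q) := by
  have hq : 0 < q := by omega
  have hd : {u | coinVal u q = k} = {u | coinVal u q < k + 1} \ {u | coinVal u q < k} := by
    ext u; simp; omega
  rw [hd, measure_sdiff (fun u hu => by
    simp only [mem_ofPred_eq] at hu ⊢; omega)
    (show MeasurableSet {u | coinVal u q < k} from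
      measurable_coinVal q (measurableSet_Iio (a := k))).nullMeasurableSet (measure_ne_top _ _),
    volume_coinVal_lt hk hq, volume_coinVal_lt hk.le hq, ← ENNReal.ofReal_sub _ (by positivity)]
  congr 1
  push_cast
  ring

lemma integral_coinVal {q : ℕ} (hq : 0 < q) (f : ℕ → ℝ) :
    ∫ u : unitInterval, f (coinVal u q) = (1 / q) * ∑ k ∈ Finset.range q, f k := by
  have h : ∀ u : unitInterval, f (coinVal u q) =
      ∑ k ∈ Finset.range q, ({u | coinVal u q = k} : Set unitInterval).indicator (fun _ => f k) u := by
    intro u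
    have hu : coinVal u q < q := Nat.mod_lt _ hq
    rw [Finset.sum_eq_single (coinVal u q)]
    · simp
    · intro k _ hk
      simp [Ne.symm hk]
    · intro h
      exact absurd (Finset.mem_range.2 hu) h
  have hm : ∀ k, MeasurableSet {u : unitInterval | coinVal u q = k} := fun k =>
    measurable_coinVal q (measurableSet_singleton k)
  simp_rw [h]
  rw [integral_finsetSum _ fun k _ => (integrable_const _).indicator (hm k), Finset.mul_sum]
  refine Finset.sum_congr rfl fun k hk => ?_
  rw [integral_indicator_const _ (hm k), Measure.real, volume_coinVal_eq (Finset.mem_range.1 hk),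
    ENNReal.toReal_ofReal (by positivity), smul_eq_mul]

/-- Accepting a draw `y` with probability `t y / q` weighs its law by `t / q`. -/
lemma withDensity_coin {Y : Type*} [MeasurableSpace Y] (ν : Measure Y) [IsProbabilityMeasure ν]
    {q : ℕ} (hq : 0 < q) {t : Y → ℕ} (ht : Measurable t) (htq : ∀ y, t y ≤ q) :
    ((ν.prod (volume : Measure unitInterval)).restrict {p | coinVal p.2 q < t p.1}).map Prod.fst =
      ν.withDensity fun y => ENNReal.ofReal (t y / q) := by
  have hA : MeasurableSet {p : Y × unitInterval | coinVal p.2 q < t p.1} :=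
    measurableSet_lt ((measurable_coinVal q).comp measurable_snd) (ht.comp measurable_fst)
  ext B hB
  rw [Measure.map_apply measurable_fst hB, Measure.restrict_apply (measurable_fst hB),
    Measure.prod_apply ((measurable_fst hB).inter hA), withDensity_apply _ hB,
    ← lintegral_indicator hB]
  refine lintegral_congr fun y => ?_
  by_cases hy : y ∈ B
  · rw [indicator_of_mem hy, ← volume_coinVal_lt (htq y) hq]
    congr 1
    ext u; simp [hy]
  · rw [indicator_of_notMem hy]
    convert measure_empty (μ := (volume : Measure unitInterval))
    ext u; simp [hy]

/-- A slot of `n + 1` cells in which each cell carries a draw from `ν` and an independent coin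
yields a sample from `rejLaw`. -/
lemma map_pick_coin {Y Z : Type*} [MeasurableSpace Y] [MeasurableSpace Z] {ζ : Measure Z}
    [IsProbabilityMeasure ζ] {ν : Measure Y} [IsProbabilityMeasure ν] {φ : Z → Y × unitInterval}
    (hφ : MeasurePreserving φ ζ (ν.prod volume)) {q : ℕ} (hq : 0 < q) {t : Y → ℕ}
    (ht : Measurable t) (htq : ∀ y, t y ≤ q) (n : ℕ) :
    (Measure.pi fun _ : Fin (n + 1) => ζ).map
      (fun s => (φ (s (pick fun k => coinVal (φ (s k)).2 q < t (φ (s k)).1))).1) =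
      rejLaw ν (fun y => ENNReal.ofReal (t y / q)) n ∧
    ζ {z | coinVal (φ z).2 q < t (φ z).1} = ∫⁻ y, ENNReal.ofReal (t y / q) ∂ν := by
  have hA : MeasurableSet {p : Y × unitInterval | coinVal p.2 q < t p.1} :=
    measurableSet_lt ((measurable_coinVal q).comp measurable_snd) (ht.comp measurable_fst)
  have hAcc : MeasurableSet {z | coinVal (φ z).2 q < t (φ z).1} := hφ.measurable hA
  have hwd : (ζ.restrict {z | coinVal (φ z).2 q < t (φ z).1}).map (fun z => (φ z).1) =
      ν.withDensity fun y => ENNReal.ofReal (t y / q) := by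
    rw [← withDensity_coin ν hq ht htq, ← hφ.map_eq, Measure.restrict_map hφ.measurable hA,
      Measure.map_map measurable_fst hφ.measurable]
    rfl
  have hM : ζ {z | coinVal (φ z).2 q < t (φ z).1} = ∫⁻ y, ENNReal.ofReal (t y / q) ∂ν := by
    have := congrArg (fun μ : Measure Y => μ univ) hwd
    simpa [Measure.map_apply hφ.measurable.fst MeasurableSet.univ] using this
  refine ⟨?_, hM⟩
  have hν : ζ.map (fun z => (φ z).1) = ν := by
    have := Measure.map_map measurable_fst hφ.measurable (μ := ζ)
    rw [hφ.map_eq, ← Measure.fst, Measure.fst_prod] at this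
    exact this.symm
  have := map_pick (n := n) ζ hAcc hφ.measurable.fst
  simp only [mem_ofPred_eq] at this
  rw [this, hwd, hM, hν, rejLaw]

section rejLaw

variable {Y : Type*} [MeasurableSpace Y] {ν : Measure Y} [IsProbabilityMeasure ν] {w : Y → ℝ}

lemma lintegral_ofReal_weight (hw : Measurable w) (h0 : ∀ y, 0 ≤ w y) (h1 : ∀ y, w y ≤ 1) :
    ∫⁻ y, ENNReal.ofReal (w y) ∂ν = ENNReal.ofReal (∫ y, w y ∂ν) := by
  rw [ofReal_integral_eq_lintegral_ofReal _ (Filter.Eventually.of_forall h0)]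
  exact Integrable.of_bound hw.aestronglyMeasurable 1
    (Filter.Eventually.of_forall fun y => by rw [Real.norm_of_nonneg (h0 y)]; exact h1 y)

lemma integrable_weight (hw : Measurable w) (h0 : ∀ y, 0 ≤ w y) (h1 : ∀ y, w y ≤ 1) :
    Integrable w ν :=
  Integrable.of_bound hw.aestronglyMeasurable 1
    (Filter.Eventually.of_forall fun y => by rw [Real.norm_of_nonneg (h0 y)]; exact h1 y)

lemma integral_weight_mem (hw : Measurable w) (h0 : ∀ y, 0 ≤ w y) (h1 : ∀ y, w y ≤ 1) :
    0 ≤ ∫ y, w y ∂ν ∧ ∫ y, w y ∂ν ≤ 1 := by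
  refine ⟨integral_nonneg h0, ?_⟩
  have := integral_mono (μ := ν) (integrable_weight hw h0 h1) (integrable_const 1) h1
  simpa using this

lemma rejLaw_eq (hw : Measurable w) (h0 : ∀ y, 0 ≤ w y) (h1 : ∀ y, w y ≤ 1) (n : ℕ) :
    rejLaw ν (fun y => ENNReal.ofReal (w y)) n =
      ENNReal.ofReal (∑ l ∈ Finset.range n, (1 - ∫ y, w y ∂ν) ^ l) •
        ν.withDensity (fun y => ENNReal.ofReal (w y)) +
      ENNReal.ofReal ((1 - ∫ y, w y ∂ν) ^ n) • ν := by
  obtain ⟨hM0, hM1⟩ := integral_weight_mem (ν := ν) hw h0 h1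
  have h : 1 - ∫⁻ y, ENNReal.ofReal (w y) ∂ν = ENNReal.ofReal (1 - ∫ y, w y ∂ν) := by
    rw [lintegral_ofReal_weight hw h0 h1, ENNReal.ofReal_sub _ hM0, ENNReal.ofReal_one]
  rw [rejLaw, h, ENNReal.ofReal_sum_of_nonneg fun l _ => pow_nonneg (by linarith) _]
  simp_rw [ENNReal.ofReal_pow (sub_nonneg.2 hM1)]

lemma geom_mul_weight (M : ℝ) (n : ℕ) :
    (∑ l ∈ Finset.range n, (1 - M) ^ l) * M = 1 - (1 - M) ^ n := by
  have := geom_sum_mul (1 - M) n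
  linarith

lemma integral_rejLaw (hw : Measurable w) (h0 : ∀ y, 0 ≤ w y) (h1 : ∀ y, w y ≤ 1) (n : ℕ)
    {f : Y → ℝ} (hf : Integrable f ν) :
    ∫ y, f y ∂(rejLaw ν (fun y => ENNReal.ofReal (w y)) n) =
      (∑ l ∈ Finset.range n, (1 - ∫ y, w y ∂ν) ^ l) * ∫ y, w y * f y ∂ν +
        (1 - ∫ y, w y ∂ν) ^ n * ∫ y, f y ∂ν := by
  obtain ⟨hM0, hM1⟩ := integral_weight_mem (ν := ν) hw h0 h1
  have hwf : Integrable (fun y => w y * f y) ν := hf.bdd_mul hw.aestronglyMeasurable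
    (c := 1) (Filter.Eventually.of_forall fun y => by
      rw [Real.norm_of_nonneg (h0 y)]; exact h1 y)
  have hwd : Integrable f (ν.withDensity fun y => ENNReal.ofReal (w y)) := by
    rw [integrable_withDensity_iff hw.ennreal_ofReal
      (Filter.Eventually.of_forall fun y => ENNReal.ofReal_lt_top)]
    refine hwf.congr (Filter.Eventually.of_forall fun y => ?_)
    simp only [ENNReal.toReal_ofReal (h0 y)]
    ring
  have hs : 0 ≤ ∑ l ∈ Finset.range n, (1 - ∫ y, w y ∂ν) ^ l :=
    Finset.sum_nonneg fun l _ => pow_nonneg (by linarith) _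
  rw [rejLaw_eq hw h0 h1, integral_add_measure (hwd.smul_measure ENNReal.ofReal_ne_top)
    (hf.smul_measure ENNReal.ofReal_ne_top), integral_smul_measure, integral_smul_measure,
    ENNReal.toReal_ofReal hs, ENNReal.toReal_ofReal (pow_nonneg (by linarith) _),
    integral_withDensity_eq_integral_toReal_smul hw.ennreal_ofReal
      (Filter.Eventually.of_forall fun y => ENNReal.ofReal_lt_top)]
  simp only [smul_eq_mul]
  congr 2
  exact integral_congr_ae (Filter.Eventually.of_forall fun y => by
    simp only [ENNReal.toReal_ofReal (h0 y)])

lemma isProbabilityMeasure_rejLaw (hw : Measurable w) (h0 : ∀ y, 0 ≤ w y) (h1 : ∀ y, w y ≤ 1)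
    (n : ℕ) : IsProbabilityMeasure (rejLaw ν (fun y => ENNReal.ofReal (w y)) n) := by
  obtain ⟨hM0, hM1⟩ := integral_weight_mem (ν := ν) hw h0 h1
  refine ⟨?_⟩
  have hs : 0 ≤ ∑ l ∈ Finset.range n, (1 - ∫ y, w y ∂ν) ^ l :=
    Finset.sum_nonneg fun l _ => pow_nonneg (by linarith) _
  rw [rejLaw_eq hw h0 h1]
  simp only [Measure.add_apply, Measure.smul_apply, smul_eq_mul, measure_univ, mul_one,
    withDensity_apply _ MeasurableSet.univ, Measure.restrict_univ]
  rw [lintegral_ofReal_weight hw h0 h1, ← ENNReal.ofReal_mul hs,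
    ← ENNReal.ofReal_add (mul_nonneg hs hM0) (pow_nonneg (by linarith) _), geom_mul_weight]
  simp

lemma mul_one_sub_pow_le {M : ℝ} (h0 : 0 ≤ M) (h1 : M ≤ 1) (n : ℕ) :
    M * (1 - M) ^ n ≤ 1 / (n + 1) := by
  -- `(1 - M) ^ n ≤ (1 - M) ^ l` for `l ≤ n`, and `M * ∑ l ≤ n, (1 - M) ^ l = 1 - (1 - M) ^ (n + 1)`
  have hsum : ((n : ℝ) + 1) * (1 - M) ^ n ≤ ∑ l ∈ Finset.range (n + 1), (1 - M) ^ l := by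
    have := Finset.card_nsmul_le_sum (Finset.range (n + 1)) (fun l => (1 - M) ^ l) ((1 - M) ^ n)
      fun l hl => pow_le_pow_of_le_one (by linarith) (by linarith)
        (Nat.lt_succ_iff.1 (Finset.mem_range.1 hl))
    simpa using this
  have hg := geom_mul_weight M (n + 1)
  have hp : 0 ≤ (1 - M) ^ (n + 1) := pow_nonneg (by linarith) _
  rw [le_div_iff₀ (by positivity)]
  nlinarith

/-- Up to the mass of the weight, integrals with respect to `rejLaw` are weighted integrals; the
error is due to the samples on which all tries fail. -/
lemma abs_integral_rejLaw_sub_le (hw : Measurable w) (h0 : ∀ y, 0 ≤ w y) (h1 : ∀ y, w y ≤ 1)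
    (n : ℕ) {f : Y → ℝ} (hf : Measurable f) (hf0 : ∀ y, 0 ≤ f y) (hf1 : ∀ y, f y ≤ 1) :
    |(∫ y, w y ∂ν) * ∫ y, f y ∂(rejLaw ν (fun y => ENNReal.ofReal (w y)) n) -
      ∫ y, w y * f y ∂ν| ≤ 1 / (n + 1) := by
  obtain ⟨hM0, hM1⟩ := integral_weight_mem (ν := ν) hw h0 h1
  obtain ⟨hF0, hF1⟩ := integral_weight_mem (ν := ν) hf hf0 hf1
  have hwf0 : 0 ≤ ∫ y, w y * f y ∂ν := integral_nonneg fun y => mul_nonneg (h0 y) (hf0 y)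
  have hwf1 : ∫ y, w y * f y ∂ν ≤ ∫ y, w y ∂ν := by
    refine integral_mono (integrable_weight (hw.mul hf) (fun y => mul_nonneg (h0 y) (hf0 y))
      fun y => mul_le_one₀ (h1 y) (hf0 y) (hf1 y)) (integrable_weight hw h0 h1) fun y => ?_
    exact mul_le_of_le_one_right (h0 y) (hf1 y)
  rw [integral_rejLaw hw h0 h1 n (integrable_weight hf hf0 hf1)]
  have hg := geom_mul_weight (∫ y, w y ∂ν) n
  have hp : 0 ≤ (1 - ∫ y, w y ∂ν) ^ n := pow_nonneg (by linarith) _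
  have hb := mul_one_sub_pow_le hM0 hM1 n
  have key : (∫ y, w y ∂ν) * ((∑ l ∈ Finset.range n, (1 - ∫ y, w y ∂ν) ^ l) * ∫ y, w y * f y ∂ν +
        (1 - ∫ y, w y ∂ν) ^ n * ∫ y, f y ∂ν) - ∫ y, w y * f y ∂ν =
      (1 - ∫ y, w y ∂ν) ^ n * ((∫ y, w y ∂ν) * ∫ y, f y ∂ν - ∫ y, w y * f y ∂ν) := by
    linear_combination (∫ y, w y * f y ∂ν) * hg
  rw [key, abs_mul, abs_of_nonneg hp]
  refine le_trans ?_ hb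
  rw [mul_comm]
  refine mul_le_mul_of_nonneg_right ?_ hp
  rw [abs_le]
  constructor <;> nlinarith

/-- Up to the mass of the weight, `rejLaw` is at most twice the original law. -/
lemma rejLaw_real_le (hw : Measurable w) (h0 : ∀ y, 0 ≤ w y) (h1 : ∀ y, w y ≤ 1) (n : ℕ)
    (B : Set Y) :
    (∫ y, w y ∂ν) * (rejLaw ν (fun y => ENNReal.ofReal (w y)) n).real B ≤ 2 * ν.real B := by
  obtain ⟨hM0, hM1⟩ := integral_weight_mem (ν := ν) hw h0 h1
  have := isProbabilityMeasure_rejLaw (ν := ν) hw h0 h1 n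
  have hs : 0 ≤ ∑ l ∈ Finset.range n, (1 - ∫ y, w y ∂ν) ^ l :=
    Finset.sum_nonneg fun l _ => pow_nonneg (by linarith) _
  have hle : rejLaw ν (fun y => ENNReal.ofReal (w y)) n B ≤
      ENNReal.ofReal (∑ l ∈ Finset.range n, (1 - ∫ y, w y ∂ν) ^ l + (1 - ∫ y, w y ∂ν) ^ n) * ν B := by
    rw [rejLaw_eq hw h0 h1, ENNReal.ofReal_add hs (pow_nonneg (by linarith) _), add_mul]
    simp only [Measure.add_apply, Measure.smul_apply, smul_eq_mul]
    gcongr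
    have : ν.withDensity (fun y => ENNReal.ofReal (w y)) ≤ ν.withDensity 1 :=
      withDensity_mono (Filter.Eventually.of_forall fun y => by
        simpa using h1 y)
    rw [withDensity_one] at this
    exact this
  have hle' : (rejLaw ν (fun y => ENNReal.ofReal (w y)) n).real B ≤
      (∑ l ∈ Finset.range n, (1 - ∫ y, w y ∂ν) ^ l + (1 - ∫ y, w y ∂ν) ^ n) * ν.real B := by
    have := ENNReal.toReal_mono (ENNReal.mul_ne_top ENNReal.ofReal_ne_top (measure_ne_top _ _)) hle
    rwa [ENNReal.toReal_mul, ENNReal.toReal_ofReal (add_nonneg hs (pow_nonneg (by linarith) _))]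
      at this
  have hg := geom_mul_weight (∫ y, w y ∂ν) n
  have hp : 0 ≤ (1 - ∫ y, w y ∂ν) ^ n := pow_nonneg (by linarith) _
  have hp1 : (1 - ∫ y, w y ∂ν) ^ n ≤ 1 := pow_le_one₀ (by linarith) (by linarith)
  have hB : 0 ≤ ν.real B := measureReal_nonneg
  calc _ ≤ (∫ y, w y ∂ν) * ((∑ l ∈ Finset.range n, (1 - ∫ y, w y ∂ν) ^ l +
            (1 - ∫ y, w y ∂ν) ^ n) * ν.real B) := by gcongr
    _ = (1 - (1 - ∫ y, w y ∂ν) ^ n + (∫ y, w y ∂ν) * (1 - ∫ y, w y ∂ν) ^ n) * ν.real B := by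
        rw [← hg]; ring
    _ ≤ 2 * ν.real B := by
        refine mul_le_mul_of_nonneg_right ?_ hB
        nlinarith

/-- Where the weight is at least `1 / 2`, the law `rejLaw` is bounded below by the original law, up
to the mass of the weight and to the event that all tries fail. -/
lemma le_rejLaw_real (hw : Measurable w) (h0 : ∀ y, 0 ≤ w y) (h1 : ∀ y, w y ≤ 1) (n : ℕ)
    {B B' : Set Y} (hB' : MeasurableSet B') (hBB' : B' ⊆ B) (hB : ∀ y ∈ B', 1 / 2 ≤ w y) :
    (1 - (1 - ∫ y, w y ∂ν) ^ n) * ν.real B' ≤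
      2 * ((∫ y, w y ∂ν) * (rejLaw ν (fun y => ENNReal.ofReal (w y)) n).real B) := by
  obtain ⟨hM0, hM1⟩ := integral_weight_mem (ν := ν) hw h0 h1
  have := isProbabilityMeasure_rejLaw (ν := ν) hw h0 h1 n
  have hs : 0 ≤ ∑ l ∈ Finset.range n, (1 - ∫ y, w y ∂ν) ^ l :=
    Finset.sum_nonneg fun l _ => pow_nonneg (by linarith) _
  have hle : ENNReal.ofReal (∑ l ∈ Finset.range n, (1 - ∫ y, w y ∂ν) ^ l) *
      (ENNReal.ofReal (1 / 2) * ν B') ≤ rejLaw ν (fun y => ENNReal.ofReal (w y)) n B := by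
    rw [rejLaw_eq hw h0 h1]
    simp only [Measure.add_apply, Measure.smul_apply, smul_eq_mul]
    refine le_add_right (mul_le_mul_right ?_ _)
    calc ENNReal.ofReal (1 / 2) * ν B' = ∫⁻ y in B', ENNReal.ofReal (1 / 2) ∂ν := by
          rw [setLIntegral_const]
      _ ≤ ∫⁻ y in B', ENNReal.ofReal (w y) ∂ν :=
          setLIntegral_mono hw.ennreal_ofReal fun y hy => ENNReal.ofReal_le_ofReal (hB y hy)
      _ = ν.withDensity (fun y => ENNReal.ofReal (w y)) B' := (withDensity_apply _ hB').symm
      _ ≤ _ := measure_mono hBB'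
  have hle' := ENNReal.toReal_mono (measure_ne_top _ _) hle
  rw [ENNReal.toReal_mul, ENNReal.toReal_mul, ENNReal.toReal_ofReal hs,
    ENNReal.toReal_ofReal (by norm_num)] at hle'
  change _ * (1 / 2 * ν.real B') ≤ (rejLaw ν (fun y => ENNReal.ofReal (w y)) n).real B at hle'
  rw [← geom_mul_weight]
  nlinarith

lemma rejLaw_map {Y' : Type*} [MeasurableSpace Y'] {ν : Measure Y} {g : Y → Y'} (hg : Measurable g)
    {w : Y' → ENNReal} (hw : Measurable w) (n : ℕ) :
    (rejLaw ν (fun y => w (g y)) n).map g = rejLaw (ν.map g) w n := by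
  have hwd : (ν.withDensity fun y => w (g y)).map g = (ν.map g).withDensity w := by
    ext B hB
    rw [Measure.map_apply hg hB, withDensity_apply _ (hg hB), withDensity_apply _ hB,
      setLIntegral_map hB hw hg]
  rw [rejLaw, rejLaw, lintegral_map hw hg, Measure.map_add _ _ hg, Measure.map_smul,
    Measure.map_smul, hwd]

end rejLaw

/-- The expected number of tries, capped at `c`, of rejection sampling. -/
lemma integral_min_pick {Z : Type*} [MeasurableSpace Z] {n c : ℕ} (hc : c ≤ n + 1) (ζ : Measure Z)
    [IsProbabilityMeasure ζ] {Acc : Set Z} (hAcc : MeasurableSet Acc) :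
    ∫ s, ((min ((pick fun k => s k ∈ Acc : Fin (n + 1)) + 1 : ℕ) c : ℕ) : ℝ)
      ∂(Measure.pi fun _ : Fin (n + 1) => ζ) = ∑ l ∈ Finset.range c, (1 - ζ.real Acc) ^ l := by
  have hm : ∀ l, MeasurableSet {s : Fin (n + 1) → Z | l ≤ (pick (fun k => s k ∈ Acc) : ℕ)} :=
    fun l => (measurable_of_countable (fun i : Fin (n + 1) => (i : ℕ))).comp
      (measurable_pick fun i => (measurable_pi_apply i) hAcc) (measurableSet_Ici (a := l))
  have h : ∀ s : Fin (n + 1) → Z, ((min ((pick fun k => s k ∈ Acc : Fin (n + 1)) + 1 : ℕ) c : ℕ) : ℝ) =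
      ∑ l ∈ Finset.range c, ({s : Fin (n + 1) → Z | l ≤ (pick (fun k => s k ∈ Acc) : ℕ)} :
        Set _).indicator (fun _ => (1 : ℝ)) s := by
    intro s
    simp only [indicator_apply, mem_ofPred_eq]
    rw [Finset.sum_boole]
    congr 1
    rw [← Finset.card_range (min _ c)]
    congr 1
    ext l
    simp only [Finset.mem_range, Finset.mem_filter, lt_min_iff]
    omega
  simp_rw [h]
  rw [integral_finsetSum _ fun l _ => (integrable_const _).indicator (hm l)]
  refine Finset.sum_congr rfl fun l hl => ?_
  have hl : l ≤ n := by have := Finset.mem_range.1 hl; omega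
  rw [integral_indicator_const _ (hm l), Measure.real, pi_le_pick hl ζ hAcc, smul_eq_mul, mul_one,
    ENNReal.toReal_pow, ENNReal.toReal_sub_of_le prob_le_one ENNReal.one_ne_top]
  rfl

/-- The first try succeeds with the probability of acceptance. -/
lemma integral_pick_eq_zero {Z : Type*} [MeasurableSpace Z] {n : ℕ} (hn : 1 ≤ n) (ζ : Measure Z)
    [IsProbabilityMeasure ζ] {Acc : Set Z} (hAcc : MeasurableSet Acc) :
    ∫ s, ((1 - (pick fun k => s k ∈ Acc : Fin (n + 1)) : ℕ) : ℝ)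
      ∂(Measure.pi fun _ : Fin (n + 1) => ζ) = ζ.real Acc := by
  -- the number in question is `2` minus the number of tries, capped at `2`
  have h2 := integral_min_pick (c := 2) (by omega) ζ hAcc (n := n)
  have h : ∀ s : Fin (n + 1) → Z, ((1 - (pick fun k => s k ∈ Acc : Fin (n + 1)) : ℕ) : ℝ) =
      2 - ((min ((pick fun k => s k ∈ Acc : Fin (n + 1)) + 1 : ℕ) 2 : ℕ) : ℝ) := by
    intro s
    rcases Nat.eq_zero_or_pos ((pick fun k => s k ∈ Acc : Fin (n + 1)) : ℕ) with h | h
    · rw [h]; norm_num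
    · rw [Nat.sub_eq_zero_of_le h, min_eq_right (by omega)]; norm_num
  have hmeas : Measurable fun s : Fin (n + 1) → Z =>
      ((min ((pick fun k => s k ∈ Acc : Fin (n + 1)) + 1 : ℕ) 2 : ℕ) : ℝ) :=
    (measurable_of_countable (fun i : Fin (n + 1) => ((min ((i : ℕ) + 1) 2 : ℕ) : ℝ))).comp
      (measurable_pick fun i => (measurable_pi_apply i) hAcc)
  simp_rw [h]
  rw [integral_sub (integrable_const _), h2]
  · simp only [integral_const, probReal_univ, smul_eq_mul, Finset.sum_range_succ,
      Finset.sum_range_zero]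
    ring
  · refine Integrable.of_bound hmeas.aestronglyMeasurable 2 (Filter.Eventually.of_forall fun s => ?_)
    rw [Real.norm_of_nonneg (Nat.cast_nonneg _)]
    exact_mod_cast min_le_right _ _


/-! ### The potential -/

/-- A primitive of `r ↦ min 1 (max r 0)`. -/
def alphaPot (r : ℝ) : ℝ := (max r 0) ^ 2 / 2 - (max (r - 1) 0) ^ 2 / 2

/-- A primitive of `r ↦ min 1 (max r 0) - 1`. -/
def betaPot (r : ℝ) : ℝ := alphaPot r - r + 1 / 2

lemma alphaPot_of_nonpos {r : ℝ} (h : r ≤ 0) : alphaPot r = 0 := by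
  rw [alphaPot, max_eq_right h, max_eq_right (by linarith)]; ring

lemma alphaPot_of_mem {r : ℝ} (h : 0 ≤ r) (h' : r ≤ 1) : alphaPot r = r ^ 2 / 2 := by
  rw [alphaPot, max_eq_left h, max_eq_right (by linarith)]; ring

lemma alphaPot_of_ge {r : ℝ} (h : 1 ≤ r) : alphaPot r = r - 1 / 2 := by
  rw [alphaPot, max_eq_left (by linarith), max_eq_left (by linarith)]; ring

lemma alphaPot_nonneg (r : ℝ) : 0 ≤ alphaPot r := by
  rcases le_total r 0 with h | h
  · rw [alphaPot_of_nonpos h]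
  · rcases le_total r 1 with h' | h'
    · rw [alphaPot_of_mem h h']; positivity
    · rw [alphaPot_of_ge h']; linarith

lemma alphaPot_le (r : ℝ) : alphaPot r ≤ |r| := by
  rcases le_total r 0 with h | h
  · rw [alphaPot_of_nonpos h]; positivity
  · rw [abs_of_nonneg h]
    rcases le_total r 1 with h' | h'
    · rw [alphaPot_of_mem h h']; nlinarith
    · rw [alphaPot_of_ge h']; linarith

lemma betaPot_nonneg (r : ℝ) : 0 ≤ betaPot r := by
  rw [betaPot]
  rcases le_total r 0 with h | h
  · rw [alphaPot_of_nonpos h]; linarith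
  · rcases le_total r 1 with h' | h'
    · rw [alphaPot_of_mem h h']; nlinarith [sq_nonneg (r - 1)]
    · rw [alphaPot_of_ge h']; linarith

/-- The second-order Taylor bound for `alphaPot`, the derivative of which is `1`-Lipschitz. -/
lemma alphaPot_add_le (r h : ℝ) :
    alphaPot (r + h) ≤ alphaPot r + min 1 (max r 0) * h + h ^ 2 / 2 := by
  rcases le_total r 0 with h0 | h0
  · rw [alphaPot_of_nonpos h0, max_eq_right h0, min_eq_right zero_le_one]
    rcases le_total (r + h) 0 with h1 | h1
    · rw [alphaPot_of_nonpos h1]; nlinarith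
    · rcases le_total (r + h) 1 with h2 | h2
      · rw [alphaPot_of_mem h1 h2]; nlinarith
      · rw [alphaPot_of_ge h2]; nlinarith [sq_nonneg (h - 1)]
  · rw [max_eq_left h0]
    rcases le_total r 1 with h0' | h0'
    · rw [alphaPot_of_mem h0 h0', min_eq_right h0']
      rcases le_total (r + h) 0 with h1 | h1
      · rw [alphaPot_of_nonpos h1]; nlinarith [sq_nonneg (r + h)]
      · rcases le_total (r + h) 1 with h2 | h2
        · rw [alphaPot_of_mem h1 h2]; nlinarith
        · rw [alphaPot_of_ge h2]; nlinarith [sq_nonneg (r + h - 1)]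
    · rw [alphaPot_of_ge h0', min_eq_left h0']
      rcases le_total (r + h) 0 with h1 | h1
      · rw [alphaPot_of_nonpos h1]; nlinarith [sq_nonneg (h + 1)]
      · rcases le_total (r + h) 1 with h2 | h2
        · rw [alphaPot_of_mem h1 h2]; nlinarith
        · rw [alphaPot_of_ge h2]; nlinarith

lemma continuous_alphaPot : Continuous alphaPot := by unfold alphaPot; fun_prop

lemma continuous_betaPot : Continuous betaPot := by
  unfold betaPot; exact (continuous_alphaPot.sub continuous_id).add continuous_const

variable {X : Type*} [MeasurableSpace X]

/-- The number of the `q` units of weight that a point with the integral score `V x` receives in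
the training distribution; the remaining units are its weight in the test distribution. -/
def units (q : ℕ) (V : X → ℤ) (x : X) : ℕ := min q (V x).toNat

omit [MeasurableSpace X] in
lemma units_le (q : ℕ) (V : X → ℤ) (x : X) : units q V x ≤ q := min_le_left _ _

omit [MeasurableSpace X] in
lemma units_div {q : ℕ} (hq : 0 < q) (V : X → ℤ) (x : X) :
    (units q V x : ℝ) / q = min 1 (max ((V x : ℝ) / q) 0) := by
  have hq' : (0 : ℝ) < q := by exact_mod_cast hq
  have h : (((V x).toNat : ℕ) : ℝ) = max (V x : ℝ) 0 := by
    have := Int.toNat_eq_max (V x)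
    exact_mod_cast congrArg (fun z : ℤ => (z : ℝ)) this
  rw [units, Nat.cast_min, h, ← min_div_div_right hq'.le, div_self hq'.ne',
    ← max_div_div_right hq'.le, zero_div]

/-- The potential of a score: `H * E_train [α (V / q)] + E_test [β (V / q)]`. -/
def potential (D D' : Measure X) (H q : ℕ) (V : X → ℤ) : ℝ :=
  H * ∫ x, alphaPot (V x / q) ∂D + ∫ x, betaPot (V x / q) ∂D'

lemma potential_nonneg (D D' : Measure X) (H q : ℕ) (V : X → ℤ) : 0 ≤ potential D D' H q V :=
  add_nonneg (mul_nonneg (Nat.cast_nonneg _) (integral_nonneg fun _ => alphaPot_nonneg _))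
    (integral_nonneg fun _ => betaPot_nonneg _)

lemma potential_zero (D D' : Measure X) [IsProbabilityMeasure D'] (H q : ℕ) :
    potential D D' H q (fun _ => 0) = 1 / 2 := by
  simp [potential, betaPot, alphaPot_of_nonpos le_rfl]

lemma integrable_of_abs_le {Y : Type*} [MeasurableSpace Y] {ν : Measure Y} [IsFiniteMeasure ν]
    {f : Y → ℝ} (hf : Measurable f) {C : ℝ} (h : ∀ y, |f y| ≤ C) : Integrable f ν :=
  Integrable.of_bound hf.aestronglyMeasurable C (Filter.Eventually.of_forall h)

lemma abs_betaPot_le (r : ℝ) : |betaPot r| ≤ 2 * |r| + 1 := by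
  rw [abs_of_nonneg (betaPot_nonneg r), betaPot]
  have := alphaPot_le r
  have := neg_abs_le r
  linarith

lemma abs_alphaPot_le (r : ℝ) : |alphaPot r| ≤ 2 * |r| + 1 := by
  rw [abs_of_nonneg (alphaPot_nonneg r)]
  have := alphaPot_le r
  have := abs_nonneg r
  linarith

section

variable {D D' : Measure X} [IsProbabilityMeasure D] [IsProbabilityMeasure D'] {H q : ℕ}
  {V : X → ℤ}

lemma measurable_score_div (hV : Measurable V) (q : ℕ) : Measurable fun x => (V x : ℝ) / q :=
  ((measurable_of_countable (fun k : ℤ => (k : ℝ))).comp hV).div_const _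

omit [MeasurableSpace X] in
lemma abs_score_div_le {C : ℕ} (hC : ∀ x, |V x| ≤ C) (x : X) : |(V x : ℝ) / q| ≤ C := by
  rw [abs_div, Nat.abs_cast]
  have h : |(V x : ℝ)| ≤ C := by exact_mod_cast hC x
  rcases Nat.eq_zero_or_pos q with h0 | h0
  · rw [h0]; simp
  · exact (div_le_self (abs_nonneg _) (by exact_mod_cast h0)).trans h

lemma integrable_alphaPot (hV : Measurable V) {C : ℕ} (hC : ∀ x, |V x| ≤ C) :
    Integrable (fun x => alphaPot (V x / q)) D :=
  integrable_of_abs_le (continuous_alphaPot.measurable.comp (measurable_score_div hV q))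
    (C := 2 * C + 1) fun x => (abs_alphaPot_le _).trans (by have := abs_score_div_le (q := q) hC x; linarith)

lemma integrable_betaPot (hV : Measurable V) {C : ℕ} (hC : ∀ x, |V x| ≤ C) :
    Integrable (fun x => betaPot (V x / q)) D :=
  integrable_of_abs_le (continuous_betaPot.measurable.comp (measurable_score_div hV q))
    (C := 2 * C + 1) fun x => (abs_betaPot_le _).trans (by have := abs_score_div_le (q := q) hC x; linarith)

lemma measurable_units (hV : Measurable V) (q : ℕ) : Measurable (units q V) :=
  (measurable_of_countable fun k : ℤ => min q k.toNat).comp hV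

lemma potential_le (hV : Measurable V) {C : ℕ} (hC : ∀ x, |V x| ≤ C) :
    |potential D D' H q V| ≤ (H + 1) * (2 * C + 1) := by
  rw [abs_of_nonneg (potential_nonneg _ _ _ _ _), potential]
  have h1 : ∫ x, alphaPot (V x / q) ∂D ≤ 2 * C + 1 := by
    have := integral_mono (μ := D) (integrable_alphaPot hV hC (q := q)) (integrable_const (2 * (C : ℝ) + 1))
      fun x => (le_abs_self _).trans ((abs_alphaPot_le _).trans (by
        have := abs_score_div_le (q := q) hC x; linarith))
    simpa using this
  have h2 : ∫ x, betaPot (V x / q) ∂D' ≤ 2 * C + 1 := by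
    have := integral_mono (μ := D') (integrable_betaPot hV hC (q := q)) (integrable_const (2 * (C : ℝ) + 1))
      fun x => (le_abs_self _).trans ((abs_betaPot_le _).trans (by
        have := abs_score_div_le (q := q) hC x; linarith))
    simpa using this
  have : (H : ℝ) * ∫ x, alphaPot (V x / q) ∂D ≤ H * (2 * C + 1) := by gcongr
  linarith

/-- Second-order upper bound for the change of the potential under an update of the score. -/
lemma potential_add_le (hq : 0 < q) (hV : Measurable V) {C : ℕ} (hC : ∀ x, |V x| ≤ C)
    {e : X → ℤ} (he : Measurable e) {G : ℕ} (hG : ∀ x, |e x| ≤ G) :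
    potential D D' H q (fun x => V x + e x) ≤ potential D D' H q V +
      (1 / q) * (H * ∫ x, (units q V x : ℝ) / q * e x ∂D -
        ∫ x, (1 - (units q V x : ℝ) / q) * e x ∂D') + (H + 1) * (G : ℝ) ^ 2 / (2 * q ^ 2) := by
  have hq' : (0 : ℝ) < q := by exact_mod_cast hq
  have hVe : ∀ x, |V x + e x| ≤ ((C + G : ℕ) : ℤ) := fun x => by
    push_cast; exact (abs_add_le _ _).trans (add_le_add (hC x) (hG x))
  have hVem : Measurable fun x => V x + e x := hV.add he
  have hu0 : ∀ x, 0 ≤ (units q V x : ℝ) / q := fun x => by positivity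
  have hu1 : ∀ x, (units q V x : ℝ) / q ≤ 1 := fun x => by
    rw [div_le_one hq']; exact_mod_cast units_le q V x
  have hum : Measurable fun x => (units q V x : ℝ) / q :=
    ((measurable_of_countable (fun k : ℕ => (k : ℝ))).comp (measurable_units hV q)).div_const _
  have hem : Measurable fun x => (e x : ℝ) := (measurable_of_countable (fun k : ℤ => (k : ℝ))).comp he
  have heG : ∀ x, |(e x : ℝ)| ≤ G := fun x => by exact_mod_cast hG x
  have hsq : ∀ x, ((e x : ℝ) / q) ^ 2 / 2 ≤ (G : ℝ) ^ 2 / (2 * q ^ 2) := fun x => by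
    have h : (e x : ℝ) ^ 2 ≤ (G : ℝ) ^ 2 := sq_le_sq' (neg_le_of_abs_le (heG x)) (le_of_abs_le (heG x))
    rw [div_pow, div_div, mul_comm ((q : ℝ) ^ 2)]
    exact div_le_div_of_nonneg_right h (by positivity)
  have hi1 : ∀ ν : Measure X, IsProbabilityMeasure ν →
      Integrable (fun x => (units q V x : ℝ) / q * e x) ν := fun ν _ =>
    integrable_of_abs_le (hum.mul hem) (C := G) fun x => by
      rw [abs_mul, abs_of_nonneg (hu0 x)]
      exact (mul_le_of_le_one_left (abs_nonneg _) (hu1 x)).trans (heG x)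
  have hi2 : Integrable (fun x => (1 - (units q V x : ℝ) / q) * e x) D' :=
    integrable_of_abs_le ((measurable_const.sub hum).mul hem) (C := G) fun x => by
      rw [abs_mul, abs_of_nonneg (sub_nonneg.2 (hu1 x))]
      exact (mul_le_of_le_one_left (abs_nonneg _) (by linarith [hu0 x])).trans (heG x)
  have hα : ∫ x, alphaPot ((V x + e x : ℤ) / q) ∂D ≤ ∫ x, alphaPot (V x / q) ∂D +
      (1 / q) * ∫ x, (units q V x : ℝ) / q * e x ∂D + (G : ℝ) ^ 2 / (2 * q ^ 2) := by
    have h3 : Integrable (fun x => alphaPot (V x / q) + (1 / q) * ((units q V x : ℝ) / q * e x)) D :=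
      (integrable_alphaPot hV hC).add ((hi1 D inferInstance).const_mul _)
    have := integral_mono (μ := D) (integrable_alphaPot hVem hVe (q := q))
      (h3.add (integrable_const ((G : ℝ) ^ 2 / (2 * q ^ 2)))) fun x => by
        have := alphaPot_add_le ((V x : ℝ) / q) (e x / q)
        rw [← units_div hq] at this
        have hs := hsq x
        simp only [Pi.add_apply]
        push_cast
        rw [add_div]
        have : (units q V x : ℝ) / q * (e x / q) = 1 / q * ((units q V x : ℝ) / q * e x) := by ring
        linarith
    simp only [Pi.add_apply] at this
    rw [integral_add h3 (integrable_const _), integral_add (integrable_alphaPot hV hC)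
      ((hi1 D inferInstance).const_mul _), integral_const_mul] at this
    simpa using this
  have hβ : ∫ x, betaPot ((V x + e x : ℤ) / q) ∂D' ≤ ∫ x, betaPot (V x / q) ∂D' -
      (1 / q) * ∫ x, (1 - (units q V x : ℝ) / q) * e x ∂D' + (G : ℝ) ^ 2 / (2 * q ^ 2) := by
    have h3 : Integrable (fun x => betaPot (V x / q) - (1 / q) * ((1 - (units q V x : ℝ) / q) * e x)) D' :=
      (integrable_betaPot hV hC).sub (hi2.const_mul _)
    have := integral_mono (μ := D') (integrable_betaPot hVem hVe (q := q))
      (h3.add (integrable_const ((G : ℝ) ^ 2 / (2 * q ^ 2)))) fun x => by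
        have := alphaPot_add_le ((V x : ℝ) / q) (e x / q)
        rw [← units_div hq] at this
        have hs := hsq x
        simp only [Pi.add_apply, betaPot]
        push_cast
        rw [add_div]
        have : (units q V x : ℝ) / q * (e x / q) = 1 / q * ((units q V x : ℝ) / q * e x) := by ring
        have : 1 / (q : ℝ) * ((1 - (units q V x : ℝ) / q) * e x) =
          e x / q - 1 / q * ((units q V x : ℝ) / q * e x) := by ring
        linarith
    simp only [Pi.add_apply] at this
    rw [integral_add h3 (integrable_const _), integral_sub (integrable_betaPot hV hC)
      (hi2.const_mul _), integral_const_mul] at this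
    simpa using this
  have hHα : (H : ℝ) * ∫ x, alphaPot ((V x + e x : ℤ) / q) ∂D ≤ H * (∫ x, alphaPot (V x / q) ∂D +
      (1 / q) * ∫ x, (units q V x : ℝ) / q * e x ∂D + (G : ℝ) ^ 2 / (2 * q ^ 2)) := by gcongr
  simp only [potential]
  calc _ ≤ H * (∫ x, alphaPot (V x / q) ∂D +
      (1 / q) * ∫ x, (units q V x : ℝ) / q * e x ∂D + (G : ℝ) ^ 2 / (2 * q ^ 2)) +
      (∫ x, betaPot (V x / q) ∂D' -
      (1 / q) * ∫ x, (1 - (units q V x : ℝ) / q) * e x ∂D' + (G : ℝ) ^ 2 / (2 * q ^ 2)) :=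
        add_le_add hHα hβ
    _ = _ := by ring
end


/-! ### One round of the boosting process -/

/-- The cells from which one sample is drawn. -/
abbrev Slot (X : Type*) (n : ℕ) : Type _ := Fin (n + 1) → Cell X

section samples

variable {X : Type*} {n : ℕ}

/-- The cell of a slot that provides a training example, when a point `x` is accepted with
probability `t x / q`. -/
def trainPick (q : ℕ) (t : X → ℕ) (s : Slot X n) : Fin (n + 1) :=
  pick fun k => coinVal (s k).2.2.1 q < t (s k).1.1

/-- The cell of a slot that provides a test point, when a point `x` is accepted with probability
`1 - t x / q`. -/
def testPick (q : ℕ) (t : X → ℕ) (s : Slot X n) : Fin (n + 1) :=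
  pick fun k => coinVal (s k).2.2.1 q < q - t (s k).2.1

/-- The training example that a slot provides. -/
def trainSample (q : ℕ) (t : X → ℕ) (s : Slot X n) : X × Bool := (s (trainPick q t s)).1

/-- The test point that a slot provides. -/
def testSample (q : ℕ) (t : X → ℕ) (s : Slot X n) : X := (s (testPick q t s)).2.1

/-- Test points of which the first `j` are drawn from the reweighted training distribution and the
others from the reweighted test distribution. -/
def hybridSample {b : ℕ} (q : ℕ) (t : X → ℕ) (j : ℕ) (s : Fin b → Slot X n) : Fin b → X :=
  fun k => if (k : ℕ) < j then (trainSample q t (s k)).1 else testSample q t (s k)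

end samples

/-- The cells that one round reads: one that provides a position and a seed, and the slots for a
reference point, for the training examples, for the test points and for the number of tries. -/
abbrev Round (X : Type*) (a b n : ℕ) : Type _ :=
  Cell X × Slot X n × (Fin a → Slot X n) × (Fin b → Slot X n) × Slot X n

/-- `1` if the algorithm accepts when `x` takes the place of the `j`-th test point, and `0` if it
rejects. -/
def acceptsAt {X : Type*} [MeasurableSpace X] (A : TDSAlgorithm X) (tr : Fin A.nTrain → X × Bool)
    (te : Fin A.nTest → X) (j : ℕ) (u : unitInterval) (x : X) : ℕ :=
  (A.run tr (fun k => if (k : ℕ) = j then x else te k) u).isSome.toNat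

/-- The parameters of the boosting process: a sample is drawn in at most `last + 1` tries; the
multiplicity of a round is the number of tries of one sample, capped at `cap`; `weight` is the step
size of the updates that balance `ratio` times the mass of the reweighted training distribution
against that of the reweighted test distribution; weights are multiples of `1 / res`. -/
structure Tuning where
  last : ℕ
  cap : ℕ
  weight : ℕ
  ratio : ℕ
  res : ℕ

/-- The change of the score in one round. -/
def roundUpdate {X : Type*} [MeasurableSpace X] (A : TDSAlgorithm X) (P : Tuning) (V : X → ℤ)
    (c : Round X A.nTrain A.nTest P.last) (x : X) : ℤ :=
  let t := units P.res V
  let j := coinVal c.1.2.2.1 (A.nTest + 1)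
  let acc := acceptsAt A (fun k => trainSample P.res t (c.2.2.1 k))
    (hybridSample P.res t j c.2.2.2.1) j c.1.2.2.2
  (min ((testPick P.res t c.2.2.2.2 : ℕ) + 1) P.cap : ℕ) *
      ((acc (trainSample P.res t c.2.1).1 : ℤ) - acc x) +
    P.weight * (1 - (testPick P.res t c.2.2.2.2 : ℕ) : ℕ) -
    P.weight * P.ratio * (1 - (trainPick P.res t c.2.1 : ℕ) : ℕ)

lemma abs_roundUpdate_le {X : Type*} [MeasurableSpace X] (A : TDSAlgorithm X) (P : Tuning)
    (V : X → ℤ) (c : Round X A.nTrain A.nTest P.last) (x : X) :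
    |roundUpdate A P V c x| ≤ (P.cap + P.weight * (1 + P.ratio) : ℕ) := by
  unfold roundUpdate
  extract_lets t j acc
  have h1 : |(acc (trainSample P.res t c.2.1).1 : ℤ) - acc x| ≤ 1 := by
    have h0 : acc x ≤ 1 := Bool.toNat_le _
    have h0' : acc (trainSample P.res t c.2.1).1 ≤ 1 := Bool.toNat_le _
    rw [abs_le]
    constructor <;> omega
  have hn : |((min ((testPick P.res t c.2.2.2.2 : ℕ) + 1) P.cap : ℕ) : ℤ)| ≤ P.cap := by
    rw [Nat.abs_cast]
    exact_mod_cast min_le_right _ _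
  have h2 : ((1 - (testPick P.res t c.2.2.2.2 : ℕ) : ℕ) : ℤ) ≤ 1 := by omega
  have h3 : ((1 - (trainPick P.res t c.2.1 : ℕ) : ℕ) : ℤ) ≤ 1 := by omega
  have h4 : (P.weight : ℤ) * (1 - (testPick P.res t c.2.2.2.2 : ℕ) : ℕ) ≤ P.weight :=
    mul_le_of_le_one_right (by positivity) h2
  have h5 : (P.weight : ℤ) * P.ratio * (1 - (trainPick P.res t c.2.1 : ℕ) : ℕ) ≤
      P.weight * P.ratio := mul_le_of_le_one_right (by positivity) h3
  have h6 : |((min ((testPick P.res t c.2.2.2.2 : ℕ) + 1) P.cap : ℕ) : ℤ) *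
      ((acc (trainSample P.res t c.2.1).1 : ℤ) - acc x)| ≤ P.cap := by
    rw [abs_mul]
    calc _ ≤ (P.cap : ℤ) * 1 := mul_le_mul hn h1 (abs_nonneg _) (by positivity)
      _ = _ := mul_one _
  have h7 : (0 : ℤ) ≤ P.weight * (1 - (testPick P.res t c.2.2.2.2 : ℕ) : ℕ) := by positivity
  have h8 : (0 : ℤ) ≤ P.weight * P.ratio * (1 - (trainPick P.res t c.2.1 : ℕ) : ℕ) := by positivity
  rw [abs_le] at h6 ⊢
  push_cast at h4 h5 h6 h7 h8 ⊢
  constructor <;> linarith [h6.1, h6.2]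

/-! ### Measurability of the data of a round -/

section measurability

variable {X Ω : Type*} [MeasurableSpace X] [MeasurableSpace Ω] {n : ℕ}

lemma Measurable.apply_countable {ι Z : Type*} [Countable ι] [MeasurableSpace ι]
    [MeasurableSingletonClass ι] [MeasurableSpace Z] {f : Ω → ι → Z} (hf : ∀ i, Measurable fun ω => f ω i)
    {g : Ω → ι} (hg : Measurable g) : Measurable fun ω => f ω (g ω) := by
  have h : Measurable fun p : ι × Ω => f p.2 p.1 := measurable_from_prod_countable_right hf
  exact h.comp (hg.prodMk measurable_id)

lemma measurable_units_comp {q : ℕ} {V : Ω → X → ℤ} (hV : Measurable fun p : Ω × X => V p.1 p.2)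
    {x : Ω → X} (hx : Measurable x) : Measurable fun ω => units q (V ω) (x ω) :=
  (measurable_of_countable fun k : ℤ => min q k.toNat).comp (hV.comp (measurable_id.prodMk hx))

variable {q : ℕ} {V : Ω → X → ℤ} {s : Ω → Slot X n}

lemma measurable_trainPick (hV : Measurable fun p : Ω × X => V p.1 p.2) (hs : Measurable s) :
    Measurable fun ω => trainPick q (units q (V ω)) (s ω) := by
  refine measurable_pick fun i => ?_
  have hi : Measurable fun ω => s ω i := (measurable_pi_apply i).comp hs
  exact measurableSet_lt ((measurable_coinVal q).comp hi.snd.snd.fst)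
    (measurable_units_comp hV hi.fst.fst)

lemma measurable_testPick (hV : Measurable fun p : Ω × X => V p.1 p.2) (hs : Measurable s) :
    Measurable fun ω => testPick q (units q (V ω)) (s ω) := by
  refine measurable_pick fun i => ?_
  have hi : Measurable fun ω => s ω i := (measurable_pi_apply i).comp hs
  exact measurableSet_lt ((measurable_coinVal q).comp hi.snd.snd.fst)
    ((measurable_of_countable fun k => q - k).comp (measurable_units_comp hV hi.snd.fst))

lemma measurable_trainSample (hV : Measurable fun p : Ω × X => V p.1 p.2) (hs : Measurable s) :
    Measurable fun ω => trainSample q (units q (V ω)) (s ω) :=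
  (Measurable.apply_countable (fun i => (measurable_pi_apply i).comp hs)
    (measurable_trainPick hV hs)).fst

lemma measurable_testSample (hV : Measurable fun p : Ω × X => V p.1 p.2) (hs : Measurable s) :
    Measurable fun ω => testSample q (units q (V ω)) (s ω) :=
  (Measurable.apply_countable (fun i => (measurable_pi_apply i).comp hs)
    (measurable_testPick hV hs)).snd.fst

lemma measurable_hybridSample {b : ℕ} {j : Ω → ℕ} {s : Ω → Fin b → Slot X n}
    (hV : Measurable fun p : Ω × X => V p.1 p.2) (hs : Measurable s) (hj : Measurable j) :
    Measurable fun ω => hybridSample q (units q (V ω)) (j ω) (s ω) := by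
  refine measurable_pi_lambda _ fun k => ?_
  have hk : Measurable fun ω => s ω k := (measurable_pi_apply k).comp hs
  exact Measurable.ite (measurableSet_lt measurable_const hj) (measurable_trainSample hV hk).fst
    (measurable_testSample hV hk)

lemma measurable_isSome_run (A : TDSAlgorithm X) :
    Measurable fun y : (Fin A.nTrain → X × Bool) × (Fin A.nTest → X) × unitInterval =>
      (A.run y.1 y.2.1 y.2.2).isSome :=
  measurable_to_bool A.measurable_accept

lemma measurable_insert_point {b : ℕ} {te : Ω → Fin b → X} {j : Ω → ℕ} {x : Ω → X}
    (hte : Measurable te) (hj : Measurable j) (hx : Measurable x) :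
    Measurable fun ω (k : Fin b) => if (k : ℕ) = j ω then x ω else te ω k :=
  measurable_pi_lambda _ fun k => Measurable.ite
    (hj.comp measurable_id (measurableSet_singleton (k : ℕ)) |> fun h => by
      convert h using 1; ext ω; simp [eq_comm]) hx ((measurable_pi_apply k).comp hte)

lemma measurable_acceptsAt {A : TDSAlgorithm X} {tr : Ω → Fin A.nTrain → X × Bool}
    {te : Ω → Fin A.nTest → X} {j : Ω → ℕ} {u : Ω → unitInterval} {x : Ω → X}
    (htr : Measurable tr) (hte : Measurable te) (hj : Measurable j) (hu : Measurable u)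
    (hx : Measurable x) :
    Measurable fun ω => acceptsAt A (tr ω) (te ω) (j ω) (u ω) (x ω) :=
  (measurable_of_countable Bool.toNat).comp ((measurable_isSome_run A).comp
    (htr.prodMk ((measurable_insert_point hte hj hx).prodMk hu)))

lemma measurable_roundUpdate {A : TDSAlgorithm X} {P : Tuning}
    (hV : Measurable fun p : Ω × X => V p.1 p.2) {c : Ω → Round X A.nTrain A.nTest P.last}
    (hc : Measurable c) {x : Ω → X} (hx : Measurable x) :
    Measurable fun ω => roundUpdate A P (V ω) (c ω) (x ω) := by
  have hj : Measurable fun ω => coinVal (c ω).1.2.2.1 (A.nTest + 1) :=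
    (measurable_coinVal _).comp hc.fst.snd.snd.fst
  have htr : Measurable fun ω => fun k => trainSample P.res (units P.res (V ω)) ((c ω).2.2.1 k) :=
    measurable_pi_lambda _ fun k => measurable_trainSample hV
      ((measurable_pi_apply k).comp hc.snd.snd.fst)
  have hte := measurable_hybridSample (q := P.res) hV hc.snd.snd.snd.fst hj
  have hz := (measurable_trainSample (q := P.res) hV hc.snd.fst).fst
  have ha1 := measurable_acceptsAt htr hte hj hc.fst.snd.snd.snd hz
  have ha2 := measurable_acceptsAt htr hte hj hc.fst.snd.snd.snd hx
  have hp1 := measurable_testPick (q := P.res) hV hc.snd.snd.snd.snd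
  have hp2 := measurable_trainPick (q := P.res) hV hc.snd.fst
  have hcast : Measurable fun k : ℕ => (k : ℤ) := measurable_of_countable _
  unfold roundUpdate
  refine ((Measurable.mul ?_ ((hcast.comp ha1).sub (hcast.comp ha2))).add
    (Measurable.const_mul ?_ _)).sub (Measurable.const_mul ?_ _)
  · exact (measurable_of_countable fun i : Fin (P.last + 1) =>
      ((min ((i : ℕ) + 1) P.cap : ℕ) : ℤ)).comp hp1
  · exact (measurable_of_countable fun i : Fin (P.last + 1) => ((1 - (i : ℕ) : ℕ) : ℤ)).comp hp1
  · exact (measurable_of_countable fun i : Fin (P.last + 1) => ((1 - (i : ℕ) : ℕ) : ℤ)).comp hp2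

end measurability

/-! ### The laws of the data of a round -/

section laws

variable {X : Type*} [MeasurableSpace X] (Dtrain Dtest : Measure (X × Bool))

/-- The law of a slot. -/
def slotLaw (n : ℕ) : Measure (Slot X n) := Measure.pi fun _ => cellLaw Dtrain Dtest

/-- The law of the cells of a round. -/
def roundLaw (a b n : ℕ) : Measure (Round X a b n) :=
  (cellLaw Dtrain Dtest).prod ((slotLaw Dtrain Dtest n).prod
    ((Measure.pi fun _ => slotLaw Dtrain Dtest n).prod
      ((Measure.pi fun _ => slotLaw Dtrain Dtest n).prod (slotLaw Dtrain Dtest n))))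

/-- The law of a sample from the training distribution, reweighted by `t / q`. -/
def trainLaw (q n : ℕ) (t : X → ℕ) : Measure (X × Bool) :=
  rejLaw Dtrain (fun p => ENNReal.ofReal ((t p.1 : ℝ) / q)) n

/-- The law of a sample from the labeled test distribution, reweighted by `1 - t / q`. -/
def testLaw (q n : ℕ) (t : X → ℕ) : Measure (X × Bool) :=
  rejLaw Dtest (fun p => ENNReal.ofReal (((q - t p.1 : ℕ) : ℝ) / q)) n

variable [IsProbabilityMeasure Dtrain] [IsProbabilityMeasure Dtest]

instance (n : ℕ) : IsProbabilityMeasure (slotLaw Dtrain Dtest n) := by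
  unfold slotLaw; infer_instance

instance (a b n : ℕ) : IsProbabilityMeasure (roundLaw Dtrain Dtest a b n) := by
  unfold roundLaw; infer_instance

variable {q : ℕ} {t : X → ℕ}

lemma measurable_weight (ht : Measurable t) : Measurable fun x => (t x : ℝ) / q :=
  ((measurable_of_countable (fun k : ℕ => (k : ℝ))).comp ht).div_const _

lemma measurable_coweight (ht : Measurable t) : Measurable fun x => ((q - t x : ℕ) : ℝ) / q :=
  ((measurable_of_countable (fun k : ℕ => ((q - k : ℕ) : ℝ))).comp ht).div_const _

omit [MeasurableSpace X] in
lemma coweight_eq (hq : 0 < q) (htq : ∀ x, t x ≤ q) (x : X) :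
    ((q - t x : ℕ) : ℝ) / q = 1 - (t x : ℝ) / q := by
  have hq' : (q : ℝ) ≠ 0 := by exact_mod_cast hq.ne'
  rw [Nat.cast_sub (htq x), sub_div, div_self hq']

omit [MeasurableSpace X] in
lemma weight_le_one (hq : 0 < q) (htq : ∀ x, t x ≤ q) (x : X) : (t x : ℝ) / q ≤ 1 := by
  rw [div_le_one (by exact_mod_cast hq)]; exact_mod_cast htq x

lemma isProbabilityMeasure_trainLaw (hq : 0 < q) (ht : Measurable t) (htq : ∀ x, t x ≤ q) (n : ℕ) :
    IsProbabilityMeasure (trainLaw Dtrain q n t) :=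
  isProbabilityMeasure_rejLaw ((measurable_weight ht).comp measurable_fst)
    (fun _ => div_nonneg (Nat.cast_nonneg _) (Nat.cast_nonneg _)) (fun p => weight_le_one hq htq p.1) n

lemma isProbabilityMeasure_testLaw (hq : 0 < q) (ht : Measurable t) (n : ℕ) :
    IsProbabilityMeasure (testLaw Dtest q n t) :=
  isProbabilityMeasure_rejLaw ((measurable_coweight ht).comp measurable_fst)
    (fun _ => div_nonneg (Nat.cast_nonneg _) (Nat.cast_nonneg _))
    (fun p => weight_le_one (t := fun x => q - t x) hq (fun _ => Nat.sub_le _ _) p.1) n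

omit [IsProbabilityMeasure Dtest] in
lemma fst_testLaw (ht : Measurable t) (n : ℕ) :
    (testLaw Dtest q n t).fst =
      rejLaw Dtest.fst (fun x => ENNReal.ofReal (((q - t x : ℕ) : ℝ) / q)) n :=
  rejLaw_map measurable_fst (measurable_coweight ht).ennreal_ofReal n

omit [IsProbabilityMeasure Dtrain] in
lemma fst_trainLaw (ht : Measurable t) (n : ℕ) :
    (trainLaw Dtrain q n t).fst =
      rejLaw Dtrain.fst (fun x => ENNReal.ofReal ((t x : ℝ) / q)) n :=
  rejLaw_map measurable_fst (measurable_weight ht).ennreal_ofReal n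

lemma measurePreserving_cell_train :
    MeasurePreserving (fun c : Cell X => (c.1, c.2.2.1)) (cellLaw Dtrain Dtest)
      (Dtrain.prod volume) :=
  (MeasurePreserving.id Dtrain).prod (measurePreserving_fst.comp measurePreserving_snd)

lemma measurePreserving_cell_test :
    MeasurePreserving (fun c : Cell X => (c.2.1, c.2.2.1)) (cellLaw Dtrain Dtest)
      (Dtest.fst.prod volume) :=
  ((MeasurePreserving.id Dtest.fst).prod measurePreserving_fst).comp measurePreserving_snd

lemma measurePreserving_trainSample (hq : 0 < q) (ht : Measurable t) (htq : ∀ x, t x ≤ q) (n : ℕ) :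
    MeasurePreserving (trainSample q t) (slotLaw Dtrain Dtest n) (trainLaw Dtrain q n t) := by
  refine ⟨?_, (map_pick_coin (measurePreserving_cell_train Dtrain Dtest) hq
    (ht.comp measurable_fst) (fun p => htq p.1) n).1⟩
  refine (Measurable.apply_countable (fun i => measurable_pi_apply i) (measurable_pick fun i => ?_)).fst
  have hi : Measurable fun s : Slot X n => s i := measurable_pi_apply i
  exact measurableSet_lt ((measurable_coinVal q).comp hi.snd.snd.fst) (ht.comp hi.fst.fst)

lemma measurePreserving_testSample (hq : 0 < q) (ht : Measurable t) (n : ℕ) :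
    MeasurePreserving (testSample q t) (slotLaw Dtrain Dtest n) (testLaw Dtest q n t).fst := by
  have ht' : Measurable fun x => q - t x := (measurable_of_countable fun k => q - k).comp ht
  refine ⟨?_, ?_⟩
  · refine (Measurable.apply_countable (fun i => measurable_pi_apply i)
      (measurable_pick fun i => ?_)).snd.fst
    have hi : Measurable fun s : Slot X n => s i := measurable_pi_apply i
    exact measurableSet_lt ((measurable_coinVal q).comp hi.snd.snd.fst) (ht'.comp hi.snd.fst)
  · rw [fst_testLaw Dtest ht]
    exact (map_pick_coin (measurePreserving_cell_test Dtrain Dtest) hq ht'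
      (fun x => Nat.sub_le _ _) n).1

lemma measurePreserving_trainSamples (hq : 0 < q) (ht : Measurable t) (htq : ∀ x, t x ≤ q)
    (a n : ℕ) :
    MeasurePreserving (fun (s : Fin a → Slot X n) k => trainSample q t (s k))
      (Measure.pi fun _ => slotLaw Dtrain Dtest n) (Measure.pi fun _ => trainLaw Dtrain q n t) := by
  have := isProbabilityMeasure_trainLaw Dtrain hq ht htq n
  exact measurePreserving_pi _ _ fun _ => measurePreserving_trainSample Dtrain Dtest hq ht htq n

/-- The laws of the test points of a hybrid input. -/
def hybridLaw (q n : ℕ) (t : X → ℕ) (j : ℕ) {b : ℕ} (k : Fin b) : Measure X :=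
  if (k : ℕ) < j then (trainLaw Dtrain q n t).fst else (testLaw Dtest q n t).fst

lemma isProbabilityMeasure_hybridLaw (hq : 0 < q) (ht : Measurable t) (htq : ∀ x, t x ≤ q)
    (n j : ℕ) {b : ℕ} (k : Fin b) : IsProbabilityMeasure (hybridLaw Dtrain Dtest q n t j k) := by
  have := isProbabilityMeasure_trainLaw Dtrain hq ht htq n
  have := isProbabilityMeasure_testLaw Dtest hq ht n
  unfold hybridLaw
  split_ifs <;> infer_instance

lemma measurePreserving_hybridSample (hq : 0 < q) (ht : Measurable t) (htq : ∀ x, t x ≤ q)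
    (n j b : ℕ) :
    MeasurePreserving (hybridSample (b := b) q t j)
      (Measure.pi fun _ => slotLaw Dtrain Dtest n)
      (Measure.pi fun k => hybridLaw Dtrain Dtest q n t j k) := by
  have := isProbabilityMeasure_hybridLaw Dtrain Dtest hq ht htq n j (b := b)
  have h : ∀ k : Fin b, MeasurePreserving
      (fun s : Slot X n => if (k : ℕ) < j then (trainSample q t s).1 else testSample q t s)
      (slotLaw Dtrain Dtest n) (hybridLaw Dtrain Dtest q n t j k) := by
    intro k
    unfold hybridLaw
    split_ifs
    · have h1 := measurePreserving_trainSample Dtrain Dtest hq ht htq n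
      exact ⟨h1.measurable.fst, by
        rw [Measure.fst, ← h1.map_eq, Measure.map_map measurable_fst h1.measurable]; rfl⟩
    · exact measurePreserving_testSample Dtrain Dtest hq ht n
  exact measurePreserving_pi _ _ h

end laws

/-- Resampling one coordinate of a product measure. -/
lemma measurePreserving_update {ι : Type*} [Fintype ι] [DecidableEq ι] {Y : Type*}
    [MeasurableSpace Y] (μ : ι → Measure Y) [∀ i, IsProbabilityMeasure (μ i)] (j : ι)
    (ν : Measure Y) [IsProbabilityMeasure ν] :
    MeasurePreserving (fun p : (ι → Y) × Y => Function.update p.1 j p.2)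
      ((Measure.pi μ).prod ν) (Measure.pi (Function.update μ j ν)) := by
  have hm : Measurable fun p : (ι → Y) × Y => Function.update p.1 j p.2 := by
    refine measurable_pi_lambda _ fun i => ?_
    by_cases h : i = j
    · subst h; simpa using measurable_snd
    · simp only [Function.update_of_ne h]; fun_prop
  have : ∀ i, IsProbabilityMeasure (Function.update μ j ν i) := by
    intro i
    by_cases h : i = j
    · subst h; simpa
    · simp only [Function.update_of_ne h]; infer_instance
  refine ⟨hm, (Measure.pi_eq fun s hs => ?_).symm⟩
  rw [Measure.map_apply hm (MeasurableSet.univ_pi hs)]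
  have hpre : (fun p : (ι → Y) × Y => Function.update p.1 j p.2) ⁻¹' univ.pi s =
      (univ.pi (Function.update s j univ)) ×ˢ s j := by
    ext p
    simp only [mem_preimage, Set.mem_pi, mem_univ, true_implies, mem_prod]
    constructor
    · intro h
      refine ⟨fun i => ?_, by simpa using h j⟩
      by_cases hi : i = j
      · subst hi; simp
      · simpa [Function.update_of_ne hi] using h i
    · rintro ⟨h1, h2⟩ i
      by_cases hi : i = j
      · subst hi; simpa using h2
      · simpa [Function.update_of_ne hi] using h1 i
  rw [hpre, Measure.prod_prod, Measure.pi_pi, ← Finset.mul_prod_erase _ _ (Finset.mem_univ j),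
    ← Finset.mul_prod_erase Finset.univ (fun i => (Function.update μ j ν i) (s i)) (Finset.mem_univ j)]
  simp only [Function.update_self, measure_univ, one_mul]
  rw [mul_comm]
  congr 1
  refine Finset.prod_congr rfl fun i hi => ?_
  simp [Function.update_of_ne (Finset.ne_of_mem_erase hi)]


/-! ### The hybrid argument -/

section hybrid

variable {X : Type*} [MeasurableSpace X]

/-- The probability that the algorithm accepts independent training examples from `Ptrain` and
independent test points from the measures `Ptest k`. -/
def acceptProb (A : TDSAlgorithm X) (Ptrain : Measure (X × Bool))
    (Ptest : Fin A.nTest → Measure X) : ℝ :=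
  ∫ y, ((A.run y.1 y.2.1 y.2.2).isSome.toNat : ℝ)
    ∂((Measure.pi fun _ => Ptrain).prod ((Measure.pi Ptest).prod volume))

lemma measurable_toNat_isSome (A : TDSAlgorithm X) :
    Measurable fun y : (Fin A.nTrain → X × Bool) × (Fin A.nTest → X) × unitInterval =>
      ((A.run y.1 y.2.1 y.2.2).isSome.toNat : ℝ) :=
  (measurable_of_countable fun b : Bool => (b.toNat : ℝ)).comp (measurable_isSome_run A)

lemma acceptProb_eq (A : TDSAlgorithm X) (Ptrain : Measure (X × Bool))
    (Ptest : Fin A.nTest → Measure X) :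
    acceptProb A Ptrain Ptest =
      ((Measure.pi fun _ => Ptrain).prod ((Measure.pi Ptest).prod volume)).real
        {y | (A.run y.1 y.2.1 y.2.2).isSome} := by
  rw [acceptProb, ← integral_indicator_one A.measurable_accept]
  congr 1
  funext y
  by_cases h : (A.run y.1 y.2.1 y.2.2).isSome <;> simp [h]

variable {A : TDSAlgorithm X} {Ptrain : Measure (X × Bool)} [IsProbabilityMeasure Ptrain]
  {Ptest : Fin A.nTest → Measure X} [∀ k, IsProbabilityMeasure (Ptest k)]

/-- The probability of acceptance when `x` takes the place of the `j`-th test point. -/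
def acceptProbAt (A : TDSAlgorithm X) (Ptrain : Measure (X × Bool))
    (Ptest : Fin A.nTest → Measure X) (j : ℕ) (x : X) : ℝ :=
  ∫ y, (acceptsAt A y.1 y.2.1 j y.2.2 x : ℝ)
    ∂((Measure.pi fun _ => Ptrain).prod ((Measure.pi Ptest).prod volume))

lemma measurable_natCast_acceptsAt {Ω : Type*} [MeasurableSpace Ω]
    {tr : Ω → Fin A.nTrain → X × Bool} {te : Ω → Fin A.nTest → X} {j : Ω → ℕ}
    {u : Ω → unitInterval} {x : Ω → X} (htr : Measurable tr) (hte : Measurable te)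
    (hj : Measurable j) (hu : Measurable u) (hx : Measurable x) :
    Measurable fun ω => (acceptsAt A (tr ω) (te ω) (j ω) (u ω) (x ω) : ℝ) :=
  (measurable_of_countable fun k : ℕ => (k : ℝ)).comp (measurable_acceptsAt htr hte hj hu hx)

/-- Putting a random point at position `j` replaces the law of the `j`-th test point. -/
lemma integral_acceptProbAt_of_lt (ν : Measure X) [IsProbabilityMeasure ν] (j : Fin A.nTest) :
    ∫ x, acceptProbAt A Ptrain Ptest j x ∂ν =
      acceptProb A Ptrain (Function.update Ptest j ν) := by
  have h1 : MeasurePreserving (fun p : (((Fin A.nTest → X) × unitInterval) × X) =>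
      (Function.update p.1.1 j p.2, p.1.2)) (((Measure.pi Ptest).prod volume).prod ν)
      ((Measure.pi (Function.update Ptest j ν)).prod volume) := by
    have a1 := measurePreserving_prodAssoc (Measure.pi Ptest) (volume : Measure unitInterval) ν
    have a2 := (MeasurePreserving.id (Measure.pi Ptest)).prod
      (Measure.measurePreserving_swap (μ := (volume : Measure unitInterval)) (ν := ν))
    have a3 := (measurePreserving_prodAssoc (Measure.pi Ptest) ν (volume : Measure unitInterval)).symm
    exact ((measurePreserving_update Ptest j ν).prod (.id volume)).comp (a3.comp (a2.comp a1))
  have h2 := ((MeasurePreserving.id (Measure.pi fun _ : Fin A.nTrain => Ptrain)).prod h1).comp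
    (measurePreserving_prodAssoc (Measure.pi fun _ : Fin A.nTrain => Ptrain)
      ((Measure.pi Ptest).prod volume) ν)
  have h3 : ∀ y : (Fin A.nTrain → X × Bool) × (Fin A.nTest → X) × unitInterval, ∀ x,
      (acceptsAt A y.1 y.2.1 j y.2.2 x : ℝ) =
        ((A.run y.1 (Function.update y.2.1 j x) y.2.2).isSome.toNat : ℝ) := by
    intro y x
    unfold acceptsAt
    congr 5
    funext k
    by_cases hk : k = j
    · subst hk; simp
    · rw [Function.update_of_ne hk, if_neg fun h => hk (Fin.ext h)]
  have hm := measurable_toNat_isSome A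
  rw [acceptProb, ← h2.map_eq, integral_map h2.measurable.aemeasurable hm.aestronglyMeasurable,
    integral_prod_symm]
  · refine integral_congr_ae (Filter.Eventually.of_forall fun x => ?_)
    exact integral_congr_ae (Filter.Eventually.of_forall fun y => h3 y x)
  · refine integrable_of_abs_le (hm.comp h2.measurable) (C := 1) fun y => ?_
    rw [Nat.abs_cast]
    exact_mod_cast Bool.toNat_le _

omit [IsProbabilityMeasure Ptrain] [∀ k, IsProbabilityMeasure (Ptest k)] in
lemma acceptProbAt_of_le {j : ℕ} (hj : A.nTest ≤ j) (x : X) :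
    acceptProbAt A Ptrain Ptest j x = acceptProb A Ptrain Ptest := by
  refine integral_congr_ae (Filter.Eventually.of_forall fun y => ?_)
  simp only [acceptsAt]
  congr 5
  funext k
  exact if_neg (by have := k.2; omega)

variable (Dtrain Dtest : Measure (X × Bool)) [IsProbabilityMeasure Dtrain]
  [IsProbabilityMeasure Dtest] {q : ℕ} {t : X → ℕ}

/-- If `x` is put at position `j` of the `j`-th hybrid input, then a random `x` from the test side
yields the `j`-th hybrid again, and a random `x` from the training side the next one.  The sum over
all positions telescopes.  The position past the end contributes nothing; it is included so that
the number of positions is never zero. -/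
lemma sum_acceptProbAt_sub (A : TDSAlgorithm X) (hq : 0 < q) (ht : Measurable t)
    (htq : ∀ x, t x ≤ q) (n : ℕ) :
    ∑ j ∈ Finset.range (A.nTest + 1),
      (∫ x, acceptProbAt A (trainLaw Dtrain q n t) (hybridLaw Dtrain Dtest q n t j) j x
          ∂(testLaw Dtest q n t).fst -
        ∫ x, acceptProbAt A (trainLaw Dtrain q n t) (hybridLaw Dtrain Dtest q n t j) j x
          ∂(trainLaw Dtrain q n t).fst) =
      acceptProb A (trainLaw Dtrain q n t) (fun _ => (testLaw Dtest q n t).fst) -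
        acceptProb A (trainLaw Dtrain q n t) (fun _ => (trainLaw Dtrain q n t).fst) := by
  have := isProbabilityMeasure_trainLaw Dtrain hq ht htq n
  have := isProbabilityMeasure_testLaw Dtest hq ht n
  have hp := fun j => isProbabilityMeasure_hybridLaw Dtrain Dtest hq ht htq n j (b := A.nTest)
  set S : ℕ → ℝ := fun j => acceptProb A (trainLaw Dtrain q n t) (hybridLaw Dtrain Dtest q n t j)
    with hS
  have h0 : S 0 = acceptProb A (trainLaw Dtrain q n t) (fun _ => (testLaw Dtest q n t).fst) := by
    simp only [hS]
    congr 1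
  have hb : S A.nTest =
      acceptProb A (trainLaw Dtrain q n t) (fun _ => (trainLaw Dtrain q n t).fst) := by
    simp only [hS]
    congr 1
    funext k
    simp [hybridLaw, k.2]
  rw [Finset.sum_range_succ, ← h0, ← hb, ← Finset.sum_range_sub']
  have hlast : ∫ x, acceptProbAt A (trainLaw Dtrain q n t)
      (hybridLaw Dtrain Dtest q n t A.nTest) A.nTest x ∂(testLaw Dtest q n t).fst -
      ∫ x, acceptProbAt A (trainLaw Dtrain q n t) (hybridLaw Dtrain Dtest q n t A.nTest) A.nTest x
        ∂(trainLaw Dtrain q n t).fst = 0 := by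
    simp_rw [acceptProbAt_of_le le_rfl]
    simp
  rw [hlast, add_zero]
  refine Finset.sum_congr rfl fun j hj => ?_
  have hj := Finset.mem_range.1 hj
  have h1 := integral_acceptProbAt_of_lt (A := A) (Ptrain := trainLaw Dtrain q n t)
    (Ptest := hybridLaw Dtrain Dtest q n t j) (testLaw Dtest q n t).fst ⟨j, hj⟩
  have h2 := integral_acceptProbAt_of_lt (A := A) (Ptrain := trainLaw Dtrain q n t)
    (Ptest := hybridLaw Dtrain Dtest q n t j) (trainLaw Dtrain q n t).fst ⟨j, hj⟩
  simp only at h1 h2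
  rw [h1, h2]
  congr 2
  · rw [Function.update_eq_self_iff]
    simp [hybridLaw]
  · funext k
    by_cases hk : k = ⟨j, hj⟩
    · subst hk; simp [hybridLaw]
    · rw [Function.update_of_ne hk]
      have hk' : (k : ℕ) ≠ j := fun h => hk (Fin.ext h)
      simp only [hybridLaw]
      split_ifs <;> first | rfl | omega

end hybrid

/-! ### The expected change of the potential -/

section step

variable {X : Type*} [MeasurableSpace X]

/-- The part of a round that determines the test points that are accepted. -/
abbrev Probe (X : Type*) (a b n : ℕ) : Type _ :=
  unitInterval × (Fin a → Slot X n) × (Fin b → Slot X n) × unitInterval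

variable (Dtrain Dtest : Measure (X × Bool))

/-- The law of the random data of a probe. -/
def probeLaw (a b n : ℕ) : Measure (Probe X a b n) :=
  (volume : Measure unitInterval).prod ((Measure.pi fun _ => slotLaw Dtrain Dtest n).prod
    ((Measure.pi fun _ => slotLaw Dtrain Dtest n).prod (volume : Measure unitInterval)))

/-- Whether the algorithm accepts when `x` is put into the hybrid input of a probe. -/
def probeAccepts (A : TDSAlgorithm X) {n : ℕ} (q : ℕ) (t : X → ℕ)
    (c : Probe X A.nTrain A.nTest n) (x : X) : ℝ :=
  (acceptsAt A (fun k => trainSample q t (c.2.1 k))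
    (hybridSample q t (coinVal c.1 (A.nTest + 1)) c.2.2.1) (coinVal c.1 (A.nTest + 1)) c.2.2.2 x : ℝ)

/-- The expectation of `probeAccepts`. -/
def meanAccepts (A : TDSAlgorithm X) (q n : ℕ) (t : X → ℕ) (x : X) : ℝ :=
  ∫ c, probeAccepts A q t c x ∂(probeLaw Dtrain Dtest A.nTrain A.nTest n)

variable [IsProbabilityMeasure Dtrain] [IsProbabilityMeasure Dtest]

instance (a b n : ℕ) : IsProbabilityMeasure (probeLaw Dtrain Dtest a b n) := by
  unfold probeLaw; infer_instance

lemma measurePreserving_permute {U Z Y Y' : Type*} [MeasurableSpace U] [MeasurableSpace Z]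
    [MeasurableSpace Y] [MeasurableSpace Y'] (v : Measure U) (σ : Measure Z) (α : Measure Y)
    (β : Measure Y') [SFinite v] [SFinite σ] [SFinite α] [SFinite β] :
    MeasurePreserving (fun c : (U × U) × Z × Y × Y' × Z =>
        (((c.1.1, c.2.2.1, c.2.2.2.1, c.1.2), c.2.1), c.2.2.2.2))
      ((v.prod v).prod (σ.prod (α.prod (β.prod σ))))
      (((v.prod (α.prod (β.prod v))).prod σ).prod σ) := by
  have e1 := (MeasurePreserving.id σ).prod (measurePreserving_prodAssoc α β σ).symm
  have e2 := (measurePreserving_prodAssoc σ (α.prod β) σ).symm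
  have e3 := (Measure.measurePreserving_swap (μ := σ) (ν := α.prod β)).prod (MeasurePreserving.id σ)
  have e4 := (measurePreserving_prodAssoc (v.prod v) ((α.prod β).prod σ) σ).symm
  have e5 := (measurePreserving_prodAssoc (v.prod v) (α.prod β) σ).symm.prod (MeasurePreserving.id σ)
  have f1 := measurePreserving_prodAssoc v v (α.prod β)
  have f2 := (MeasurePreserving.id v).prod (Measure.measurePreserving_swap (μ := v) (ν := α.prod β))
  have f3 := (MeasurePreserving.id v).prod (measurePreserving_prodAssoc α β v)
  have e6 := ((f3.comp (f2.comp f1)).prod (MeasurePreserving.id σ)).prod (MeasurePreserving.id σ)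
  exact e6.comp (e5.comp (e4.comp ((MeasurePreserving.id (v.prod v)).prod (e3.comp (e2.comp e1)))))

/-- A round consists of a probe, a reference point and a slot for the number of tries, which are
independent. -/
lemma measurePreserving_round (a b n : ℕ) :
    MeasurePreserving (fun c : Round X a b n =>
        (((((c.1.2.2.1, c.2.2.1, c.2.2.2.1, c.1.2.2.2) : Probe X a b n), c.2.1), c.2.2.2.2) :
          (Probe X a b n × Slot X n) × Slot X n))
      (roundLaw Dtrain Dtest a b n)
      (((probeLaw Dtrain Dtest a b n).prod (slotLaw Dtrain Dtest n)).prod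
        (slotLaw Dtrain Dtest n)) := by
  have e0 : MeasurePreserving (fun c : Cell X => c.2.2) (cellLaw Dtrain Dtest)
      ((volume : Measure unitInterval).prod (volume : Measure unitInterval)) :=
    measurePreserving_snd.comp measurePreserving_snd
  exact (measurePreserving_permute volume (slotLaw Dtrain Dtest n)
    (Measure.pi fun _ : Fin a => slotLaw Dtrain Dtest n)
    (Measure.pi fun _ : Fin b => slotLaw Dtrain Dtest n)).comp (e0.prod (MeasurePreserving.id _))

variable {q : ℕ} {t : X → ℕ}

omit [IsProbabilityMeasure Dtrain] [IsProbabilityMeasure Dtest] in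
lemma measurable_probeAccepts (A : TDSAlgorithm X) (ht : Measurable t) {n : ℕ} :
    Measurable fun p : Probe X A.nTrain A.nTest n × X => probeAccepts A q t p.1 p.2 := by
  have hpick1 : Measurable (trainPick q t : Slot X n → _) := measurable_pick fun i => by
    have hi : Measurable fun s : Slot X n => s i := measurable_pi_apply i
    exact measurableSet_lt ((measurable_coinVal q).comp hi.snd.snd.fst) (ht.comp hi.fst.fst)
  have hpick2 : Measurable (testPick q t : Slot X n → _) := measurable_pick fun i => by
    have hi : Measurable fun s : Slot X n => s i := measurable_pi_apply i
    exact measurableSet_lt ((measurable_coinVal q).comp hi.snd.snd.fst)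
      ((measurable_of_countable fun k => q - k).comp (ht.comp hi.snd.fst))
  have h1 : Measurable (trainSample q t : Slot X n → _) :=
    (Measurable.apply_countable (fun i => measurable_pi_apply i) hpick1).fst
  have h2 : Measurable (testSample q t : Slot X n → _) :=
    (Measurable.apply_countable (fun i => measurable_pi_apply i) hpick2).snd.fst
  have hj : Measurable fun p : Probe X A.nTrain A.nTest n × X => coinVal p.1.1 (A.nTest + 1) :=
    (measurable_coinVal _).comp measurable_fst.fst
  refine measurable_natCast_acceptsAt ?_ ?_ hj measurable_fst.snd.snd.snd measurable_snd
  · exact measurable_pi_lambda _ fun k => h1.comp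
      ((measurable_pi_apply k).comp measurable_fst.snd.fst)
  · refine measurable_pi_lambda _ fun k => ?_
    have hk : Measurable fun p : Probe X A.nTrain A.nTest n × X => p.1.2.2.1 k :=
      (measurable_pi_apply k).comp measurable_fst.snd.snd.fst
    exact Measurable.ite (measurableSet_lt measurable_const hj) (h1.comp hk).fst (h2.comp hk)

omit [IsProbabilityMeasure Dtrain] [IsProbabilityMeasure Dtest] in
lemma measurable_probeAccepts_left (A : TDSAlgorithm X) (ht : Measurable t) {n : ℕ} (x : X) :
    Measurable fun c : Probe X A.nTrain A.nTest n => probeAccepts A q t c x := by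
  have h := measurable_probeAccepts (q := q) (n := n) A ht
  fun_prop

omit [IsProbabilityMeasure Dtrain] [IsProbabilityMeasure Dtest] in
lemma probeAccepts_mem (A : TDSAlgorithm X) {n : ℕ} (c : Probe X A.nTrain A.nTest n) (x : X) :
    0 ≤ probeAccepts A q t c x ∧ probeAccepts A q t c x ≤ 1 :=
  ⟨Nat.cast_nonneg _, by unfold probeAccepts; exact_mod_cast Bool.toNat_le _⟩

attribute [irreducible] probeAccepts

lemma measurable_meanAccepts (A : TDSAlgorithm X) (ht : Measurable t) (n : ℕ) :
    Measurable (meanAccepts Dtrain Dtest A q n t) :=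
  (show Measurable fun p : X × Probe X A.nTrain A.nTest n => probeAccepts A q t p.2 p.1 from
    (measurable_probeAccepts A ht).comp measurable_swap).stronglyMeasurable.integral_prod_right'.measurable

lemma meanAccepts_mem (A : TDSAlgorithm X) (ht : Measurable t) (n : ℕ) (x : X) :
    0 ≤ meanAccepts Dtrain Dtest A q n t x ∧ meanAccepts Dtrain Dtest A q n t x ≤ 1 := by
  have hm : Measurable fun c : Probe X A.nTrain A.nTest n => probeAccepts A q t c x :=
    measurable_probeAccepts_left A ht x
  unfold meanAccepts
  exact integral_weight_mem (w := fun c => probeAccepts A q t c x) hm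
    (fun c => (probeAccepts_mem A c x).1) fun c => (probeAccepts_mem A c x).2

lemma integral_probeAccepts (A : TDSAlgorithm X) (hq : 0 < q) (ht : Measurable t)
    (htq : ∀ x, t x ≤ q) (n : ℕ) (x : X) (u : unitInterval) :
    ∫ r, probeAccepts A q t ((u, r) : Probe X A.nTrain A.nTest n) x
        ∂((Measure.pi fun _ => slotLaw Dtrain Dtest n).prod
          ((Measure.pi fun _ => slotLaw Dtrain Dtest n).prod (volume : Measure unitInterval))) =
      acceptProbAt A (trainLaw Dtrain q n t)
        (hybridLaw Dtrain Dtest q n t (coinVal u (A.nTest + 1))) (coinVal u (A.nTest + 1)) x := by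
  generalize hj : coinVal u (A.nTest + 1) = j
  have hmp := (measurePreserving_trainSamples Dtrain Dtest hq ht htq A.nTrain n).prod
    ((measurePreserving_hybridSample Dtrain Dtest hq ht htq n j A.nTest).prod
      (MeasurePreserving.id (volume : Measure unitInterval)))
  have hma : Measurable fun y : (Fin A.nTrain → X × Bool) × (Fin A.nTest → X) × unitInterval =>
      (acceptsAt A y.1 y.2.1 j y.2.2 x : ℝ) :=
    measurable_natCast_acceptsAt measurable_fst measurable_snd.fst measurable_const
      measurable_snd.snd measurable_const
  have := isProbabilityMeasure_trainLaw Dtrain hq ht htq n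
  have := isProbabilityMeasure_hybridLaw Dtrain Dtest hq ht htq n j (b := A.nTest)
  have h1 := integral_map (μ := (Measure.pi fun _ => slotLaw Dtrain Dtest n).prod
    ((Measure.pi fun _ => slotLaw Dtrain Dtest n).prod (volume : Measure unitInterval))) hmp.measurable.aemeasurable hma.aestronglyMeasurable
  rw [hmp.map_eq] at h1
  rw [acceptProbAt, h1]
  refine integral_congr_ae (Filter.Eventually.of_forall fun r => ?_)
  simp only [probeAccepts, hj, Prod.map]
  rfl

/-- The mean over a probe is the average over the positions of the hybrid. -/
lemma meanAccepts_eq (A : TDSAlgorithm X) (hq : 0 < q) (ht : Measurable t) (htq : ∀ x, t x ≤ q)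
    (n : ℕ) (x : X) :
    meanAccepts Dtrain Dtest A q n t x = 1 / (A.nTest + 1 : ℕ) *
      ∑ j ∈ Finset.range (A.nTest + 1),
        acceptProbAt A (trainLaw Dtrain q n t) (hybridLaw Dtrain Dtest q n t j) j x := by
  have hm : Measurable fun c : Probe X A.nTrain A.nTest n => probeAccepts A q t c x :=
    measurable_probeAccepts_left A ht x
  have hint : Integrable (fun c : Probe X A.nTrain A.nTest n => probeAccepts A q t c x)
      (probeLaw Dtrain Dtest A.nTrain A.nTest n) :=
    integrable_weight hm (fun c => (probeAccepts_mem A c x).1) fun c => (probeAccepts_mem A c x).2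
  unfold meanAccepts
  unfold probeLaw at hint ⊢
  rw [integral_prod _ hint]
  simp_rw [integral_probeAccepts Dtrain Dtest A hq ht htq n x]
  exact integral_coinVal (Nat.succ_pos A.nTest) fun j =>
    acceptProbAt A (trainLaw Dtrain q n t) (hybridLaw Dtrain Dtest q n t j) j x

lemma integral_meanAccepts_sub (A : TDSAlgorithm X) (hq : 0 < q) (ht : Measurable t)
    (htq : ∀ x, t x ≤ q) (n : ℕ) :
    ∫ x, meanAccepts Dtrain Dtest A q n t x ∂(testLaw Dtest q n t).fst -
        ∫ x, meanAccepts Dtrain Dtest A q n t x ∂(trainLaw Dtrain q n t).fst =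
      1 / (A.nTest + 1 : ℕ) *
        (acceptProb A (trainLaw Dtrain q n t) (fun _ => (testLaw Dtest q n t).fst) -
          acceptProb A (trainLaw Dtrain q n t) (fun _ => (trainLaw Dtrain q n t).fst)) := by
  have := isProbabilityMeasure_trainLaw Dtrain hq ht htq n
  have := isProbabilityMeasure_testLaw Dtest hq ht n
  have hint : ∀ ν : Measure X, IsProbabilityMeasure ν → ∀ j, Integrable
      (fun x => acceptProbAt A (trainLaw Dtrain q n t) (hybridLaw Dtrain Dtest q n t j) j x) ν := by
    intro ν _ j
    have := isProbabilityMeasure_hybridLaw Dtrain Dtest hq ht htq n j (b := A.nTest)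
    have hm : Measurable fun p : X × ((Fin A.nTrain → X × Bool) × (Fin A.nTest → X) × unitInterval) =>
        (acceptsAt A p.2.1 p.2.2.1 j p.2.2.2 p.1 : ℝ) :=
      measurable_natCast_acceptsAt measurable_snd.fst measurable_snd.snd.fst measurable_const
        measurable_snd.snd.snd measurable_fst
    refine integrable_of_abs_le hm.stronglyMeasurable.integral_prod_right'.measurable (C := 1)
      fun x => ?_
    have := integral_weight_mem (ν := (Measure.pi fun _ : Fin A.nTrain => trainLaw Dtrain q n t).prod
      ((Measure.pi (hybridLaw Dtrain Dtest q n t j)).prod (volume : Measure unitInterval)))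
      (hm.comp (measurable_const.prodMk measurable_id) : Measurable fun y => (acceptsAt A y.1 y.2.1 j y.2.2 x : ℝ))
      (fun y => Nat.cast_nonneg _) (fun y => by exact_mod_cast Bool.toNat_le _)
    unfold acceptProbAt
    rw [abs_of_nonneg this.1]
    exact this.2
  simp_rw [meanAccepts_eq Dtrain Dtest A hq ht htq n]
  rw [integral_const_mul, integral_const_mul, integral_finsetSum _ fun j _ => hint _ inferInstance j,
    integral_finsetSum _ fun j _ => hint _ inferInstance j, ← mul_sub, ← Finset.sum_sub_distrib,
    sum_acceptProbAt_sub Dtrain Dtest A hq ht htq]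

end step


lemma MeasureTheory.MeasurePreserving.integral_comp_measurable {Y Z : Type*} [MeasurableSpace Y]
    [MeasurableSpace Z] {μ : Measure Y} {ν : Measure Z} {φ : Y → Z} (h : MeasurePreserving φ μ ν)
    {f : Z → ℝ} (hf : Measurable f) : ∫ y, f (φ y) ∂μ = ∫ z, f z ∂ν := by
  rw [← h.map_eq, integral_map h.measurable.aemeasurable hf.aestronglyMeasurable]

lemma measurePreserving_fst_fst {Y Z : Type*} [MeasurableSpace Y] [MeasurableSpace Z]
    (ν : Measure (Y × Z)) : MeasurePreserving Prod.fst ν ν.fst := ⟨measurable_fst, rfl⟩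

section drift

variable {X : Type*} [MeasurableSpace X]

/-- The mass of the reweighted training distribution. -/
def trainMass (D : Measure X) (q : ℕ) (V : X → ℤ) : ℝ := ∫ x, (units q V x : ℝ) / q ∂D

/-- The mass of the reweighted test distribution. -/
def testMass (D' : Measure X) (q : ℕ) (V : X → ℤ) : ℝ := ∫ x, (1 - (units q V x : ℝ) / q) ∂D'

variable (Dtrain Dtest : Measure (X × Bool)) [IsProbabilityMeasure Dtrain]
  [IsProbabilityMeasure Dtest] {A : TDSAlgorithm X} {P : Tuning} {V : X → ℤ}

omit [MeasurableSpace X] in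
lemma units_div_mem {q : ℕ} (hq : 0 < q) (V : X → ℤ) (x : X) :
    0 ≤ (units q V x : ℝ) / q ∧ (units q V x : ℝ) / q ≤ 1 :=
  ⟨by positivity, weight_le_one hq (units_le q V) x⟩

lemma trainMass_mem (D : Measure X) [IsProbabilityMeasure D] {q : ℕ} (hq : 0 < q)
    (hV : Measurable V) : 0 ≤ trainMass D q V ∧ trainMass D q V ≤ 1 :=
  integral_weight_mem (measurable_weight (measurable_units hV q))
    (fun x => (units_div_mem hq V x).1) fun x => (units_div_mem hq V x).2

lemma testMass_mem (D : Measure X) [IsProbabilityMeasure D] {q : ℕ} (hq : 0 < q)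
    (hV : Measurable V) : 0 ≤ testMass D q V ∧ testMass D q V ≤ 1 :=
  integral_weight_mem ((measurable_weight (measurable_units hV q)).const_sub 1)
    (fun x => sub_nonneg.2 (units_div_mem hq V x).2)
    fun x => by have := (units_div_mem hq V x).1; linarith

lemma integral_trainPick (hq : 0 < P.res) (hV : Measurable V) (hn : 1 ≤ P.last) :
    ∫ s, ((1 - (trainPick P.res (units P.res V) s : ℕ) : ℕ) : ℝ)
      ∂(slotLaw Dtrain Dtest P.last) = trainMass Dtrain.fst P.res V := by
  have hu := measurable_units hV P.res
  obtain ⟨-, h⟩ := map_pick_coin (measurePreserving_cell_train Dtrain Dtest) hq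
    (hu.comp measurable_fst) (fun p => units_le _ _ p.1) 0
  have hAcc : MeasurableSet {c : Cell X | coinVal c.2.2.1 P.res < units P.res V c.1.1} :=
    measurableSet_lt ((measurable_coinVal _).comp measurable_snd.snd.fst)
      (hu.comp measurable_fst.fst)
  have h1 := integral_pick_eq_zero hn (cellLaw Dtrain Dtest) hAcc
  simp only [mem_ofPred_eq] at h1
  refine h1.trans ?_
  have hw := measurable_weight (q := P.res) hu
  rw [Measure.real]
  refine (congrArg ENNReal.toReal h).trans ?_
  simp only [Function.comp_apply]
  rw [lintegral_ofReal_weight (w := fun p : X × Bool => (units P.res V p.1 : ℝ) / P.res)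
    (hw.comp measurable_fst)
    (fun p => (units_div_mem hq V p.1).1) (fun p => (units_div_mem hq V p.1).2),
    ENNReal.toReal_ofReal (integral_nonneg fun p : X × Bool => (units_div_mem hq V p.1).1)]
  exact (measurePreserving_fst_fst Dtrain).integral_comp_measurable hw

lemma cellLaw_testAccept (hq : 0 < P.res) (hV : Measurable V) :
    (cellLaw Dtrain Dtest).real
      {c : Cell X | coinVal c.2.2.1 P.res < P.res - units P.res V c.2.1} =
      testMass Dtest.fst P.res V := by
  have hu := measurable_units hV P.res
  have hu' : Measurable fun x => P.res - units P.res V x :=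
    (measurable_of_countable fun k => P.res - k).comp hu
  obtain ⟨-, h⟩ := map_pick_coin (measurePreserving_cell_test Dtrain Dtest) hq
    hu' (fun x => Nat.sub_le _ _) 0
  rw [Measure.real]
  refine (congrArg ENNReal.toReal h).trans ?_
  have hw := measurable_coweight (q := P.res) hu
  rw [lintegral_ofReal_weight hw (fun p => div_nonneg (Nat.cast_nonneg _) (Nat.cast_nonneg _))
    (fun x => weight_le_one hq (fun x => Nat.sub_le _ _) x),
    ENNReal.toReal_ofReal (integral_nonneg fun p => div_nonneg (Nat.cast_nonneg _) (Nat.cast_nonneg _)),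
    testMass]
  exact integral_congr_ae (Filter.Eventually.of_forall fun x => coweight_eq hq (units_le _ V) x)

lemma measurableSet_testAccept (hV : Measurable V) :
    MeasurableSet {c : Cell X | coinVal c.2.2.1 P.res < P.res - units P.res V c.2.1} :=
  measurableSet_lt ((measurable_coinVal _).comp measurable_snd.snd.fst)
    ((measurable_of_countable fun k => P.res - k).comp
      ((measurable_units hV P.res).comp measurable_snd.fst))

lemma integral_testPick (hq : 0 < P.res) (hV : Measurable V) (hn : 1 ≤ P.last) :
    ∫ s, ((1 - (testPick P.res (units P.res V) s : ℕ) : ℕ) : ℝ)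
      ∂(slotLaw Dtrain Dtest P.last) = testMass Dtest.fst P.res V := by
  have h1 := integral_pick_eq_zero hn (cellLaw Dtrain Dtest) (measurableSet_testAccept (P := P) hV)
  rw [cellLaw_testAccept Dtrain Dtest hq hV] at h1
  exact h1

lemma integral_tries (hq : 0 < P.res) (hV : Measurable V) (hcap : P.cap ≤ P.last + 1) :
    ∫ s, ((min ((testPick P.res (units P.res V) s : ℕ) + 1) P.cap : ℕ) : ℝ)
      ∂(slotLaw Dtrain Dtest P.last) =
        ∑ l ∈ Finset.range P.cap, (1 - testMass Dtest.fst P.res V) ^ l := by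
  have h1 := integral_min_pick hcap (cellLaw Dtrain Dtest) (measurableSet_testAccept (P := P) hV)
  rw [cellLaw_testAccept Dtrain Dtest hq hV] at h1
  exact h1

/-- The derivative of the potential in the direction of the update of one round. -/
def roundSlope (A : TDSAlgorithm X) (P : Tuning) (V : X → ℤ)
    (c : Round X A.nTrain A.nTest P.last) : ℝ :=
  P.ratio * ∫ x, (units P.res V x : ℝ) / P.res * roundUpdate A P V c x ∂Dtrain.fst -
    ∫ x, (1 - (units P.res V x : ℝ) / P.res) * roundUpdate A P V c x ∂Dtest.fst

/-- The discrepancy of the two reweighted distributions on the points that a probe accepts. -/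
def probeGap (A : TDSAlgorithm X) (P : Tuning) (V : X → ℤ)
    (c : Probe X A.nTrain A.nTest P.last) : ℝ :=
  P.ratio * ∫ x, (units P.res V x : ℝ) / P.res * probeAccepts A P.res (units P.res V) c x ∂Dtrain.fst -
    ∫ x, (1 - (units P.res V x : ℝ) / P.res) * probeAccepts A P.res (units P.res V) c x ∂Dtest.fst

omit [IsProbabilityMeasure Dtrain] [IsProbabilityMeasure Dtest] in
lemma roundUpdate_eq (c : Round X A.nTrain A.nTest P.last) (x : X) :
    (roundUpdate A P V c x : ℝ) =
      (min ((testPick P.res (units P.res V) c.2.2.2.2 : ℕ) + 1) P.cap : ℕ) *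
        (probeAccepts A P.res (units P.res V) (c.1.2.2.1, c.2.2.1, c.2.2.2.1, c.1.2.2.2)
          (trainSample P.res (units P.res V) c.2.1).1 -
        probeAccepts A P.res (units P.res V) (c.1.2.2.1, c.2.2.1, c.2.2.2.1, c.1.2.2.2) x) +
      P.weight * (1 - (testPick P.res (units P.res V) c.2.2.2.2 : ℕ) : ℕ) -
      P.weight * P.ratio * (1 - (trainPick P.res (units P.res V) c.2.1 : ℕ) : ℕ) := by
  simp only [roundUpdate, probeAccepts]
  push_cast
  ring

/-- The slope splits into the contribution of the probe, with the number of tries as its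
multiplicity, and the two balancing terms. -/
lemma roundSlope_eq (hq : 0 < P.res) (hV : Measurable V)
    (c : Round X A.nTrain A.nTest P.last) :
    roundSlope Dtrain Dtest A P V c =
      ((P.ratio * trainMass Dtrain.fst P.res V - testMass Dtest.fst P.res V) *
        probeAccepts A P.res (units P.res V) (c.1.2.2.1, c.2.2.1, c.2.2.2.1, c.1.2.2.2)
          (trainSample P.res (units P.res V) c.2.1).1 -
        probeGap Dtrain Dtest A P V (c.1.2.2.1, c.2.2.1, c.2.2.2.1, c.1.2.2.2)) *
        (min ((testPick P.res (units P.res V) c.2.2.2.2 : ℕ) + 1) P.cap : ℕ) +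
      (P.ratio * trainMass Dtrain.fst P.res V - testMass Dtest.fst P.res V) * P.weight *
        (1 - (testPick P.res (units P.res V) c.2.2.2.2 : ℕ) : ℕ) -
      (P.ratio * trainMass Dtrain.fst P.res V - testMass Dtest.fst P.res V) * P.weight * P.ratio *
        (1 - (trainPick P.res (units P.res V) c.2.1 : ℕ) : ℕ) := by
  set κ : Probe X A.nTrain A.nTest P.last := (c.1.2.2.1, c.2.2.1, c.2.2.2.1, c.1.2.2.2)
  set t := units P.res V
  set nn : ℝ := ((min ((testPick P.res t c.2.2.2.2 : ℕ) + 1) P.cap : ℕ) : ℝ) with hnn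
  set f1 : ℝ := ((1 - (testPick P.res t c.2.2.2.2 : ℕ) : ℕ) : ℝ) with hf1
  set f0 : ℝ := ((1 - (trainPick P.res t c.2.1 : ℕ) : ℕ) : ℝ) with hf0
  set z := (trainSample P.res t c.2.1).1
  have hw : Measurable fun x => (t x : ℝ) / P.res := measurable_weight (measurable_units hV _)
  have ha : Measurable fun x => probeAccepts A P.res t κ x := by
    have h := measurable_probeAccepts (q := P.res) (n := P.last) A (measurable_units hV P.res)
    fun_prop
  have ha0 := fun x => (probeAccepts_mem (q := P.res) (t := t) A κ x).1
  have ha1 := fun x => (probeAccepts_mem (q := P.res) (t := t) A κ x).2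
  have key : ∀ (ν : Measure X) [IsProbabilityMeasure ν] (w : X → ℝ), Measurable w → (∀ x, 0 ≤ w x) →
      (∀ x, w x ≤ 1) → ∫ x, w x * roundUpdate A P V c x ∂ν =
      (nn * probeAccepts A P.res t κ z + P.weight * f1 - P.weight * P.ratio * f0) * ∫ x, w x ∂ν -
        nn * ∫ x, w x * probeAccepts A P.res t κ x ∂ν := by
    intro ν _ w hwm h0 h1
    rw [← integral_const_mul, ← integral_const_mul, ← integral_sub]
    · refine integral_congr_ae (Filter.Eventually.of_forall fun x => ?_)
      simp only [roundUpdate_eq]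
      ring
    · exact (integrable_weight hwm h0 h1).const_mul _
    · exact (integrable_weight (hwm.mul ha) (fun x => mul_nonneg (h0 x) (ha0 x))
        fun x => mul_le_one₀ (h1 x) (ha0 x) (ha1 x)).const_mul _
  rw [roundSlope, key Dtrain.fst _ hw (fun x => (units_div_mem hq V x).1)
    (fun x => (units_div_mem hq V x).2), key Dtest.fst _ (hw.const_sub 1)
    (fun x => sub_nonneg.2 (units_div_mem hq V x).2)
    (fun x => by have := (units_div_mem hq V x).1; linarith), probeGap, trainMass, testMass]
  ring

lemma integral_probeGap (hq : 0 < P.res) (hV : Measurable V) :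
    Integrable (probeGap Dtrain Dtest A P V) (probeLaw Dtrain Dtest A.nTrain A.nTest P.last) ∧
    ∫ c, probeGap Dtrain Dtest A P V c ∂(probeLaw Dtrain Dtest A.nTrain A.nTest P.last) =
      P.ratio * ∫ x, (units P.res V x : ℝ) / P.res *
          meanAccepts Dtrain Dtest A P.res P.last (units P.res V) x ∂Dtrain.fst -
        ∫ x, (1 - (units P.res V x : ℝ) / P.res) *
          meanAccepts Dtrain Dtest A P.res P.last (units P.res V) x ∂Dtest.fst := by
  have h := measurable_probeAccepts (q := P.res) (n := P.last) A (measurable_units hV P.res)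
  have hw : Measurable fun x => (units P.res V x : ℝ) / P.res := measurable_weight (measurable_units hV _)
  have key : ∀ (ν : Measure X) [IsProbabilityMeasure ν] (w : X → ℝ), Measurable w → (∀ x, 0 ≤ w x) →
      (∀ x, w x ≤ 1) →
      Integrable (fun c => ∫ x, w x * probeAccepts A P.res (units P.res V) c x ∂ν)
        (probeLaw Dtrain Dtest A.nTrain A.nTest P.last) ∧
      ∫ c, ∫ x, w x * probeAccepts A P.res (units P.res V) c x ∂ν
        ∂(probeLaw Dtrain Dtest A.nTrain A.nTest P.last) =
      ∫ x, w x * meanAccepts Dtrain Dtest A P.res P.last (units P.res V) x ∂ν := by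
    intro ν _ w hwm h0 h1
    have hm : Measurable fun p : Probe X A.nTrain A.nTest P.last × X =>
        w p.2 * probeAccepts A P.res (units P.res V) p.1 p.2 := (hwm.comp measurable_snd).mul h
    have hi : Integrable (fun p : Probe X A.nTrain A.nTest P.last × X =>
        w p.2 * probeAccepts A P.res (units P.res V) p.1 p.2)
        ((probeLaw Dtrain Dtest A.nTrain A.nTest P.last).prod ν) :=
      integrable_weight hm (fun p => mul_nonneg (h0 _) (probeAccepts_mem A p.1 p.2).1)
        fun p => mul_le_one₀ (h1 _) (probeAccepts_mem A p.1 p.2).1 (probeAccepts_mem A p.1 p.2).2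
    refine ⟨hi.integral_prod_left, ?_⟩
    rw [integral_integral_swap hi]
    refine integral_congr_ae (Filter.Eventually.of_forall fun x => ?_)
    simp only [integral_const_mul, meanAccepts]
  obtain ⟨i1, e1⟩ := key Dtrain.fst _ hw (fun x => (units_div_mem hq V x).1)
    (fun x => (units_div_mem hq V x).2)
  obtain ⟨i2, e2⟩ := key Dtest.fst _ (hw.const_sub 1)
    (fun x => sub_nonneg.2 (units_div_mem hq V x).2)
    (fun x => by have := (units_div_mem hq V x).1; linarith)
  refine ⟨(i1.const_mul _).sub i2, ?_⟩
  rw [← e1, ← e2, ← integral_const_mul, ← integral_sub (i1.const_mul _) i2]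
  rfl

/-- The three parts of a round are independent, so the mean of the slope factors.  The balancing
terms contribute the negative square of the difference of the masses. -/
lemma integral_roundSlope (hq : 0 < P.res) (hV : Measurable V) (hn : 1 ≤ P.last)
    (hcap : P.cap ≤ P.last + 1) :
    Integrable (roundSlope Dtrain Dtest A P V) (roundLaw Dtrain Dtest A.nTrain A.nTest P.last) ∧
    ∫ c, roundSlope Dtrain Dtest A P V c ∂(roundLaw Dtrain Dtest A.nTrain A.nTest P.last) =
      ((P.ratio * trainMass Dtrain.fst P.res V - testMass Dtest.fst P.res V) *
          ∫ x, meanAccepts Dtrain Dtest A P.res P.last (units P.res V) x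
            ∂(trainLaw Dtrain P.res P.last (units P.res V)).fst -
        (P.ratio * ∫ x, (units P.res V x : ℝ) / P.res *
          meanAccepts Dtrain Dtest A P.res P.last (units P.res V) x ∂Dtrain.fst -
        ∫ x, (1 - (units P.res V x : ℝ) / P.res) *
          meanAccepts Dtrain Dtest A P.res P.last (units P.res V) x ∂Dtest.fst)) *
        ∑ l ∈ Finset.range P.cap, (1 - testMass Dtest.fst P.res V) ^ l -
      P.weight * (P.ratio * trainMass Dtrain.fst P.res V - testMass Dtest.fst P.res V) ^ 2 := by
  have hu := measurable_units hV P.res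
  set t := units P.res V with ht
  set Δ := P.ratio * trainMass Dtrain.fst P.res V - testMass Dtest.fst P.res V with hΔ
  set K := probeLaw Dtrain Dtest A.nTrain A.nTest P.last
  set σ := slotLaw Dtrain Dtest P.last
  have hmp := measurePreserving_round Dtrain Dtest A.nTrain A.nTest P.last
  have hsamp := measurePreserving_trainSample Dtrain Dtest hq hu (units_le P.res V) P.last
  -- the functions of the single slots
  have hVu : Measurable fun p : Slot X P.last × X => V p.2 := hV.comp measurable_snd
  have hp1 : Measurable (testPick P.res t : Slot X P.last → _) := measurable_testPick hVu measurable_id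
  have hp0 : Measurable (trainPick P.res t : Slot X P.last → _) := measurable_trainPick hVu measurable_id
  set nn : Slot X P.last → ℝ := fun l => ((min ((testPick P.res t l : ℕ) + 1) P.cap : ℕ) : ℝ) with hnn
  set f1 : Slot X P.last → ℝ := fun l => ((1 - (testPick P.res t l : ℕ) : ℕ) : ℝ) with hf1
  set f0 : Slot X P.last → ℝ := fun z => ((1 - (trainPick P.res t z : ℕ) : ℕ) : ℝ) with hf0
  have inn : Integrable nn σ := integrable_of_abs_le
    ((measurable_of_countable fun i : Fin (P.last + 1) => ((min ((i : ℕ) + 1) P.cap : ℕ) : ℝ)).comp hp1)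
    (C := P.cap) fun l => by
      rw [hnn, Nat.abs_cast]; exact_mod_cast min_le_right _ _
  have if1 : Integrable f1 σ := integrable_of_abs_le
    ((measurable_of_countable fun i : Fin (P.last + 1) => ((1 - (i : ℕ) : ℕ) : ℝ)).comp hp1)
    (C := 1) fun l => by
      rw [hf1, Nat.abs_cast]; exact_mod_cast Nat.sub_le _ _
  have if0 : Integrable f0 σ := integrable_of_abs_le
    ((measurable_of_countable fun i : Fin (P.last + 1) => ((1 - (i : ℕ) : ℕ) : ℝ)).comp hp0)
    (C := 1) fun l => by
      rw [hf0, Nat.abs_cast]; exact_mod_cast Nat.sub_le _ _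
  -- the function of the probe and the reference point
  have hm := measurable_probeAccepts (q := P.res) (n := P.last) A hu
  have hg : Measurable fun p : Probe X A.nTrain A.nTest P.last × Slot X P.last =>
      probeAccepts A P.res t p.1 (trainSample P.res t p.2).1 :=
    hm.comp (measurable_fst.prodMk (hsamp.measurable.comp measurable_snd).fst)
  have ig : Integrable (fun p : Probe X A.nTrain A.nTest P.last × Slot X P.last =>
      probeAccepts A P.res t p.1 (trainSample P.res t p.2).1) (K.prod σ) :=
    integrable_weight hg (fun p => (probeAccepts_mem A _ _).1) fun p => (probeAccepts_mem A _ _).2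
  obtain ⟨igap, egap⟩ := integral_probeGap (A := A) (P := P) Dtrain Dtest hq hV
  have igap' : Integrable (fun p : Probe X A.nTrain A.nTest P.last × Slot X P.last =>
      probeGap Dtrain Dtest A P V p.1) (K.prod σ) := igap.comp_fst σ
  set F : Probe X A.nTrain A.nTest P.last × Slot X P.last → ℝ := fun p =>
    Δ * probeAccepts A P.res t p.1 (trainSample P.res t p.2).1 - probeGap Dtrain Dtest A P V p.1 with hF
  have iF : Integrable F (K.prod σ) := (ig.const_mul Δ).sub igap'
  have eg : ∫ p, probeAccepts A P.res t p.1 (trainSample P.res t p.2).1 ∂(K.prod σ) =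
      ∫ x, meanAccepts Dtrain Dtest A P.res P.last t x ∂(trainLaw Dtrain P.res P.last t).fst := by
    have hmean := measurable_meanAccepts Dtrain Dtest (q := P.res) A hu P.last
    rw [integral_prod_symm _ ig, ← (measurePreserving_fst_fst _).integral_comp_measurable hmean]
    exact hsamp.integral_comp_measurable (hmean.comp measurable_fst)
  have eF : ∫ p, F p ∂(K.prod σ) = Δ * (∫ x, meanAccepts Dtrain Dtest A P.res P.last t x
      ∂(trainLaw Dtrain P.res P.last t).fst) - ∫ c, probeGap Dtrain Dtest A P V c ∂K := by
    rw [hF, integral_sub (ig.const_mul Δ) igap', integral_const_mul, eg]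
    congr 1
    rw [integral_fun_fst]
    simp
  -- the slope as a function on the rearranged product
  set Λ : (Probe X A.nTrain A.nTest P.last × Slot X P.last) × Slot X P.last → ℝ := fun p =>
    F p.1 * nn p.2 + Δ * P.weight * f1 p.2 - Δ * P.weight * P.ratio * f0 p.1.2 with hΛ
  have i1 : Integrable (fun p : (Probe X A.nTrain A.nTest P.last × Slot X P.last) × Slot X P.last =>
      F p.1 * nn p.2) ((K.prod σ).prod σ) := iF.mul_prod inn
  have i2 : Integrable (fun p : (Probe X A.nTrain A.nTest P.last × Slot X P.last) × Slot X P.last =>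
      Δ * P.weight * f1 p.2) ((K.prod σ).prod σ) := (if1.comp_snd (K.prod σ)).const_mul _
  have i3 : Integrable (fun p : (Probe X A.nTrain A.nTest P.last × Slot X P.last) × Slot X P.last =>
      Δ * P.weight * P.ratio * f0 p.1.2) ((K.prod σ).prod σ) :=
    ((if0.comp_snd K).comp_fst σ).const_mul _
  have iΛ : Integrable Λ ((K.prod σ).prod σ) := (i1.add i2).sub i3
  have e3 : ∫ p : (Probe X A.nTrain A.nTest P.last × Slot X P.last) × Slot X P.last, f0 p.1.2
      ∂((K.prod σ).prod σ) = trainMass Dtrain.fst P.res V := by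
    rw [integral_fun_fst (f := fun p : Probe X A.nTrain A.nTest P.last × Slot X P.last => f0 p.2),
      integral_fun_snd]
    simpa using integral_trainPick (P := P) Dtrain Dtest hq hV hn
  have e2 : ∫ p : (Probe X A.nTrain A.nTest P.last × Slot X P.last) × Slot X P.last, f1 p.2
      ∂((K.prod σ).prod σ) = testMass Dtest.fst P.res V := by
    rw [integral_fun_snd]
    simpa using integral_testPick (P := P) Dtrain Dtest hq hV hn
  have eΛ : ∫ p, Λ p ∂((K.prod σ).prod σ) = (∫ p, F p ∂(K.prod σ)) *
      (∑ l ∈ Finset.range P.cap, (1 - testMass Dtest.fst P.res V) ^ l) - P.weight * Δ ^ 2 := by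
    have h12 := integral_sub (i1.add i2) i3
    simp only [Pi.add_apply] at h12
    rw [hΛ, h12, integral_add i1 i2, integral_prod_mul F nn, integral_const_mul, integral_const_mul,
      e2, e3, ← integral_tries (P := P) Dtrain Dtest hq hV hcap]
    simp only [hΔ, hnn]
    ring
  have hcomp : roundSlope Dtrain Dtest A P V = Λ ∘ fun c : Round X A.nTrain A.nTest P.last =>
        (((((c.1.2.2.1, c.2.2.1, c.2.2.2.1, c.1.2.2.2) : Probe X A.nTrain A.nTest P.last), c.2.1),
          c.2.2.2.2) : (Probe X A.nTrain A.nTest P.last × Slot X P.last) × Slot X P.last) := by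
    funext c
    exact roundSlope_eq Dtrain Dtest hq hV c
  have hΛm : AEStronglyMeasurable Λ (Measure.map _ _) := hmp.map_eq ▸ iΛ.aestronglyMeasurable
  constructor
  · rw [hcomp]
    exact hmp.integrable_comp_of_integrable iΛ
  · rw [← egap, ← eF, ← eΛ, ← hmp.map_eq, integral_map hmp.measurable.aemeasurable hΛm, hcomp]
    rfl

end drift


section drift

variable {X : Type*} [MeasurableSpace X] (Dtrain Dtest : Measure (X × Bool))
  [IsProbabilityMeasure Dtrain] [IsProbabilityMeasure Dtest] {A : TDSAlgorithm X} {P : Tuning}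
  {V : X → ℤ}

/-- The largest change of the score in one round. -/
def Tuning.maxUpdate (P : Tuning) : ℕ := P.cap + P.weight * (1 + P.ratio)

lemma measurable_potential_step (hV : Measurable V) :
    Measurable fun c : Round X A.nTrain A.nTest P.last =>
      potential Dtrain.fst Dtest.fst P.ratio P.res (fun x => V x + roundUpdate A P V c x) := by
  have hu : Measurable fun p : Round X A.nTrain A.nTest P.last × X =>
      V p.2 + roundUpdate A P V p.1 p.2 :=
    (hV.comp measurable_snd).add (measurable_roundUpdate (V := fun _ => V)
      (hV.comp measurable_snd) measurable_fst measurable_snd)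
  have hc : Measurable fun p : Round X A.nTrain A.nTest P.last × X =>
      ((V p.2 + roundUpdate A P V p.1 p.2 : ℤ) : ℝ) / P.res :=
    ((measurable_of_countable (fun k : ℤ => (k : ℝ))).comp hu).div_const _
  exact ((continuous_alphaPot.measurable.comp hc).stronglyMeasurable.integral_prod_right'.measurable.const_mul
    _).add (continuous_betaPot.measurable.comp hc).stronglyMeasurable.integral_prod_right'.measurable

lemma integrable_potential_step (hV : Measurable V) {C : ℕ} (hC : ∀ x, |V x| ≤ C) :
    Integrable (fun c : Round X A.nTrain A.nTest P.last =>
      potential Dtrain.fst Dtest.fst P.ratio P.res (fun x => V x + roundUpdate A P V c x))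
      (roundLaw Dtrain Dtest A.nTrain A.nTest P.last) := by
  refine integrable_of_abs_le (measurable_potential_step Dtrain Dtest hV)
    (C := (P.ratio + 1) * (2 * (C + P.maxUpdate : ℕ) + 1)) fun c => ?_
  refine potential_le ?_ fun x => ?_
  · exact hV.add (measurable_roundUpdate (V := fun _ => V)
      (hV.comp measurable_snd) measurable_const measurable_id)
  · push_cast
    exact (abs_add_le _ _).trans (add_le_add (hC x) (by exact_mod_cast abs_roundUpdate_le A P V c x))

/-- In expectation, a round decreases the potential by an amount which is large unless the two
reweighted distributions have balanced masses and the algorithm accepts them. -/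
lemma potential_drift (hq : 0 < P.res) (hn : 1 ≤ P.last) (hcap : P.cap ≤ P.last + 1)
    (hV : Measurable V) {C : ℕ} (hC : ∀ x, |V x| ≤ C)
    (hacc : 99 / 100 ≤ acceptProb A (trainLaw Dtrain P.res P.last (units P.res V))
      fun _ => (trainLaw Dtrain P.res P.last (units P.res V)).fst) :
    P.weight * (P.ratio * trainMass Dtrain.fst P.res V - testMass Dtest.fst P.res V) ^ 2 +
      (1 - (1 - testMass Dtest.fst P.res V) ^ P.cap) *
        (99 / 100 - acceptProb A (trainLaw Dtrain P.res P.last (units P.res V))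
          fun _ => (testLaw Dtest P.res P.last (units P.res V)).fst) / (A.nTest + 1) ≤
    P.res * (potential Dtrain.fst Dtest.fst P.ratio P.res V -
      ∫ c, potential Dtrain.fst Dtest.fst P.ratio P.res (fun x => V x + roundUpdate A P V c x)
        ∂(roundLaw Dtrain Dtest A.nTrain A.nTest P.last)) +
      ((P.ratio + 1) * (P.maxUpdate : ℝ) ^ 2 / (2 * P.res) +
        P.cap * (P.ratio + 1) / (P.last + 1)) := by
  have hq' : (0 : ℝ) < P.res := by exact_mod_cast hq
  have hu := measurable_units hV P.res
  obtain ⟨islope, eslope⟩ := integral_roundSlope (A := A) Dtrain Dtest hq hV hn hcap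
  have hstep : ∫ c, potential Dtrain.fst Dtest.fst P.ratio P.res
        (fun x => V x + roundUpdate A P V c x) ∂(roundLaw Dtrain Dtest A.nTrain A.nTest P.last) ≤
      potential Dtrain.fst Dtest.fst P.ratio P.res V + (1 / P.res) *
        ∫ c, roundSlope Dtrain Dtest A P V c ∂(roundLaw Dtrain Dtest A.nTrain A.nTest P.last) +
        (P.ratio + 1) * (P.maxUpdate : ℝ) ^ 2 / (2 * P.res ^ 2) := by
    have i12 : Integrable (fun c => potential Dtrain.fst Dtest.fst P.ratio P.res V +
        1 / (P.res : ℝ) * roundSlope Dtrain Dtest A P V c)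
        (roundLaw Dtrain Dtest A.nTrain A.nTest P.last) :=
      (integrable_const _).add (islope.const_mul _)
    have hi : Integrable (fun c => potential Dtrain.fst Dtest.fst P.ratio P.res V +
        1 / (P.res : ℝ) * roundSlope Dtrain Dtest A P V c +
        (P.ratio + 1) * (P.maxUpdate : ℝ) ^ 2 / (2 * P.res ^ 2))
        (roundLaw Dtrain Dtest A.nTrain A.nTest P.last) := i12.add (integrable_const _)
    have := integral_mono (integrable_potential_step (A := A) (P := P) Dtrain Dtest hV hC) hi
      fun c => potential_add_le hq hV hC (measurable_roundUpdate (V := fun _ => V)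
        (hV.comp measurable_snd) measurable_const measurable_id) (abs_roundUpdate_le A P V c)
    refine this.trans (le_of_eq ?_)
    rw [integral_add i12 (integrable_const _),
      integral_add (integrable_const _) (islope.const_mul _), integral_const_mul]
    simp
  have hmean := measurable_meanAccepts Dtrain Dtest (q := P.res) A hu P.last
  have hmean0 := fun x => (meanAccepts_mem Dtrain Dtest (q := P.res) A hu P.last x).1
  have hmean1 := fun x => (meanAccepts_mem Dtrain Dtest (q := P.res) A hu P.last x).2
  have hsub := integral_meanAccepts_sub Dtrain Dtest A hq hu (units_le P.res V) P.last
  have hP := abs_integral_rejLaw_sub_le (ν := Dtrain.fst) (measurable_weight hu)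
    (fun x => (units_div_mem hq V x).1) (fun x => (units_div_mem hq V x).2) P.last
    hmean hmean0 hmean1
  rw [← fst_trainLaw Dtrain hu] at hP
  have hQ := abs_integral_rejLaw_sub_le (ν := Dtest.fst) (measurable_coweight hu)
    (fun x => div_nonneg (Nat.cast_nonneg _) (Nat.cast_nonneg _))
    (fun x => weight_le_one hq (fun x => Nat.sub_le _ _) x) P.last hmean hmean0 hmean1
  rw [← fst_testLaw Dtest hu] at hQ
  simp_rw [coweight_eq hq (units_le P.res V)] at hQ
  obtain ⟨hM0, hM1⟩ := trainMass_mem Dtrain.fst hq hV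
  obtain ⟨hμ0, hμ1⟩ := testMass_mem Dtest.fst hq hV
  have hgeom := geom_mul_weight (testMass Dtest.fst P.res V) P.cap
  change |trainMass Dtrain.fst P.res V * _ - _| ≤ _ at hP
  change |testMass Dtest.fst P.res V * _ - _| ≤ _ at hQ
  rw [eslope] at hstep
  clear eslope islope
  generalize trainMass Dtrain.fst P.res V = M at *
  generalize testMass Dtest.fst P.res V = μ at *
  generalize ∫ x, meanAccepts Dtrain Dtest A P.res P.last (units P.res V) x
    ∂(trainLaw Dtrain P.res P.last (units P.res V)).fst = p at *
  generalize ∫ x, meanAccepts Dtrain Dtest A P.res P.last (units P.res V) x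
    ∂(testLaw Dtest P.res P.last (units P.res V)).fst = p' at *
  generalize ∫ x, (units P.res V x : ℝ) / P.res *
    meanAccepts Dtrain Dtest A P.res P.last (units P.res V) x ∂Dtrain.fst = I at *
  generalize ∫ x, (1 - (units P.res V x : ℝ) / P.res) *
    meanAccepts Dtrain Dtest A P.res P.last (units P.res V) x ∂Dtest.fst = I' at *
  generalize acceptProb A (trainLaw Dtrain P.res P.last (units P.res V))
    (fun _ => (trainLaw Dtrain P.res P.last (units P.res V)).fst) = aP at *
  generalize acceptProb A (trainLaw Dtrain P.res P.last (units P.res V))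
    (fun _ => (testLaw Dtest P.res P.last (units P.res V)).fst) = aQ at *
  generalize ∫ c, potential Dtrain.fst Dtest.fst P.ratio P.res
    (fun x => V x + roundUpdate A P V c x) ∂(roundLaw Dtrain Dtest A.nTrain A.nTest P.last) = Φ' at *
  generalize potential Dtrain.fst Dtest.fst P.ratio P.res V = Φ at *
  set S := ∑ l ∈ Finset.range P.cap, (1 - μ) ^ l with hS
  have hS0 : 0 ≤ S := Finset.sum_nonneg fun l _ => pow_nonneg (by linarith) _
  have hScap : S ≤ P.cap := by
    have := Finset.sum_le_card_nsmul (Finset.range P.cap) (fun l => (1 - μ) ^ l) 1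
      fun l _ => pow_le_one₀ (by linarith) (by linarith)
    simpa using this
  set E : ℝ := 1 / (P.last + 1) with hE
  have hE0 : 0 ≤ E := by positivity
  have hH : (0 : ℝ) ≤ P.ratio := Nat.cast_nonneg _
  have hm : (0 : ℝ) < A.nTest + 1 := by positivity
  -- the slope of the potential is, up to sampling errors, `μ * (p' - p)`
  have h1 : (P.ratio * M - μ) * p - (P.ratio * I - I') ≤ (P.ratio + 1) * E + μ * (p' - p) := by
    have a1 : P.ratio * (M * p - I) ≤ P.ratio * E := by
      gcongr; exact (le_abs_self _).trans hP
    have a2 : -E ≤ μ * p' - I' := (abs_le.1 hQ).1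
    nlinarith
  have h2 : p' - p ≤ (aQ - 99 / 100) / (A.nTest + 1) := by
    rw [hsub]
    push_cast
    rw [one_div, inv_mul_eq_div]
    gcongr
  -- the multiplicity `S` cancels the unknown factor `μ`: `S * μ = 1 - (1 - μ) ^ P.cap`
  have h3 : ((P.ratio * M - μ) * p - (P.ratio * I - I')) * S ≤
      P.cap * ((P.ratio + 1) * E) + (1 - (1 - μ) ^ P.cap) * ((aQ - 99 / 100) / (A.nTest + 1)) := by
    calc _ ≤ ((P.ratio + 1) * E + μ * (p' - p)) * S := by gcongr
      _ ≤ ((P.ratio + 1) * E + μ * ((aQ - 99 / 100) / (A.nTest + 1))) * S := by gcongr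
      _ = S * ((P.ratio + 1) * E) + (S * μ) * ((aQ - 99 / 100) / (A.nTest + 1)) := by ring
      _ ≤ _ := by rw [hgeom]; gcongr
  have h4 : P.res * (Φ' - Φ) ≤ P.cap * ((P.ratio + 1) * E) +
      (1 - (1 - μ) ^ P.cap) * ((aQ - 99 / 100) / (A.nTest + 1)) - P.weight * (P.ratio * M - μ) ^ 2 +
      (P.ratio + 1) * (P.maxUpdate : ℝ) ^ 2 / (2 * P.res) := by
    have e1 : P.res * ((P.ratio + 1) * (P.maxUpdate : ℝ) ^ 2 / (2 * P.res ^ 2)) =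
        (P.ratio + 1) * (P.maxUpdate : ℝ) ^ 2 / (2 * P.res) := by field_simp
    have := mul_le_mul_of_nonneg_left hstep hq'.le
    rw [mul_add, mul_add, e1, ← mul_assoc, mul_one_div_cancel hq'.ne', one_mul] at this
    linarith
  have e2 : (P.cap : ℝ) * (P.ratio + 1) / (P.last + 1) = P.cap * ((P.ratio + 1) * E) := by
    rw [hE]; ring
  have e3 : (1 - (1 - μ) ^ P.cap) * (99 / 100 - aQ) / (A.nTest + 1) =
      -((1 - (1 - μ) ^ P.cap) * ((aQ - 99 / 100) / (A.nTest + 1))) := by ring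
  rw [e2, e3]
  linarith

end drift


/-! ### The hypothesis of a final round -/

/-- If each try succeeds with probability at least `1 / E`, then `10 * E` tries hardly ever all
fail. -/
lemma one_sub_pow_le {μ : ℝ} {E n : ℕ} (hE : 0 < E) (hμ : 1 / (E : ℝ) ≤ μ) (hμ1 : μ ≤ 1)
    (hn : 10 * E ≤ n) : (1 - μ) ^ n ≤ 1 / 1000 := by
  have hE' : (0 : ℝ) < E := by exact_mod_cast hE
  have h1 : (10 : ℝ) ≤ n * μ := by
    calc (10 : ℝ) = (10 * E) * (1 / E) := by field_simp
      _ ≤ n * μ := by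
        gcongr
        exact_mod_cast hn
  have h2 : (1 - μ) ^ n ≤ Real.exp (-(n * μ)) := by
    calc (1 - μ) ^ n ≤ Real.exp (-μ) ^ n := by
          apply pow_le_pow_left₀ (by linarith)
          have := Real.add_one_le_exp (-μ)
          linarith
      _ = _ := by rw [← Real.exp_nat_mul]; ring_nf
  have h3 : Real.exp (-(n * μ)) ≤ Real.exp (-10) := Real.exp_le_exp.2 (by linarith)
  have h4 : (1000 : ℝ) ≤ Real.exp 10 := by
    have h5 : Real.exp 10 = Real.exp 1 ^ 10 := by rw [← Real.exp_nat_mul]; norm_num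
    rw [h5]
    calc (1000 : ℝ) ≤ 2 ^ 10 := by norm_num
      _ ≤ _ := by gcongr; have := Real.exp_one_gt_d9; linarith
  have h5 : Real.exp (-10) ≤ 1 / 1000 := by
    rw [Real.exp_neg, ← one_div]
    exact one_div_le_one_div_of_le (by norm_num) h4
  linarith

lemma jointError_le {X : Type*} [MeasurableSpace X] {C : Set (X → Bool)}
    (Dtrain Dtest : Measure (X × Bool)) {f : X → Bool} (hf : f ∈ C) :
    jointError C Dtrain Dtest ≤ Dtrain.real {p | f p.1 ≠ p.2} + Dtest.real {p | f p.1 ≠ p.2} :=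
  ciInf_le ⟨0, by rintro _ ⟨g, rfl⟩; positivity⟩ (⟨f, hf⟩ : C)

lemma jointError_nonneg {X : Type*} [MeasurableSpace X] (C : Set (X → Bool))
    (Dtrain Dtest : Measure (X × Bool)) : 0 ≤ jointError C Dtrain Dtest :=
  Real.iInf_nonneg fun _ => by positivity

section final

variable {X : Type*} [MeasurableSpace X] (Dtrain Dtest : Measure (X × Bool))
  [IsProbabilityMeasure Dtrain] [IsProbabilityMeasure Dtest] {A : TDSAlgorithm X} {q n : ℕ}
  {V : X → ℤ}

omit [IsProbabilityMeasure Dtest] in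
lemma integral_weight_fst (hV : Measurable V) :
    ∫ p, (units q V p.1 : ℝ) / q ∂Dtrain = trainMass Dtrain.fst q V :=
  (measurePreserving_fst_fst Dtrain).integral_comp_measurable
    (measurable_weight (measurable_units hV q))

lemma integral_coweight_fst (hq : 0 < q) (hV : Measurable V) :
    ∫ p, ((q - units q V p.1 : ℕ) : ℝ) / q ∂Dtest = testMass Dtest.fst q V := by
  rw [testMass, ← (measurePreserving_fst_fst Dtest).integral_comp_measurable
    ((measurable_weight (measurable_units hV q)).const_sub 1)]
  simp_rw [coweight_eq hq (units_le q V)]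

/-- The benchmark of the two reweighted distributions is not much larger than that of the original
ones, up to the mass of the reweighted test distribution. -/
lemma testMass_mul_jointError_le {C : Set (X → Bool)} (hC : C.Nonempty) (hq : 0 < q)
    (hV : Measurable V) {H : ℝ} (hH : 1 ≤ H)
    (hbal : testMass Dtest.fst q V ≤ 2 * (H * trainMass Dtrain.fst q V)) :
    testMass Dtest.fst q V *
        jointError C (trainLaw Dtrain q n (units q V)) (testLaw Dtest q n (units q V)) ≤
      4 * H * jointError C Dtrain Dtest := by
  have : Nonempty C := hC.to_subtype
  have hH0 : 0 < 4 * H := by linarith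
  have hu := measurable_units hV q
  obtain ⟨hμ0, hμ1⟩ := testMass_mem Dtest.fst hq hV
  rw [← div_le_iff₀' hH0]
  refine le_ciInf fun f => ?_
  rw [div_le_iff₀' hH0]
  have h1 := rejLaw_real_le (ν := Dtrain) (w := fun p => (units q V p.1 : ℝ) / q)
    ((measurable_weight hu).comp measurable_fst) (fun p => (units_div_mem hq V p.1).1)
    (fun p => (units_div_mem hq V p.1).2) n {p | f.1 p.1 ≠ p.2}
  have h2 := rejLaw_real_le (ν := Dtest) (w := fun p => ((q - units q V p.1 : ℕ) : ℝ) / q)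
    ((measurable_coweight hu).comp measurable_fst)
    (fun p => div_nonneg (Nat.cast_nonneg _) (Nat.cast_nonneg _))
    (fun p => weight_le_one (t := fun x => q - units q V x) hq (fun _ => Nat.sub_le _ _) p.1) n
    {p | f.1 p.1 ≠ p.2}
  rw [integral_weight_fst Dtrain hV] at h1
  rw [integral_coweight_fst Dtest hq hV] at h2
  change _ * (trainLaw Dtrain q n (units q V)).real _ ≤ _ at h1
  change _ * (testLaw Dtest q n (units q V)).real _ ≤ _ at h2
  have h3 := mul_le_mul_of_nonneg_left
    (jointError_le (trainLaw Dtrain q n (units q V)) (testLaw Dtest q n (units q V)) f.2) hμ0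
  have h4 : testMass Dtest.fst q V *
      (trainLaw Dtrain q n (units q V)).real {p | f.1 p.1 ≠ p.2} ≤
      4 * H * Dtrain.real {p | f.1 p.1 ≠ p.2} := by
    calc _ ≤ 2 * (H * trainMass Dtrain.fst q V) *
          (trainLaw Dtrain q n (units q V)).real {p | f.1 p.1 ≠ p.2} := by gcongr
      _ = 2 * H * (trainMass Dtrain.fst q V *
          (trainLaw Dtrain q n (units q V)).real {p | f.1 p.1 ≠ p.2}) := by ring
      _ ≤ 2 * H * (2 * Dtrain.real {p | f.1 p.1 ≠ p.2}) := by gcongr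
      _ = _ := by ring
  have h5 : 2 * Dtest.real {p | f.1 p.1 ≠ p.2} ≤ 4 * H * Dtest.real {p | f.1 p.1 ≠ p.2} := by
    gcongr; linarith
  rw [mul_add] at h3 ⊢
  linarith

/-- The hypothesis returned on a sample from the two reweighted distributions (a constant one if
the algorithm rejects). -/
def finalHyp (A : TDSAlgorithm X) (q : ℕ) (V : X → ℤ) (c : Probe X A.nTrain A.nTest n) : X → Bool :=
  (A.run (fun k => trainSample q (units q V) (c.2.1 k)) (hybridSample q (units q V) 0 c.2.2.1)
    c.2.2.2).getD fun _ => true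

lemma measurable_finalHyp {Ω : Type*} [MeasurableSpace Ω] {V : Ω → X → ℤ}
    (hV : Measurable fun p : Ω × X => V p.1 p.2) {c : Ω → Probe X A.nTrain A.nTest n}
    (hc : Measurable c) {x : Ω → X} (hx : Measurable x) :
    Measurable fun ω => finalHyp A q (V ω) (c ω) (x ω) := by
  have htr : Measurable fun ω => fun k => trainSample q (units q (V ω)) ((c ω).2.1 k) :=
    measurable_pi_lambda _ fun k => measurable_trainSample hV
      ((measurable_pi_apply k).comp hc.snd.fst)
  have hte := measurable_hybridSample (q := q) hV hc.snd.snd.fst (j := fun _ => 0) measurable_const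
  have hin := htr.prodMk (hte.prodMk hc.snd.snd.snd)
  have h1 := (measurable_isSome_run A).comp hin
  have h2 := (hin.prodMk hx) A.measurable_predict
  refine measurable_to_bool ?_
  have : (fun ω => finalHyp A q (V ω) (c ω) (x ω)) ⁻¹' {true} =
      {ω | (A.run (fun k => trainSample q (units q (V ω)) ((c ω).2.1 k))
        (hybridSample q (units q (V ω)) 0 (c ω).2.2.1) (c ω).2.2.2).isSome = false} ∪
      {ω | ∃ h, A.run (fun k => trainSample q (units q (V ω)) ((c ω).2.1 k))
        (hybridSample q (units q (V ω)) 0 (c ω).2.2.1) (c ω).2.2.2 = some h ∧ h (x ω) = true} := by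
    ext ω
    simp only [mem_preimage, mem_singleton_iff, mem_union, mem_ofPred_eq, finalHyp]
    cases A.run (fun k => trainSample q (units q (V ω)) ((c ω).2.1 k))
        (hybridSample q (units q (V ω)) 0 (c ω).2.2.1) (c ω).2.2.2 <;> simp
  rw [this]
  exact (h1 (measurableSet_singleton false)).union h2

/-- The input of the algorithm in a final round has the law of independent samples from the two
reweighted distributions. -/
lemma measurePreserving_finalInput (hq : 0 < q) (hV : Measurable V) :
    MeasurePreserving (fun c : Probe X A.nTrain A.nTest n =>
        ((fun k => trainSample q (units q V) (c.2.1 k)), hybridSample q (units q V) 0 c.2.2.1,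
          c.2.2.2))
      (probeLaw Dtrain Dtest A.nTrain A.nTest n)
      (A.inputLaw (trainLaw Dtrain q n (units q V)) (testLaw Dtest q n (units q V))) := by
  have hu := measurable_units hV q
  have := isProbabilityMeasure_trainLaw Dtrain hq hu (units_le q V) n
  have := isProbabilityMeasure_testLaw Dtest hq hu n
  have h1 := measurePreserving_trainSamples Dtrain Dtest hq hu (units_le q V) A.nTrain n
  have h2 := measurePreserving_hybridSample Dtrain Dtest hq hu (units_le q V) n 0 A.nTest
  simp only [hybridLaw, Nat.not_lt_zero, if_false] at h2
  exact (h1.prod (h2.prod (MeasurePreserving.id volume))).comp measurePreserving_snd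

/-- If the algorithm returns a good hypothesis on the reweighted distributions, the masses of which
are balanced, then its error on the selected part of the test distribution is small. -/
lemma selected_error_le {C : Set (X → Bool)} (hC : C.Nonempty) (hq : 0 < q)
    (hV : Measurable V) {H B ε : ℝ} (hH : 1 ≤ H) (hB : 1 ≤ B) (hε : 0 ≤ ε)
    (hbal : testMass Dtest.fst q V ≤ 2 * (H * trainMass Dtrain.fst q V))
    {E : ℕ} (hE : 0 < E) (hμ : 1 / (E : ℝ) ≤ testMass Dtest.fst q V) (hn : 10 * E ≤ n)
    {h : X → Bool} (hh : Measurable h)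
    (herr : (testLaw Dtest q n (units q V)).real {p | p.2 ≠ h p.1} ≤
      B * jointError C (trainLaw Dtrain q n (units q V)) (testLaw Dtest q n (units q V)) + ε) :
    Dtest.real {p | p.2 ≠ h p.1 ∧ 2 * units q V p.1 < q} ≤
      20 * B * H * jointError C Dtrain Dtest + 5 * ε := by
  have hu := measurable_units hV q
  obtain ⟨hμ0, hμ1⟩ := testMass_mem Dtest.fst hq hV
  have hq' : (0 : ℝ) < q := by exact_mod_cast hq
  have hm : MeasurableSet {p : X × Bool | p.2 ≠ h p.1 ∧ 2 * units q V p.1 < q} := by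
    refine MeasurableSet.inter ?_ ?_
    · exact (measurableSet_eq_fun measurable_snd (hh.comp measurable_fst)).compl
    · exact measurableSet_lt ((measurable_of_countable fun k => 2 * k).comp
        (hu.comp measurable_fst)) measurable_const
  have h1 := le_rejLaw_real (ν := Dtest) (w := fun p => ((q - units q V p.1 : ℕ) : ℝ) / q)
    ((measurable_coweight hu).comp measurable_fst)
    (fun p => div_nonneg (Nat.cast_nonneg _) (Nat.cast_nonneg _))
    (fun p => weight_le_one (t := fun x => q - units q V x) hq (fun _ => Nat.sub_le _ _) p.1) n
    hm (B := {p | p.2 ≠ h p.1}) (fun p hp => hp.1) fun p hp => by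
      rw [coweight_eq hq (units_le q V)]
      have h2 : (2 * units q V p.1 : ℝ) < q := by exact_mod_cast hp.2
      have h3 : (units q V p.1 : ℝ) / q ≤ 1 / 2 := by
        rw [div_le_iff₀ hq']; linarith
      linarith
  rw [integral_coweight_fst Dtest hq hV] at h1
  change _ ≤ 2 * (_ * (testLaw Dtest q n (units q V)).real _) at h1
  have h2 := one_sub_pow_le hE hμ hμ1 hn
  have h3 := testMass_mul_jointError_le Dtrain Dtest hC hq hV hH hbal (n := n)
  have h4 := mul_le_mul_of_nonneg_left herr hμ0
  have h5 := mul_le_mul_of_nonneg_left h3 (zero_le_one.trans hB)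
  have h6 := mul_le_mul_of_nonneg_right hμ1 hε
  have h7 : 0 ≤ B * (4 * H * jointError C Dtrain Dtest) :=
    mul_nonneg (by linarith) (mul_nonneg (by linarith) (jointError_nonneg _ _ _))
  have h8 : 0 ≤ Dtest.real {p | p.2 ≠ h p.1 ∧ 2 * units q V p.1 < q} := measureReal_nonneg
  generalize Dtest.real {p | p.2 ≠ h p.1 ∧ 2 * units q V p.1 < q} = r at *
  generalize (testLaw Dtest q n (units q V)).real {p | p.2 ≠ h p.1} = e at *
  generalize jointError C (trainLaw Dtrain q n (units q V)) (testLaw Dtest q n (units q V)) = l' at *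
  generalize jointError C Dtrain Dtest = l at *
  generalize testMass Dtest.fst q V = μ at *
  have h9 : 999 / 1000 * r ≤ (1 - (1 - μ) ^ n) * r := by gcongr; linarith
  have h10 : 20 * B * H * l = 5 * (B * (4 * H * l)) := by ring
  rw [h10]
  have h11 : μ * e ≤ B * (4 * H * l) + ε := by
    calc μ * e ≤ μ * (B * l' + ε) := h4
      _ = B * (μ * l') + μ * ε := by ring
      _ ≤ _ := by linarith
  linarith

end final


/-! ### One repetition -/

section fixed

variable {X : Type*} [MeasurableSpace X] (Dtrain Dtest : Measure (X × Bool)) {A : TDSAlgorithm X}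

/-- The hypothesis of the final round and the selector `2 * t x < q` have test error at most `b`
and training rejection rate at most `r`. -/
def FinalGood (A : TDSAlgorithm X) (q : ℕ) {n : ℕ} (b r : ℝ) (V : X → ℤ)
    (c : Probe X A.nTrain A.nTest n) : Prop :=
  Dtest.real {p | p.2 ≠ finalHyp A q V c p.1 ∧ 2 * units q V p.1 < q} ≤ b ∧
    Dtrain.fst.real {x | ¬ 2 * units q V x < q} ≤ r

lemma measurableSet_finalGood [IsProbabilityMeasure Dtrain] [IsProbabilityMeasure Dtest]
    {q n : ℕ} {b r : ℝ} {Ω : Type*} [MeasurableSpace Ω] {V : Ω → X → ℤ}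
    (hV : Measurable fun p : Ω × X => V p.1 p.2) {c : Ω → Probe X A.nTrain A.nTest n}
    (hc : Measurable c) : MeasurableSet {ω | FinalGood Dtrain Dtest A q b r (V ω) (c ω)} := by
  have hlt : MeasurableSet {p : Ω × X | 2 * units q (V p.1) p.2 < q} := by
    have : Measurable fun p : Ω × X => units q (V p.1) p.2 :=
      measurable_units_comp (V := fun p : Ω × X => V p.1)
        (hV.comp (measurable_fst.fst.prodMk measurable_snd)) measurable_snd
    exact measurableSet_lt ((measurable_of_countable fun k => 2 * k).comp this) measurable_const
  have hne : MeasurableSet {p : Ω × X × Bool | p.2.2 ≠ finalHyp A q (V p.1) (c p.1) p.2.1} := by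
    refine (measurableSet_eq_fun measurable_snd.snd ?_).compl
    exact measurable_finalHyp (V := fun p : Ω × X × Bool => V p.1)
      (hV.comp (measurable_fst.fst.prodMk measurable_snd)) (hc.comp measurable_fst)
      measurable_snd.fst
  have h1 : Measurable fun ω => Dtest
      {p | p.2 ≠ finalHyp A q (V ω) (c ω) p.1 ∧ 2 * units q (V ω) p.1 < q} :=
    measurable_measure_prodMk_left (hne.inter
      ((measurable_fst.prodMk measurable_snd.fst : Measurable fun p : Ω × X × Bool => (p.1, p.2.1)) hlt))
  have h2 : Measurable fun ω => Dtrain.fst {x | ¬ 2 * units q (V ω) x < q} :=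
    measurable_measure_prodMk_left hlt.compl
  exact (measurableSet_le h1.ennreal_toReal measurable_const).inter
    (measurableSet_le h2.ennreal_toReal measurable_const)

variable [IsProbabilityMeasure Dtrain] [IsProbabilityMeasure Dtest] {P : Tuning} {V : X → ℤ}

/-- The algorithm accepts when the training and the test distribution coincide. -/
lemma acceptProb_self_ge {C : Set (X → Bool)} {B ε : ℝ}
    (hA : IsAgnosticTDSLearner A C B ε (1 / 100)) (D : Measure (X × Bool)) [IsProbabilityMeasure D] :
    99 / 100 ≤ acceptProb A D fun _ => D.fst := by
  have h := hA D D
  rw [acceptProb_eq]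
  change 99 / 100 ≤ (A.inputLaw D D).real _
  have : IsProbabilityMeasure (A.inputLaw D D) := by
    unfold TDSAlgorithm.inputLaw; infer_instance
  have h1 : A.inputLaw D D {y | (A.run y.1 y.2.1 y.2.2).isSome}ᶜ ≤ ENNReal.ofReal (1 / 100) :=
    by
      refine (measure_mono ?_).trans h
      intro y hy hy'
      exact hy (hy'.2 rfl)
  have h2 : (A.inputLaw D D).real {y | (A.run y.1 y.2.1 y.2.2).isSome}ᶜ ≤ 1 / 100 :=
    ENNReal.toReal_le_of_le_ofReal (by norm_num) h1
  rw [probReal_compl_eq_one_sub A.measurable_accept] at h2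
  linarith

/-- For a fixed score, the probability that the final round fails is small, up to the lower bound for
the drift of the potential that `potential_drift` provides.  If the masses are not balanced, then the
drift is large.  If they are balanced and the test mass is tiny, then the selected part of the test
distribution is tiny, whatever the hypothesis may be.  Otherwise a failure is a rejection, which
makes for a large drift, or a violation of the guarantee of the algorithm. -/
lemma finalGood_prob {C : Set (X → Bool)} (hC : C.Nonempty) {B ε η : ℝ} (hB : 1 ≤ B)
    (hA : IsAgnosticTDSLearner A C B ε (1 / 100)) {E : ℕ} (hE : 0 < E)
    (hEε : 1 / (E : ℝ) ≤ ε) (hH : 1 ≤ P.ratio) (hHη : 1 / (P.ratio : ℝ) ≤ η)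
    (hcap : P.cap = 10 * E) (hW : P.weight = 16 * E ^ 2)
    (hlast : 10 * E ≤ P.last) (hq : 0 < P.res) (hV : Measurable V) :
    (probeLaw Dtrain Dtest A.nTrain A.nTest P.last).real
        {c | ¬ FinalGood Dtrain Dtest A P.res
          (20 * B * P.ratio * jointError C Dtrain Dtest + 5 * ε) (3 * (η + ε)) V c} ≤
      21 / 1000 + 11 / 10 * (A.nTest + 1) *
        (P.weight * (P.ratio * trainMass Dtrain.fst P.res V - testMass Dtest.fst P.res V) ^ 2 +
        (1 - (1 - testMass Dtest.fst P.res V) ^ P.cap) *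
        (99 / 100 - acceptProb A (trainLaw Dtrain P.res P.last (units P.res V))
          fun _ => (testLaw Dtest P.res P.last (units P.res V)).fst) / (A.nTest + 1)) := by
  have hE' : (0 : ℝ) < E := by exact_mod_cast hE
  have hEi : 0 < 1 / (E : ℝ) := by positivity
  have hH' : (1 : ℝ) ≤ P.ratio := by exact_mod_cast hH
  have hu := measurable_units hV P.res
  have hPr := isProbabilityMeasure_trainLaw Dtrain hq hu (units_le P.res V) P.last
  have hQr := isProbabilityMeasure_testLaw Dtest hq hu P.last
  obtain ⟨hM0, hM1⟩ := trainMass_mem Dtrain.fst hq hV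
  obtain ⟨hμ0, hμ1⟩ := testMass_mem Dtest.fst hq hV
  have hin := measurePreserving_finalInput (A := A) (n := P.last) Dtrain Dtest hq hV
  have hinp : IsProbabilityMeasure (A.inputLaw (trainLaw Dtrain P.res P.last (units P.res V))
      (testLaw Dtest P.res P.last (units P.res V))) := by
    unfold TDSAlgorithm.inputLaw; infer_instance
  set aQ := acceptProb A (trainLaw Dtrain P.res P.last (units P.res V))
    (fun _ => (testLaw Dtest P.res P.last (units P.res V)).fst) with haQ
  have haQ1 : aQ ≤ 1 := by
    rw [haQ, acceptProb_eq]; exact measureReal_le_one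
  set M := trainMass Dtrain.fst P.res V with hM
  set μ := testMass Dtest.fst P.res V with hμ
  set p := (probeLaw Dtrain Dtest A.nTrain A.nTest P.last).real
        {c | ¬ FinalGood Dtrain Dtest A P.res
          (20 * B * P.ratio * jointError C Dtrain Dtest + 5 * ε) (3 * (η + ε)) V c} with hp
  have hp1 : p ≤ 1 := measureReal_le_one
  have hm : (0 : ℝ) < A.nTest + 1 := by positivity
  have hm1 : (1 : ℝ) ≤ A.nTest + 1 := by linarith [(Nat.cast_nonneg A.nTest : (0 : ℝ) ≤ A.nTest)]
  have hκ0 : 0 ≤ 1 - (1 - μ) ^ P.cap := by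
    have := pow_le_one₀ (n := P.cap) (show 0 ≤ 1 - μ by linarith) (by linarith); linarith
  have hκ1 : 1 - (1 - μ) ^ P.cap ≤ 1 := by
    have := pow_nonneg (show 0 ≤ 1 - μ by linarith) P.cap; linarith
  have hsplit : ∀ a b : ℝ, 11 / 10 * ((A.nTest : ℝ) + 1) * (a + b / (A.nTest + 1)) =
      11 / 10 * (A.nTest + 1) * a + 11 / 10 * b := by intro a b; field_simp
  rw [hsplit]
  set κ := 1 - (1 - μ) ^ P.cap with hκ
  have hκa : -(1 / 100) ≤ κ * (99 / 100 - aQ) := by nlinarith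
  have hW' : (P.weight : ℝ) = 16 * (E : ℝ) ^ 2 := by rw [hW]; push_cast; ring
  have hsq : 0 ≤ 11 / 10 * ((A.nTest : ℝ) + 1) * (P.weight * (P.ratio * M - μ) ^ 2) := by positivity
  by_cases hbal : |P.ratio * M - μ| ≤ 1 / (2 * E)
  · obtain ⟨hb1, hb2⟩ := abs_le.1 hbal
    have h2E : 1 / (2 * (E : ℝ)) = 1 / E / 2 := by field_simp
    rw [h2E] at hb1 hb2
    -- the rejection rate is small whenever the masses are balanced
    have hrej : Dtrain.fst.real {x | ¬ 2 * units P.res V x < P.res} ≤ 3 * (η + ε) := by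
      have hq' : (0 : ℝ) < P.res := by exact_mod_cast hq
      have h1 := mul_meas_ge_le_integral_of_nonneg (μ := Dtrain.fst)
        (f := fun x => (units P.res V x : ℝ) / P.res)
        (Filter.Eventually.of_forall fun x => (units_div_mem hq V x).1)
        (integrable_weight (measurable_weight hu) (fun x => (units_div_mem hq V x).1)
          fun x => (units_div_mem hq V x).2) (1 / 2)
      change _ ≤ M at h1
      have h2 : Dtrain.fst.real {x | ¬ 2 * units P.res V x < P.res} ≤
          Dtrain.fst.real {x | 1 / 2 ≤ (units P.res V x : ℝ) / P.res} := by
        refine measureReal_mono fun x hx => ?_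
        simp only [mem_ofPred_eq, not_lt] at hx ⊢
        rw [le_div_iff₀ hq']
        have : (P.res : ℝ) ≤ 2 * units P.res V x := by exact_mod_cast hx
        linarith
      have h3 : M ≤ 1 / P.ratio * (1 + 1 / E / 2) := by
        rw [one_div_mul_eq_div, le_div_iff₀ (by linarith)]
        linarith
      have h4 : 1 / (E : ℝ) ≤ 1 := by
        rw [div_le_one hE']; exact_mod_cast hE
      have h5 : 1 / (P.ratio : ℝ) * (1 + 1 / E / 2) ≤ η * (3 / 2) := by
        have : 0 ≤ 1 / (P.ratio : ℝ) := by positivity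
        exact mul_le_mul hHη (by linarith) (by positivity) (this.trans hHη)
      linarith
    -- if the test mass is tiny, then any hypothesis will do
    by_cases hμE : μ ≤ 1 / E
    · have hp0 : p = 0 := by
        rw [hp]
        convert measureReal_empty
        ext c
        simp only [mem_ofPred_eq, mem_empty_iff_false, iff_false, not_not]
        refine ⟨?_, hrej⟩
        have hq' : (0 : ℝ) < P.res := by exact_mod_cast hq
        have h1 := mul_meas_ge_le_integral_of_nonneg (μ := Dtest)
          (f := fun p => ((P.res - units P.res V p.1 : ℕ) : ℝ) / P.res)
          (Filter.Eventually.of_forall fun p => div_nonneg (Nat.cast_nonneg _) (Nat.cast_nonneg _))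
          (integrable_weight ((measurable_coweight hu).comp measurable_fst)
            (fun p => div_nonneg (Nat.cast_nonneg _) (Nat.cast_nonneg _))
            (fun p => weight_le_one (t := fun x => P.res - units P.res V x) hq
              (fun _ => Nat.sub_le _ _) p.1)) (1 / 2)
        rw [integral_coweight_fst Dtest hq hV] at h1
        change _ ≤ μ at h1
        have h2 : Dtest.real {p | p.2 ≠ finalHyp A P.res V c p.1 ∧ 2 * units P.res V p.1 < P.res} ≤
            Dtest.real {p | 1 / 2 ≤ ((P.res - units P.res V p.1 : ℕ) : ℝ) / P.res} := by
          refine measureReal_mono fun p hp => ?_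
          have h3 := hp.2
          simp only [mem_ofPred_eq]
          rw [le_div_iff₀ hq']
          have : P.res ≤ 2 * (P.res - units P.res V p.1) := by omega
          have : (P.res : ℝ) ≤ 2 * ((P.res - units P.res V p.1 : ℕ) : ℝ) := by exact_mod_cast this
          linarith
        have h3 : 0 ≤ 20 * B * P.ratio * jointError C Dtrain Dtest :=
          mul_nonneg (by positivity) (jointError_nonneg _ _ _)
        linarith
      rw [hp0]
      linarith
    · push Not at hμE
      have hbal' : μ ≤ 2 * (P.ratio * M) := by linarith
      have hκ2 : 999 / 1000 ≤ κ := by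
        have := one_sub_pow_le (n := P.cap) hE hμE.le hμ1 (by omega)
        linarith
      have hε : 0 ≤ ε := hEi.le.trans hEε
      -- a failure means that the algorithm rejects, or that it returns a bad hypothesis
      have hsub : {c | ¬ FinalGood Dtrain Dtest A P.res
          (20 * B * P.ratio * jointError C Dtrain Dtest + 5 * ε) (3 * (η + ε)) V c} ⊆
          (fun c : Probe X A.nTrain A.nTest P.last =>
            ((fun k => trainSample P.res (units P.res V) (c.2.1 k)),
              hybridSample P.res (units P.res V) 0 c.2.2.1, c.2.2.2)) ⁻¹'
          ({y | (A.run y.1 y.2.1 y.2.2).isSome}ᶜ ∪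
            {ω | ¬ ((∀ h, A.run ω.1 ω.2.1 ω.2.2 = some h →
                (testLaw Dtest P.res P.last (units P.res V)).real {p | p.2 ≠ h p.1} ≤
                  B * jointError C (trainLaw Dtrain P.res P.last (units P.res V))
                    (testLaw Dtest P.res P.last (units P.res V)) + ε) ∧
              ((trainLaw Dtrain P.res P.last (units P.res V)).fst =
                (testLaw Dtest P.res P.last (units P.res V)).fst →
                  (A.run ω.1 ω.2.1 ω.2.2).isSome))}) := by
        intro c hc
        by_contra hc'
        simp only [mem_preimage, mem_union, mem_compl_iff, mem_ofPred_eq, not_or, not_not] at hc'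
        obtain ⟨hs, hg, -⟩ := hc'
        obtain ⟨h, hh⟩ := Option.isSome_iff_exists.1 hs
        refine hc ⟨?_, hrej⟩
        have hfin : finalHyp A P.res V c = h := by rw [finalHyp, hh]; rfl
        have hmeas : Measurable h := by
          rw [← hfin]
          exact measurable_finalHyp (Ω := X) (V := fun _ => V) (c := fun _ => c)
            (hV.comp measurable_snd) measurable_const measurable_id
        rw [hfin]
        exact selected_error_le Dtrain Dtest hC hq hV hH' hB hε hbal' hE hμE.le hlast hmeas
          (hg h hh)
      have h1 := (measure_mono (μ := probeLaw Dtrain Dtest A.nTrain A.nTest P.last) hsub).trans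
        (Measure.le_map_apply hin.measurable.aemeasurable _)
      rw [hin.map_eq] at h1
      have h2 : p ≤ (A.inputLaw (trainLaw Dtrain P.res P.last (units P.res V))
          (testLaw Dtest P.res P.last (units P.res V))).real {y | (A.run y.1 y.2.1 y.2.2).isSome}ᶜ +
          1 / 100 := by
        rw [hp]
        refine (ENNReal.toReal_mono (measure_ne_top _ _) h1).trans ?_
        refine (measureReal_union_le _ _).trans ?_
        gcongr
        exact ENNReal.toReal_le_of_le_ofReal (by norm_num) (hA _ _)
      rw [probReal_compl_eq_one_sub A.measurable_accept] at h2
      have h3 : (A.inputLaw (trainLaw Dtrain P.res P.last (units P.res V))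
          (testLaw Dtest P.res P.last (units P.res V))).real
          {y | (A.run y.1 y.2.1 y.2.2).isSome} = aQ := by
        rw [haQ, acceptProb_eq]; rfl
      rw [h3] at h2
      have h4 : 99 / 100 - aQ + 2 / 100 ≤ 21 / 1000 + 11 / 10 * (κ * (99 / 100 - aQ)) := by
        rcases le_total 0 (99 / 100 - aQ) with h | h <;> nlinarith
      linarith
  -- if the masses are not balanced, then the bound exceeds `1`
  · push Not at hbal
    have h1 : 4 ≤ P.weight * (P.ratio * M - μ) ^ 2 := by
      have h2 : (1 / (2 * (E : ℝ))) ^ 2 ≤ (P.ratio * M - μ) ^ 2 := by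
        rw [← sq_abs (P.ratio * M - μ)]
        gcongr
      calc (4 : ℝ) = 16 * (E : ℝ) ^ 2 * (1 / (2 * (E : ℝ))) ^ 2 := by field_simp; norm_num
        _ ≤ _ := by rw [hW']; gcongr
    have h2 : 11 / 10 * 1 * 4 ≤ 11 / 10 * ((A.nTest : ℝ) + 1) * (P.weight * (P.ratio * M - μ) ^ 2) := by
      gcongr
    linarith

end fixed


/-! ### The boosting process, stopped at a random time -/

section process

variable {X : Type*} [MeasurableSpace X]

/-- The score after the first `t` rounds. -/
def scoreAt (A : TDSAlgorithm X) (P : Tuning) (b : ℕ → Round X A.nTrain A.nTest P.last) :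
    ℕ → X → ℤ
  | 0 => fun _ => 0
  | t + 1 => fun x => scoreAt A P b t x + roundUpdate A P (scoreAt A P b t) (b t) x

variable {A : TDSAlgorithm X} {P : Tuning}

lemma scoreAt_congr {b b' : ℕ → Round X A.nTrain A.nTest P.last} {t : ℕ}
    (h : ∀ k < t, b k = b' k) : scoreAt A P b t = scoreAt A P b' t := by
  induction t with
  | zero => rfl
  | succ t ih =>
    have h1 := ih fun k hk => h k (by omega)
    funext x
    rw [scoreAt, scoreAt, h1, h t (by omega)]

lemma abs_scoreAt_le (b : ℕ → Round X A.nTrain A.nTest P.last) (t : ℕ) (x : X) :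
    |scoreAt A P b t x| ≤ (t * P.maxUpdate : ℕ) := by
  induction t with
  | zero => simp [scoreAt]
  | succ t ih =>
    have h := abs_roundUpdate_le A P (scoreAt A P b t) (b t) x
    rw [scoreAt]
    refine (abs_add_le _ _).trans ?_
    change _ ≤ (P.maxUpdate : ℤ) at h
    push_cast at ih ⊢
    linarith

lemma measurable_scoreAt {Ω : Type*} [MeasurableSpace Ω]
    {b : Ω → ℕ → Round X A.nTrain A.nTest P.last} (hb : ∀ k, Measurable fun ω => b ω k) (t : ℕ) :
    Measurable fun p : Ω × X => scoreAt A P (b p.1) t p.2 := by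
  induction t with
  | zero => exact measurable_const
  | succ t ih =>
    exact ih.add (measurable_roundUpdate (Ω := Ω × X) (V := fun p => scoreAt A P (b p.1) t)
      (ih.comp (measurable_fst.fst.prodMk measurable_snd)) ((hb t).comp measurable_fst)
      measurable_snd)

/-- The infinite sequence that repeats a finite one; only its first `T` terms matter. -/
def cyclic {Y : Type*} {T : ℕ} [NeZero T] (b : Fin T → Y) (k : ℕ) : Y := b (Fin.ofNat T k)

lemma cyclic_update_of_lt {Y : Type*} {T : ℕ} [NeZero T] (b : Fin T → Y) {t k : ℕ} (hk : k < t)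
    (ht : t < T) (y : Y) : cyclic (Function.update b (Fin.ofNat T t) y) k = cyclic b k := by
  rw [cyclic, cyclic, Function.update_of_ne]
  intro h
  have := congrArg Fin.val h
  simp only [Fin.ofNat, Nat.mod_eq_of_lt ht, Nat.mod_eq_of_lt (hk.trans ht)] at this
  omega

lemma cyclic_update_self {Y : Type*} {T : ℕ} [NeZero T] (b : Fin T → Y) (t : ℕ) (y : Y) :
    cyclic (Function.update b (Fin.ofNat T t) y) t = y := by
  rw [cyclic, Function.update_self]

variable (Dtrain Dtest : Measure (X × Bool)) [IsProbabilityMeasure Dtrain]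
  [IsProbabilityMeasure Dtest] {T : ℕ} [NeZero T]

/-- The potential after `t` rounds. -/
def potentialAt (A : TDSAlgorithm X) (P : Tuning) (t : ℕ)
    (b : Fin T → Round X A.nTrain A.nTest P.last) : ℝ :=
  potential Dtrain.fst Dtest.fst P.ratio P.res (scoreAt A P (cyclic b) t)

lemma measurable_potential {Ω : Type*} [MeasurableSpace Ω] {V : Ω → X → ℤ}
    (hV : Measurable fun p : Ω × X => V p.1 p.2) (H q : ℕ) :
    Measurable fun ω => potential Dtrain.fst Dtest.fst H q (V ω) := by
  have hc : Measurable fun p : Ω × X => (V p.1 p.2 : ℝ) / q :=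
    ((measurable_of_countable (fun k : ℤ => (k : ℝ))).comp hV).div_const _
  exact ((continuous_alphaPot.measurable.comp hc).stronglyMeasurable.integral_prod_right'.measurable.const_mul
    _).add (continuous_betaPot.measurable.comp hc).stronglyMeasurable.integral_prod_right'.measurable

lemma measurable_cyclic {Y : Type*} [MeasurableSpace Y] (k : ℕ) :
    Measurable fun b : Fin T → Y => cyclic b k := measurable_pi_apply _

lemma measurable_scoreAt_cyclic (t : ℕ) :
    Measurable fun p : (Fin T → Round X A.nTrain A.nTest P.last) × X =>
      scoreAt A P (cyclic p.1) t p.2 := measurable_scoreAt (b := cyclic) measurable_cyclic t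

lemma measurable_scoreAt_right (b : ℕ → Round X A.nTrain A.nTest P.last) (t : ℕ) :
    Measurable (scoreAt A P b t) :=
  (measurable_scoreAt (Ω := X) (b := fun _ => b) (fun _ => measurable_const) t).comp
    (measurable_id.prodMk measurable_id)

lemma measurable_potentialAt (t : ℕ) :
    Measurable (potentialAt (T := T) Dtrain Dtest A P t) :=
  measurable_potential Dtrain Dtest (measurable_scoreAt_cyclic t) _ _

lemma abs_potentialAt_le (t : ℕ) (b : Fin T → Round X A.nTrain A.nTest P.last) :
    |potentialAt Dtrain Dtest A P t b| ≤ (P.ratio + 1) * (2 * (t * P.maxUpdate : ℕ) + 1) :=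
  potential_le (measurable_scoreAt_right _ _) (abs_scoreAt_le _ _)

lemma integrable_potentialAt (t : ℕ) : Integrable (potentialAt (T := T) Dtrain Dtest A P t)
    (Measure.pi fun _ => roundLaw Dtrain Dtest A.nTrain A.nTest P.last) :=
  integrable_of_abs_le (measurable_potentialAt Dtrain Dtest t) (abs_potentialAt_le Dtrain Dtest t)

/-- The expected potential after a further round. -/
def nextPotentialAt (A : TDSAlgorithm X) (P : Tuning) (t : ℕ)
    (b : Fin T → Round X A.nTrain A.nTest P.last) : ℝ :=
  ∫ c, potential Dtrain.fst Dtest.fst P.ratio P.res (fun x =>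
      scoreAt A P (cyclic b) t x + roundUpdate A P (scoreAt A P (cyclic b) t) c x)
    ∂(roundLaw Dtrain Dtest A.nTrain A.nTest P.last)

lemma integrable_nextPotentialAt (t : ℕ) : Integrable (nextPotentialAt (T := T) Dtrain Dtest A P t)
    (Measure.pi fun _ => roundLaw Dtrain Dtest A.nTrain A.nTest P.last) := by
  have hV := measurable_scoreAt_cyclic (A := A) (P := P) (T := T) t
  have hm : Measurable fun p : (Fin T → Round X A.nTrain A.nTest P.last) ×
      Round X A.nTrain A.nTest P.last => potential Dtrain.fst Dtest.fst P.ratio P.res (fun x =>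
        scoreAt A P (cyclic p.1) t x + roundUpdate A P (scoreAt A P (cyclic p.1) t) p.2 x) := by
    have hV1 : Measurable fun p : ((Fin T → Round X A.nTrain A.nTest P.last) ×
      Round X A.nTrain A.nTest P.last) × X => scoreAt A P (cyclic p.1.1) t p.2 :=
      hV.comp (measurable_fst.fst.prodMk measurable_snd)
    refine measurable_potential Dtrain Dtest (hV1.add (measurable_roundUpdate
      (Ω := ((Fin T → Round X A.nTrain A.nTest P.last) × Round X A.nTrain A.nTest P.last) × X)
      (V := fun p => scoreAt A P (cyclic p.1.1) t) ?_ measurable_fst.snd measurable_snd)) _ _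
    exact hV1.comp (measurable_fst.fst.prodMk measurable_snd)
  refine integrable_of_abs_le hm.stronglyMeasurable.integral_prod_right'.measurable
    (C := (P.ratio + 1) * (2 * ((t + 1) * P.maxUpdate : ℕ) + 1)) fun b' => ?_
  have hbd : ∀ c, |potential Dtrain.fst Dtest.fst P.ratio P.res (fun x =>
      scoreAt A P (cyclic b') t x + roundUpdate A P (scoreAt A P (cyclic b') t) c x)| ≤
      (P.ratio + 1) * (2 * ((t + 1) * P.maxUpdate : ℕ) + 1) := fun c => by
    refine potential_le ((measurable_scoreAt_right _ _).add (measurable_roundUpdate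
      (V := fun _ => scoreAt A P (cyclic b') t)
      ((measurable_scoreAt_right _ _).comp measurable_snd) measurable_const measurable_id))
      fun x => ?_
    have h1 := abs_scoreAt_le (cyclic b') t x
    have h2 := abs_roundUpdate_le A P (scoreAt A P (cyclic b') t) c x
    change _ ≤ (P.maxUpdate : ℤ) at h2
    refine (abs_add_le _ _).trans ?_
    push_cast at h1 ⊢
    simp only [id]
    linarith
  have := norm_integral_le_of_norm_le_const
    (μ := roundLaw Dtrain Dtest A.nTrain A.nTest P.last)
    (f := fun c => potential Dtrain.fst Dtest.fst P.ratio P.res (fun x =>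
      scoreAt A P (cyclic b') t x + roundUpdate A P (scoreAt A P (cyclic b') t) c x))
    (Filter.Eventually.of_forall hbd)
  simpa [nextPotentialAt] using this

/-- The next round is independent of the previous ones. -/
lemma integral_potentialAt_succ {t : ℕ} (ht : t < T) :
    ∫ b, potentialAt (T := T) Dtrain Dtest A P (t + 1) b
        ∂(Measure.pi fun _ => roundLaw Dtrain Dtest A.nTrain A.nTest P.last) =
      ∫ b, nextPotentialAt (T := T) Dtrain Dtest A P t b
        ∂(Measure.pi fun _ => roundLaw Dtrain Dtest A.nTrain A.nTest P.last) := by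
  have h := measurePreserving_update
    (fun _ : Fin T => roundLaw Dtrain Dtest A.nTrain A.nTest P.last) (Fin.ofNat T t)
    (roundLaw Dtrain Dtest A.nTrain A.nTest P.last)
  have he : Function.update (fun _ : Fin T => roundLaw Dtrain Dtest A.nTrain A.nTest P.last)
      (Fin.ofNat T t) (roundLaw Dtrain Dtest A.nTrain A.nTest P.last) =
      fun _ => roundLaw Dtrain Dtest A.nTrain A.nTest P.last := Function.update_eq_self _ _
  rw [he] at h
  have hm := measurable_potentialAt (T := T) (A := A) (P := P) Dtrain Dtest (t + 1)
  rw [← h.integral_comp_measurable hm, integral_prod]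
  · refine integral_congr_ae (Filter.Eventually.of_forall fun b => ?_)
    refine integral_congr_ae (Filter.Eventually.of_forall fun c => ?_)
    simp only [potentialAt]
    congr 1
    funext x
    rw [scoreAt, cyclic_update_self,
      scoreAt_congr fun k hk => cyclic_update_of_lt b hk ht c]
  · exact integrable_of_abs_le (hm.comp h.measurable) fun p => abs_potentialAt_le Dtrain Dtest _ _

/-- The hypothesis and the selector of a repetition have test error at most `b` and training
rejection rate at most `r`.  The selector comes from the score at a random time, which the coin of
the final round provides. -/
def RepGood (A : TDSAlgorithm X) (P : Tuning) (T : ℕ) [NeZero T] (b r : ℝ)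
    (ξ : (Fin T → Round X A.nTrain A.nTest P.last) × Round X A.nTrain A.nTest P.last) : Prop :=
  FinalGood Dtrain Dtest A P.res b r (scoreAt A P (cyclic ξ.1) (coinVal ξ.2.1.2.2.1 T))
    ((ξ.2.1.2.2.1, ξ.2.2.2.1, ξ.2.2.2.2.1, ξ.2.1.2.2.2) : Probe X A.nTrain A.nTest P.last)

/-- The law of the random data of a repetition. -/
def repLaw (a b n T : ℕ) : Measure ((Fin T → Round X a b n) × Round X a b n) :=
  (Measure.pi fun _ => roundLaw Dtrain Dtest a b n).prod (roundLaw Dtrain Dtest a b n)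

instance (a b n T : ℕ) : IsProbabilityMeasure (repLaw Dtrain Dtest a b n T) := by
  unfold repLaw; infer_instance

/-- The coin of a probe picks a uniformly random index below `T`, independently of the rest. -/
lemma real_probeLaw_eq {n a b : ℕ} (F : ℕ → (Fin a → Slot X n) × (Fin b → Slot X n) × unitInterval → Prop)
    (hF : ∀ k, MeasurableSet {r | F k r}) (hT : 0 < T) :
    (probeLaw Dtrain Dtest a b n).real {c | F (coinVal c.1 T) c.2} =
      (1 / T) * ∑ k ∈ Finset.range T, (probeLaw Dtrain Dtest a b n).real {c | F k c.2} := by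
  set ρ := (Measure.pi fun _ : Fin a => slotLaw Dtrain Dtest n).prod
    ((Measure.pi fun _ : Fin b => slotLaw Dtrain Dtest n).prod (volume : Measure unitInterval)) with hρ
  have hm : MeasurableSet {c : Probe X a b n | F (coinVal c.1 T) c.2} := by
    have : {c : Probe X a b n | F (coinVal c.1 T) c.2} =
        ⋃ k, {c : Probe X a b n | coinVal c.1 T = k} ∩ Prod.snd ⁻¹' {r | F k r} := by
      ext c; simp
    rw [this]
    exact MeasurableSet.iUnion fun k => (((measurable_coinVal T).comp measurable_fst)
      (measurableSet_singleton k)).inter (measurable_snd (hF k))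
  have h1 : ∀ k, (probeLaw Dtrain Dtest a b n).real {c | F k c.2} = ρ.real {r | F k r} := fun k => by
    have : {c : Probe X a b n | F k c.2} = univ ×ˢ {r | F k r} := by ext c; simp
    rw [this, probeLaw, ← hρ, measureReal_prod_prod, probReal_univ, one_mul]
  simp_rw [h1]
  rw [← integral_coinVal hT (fun k => ρ.real {r | F k r}), ← integral_indicator_one hm, probeLaw,
    ← hρ, integral_prod]
  · refine integral_congr_ae (Filter.Eventually.of_forall fun u => ?_)
    dsimp only
    rw [← integral_indicator_one (hF _)]
    rfl
  · exact (integrable_indicator_iff hm).2 (integrableOn_const (by simp) (by simp))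

lemma measurableSet_finalGood_rest (q : ℕ) {n : ℕ} (b r : ℝ) {V : X → ℤ} (hV : Measurable V) :
    MeasurableSet {c : (Fin A.nTrain → Slot X n) × (Fin A.nTest → Slot X n) × unitInterval |
      ¬ FinalGood Dtrain Dtest A q b r V ((0, c) : Probe X A.nTrain A.nTest n)} :=
  (measurableSet_finalGood Dtrain Dtest (V := fun _ => V) (hV.comp measurable_snd)
    (measurable_const.prodMk measurable_id)).compl

/-- If a score that fails is charged to the decrease of the potential, a random score of the process
rarely fails. -/
lemma repLaw_not_repGood_le {b r c₀ c₁ err : ℝ} (hc₁ : 0 ≤ c₁)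
    (hfail : ∀ (V : X → ℤ) (C : ℕ), Measurable V → (∀ x, |V x| ≤ C) →
      (probeLaw Dtrain Dtest A.nTrain A.nTest P.last).real
          {c | ¬ FinalGood Dtrain Dtest A P.res b r V c} ≤
        c₀ + c₁ * (P.res * (potential Dtrain.fst Dtest.fst P.ratio P.res V -
      ∫ c, potential Dtrain.fst Dtest.fst P.ratio P.res (fun x => V x + roundUpdate A P V c x)
        ∂(roundLaw Dtrain Dtest A.nTrain A.nTest P.last)) + err)) :
    (repLaw Dtrain Dtest A.nTrain A.nTest P.last T).real {ξ | ¬ RepGood Dtrain Dtest A P T b r ξ} ≤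
      c₀ + c₁ * (P.res / (2 * T) + err) := by
  have hT : 0 < T := Nat.pos_of_ne_zero (NeZero.ne T)
  have hT' : (0 : ℝ) < T := by exact_mod_cast hT
  set rl := roundLaw Dtrain Dtest A.nTrain A.nTest P.last with hrl
  set pl := probeLaw Dtrain Dtest A.nTrain A.nTest P.last with hpl
  have hproj := measurePreserving_fst.comp (measurePreserving_fst.comp
    (measurePreserving_round Dtrain Dtest A.nTrain A.nTest P.last))
  rw [← hrl, ← hpl] at hproj
  have hmp := (MeasurePreserving.id (Measure.pi fun _ : Fin T => rl)).prod hproj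
  -- the score at the random time
  let W : ((Fin T → Round X A.nTrain A.nTest P.last) × Probe X A.nTrain A.nTest P.last) → X → ℤ :=
    fun p => scoreAt A P (cyclic p.1) (coinVal p.2.1 T)
  have hW : Measurable fun p : ((Fin T → Round X A.nTrain A.nTest P.last) ×
      Probe X A.nTrain A.nTest P.last) × X => W p.1 p.2 := by
    refine Measurable.apply_countable (ι := ℕ)
      (f := fun (p : ((Fin T → Round X A.nTrain A.nTest P.last) ×
      Probe X A.nTrain A.nTest P.last) × X) t => scoreAt A P (cyclic p.1.1) t p.2) (fun t => ?_) ?_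
    · exact (measurable_scoreAt_cyclic t).comp (measurable_fst.fst.prodMk measurable_snd)
    · exact (measurable_coinVal T).comp measurable_fst.snd.fst
  have hbad : MeasurableSet {p | ¬ FinalGood Dtrain Dtest A P.res b r (W p) p.2} :=
    (measurableSet_finalGood Dtrain Dtest hW measurable_snd).compl
  have e1 : (repLaw Dtrain Dtest A.nTrain A.nTest P.last T).real
      {ξ | ¬ RepGood Dtrain Dtest A P T b r ξ} =
      ((Measure.pi fun _ : Fin T => rl).prod pl).real
        {p | ¬ FinalGood Dtrain Dtest A P.res b r (W p) p.2} := by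
    rw [measureReal_def, measureReal_def, ← hmp.measure_preimage hbad.nullMeasurableSet]
    rfl
  have hfin : ∀ t, Integrable (nextPotentialAt (T := T) Dtrain Dtest A P t)
      (Measure.pi fun _ => rl) := integrable_nextPotentialAt Dtrain Dtest
  have e2 : ((Measure.pi fun _ : Fin T => rl).prod pl).real
        {p | ¬ FinalGood Dtrain Dtest A P.res b r (W p) p.2} ≤
      ∫ b', (1 / T) * ∑ t ∈ Finset.range T, (c₀ + c₁ * (P.res *
        (potentialAt Dtrain Dtest A P t b' -
        nextPotentialAt Dtrain Dtest A P t b') + err))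
        ∂(Measure.pi fun _ : Fin T => rl) := by
    rw [← integral_indicator_one hbad, integral_prod]
    · refine integral_mono ?_ ?_ fun b' => ?_
      · exact ((integrable_indicator_iff hbad).2
          (integrableOn_const (by simp) (by simp))).integral_prod_left
      · refine (integrable_finsetSum _ fun t _ => ?_).const_mul _
        exact (integrable_const _).add (((((integrable_potentialAt Dtrain Dtest t).sub
          (hfin t)).const_mul _).add (integrable_const _)).const_mul _)
      · have h1 : ∫ y, {p | ¬ FinalGood Dtrain Dtest A P.res b r (W p) p.2}.indicator
            (fun _ => (1 : ℝ)) (b', y) ∂pl =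
            pl.real {c : Probe X A.nTrain A.nTest P.last | ¬ FinalGood Dtrain Dtest A P.res b r
              (scoreAt A P (cyclic b') (coinVal c.1 T)) ((0, c.2) : Probe X A.nTrain A.nTest P.last)} := by
          rw [← integral_indicator_one (s := {c : Probe X A.nTrain A.nTest P.last | ¬ FinalGood Dtrain Dtest A P.res b r
              (scoreAt A P (cyclic b') (coinVal c.1 T)) ((0, c.2) : Probe X A.nTrain A.nTest P.last)})]
          · rfl
          · exact measurable_prodMk_left hbad
        dsimp only
        refine (le_of_eq h1).trans ?_
        rw [hpl, real_probeLaw_eq Dtrain Dtest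
          (fun k c => ¬ FinalGood Dtrain Dtest A P.res b r (scoreAt A P (cyclic b') k)
            ((0, c) : Probe X A.nTrain A.nTest P.last))
          (fun k => measurableSet_finalGood_rest Dtrain Dtest _ _ _ (measurable_scoreAt_right _ _)) hT]
        refine mul_le_mul_of_nonneg_left (Finset.sum_le_sum fun t _ => ?_) (by positivity)
        exact hfail _ _ (measurable_scoreAt_right _ _) (abs_scoreAt_le _ _)
    · exact (integrable_indicator_iff hbad).2 (integrableOn_const (by simp) (by simp))
  rw [e1]
  refine e2.trans ?_
  have hI : ∀ t, Integrable (fun b' => c₀ + c₁ * (P.res *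
        (potentialAt Dtrain Dtest A P t b' -
        nextPotentialAt Dtrain Dtest A P t b') + err))
        (Measure.pi fun _ : Fin T => rl) := fun t =>
    (integrable_const _).add (((((integrable_potentialAt Dtrain Dtest t).sub
          (hfin t)).const_mul _).add (integrable_const _)).const_mul _)
  rw [integral_const_mul, integral_finsetSum _ fun t _ => hI t]
  have e3 : ∀ t ∈ Finset.range T, ∫ b', (c₀ + c₁ * (P.res *
        (potentialAt Dtrain Dtest A P t b' -
        nextPotentialAt Dtrain Dtest A P t b') + err))
        ∂(Measure.pi fun _ : Fin T => rl) =
      (c₀ + c₁ * err) + c₁ * P.res *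
        (∫ b', potentialAt Dtrain Dtest A P t b' ∂(Measure.pi fun _ : Fin T => rl) -
          ∫ b', potentialAt Dtrain Dtest A P (t + 1) b' ∂(Measure.pi fun _ : Fin T => rl)) := by
    intro t ht
    rw [integral_potentialAt_succ Dtrain Dtest (Finset.mem_range.1 ht), ← hrl,
      ← integral_sub (integrable_potentialAt Dtrain Dtest t) (hfin t)]
    have hd : Integrable (fun b' : Fin T → Round X A.nTrain A.nTest P.last =>
        potentialAt Dtrain Dtest A P t b' - nextPotentialAt Dtrain Dtest A P t b')
        (Measure.pi fun _ => rl) := (integrable_potentialAt Dtrain Dtest t).sub (hfin t)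
    have e4 : ∀ b' : Fin T → Round X A.nTrain A.nTest P.last, c₀ + c₁ * (P.res *
        (potentialAt Dtrain Dtest A P t b' -
        nextPotentialAt Dtrain Dtest A P t b') + err) =
        (c₀ + c₁ * err) + c₁ * P.res * (potentialAt Dtrain Dtest A P t b' -
        nextPotentialAt Dtrain Dtest A P t b') :=
      fun b' => by ring
    simp_rw [e4]
    rw [integral_add (integrable_const _) (hd.const_mul _), integral_const_mul]
    simp [hrl]
  rw [Finset.sum_congr rfl e3, Finset.sum_add_distrib, ← Finset.mul_sum, Finset.sum_range_sub']
  -- the sum over the rounds telescopes; the potential is `1 / 2` at first, and never negative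
  have e5 : ∫ b', potentialAt Dtrain Dtest A P 0 b' ∂(Measure.pi fun _ : Fin T => rl) = 1 / 2 := by
    have : ∀ b' : Fin T → Round X A.nTrain A.nTest P.last,
        potentialAt Dtrain Dtest A P 0 b' = 1 / 2 := fun b' => by
      rw [potentialAt]; exact potential_zero _ _ _ _
    simp_rw [this]
    simp
  have e6 : 0 ≤ ∫ b', potentialAt Dtrain Dtest A P T b' ∂(Measure.pi fun _ : Fin T => rl) :=
    integral_nonneg fun b' => potential_nonneg _ _ _ _ _
  rw [e5]
  simp only [Finset.sum_const, Finset.card_range, nsmul_eq_mul]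
  have hres : (0 : ℝ) ≤ P.res := Nat.cast_nonneg _
  calc _ ≤ 1 / (T : ℝ) * (T * (c₀ + c₁ * err) + c₁ * P.res * (1 / 2)) := by
        gcongr
        linarith
    _ = _ := by field_simp; ring

end process


/-! ### The tuning, and the failure probability of one repetition -/

/-- The tuning of the boosting process.  Here `m` exceeds the sample size of the TDS algorithm, and
`E` and `H` stand for `⌈1 / ε⌉` and `⌈1 / η⌉`. -/
def stdTuning (m E H : ℕ) : Tuning where
  last := 20000 * E ^ 2 * m
  cap := 10 * E
  weight := 16 * E ^ 2
  ratio := min E H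
  res := 2000000 * E ^ 7 * m

/-- The number of rounds of the boosting process. -/
def stdRounds (m E : ℕ) : ℕ := 500 * m * (2000000 * E ^ 7 * m)

instance (m E : ℕ) [NeZero m] [NeZero E] : NeZero (stdRounds m E) :=
  ⟨by have := NeZero.ne m; have := NeZero.ne E; simp [stdRounds, *]⟩

/-- With the standard tuning, a repetition fails with probability at most `1 / 25`.  The ratio is
`min E H` rather than `H`, so that the sizes of the updates, and with them the number of calls of
the algorithm, do not depend on `η`; this costs `ε` in the rejection rate. -/
lemma repLaw_std_not_repGood_le {X : Type*} [MeasurableSpace X] (Dtrain Dtest : Measure (X × Bool))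
    [IsProbabilityMeasure Dtrain] [IsProbabilityMeasure Dtest] {A : TDSAlgorithm X}
    {C : Set (X → Bool)} (hC : C.Nonempty) {B ε η : ℝ} (hB : 1 ≤ B)
    (hA : IsAgnosticTDSLearner A C B ε (1 / 100)) {m E H : ℕ} [NeZero m] [NeZero E]
    (hm : A.nTest + 1 ≤ m) (hEε : 1 / (E : ℝ) ≤ ε) (hH : 1 ≤ H) (hHη : 1 / (H : ℝ) ≤ η) :
    (repLaw Dtrain Dtest A.nTrain A.nTest (stdTuning m E H).last (stdRounds m E)).real
      {ξ | ¬ RepGood Dtrain Dtest A (stdTuning m E H) (stdRounds m E)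
        (20 * B * H * jointError C Dtrain Dtest + 5 * ε) (6 * (η + ε)) ξ} ≤ 1 / 25 := by
  have hE : 0 < E := Nat.pos_of_ne_zero (NeZero.ne E)
  have hm0 : 0 < m := Nat.pos_of_ne_zero (NeZero.ne m)
  have hE1 : (1 : ℝ) ≤ E := by exact_mod_cast hE
  have hm1 : (1 : ℝ) ≤ m := by exact_mod_cast hm0
  have hH1 : (1 : ℝ) ≤ H := by exact_mod_cast hH
  have hmr : (A.nTest : ℝ) + 1 ≤ m := by exact_mod_cast hm
  have hratio : 1 ≤ min E H := le_min hE hH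
  have hratioH : ((min E H : ℕ) : ℝ) ≤ H := by exact_mod_cast min_le_right _ _
  have hratioE : ((min E H : ℕ) : ℝ) ≤ E := by exact_mod_cast min_le_left _ _
  have hε0 : 0 ≤ ε := le_trans (by positivity) hEε
  have hη0 : 0 ≤ η := le_trans (by positivity) hHη
  have hratio' : 1 / ((min E H : ℕ) : ℝ) ≤ η + ε := by
    rcases min_choice E H with h | h <;> rw [h] <;> linarith
  have hq : 0 < (stdTuning m E H).res := by simp only [stdTuning]; positivity
  have hlast : 10 * E ≤ (stdTuning m E H).last := by
    simp only [stdTuning]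
    have h1 : E ≤ E ^ 2 := Nat.le_self_pow (by norm_num) E
    nlinarith
  have key := repLaw_not_repGood_le (A := A) (P := stdTuning m E H) (T := stdRounds m E)
    Dtrain Dtest (b := 20 * B * (stdTuning m E H).ratio * jointError C Dtrain Dtest + 5 * ε)
    (r := 3 * ((η + ε) + ε)) (c₀ := 21 / 1000) (c₁ := 11 / 10 * (A.nTest + 1))
    (err := (((stdTuning m E H).ratio + 1) * ((stdTuning m E H).maxUpdate : ℝ) ^ 2 /
      (2 * (stdTuning m E H).res) + (stdTuning m E H).cap * ((stdTuning m E H).ratio + 1) /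
        ((stdTuning m E H).last + 1))) (by positivity) (fun V C' hV hC' => by
      have hu := measurable_units hV (stdTuning m E H).res
      have := isProbabilityMeasure_trainLaw Dtrain hq hu (units_le _ V) (stdTuning m E H).last
      refine (finalGood_prob (P := stdTuning m E H) Dtrain Dtest hC hB hA hE hEε hratio
        hratio' rfl rfl hlast hq hV).trans ?_
      refine add_le_add le_rfl (mul_le_mul_of_nonneg_left ?_ (by positivity))
      exact potential_drift Dtrain Dtest hq (by omega) (by simp only [stdTuning] at hlast ⊢; omega)
        hV hC' (acceptProb_self_ge hA _))
  have hmono : {ξ | ¬ RepGood Dtrain Dtest A (stdTuning m E H) (stdRounds m E)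
        (20 * B * H * jointError C Dtrain Dtest + 5 * ε) (6 * (η + ε)) ξ} ⊆
      {ξ | ¬ RepGood Dtrain Dtest A (stdTuning m E H) (stdRounds m E)
        (20 * B * (stdTuning m E H).ratio * jointError C Dtrain Dtest + 5 * ε)
          (3 * ((η + ε) + ε)) ξ} := by
    intro ξ hξ hg
    refine hξ ⟨hg.1.trans ?_, hg.2.trans (by linarith)⟩
    have := jointError_nonneg C Dtrain Dtest
    simp only [stdTuning]
    gcongr
  refine (measureReal_mono hmono).trans (key.trans ?_)
  -- the error terms are of order `1 / m`
  have hG : ((stdTuning m E H).maxUpdate : ℝ) ≤ 42 * (E : ℝ) ^ 3 := by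
    simp only [stdTuning, Tuning.maxUpdate]
    push_cast
    have h1 : (E : ℝ) ≤ (E : ℝ) ^ 3 := le_self_pow₀ hE1 (by norm_num)
    have h2 : (E : ℝ) ^ 2 ≤ (E : ℝ) ^ 3 := pow_le_pow_right₀ hE1 (by norm_num)
    have h3 : 16 * (E : ℝ) ^ 2 * (1 + min (E : ℝ) H) ≤ 16 * (E : ℝ) ^ 2 * (1 + E) := by
      gcongr
      exact min_le_left _ _
    nlinarith
  have hr : ((stdTuning m E H).ratio : ℝ) + 1 ≤ 2 * E := by
    change ((min E H : ℕ) : ℝ) + 1 ≤ _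
    linarith
  have e1 : ((stdTuning m E H).ratio + 1) * ((stdTuning m E H).maxUpdate : ℝ) ^ 2 /
      (2 * (stdTuning m E H).res) ≤ 1 / (1000 * m) := by
    have hres : ((stdTuning m E H).res : ℝ) = 2000000 * (E : ℝ) ^ 7 * m := by
      simp only [stdTuning]; push_cast; ring
    calc _ ≤ (2 * (E : ℝ)) * (42 * (E : ℝ) ^ 3) ^ 2 / (2 * (2000000 * (E : ℝ) ^ 7 * m)) := by
          rw [hres]; gcongr
      _ = 1764 / (2000000 * m) := by field_simp; ring
      _ ≤ 2000 / (2000000 * m) := by gcongr; norm_num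
      _ = _ := by field_simp; norm_num
  have e2 : (stdTuning m E H).cap * ((stdTuning m E H).ratio + 1) /
        (((stdTuning m E H).last : ℝ) + 1) ≤ 1 / (1000 * m) := by
    have hcap : ((stdTuning m E H).cap : ℝ) = 10 * E := by simp only [stdTuning]; push_cast; ring
    have hl : (20000 * (E : ℝ) ^ 2 * m) ≤ ((stdTuning m E H).last : ℝ) + 1 := by
      simp only [stdTuning]; push_cast; linarith
    calc _ ≤ 10 * (E : ℝ) * (2 * E) / (20000 * (E : ℝ) ^ 2 * m) := by
          rw [hcap]; gcongr
      _ = _ := by field_simp; norm_num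
  have e3 : ((stdTuning m E H).res : ℝ) / (2 * stdRounds m E) = 1 / (1000 * m) := by
    have : (0 : ℝ) < (stdTuning m E H).res := by exact_mod_cast hq
    have hT : (stdRounds m E : ℝ) = 500 * m * (stdTuning m E H).res := by
      simp only [stdRounds, stdTuning]; push_cast; ring
    rw [hT]
    field_simp
    norm_num
  rw [e3]
  calc _ ≤ 21 / 1000 + 11 / 10 * (m : ℝ) *
        (1 / (1000 * m) + (1 / (1000 * m) + 1 / (1000 * m))) := by gcongr
    _ = 21 / 1000 + 33 / 10000 := by field_simp; norm_num
    _ ≤ _ := by norm_num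

/-! ### Amplification by independent repetitions -/

/-- Of `12 * L` independent events of probability at most `1 / 25`, more than `3 * L` occur with
probability at most `exp (-L)`. -/
lemma pi_many_bad_le {Y : Type*} [MeasurableSpace Y] (ν : Measure Y) [IsProbabilityMeasure ν]
    {bad : Set Y} (hbad : ν.real bad ≤ 1 / 25) (L : ℕ) :
    (Measure.pi fun _ : Fin (12 * L) => ν)
      {ξ | ∀ S : Finset (Fin (12 * L)), (∀ i, i ∉ S → ξ i ∉ bad) → 3 * L < S.card} ≤
      ENNReal.ofReal (Real.exp (-L)) := by
  have hsub : {ξ : Fin (12 * L) → Y |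
        ∀ S : Finset (Fin (12 * L)), (∀ i, i ∉ S → ξ i ∉ bad) → 3 * L < S.card} ⊆
      ⋃ S ∈ Finset.univ.filter (fun S : Finset (Fin (12 * L)) => 3 * L ≤ S.card),
        univ.pi fun i => if i ∈ S then bad else univ := by
    classical
    intro ξ hξ
    have h := hξ (Finset.univ.filter fun i => ξ i ∈ bad) fun i hi => by simpa using hi
    simp only [mem_iUnion]
    refine ⟨Finset.univ.filter fun i => ξ i ∈ bad, by simp; omega, fun i _ => ?_⟩
    by_cases hi : ξ i ∈ bad <;> simp [hi]
  refine (measure_mono hsub).trans ((measure_biUnion_finset_le _ _).trans ?_)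
  have hb : ν bad ≤ ENNReal.ofReal (1 / 25) := by
    rw [← ofReal_measureReal]; exact ENNReal.ofReal_le_ofReal hbad
  have h1 : ∀ S ∈ Finset.univ.filter (fun S : Finset (Fin (12 * L)) => 3 * L ≤ S.card),
      (Measure.pi fun _ : Fin (12 * L) => ν) (univ.pi fun i => if i ∈ S then bad else univ) ≤
        ENNReal.ofReal ((1 / 25) ^ (3 * L)) := by
    intro S hS
    rw [Measure.pi_pi]
    have : ∏ i, ν (if i ∈ S then bad else univ) = ∏ i ∈ S, ν bad := by
      rw [← Finset.prod_subset (Finset.subset_univ S) (fun i _ hi => by simp [hi])]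
      exact Finset.prod_congr rfl fun i hi => by simp [hi]
    rw [this, Finset.prod_const]
    calc ν bad ^ S.card ≤ ENNReal.ofReal (1 / 25) ^ S.card := by gcongr
      _ ≤ ENNReal.ofReal (1 / 25) ^ (3 * L) := by
        refine pow_le_pow_right_of_le_one' ?_ (Finset.mem_filter.1 hS).2
        rw [ENNReal.ofReal_le_one]
        norm_num
      _ = _ := by rw [ENNReal.ofReal_pow (by norm_num)]
  refine (Finset.sum_le_card_nsmul _ _ _ h1).trans ?_
  have hcard : (Finset.univ.filter
      (fun S : Finset (Fin (12 * L)) => 3 * L ≤ S.card)).card ≤ 2 ^ (12 * L) :=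
    (Finset.card_filter_le _ _).trans (by simp)
  rw [nsmul_eq_mul, ← ENNReal.ofReal_natCast, ← ENNReal.ofReal_mul (Nat.cast_nonneg _)]
  refine ENNReal.ofReal_le_ofReal ?_
  calc _ ≤ ((2 ^ (12 * L) : ℕ) : ℝ) * (1 / 25) ^ (3 * L) := by gcongr
    -- `4096 / 15625 = 2 ^ 12 * (1 / 25) ^ 3` is less than `exp (-1)`
    _ = (4096 / 15625) ^ L := by
      push_cast
      rw [pow_mul, pow_mul, ← mul_pow]
      norm_num
    _ ≤ Real.exp (-1) ^ L := by
      gcongr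
      rw [Real.exp_neg, ← one_div, le_div_iff₀ (Real.exp_pos 1)]
      have := Real.exp_one_lt_d9
      linarith
    _ = _ := by rw [← Real.exp_nat_mul]; ring_nf

/-- If every point of `B` lies in at least `L` of at most `12 * L` sets of measure at most `b`, then
`B` has measure at most `12 * b`. -/
lemma measureReal_le_of_many {Y ι : Type*} [MeasurableSpace Y] (ν : Measure Y)
    [IsProbabilityMeasure ν] {L : ℕ} (hL : 0 < L) (G : Finset ι) (hG : G.card ≤ 12 * L)
    {F : ι → Set Y} (hF : ∀ i ∈ G, MeasurableSet (F i)) {b : ℝ} (hb0 : 0 ≤ b)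
    (hb : ∀ i ∈ G, ν.real (F i) ≤ b) {B : Set Y}
    (hB : ∀ y ∈ B, ∃ S ⊆ G, L ≤ S.card ∧ ∀ i ∈ S, y ∈ F i) : ν.real B ≤ 12 * b := by
  have hL' : (0 : ℝ) < L := by exact_mod_cast hL
  have hint : ∀ i ∈ G, Integrable ((F i).indicator fun _ => (1 : ℝ)) ν := fun i hi =>
    (integrable_indicator_iff (hF i hi)).2 (integrableOn_const (by simp) (by simp))
  have hf0 : ∀ y, 0 ≤ ∑ i ∈ G, (F i).indicator (fun _ => (1 : ℝ)) y := fun y =>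
    Finset.sum_nonneg fun i _ => indicator_nonneg (fun _ _ => zero_le_one) _
  have h1 := mul_meas_ge_le_integral_of_nonneg (μ := ν)
    (f := fun y => ∑ i ∈ G, (F i).indicator (fun _ => (1 : ℝ)) y)
    (Filter.Eventually.of_forall hf0) (integrable_finsetSum _ hint) (L : ℝ)
  rw [integral_finsetSum _ hint] at h1
  have h2 : ∑ i ∈ G, ∫ y, (F i).indicator (fun _ => (1 : ℝ)) y ∂ν ≤ 12 * L * b := by
    calc _ ≤ ∑ i ∈ G, b := Finset.sum_le_sum fun i hi => by
          have := integral_indicator_one (μ := ν) (hF i hi)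
          exact (le_of_eq this).trans (hb i hi)
      _ = G.card * b := by simp
      _ ≤ _ := by gcongr; exact_mod_cast hG
  have h3 : ν.real B ≤ ν.real {y | (L : ℝ) ≤ ∑ i ∈ G, (F i).indicator (fun _ => (1 : ℝ)) y} := by
    refine measureReal_mono fun y hy => ?_
    obtain ⟨S, hS, hcard, hSF⟩ := hB y hy
    have : (S.card : ℝ) ≤ ∑ i ∈ G, (F i).indicator (fun _ => (1 : ℝ)) y := by
      calc (S.card : ℝ) = ∑ i ∈ S, (F i).indicator (fun _ => (1 : ℝ)) y := by
            rw [Finset.sum_congr rfl fun i hi => indicator_of_mem (hSF i hi) _]; simp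
        _ ≤ _ := Finset.sum_le_sum_of_subset_of_nonneg hS fun i _ _ =>
            indicator_nonneg (fun _ _ => zero_le_one) _
    exact le_trans (by exact_mod_cast hcard) this
  have h4 : (L : ℝ) * ν.real B ≤ L * (12 * b) := by
    calc _ ≤ (L : ℝ) * ν.real {y | (L : ℝ) ≤ ∑ i ∈ G, (F i).indicator (fun _ => (1 : ℝ)) y} := by
          gcongr
      _ ≤ _ := by linarith
  exact le_of_mul_le_mul_left h4 hL'

/-- The majority vote of several selectors (with threshold two thirds). -/
def voteSel {X : Type*} {R : ℕ} (g : Fin R → X → Bool) (x : X) : Bool :=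
  decide (2 * R ≤ 3 * (Finset.univ.filter fun i => g i x = true).card)

/-- The majority vote of several hypotheses, in which those that select the point take part. -/
def voteHyp {X : Type*} {R : ℕ} (h g : Fin R → X → Bool) (x : X) : Bool :=
  decide ((Finset.univ.filter fun i => g i x = true).card <
    2 * (Finset.univ.filter fun i => g i x = true ∧ h i x = true).card)

lemma card_sdiff_ge {L : ℕ} {R : ℕ} {S T : Finset (Fin R)} (hS : S.card ≤ 3 * L)
    (hT : 4 * L ≤ T.card) : ∃ U ⊆ Finset.univ \ S, L ≤ U.card ∧ U ⊆ T := by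
  refine ⟨T \ S, Finset.sdiff_subset_sdiff (Finset.subset_univ _) le_rfl, ?_, Finset.sdiff_subset⟩
  have := Finset.le_card_sdiff S T
  omega

/-- If at most `3 * L` of `12 * L` pairs are bad, then the majority vote is good. -/
lemma vote_good {X : Type*} [MeasurableSpace X] (Dtrain Dtest : Measure (X × Bool))
    [IsProbabilityMeasure Dtrain] [IsProbabilityMeasure Dtest] {L : ℕ} (hL : 0 < L)
    {h g : Fin (12 * L) → X → Bool} (hh : ∀ i, Measurable (h i)) (hg : ∀ i, Measurable (g i))
    {b r : ℝ} (hb : 0 ≤ b) (hr : 0 ≤ r) {S : Finset (Fin (12 * L))} (hS : S.card ≤ 3 * L)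
    (hgood : ∀ i, i ∉ S → Dtest.real {p | p.2 ≠ h i p.1 ∧ g i p.1 = true} ≤ b ∧
      Dtrain.fst.real {x | g i x = false} ≤ r) :
    Dtest.real {p | p.2 ≠ voteHyp h g p.1 ∧ voteSel g p.1 = true} ≤ 12 * b ∧
      Dtrain.fst.real {x | voteSel g x = false} ≤ 12 * r := by
  have hmg : ∀ i, MeasurableSet {x | g i x = false} := fun i => hg i (measurableSet_singleton false)
  have hcardG : (Finset.univ \ S).card ≤ 12 * L := (Finset.card_le_univ _).trans (by simp)
  constructor
  · refine measureReal_le_of_many Dtest hL (Finset.univ \ S) hcardG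
      (F := fun i => {p | p.2 ≠ h i p.1 ∧ g i p.1 = true}) (fun i _ => ?_) hb
      (fun i hi => (hgood i (by simpa using hi)).1) fun p hp => ?_
    · exact (measurableSet_eq_fun measurable_snd ((hh i).comp measurable_fst)).compl.inter
        (((hg i).comp measurable_fst) (measurableSet_singleton true))
    · obtain ⟨hne, hsel⟩ := hp
      simp only [voteSel, decide_eq_true_eq] at hsel
      -- at least `4 * L` of the pairs select the point and err
      have hT : 4 * L ≤ (Finset.univ.filter fun i => p.2 ≠ h i p.1 ∧ g i p.1 = true).card := by
        have hsplit := Finset.card_filter_add_card_filter_not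
          (s := Finset.univ.filter fun i => g i p.1 = true) (fun i => h i p.1 = true)
        rw [Finset.filter_filter, Finset.filter_filter] at hsplit
        cases hy : p.2
        · have hv : voteHyp h g p.1 = true := by
            rw [hy] at hne
            simpa using hne
          simp only [voteHyp, decide_eq_true_eq] at hv
          have he : (Finset.univ.filter fun i => false ≠ h i p.1 ∧ g i p.1 = true) =
              Finset.univ.filter fun i => g i p.1 = true ∧ h i p.1 = true := by
            ext i
            simp only [Finset.mem_filter, Finset.mem_univ, true_and]
            cases h i p.1 <;> simp
          rw [he]
          omega
        · have hv : voteHyp h g p.1 = false := by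
            rw [hy] at hne
            simpa using hne
          simp only [voteHyp, decide_eq_false_iff_not, not_lt] at hv
          have he : (Finset.univ.filter fun i => true ≠ h i p.1 ∧ g i p.1 = true) =
              Finset.univ.filter fun i => g i p.1 = true ∧ ¬ h i p.1 = true := by
            ext i
            simp only [Finset.mem_filter, Finset.mem_univ, true_and]
            cases h i p.1 <;> simp
          rw [he]
          omega
      obtain ⟨U, hU, hUL, hUT⟩ := card_sdiff_ge hS hT
      exact ⟨U, hU, hUL, fun i hi => (Finset.mem_filter.1 (hUT hi)).2⟩
  · refine measureReal_le_of_many Dtrain.fst hL (Finset.univ \ S) hcardG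
      (F := fun i => {x | g i x = false}) (fun i _ => hmg i) hr
      (fun i hi => (hgood i (by simpa using hi)).2) fun x hx => ?_
    simp only [voteSel, mem_ofPred_eq, decide_eq_false_iff_not, not_le] at hx
    have hT : 4 * L ≤ (Finset.univ.filter fun i => g i x = false).card := by
      have hsplit := Finset.card_filter_add_card_filter_not
          (s := (Finset.univ : Finset (Fin (12 * L)))) (fun i => g i x = true)
      simp only [Bool.not_eq_true, Finset.card_univ, Fintype.card_fin] at hsplit
      omega
    obtain ⟨U, hU, hUL, hUT⟩ := card_sdiff_ge hS hT
    exact ⟨U, hU, hUL, fun i hi => (Finset.mem_filter.1 (hUT hi)).2⟩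


/-! ### Expressions and programs: footprints, invariants of loops, costs -/

instance : Add RExpr := ⟨.plus⟩
instance : Sub RExpr := ⟨.minus⟩
instance : Mul RExpr := ⟨.times⟩
instance (n : ℕ) : OfNat RExpr n := ⟨.const n⟩

namespace RExpr

variable {M : ℕ → ℕ → ℕ}

@[simp] lemma val_add (e f : RExpr) : (e + f).val M = e.val M + f.val M := rfl
@[simp] lemma val_sub (e f : RExpr) : (e - f).val M = e.val M - f.val M := rfl
@[simp] lemma val_mul (e f : RExpr) : (e * f).val M = e.val M * f.val M := rfl
@[simp] lemma val_cell (a : ℕ) (i : RExpr) : (RExpr.cell a i).val M = M a (i.val M) := rfl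
@[simp] lemma val_ofNat (n : ℕ) : (no_index (OfNat.ofNat n) : RExpr).val M = n := rfl

/-- The minimum of two expressions.  Its value is bounded by that of the first one, whatever the
second one may be. -/
def cap (p e : RExpr) : RExpr := p - (p - e)

@[simp] lemma val_cap (p e : RExpr) : (cap p e).val M = min (p.val M) (e.val M) := by
  simp only [cap, val_sub]; omega

/-- Expressions that depend on the input parameters (array `0`) only. -/
def Pure : RExpr → Prop
  | .const _ => True
  | .cell a i => a = 0 ∧ i.Pure
  | .plus e f => e.Pure ∧ f.Pure
  | .minus e f => e.Pure ∧ f.Pure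
  | .times e f => e.Pure ∧ f.Pure
  | .quot e f => e.Pure ∧ f.Pure

/-- Expressions that are bounded by a function of the input parameters, for a syntactic reason. -/
def Capped : RExpr → Prop
  | .minus e _ => e.Pure
  | e => e.Pure

/-- An exponent such that the value and the cost of the expression are at most `V ^ deg` if all
numbers in the memory are at most `V`. -/
def deg : RExpr → ℕ
  | .const n => n + 1
  | .cell _ i => i.deg + 4
  | .plus e f => 2 * (e.deg + f.deg) + 4
  | .minus e f => 2 * (e.deg + f.deg) + 4
  | .times e f => 2 * (e.deg + f.deg) + 4
  | .quot e f => 2 * (e.deg + f.deg) + 4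

end RExpr

lemma add_le_pow {V x y a b : ℕ} (hV : 2 ≤ V) (hx : x ≤ V ^ a) (hy : y ≤ V ^ b) :
    x + y ≤ V ^ (a + b + 1) := by
  have h1 : V ^ a ≤ V ^ (a + b) := Nat.pow_le_pow_right (by omega) (by omega)
  have h2 : V ^ b ≤ V ^ (a + b) := Nat.pow_le_pow_right (by omega) (by omega)
  have h3 : V ^ (a + b) * 2 ≤ V ^ (a + b) * V := Nat.mul_le_mul_left _ hV
  rw [pow_succ]
  omega

lemma one_add_size_le {V v a : ℕ} (hV : 2 ≤ V) (hv : v ≤ V ^ a) : 1 + v.size ≤ V ^ (a + 1) := by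
  have h1 : v.size ≤ V ^ a :=
    (Nat.size_le.2 (lt_of_lt_of_le v.lt_two_pow_self le_rfl)).trans hv
  have := add_le_pow hV (show 1 ≤ V ^ 0 by simp) h1
  simpa using this

namespace RExpr

variable {M : ℕ → ℕ → ℕ} {V : ℕ}

/-- The value and the cost of an expression are polynomial in a bound for the memory contents. -/
lemma val_cost_le (hV : 2 ≤ V) (hM : ∀ a i, M a i ≤ V) (e : RExpr) :
    e.val M ≤ V ^ e.deg ∧ e.cost M ≤ V ^ e.deg := by
  have binary : ∀ {v c c' d d' : ℕ}, v ≤ V ^ (d + d' + 1) → c ≤ V ^ d → c' ≤ V ^ d' →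
      v ≤ V ^ (2 * (d + d') + 4) ∧ 1 + v.size + c + c' ≤ V ^ (2 * (d + d') + 4) := by
    intro v c c' d d' hv hc hc'
    refine ⟨hv.trans (Nat.pow_le_pow_right (by omega) (by omega)), ?_⟩
    have := add_le_pow hV (one_add_size_le hV hv) (add_le_pow hV hc hc')
    rw [add_assoc]
    exact this.trans (Nat.pow_le_pow_right (by omega) (by omega))
  have weaken : ∀ {v d d' : ℕ}, v ≤ V ^ d → v ≤ V ^ (d + d' + 1) := fun h =>
    h.trans (Nat.pow_le_pow_right (by omega) (by omega))
  induction e with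
  | const n =>
    have hn : n ≤ V ^ n := (n.lt_two_pow_self.le).trans (Nat.pow_le_pow_left hV n)
    exact ⟨hn.trans (Nat.pow_le_pow_right (by omega) (by simp [deg])), one_add_size_le hV hn⟩
  | cell a i ih =>
    have h1 : M a (i.val M) ≤ V ^ 1 := by simpa using hM _ _
    refine ⟨h1.trans (Nat.pow_le_pow_right (by omega) (by simp [deg])), ?_⟩
    exact (add_le_pow hV (one_add_size_le hV h1) ih.2).trans
      (Nat.pow_le_pow_right (by omega) (by simp [deg]; omega))
  | plus e f he hf => exact binary (add_le_pow hV he.1 hf.1) he.2 hf.2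
  | minus e f he hf => exact binary (weaken ((Nat.sub_le _ _).trans he.1)) he.2 hf.2
  | times e f he hf =>
    exact binary ((Nat.mul_le_mul he.1 hf.1).trans (by
      rw [← pow_add]; exact Nat.pow_le_pow_right (by omega) (by omega))) he.2 hf.2
  | quot e f he hf => exact binary (weaken ((Nat.div_le_self _ _).trans he.1)) he.2 hf.2

lemma Pure.val_congr {e : RExpr} (he : e.Pure) {M M' : ℕ → ℕ → ℕ} (h : M 0 = M' 0) :
    e.val M = e.val M' := by
  induction e with
  | const n => rfl
  | cell a i ih => obtain ⟨rfl, hi⟩ := he; simp only [val, ih hi, h]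
  | plus e f ihe ihf => simp only [val, ihe he.1, ihf he.2]
  | minus e f ihe ihf => simp only [val, ihe he.1, ihf he.2]
  | times e f ihe ihf => simp only [val, ihe he.1, ihf he.2]
  | quot e f ihe ihf => simp only [val, ihe he.1, ihf he.2]

lemma Pure.val_le {e : RExpr} (he : e.Pure) (hV : 2 ≤ V) (hM : ∀ i, M 0 i ≤ V) :
    e.val M ≤ V ^ e.deg := by
  rw [he.val_congr (M' := fun a i => if a = 0 then M 0 i else 0) (by simp)]
  refine (val_cost_le hV (fun a i => ?_) e).1
  split_ifs
  · exact hM i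
  · omega

lemma Capped.val_le {e : RExpr} (he : e.Capped) (hV : 2 ≤ V) (hM : ∀ i, M 0 i ≤ V) :
    e.val M ≤ V ^ e.deg := by
  cases e with
  | minus e f =>
    exact (Nat.sub_le _ _).trans ((Pure.val_le (e := e) he hV hM).trans
      (Nat.pow_le_pow_right (by omega) (by simp only [deg]; omega)))
  | const n => exact Pure.val_le he hV hM
  | cell a i => exact Pure.val_le he hV hM
  | plus e f => exact Pure.val_le (e := .plus e f) he hV hM
  | times e f => exact Pure.val_le (e := .times e f) he hV hM
  | quot e f => exact Pure.val_le (e := .quot e f) he hV hM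

end RExpr

namespace Cmd

/-- The arrays of numbers that a program may write. -/
def numWrites : Cmd → List ℕ
  | .skip => []
  | .assign a _ _ => [a]
  | .copy _ _ _ _ => []
  | .drawTrain _ b _ => [b]
  | .drawTest _ _ => []
  | .uniform a _ _ => [a]
  | .drawSeed _ => []
  | .callTDS _ _ _ _ _ d => [d]
  | .applyHyp _ _ _ d _ => [d]
  | .seq c c' => c.numWrites ++ c'.numWrites
  | .ite _ c c' => c.numWrites ++ c'.numWrites
  | .loop a _ c => a :: c.numWrites

/-- The arrays of points that a program may write. -/
def ptWrites : Cmd → List ℕ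
  | .skip => []
  | .assign _ _ _ => []
  | .copy a _ _ _ => [a]
  | .drawTrain a _ _ => [a]
  | .drawTest a _ => [a]
  | .uniform _ _ _ => []
  | .drawSeed _ => []
  | .callTDS _ _ _ _ _ _ => []
  | .applyHyp _ _ _ _ _ => []
  | .seq c c' => c.ptWrites ++ c'.ptWrites
  | .ite _ c c' => c.ptWrites ++ c'.ptWrites
  | .loop _ _ c => c.ptWrites

/-- Programs that write no hypothesis cell except cell `0`, and no seed cell except cell `0`. -/
def Scratch : Cmd → Prop
  | .drawSeed i => i = .const 0
  | .callTDS _ _ _ _ i _ => i = .const 0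
  | .seq c c' => c.Scratch ∧ c'.Scratch
  | .ite _ c c' => c.Scratch ∧ c'.Scratch
  | .loop _ _ c => c.Scratch
  | _ => True

variable {X : Type*} [MeasurableSpace X] {A : TDSAlgorithm X} {ω : Tape X}

/-- Proof of an invariant of a loop. -/
lemma run_loop (a : ℕ) (e : RExpr) (c : Cmd) (s : MState X) (I : ℕ → MState X → Prop)
    (h0 : I 0 (s.charge (1 + e.cost s.num)))
    (hs : ∀ k < e.val s.num, ∀ r, I k r →
      I (k + 1) (c.run A ω ((r.setNum a 0 k).charge (1 + k.size)))) :
    I (e.val s.num) ((Cmd.loop a e c).run A ω s) := by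
  have key : ∀ n ≤ e.val s.num, I n ((List.range n).foldl
      (fun s k => c.run A ω ((s.setNum a 0 k).charge (1 + k.size)))
        (s.charge (1 + e.cost s.num))) := by
    intro n hn
    induction n with
    | zero => exact h0
    | succ n ih =>
      rw [List.range_succ, List.foldl_append]
      exact hs n (by omega) _ (ih (by omega))
  exact key _ le_rfl

lemma setNum_num_of_ne {s : MState X} {a b i v : ℕ} (h : b ≠ a) : (s.setNum a i v).num b = s.num b :=
  Function.update_of_ne h _ _

lemma setNum_num_self {s : MState X} {a i v : ℕ} : (s.setNum a i v).num a i = v := by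
  simp [MState.setNum]

lemma run_num_of_notMem (c : Cmd) {a : ℕ} (h : a ∉ c.numWrites) (s : MState X) :
    (c.run A ω s).num a = s.num a := by
  induction c generalizing s with
  | skip => rfl
  | assign b i e =>
    exact setNum_num_of_ne (by simpa [numWrites] using h)
  | copy => rfl
  | drawTrain b b' i =>
    exact setNum_num_of_ne (by simpa [numWrites] using h)
  | drawTest => rfl
  | uniform b i e =>
    exact setNum_num_of_ne (by simpa [numWrites] using h)
  | drawSeed => rfl
  | callTDS b b' b'' t i d =>
    have h' : a ≠ d := by simpa [numWrites] using h
    simp only [run]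
    split
    · exact setNum_num_of_ne h'
    · exact setNum_num_of_ne h'
  | applyHyp i b j d k =>
    exact setNum_num_of_ne (by simpa [numWrites] using h)
  | seq c c' ih ih' =>
    simp only [numWrites, List.mem_append, not_or] at h
    rw [run, ih' h.2, ih h.1]
  | ite e c c' ih ih' =>
    simp only [numWrites, List.mem_append, not_or] at h
    simp only [run]
    split_ifs
    · exact ih h.1 _
    · exact ih' h.2 _
  | loop b e c ih =>
    simp only [numWrites, List.mem_cons, not_or] at h
    refine run_loop b e c s (fun _ r => r.num a = s.num a) rfl fun k _ r hr => ?_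
    rw [ih h.2]
    exact (setNum_num_of_ne h.1).trans hr

lemma run_pt_of_notMem (c : Cmd) {a : ℕ} (h : a ∉ c.ptWrites) (s : MState X) :
    (c.run A ω s).pt a = s.pt a := by
  induction c generalizing s with
  | copy b i b' j => exact Function.update_of_ne (by simpa [ptWrites] using h) _ _
  | drawTrain b b' i => exact Function.update_of_ne (by simpa [ptWrites] using h) _ _
  | drawTest b i => exact Function.update_of_ne (by simpa [ptWrites] using h) _ _
  | callTDS b b' b'' t i d =>
    simp only [run]
    split <;> rfl
  | seq c c' ih ih' =>
    simp only [ptWrites, List.mem_append, not_or] at h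
    rw [run, ih' h.2, ih h.1]
  | ite e c c' ih ih' =>
    simp only [ptWrites, List.mem_append, not_or] at h
    simp only [run]
    split_ifs
    · exact ih h.1 _
    · exact ih' h.2 _
  | loop b e c ih =>
    refine run_loop b e c s (fun _ r => r.pt a = s.pt a) rfl fun k _ r hr => ?_
    rw [ih h]
    exact hr
  | _ => rfl

lemma run_scratch (c : Cmd) (h : c.Scratch) (s : MState X) {i : ℕ} (hi : i ≠ 0) :
    (c.run A ω s).hyp i = s.hyp i ∧ (c.run A ω s).seed i = s.seed i := by
  induction c generalizing s with
  | drawSeed j =>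
    obtain rfl : j = .const 0 := h
    exact ⟨rfl, Function.update_of_ne hi _ _⟩
  | callTDS b b' b'' t j d =>
    obtain rfl : j = .const 0 := h
    simp only [run]
    split
    · exact ⟨Function.update_of_ne hi _ _, rfl⟩
    · exact ⟨rfl, rfl⟩
  | seq c c' ih ih' =>
    rw [run, (ih' h.2 _).1, (ih' h.2 _).2]
    exact ih h.1 s
  | ite e c c' ih ih' =>
    simp only [run]
    split_ifs
    · exact ih h.1 _
    · exact ih' h.2 _
  | loop b e c ih =>
    refine run_loop b e c s (fun _ r => r.hyp i = s.hyp i ∧ r.seed i = s.seed i) ⟨rfl, rfl⟩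
      fun k _ r hr => ?_
    rw [(ih h _).1, (ih h _).2]
    exact hr
  | _ => exact ⟨rfl, rfl⟩

/-- The numbers of draws of the four kinds are all equal to `N`. -/
def _root_.MState.Clock (s : MState X) (N : ℕ) : Prop :=
  s.trainDrawn = N ∧ s.testDrawn = N ∧ s.coinsDrawn = N ∧ s.seedsDrawn = N

/-- A deterministic program draws nothing and leaves the seeds alone. -/
lemma run_deterministic {c : Cmd} (h : c.Deterministic) (s : MState X) :
    (∀ N, s.Clock N → (c.run A ω s).Clock N) ∧ (c.run A ω s).seed = s.seed := by
  induction c generalizing s with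
  | callTDS b b' b'' t j d =>
    simp only [run]
    split <;> exact ⟨fun _ hs => hs, rfl⟩
  | drawTrain => exact h.elim
  | drawTest => exact h.elim
  | uniform => exact h.elim
  | drawSeed => exact h.elim
  | seq c c' ih ih' =>
    obtain ⟨h1, h2⟩ := ih h.1 s
    obtain ⟨h3, h4⟩ := ih' h.2 (c.run A ω s)
    exact ⟨fun N hs => h3 N (h1 N hs), h4.trans h2⟩
  | ite e c c' ih ih' =>
    simp only [run]
    split_ifs
    · exact ih h.1 (s.charge (1 + e.cost s.num))
    · exact ih' h.2 (s.charge (1 + e.cost s.num))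
  | loop b e c ih =>
    refine run_loop b e c s (fun _ r => (∀ N, s.Clock N → r.Clock N) ∧ r.seed = s.seed)
      ⟨fun _ hs => hs, rfl⟩ fun k _ r hr => ?_
    obtain ⟨h1, h2⟩ := ih h ((r.setNum b 0 k).charge (1 + k.size))
    exact ⟨fun N hs => h1 N (hr.1 N hs), h2.trans hr.2⟩
  | _ => exact ⟨fun _ hs => hs, rfl⟩

end Cmd

section steps

variable {X : Type*} [MeasurableSpace X] {A : TDSAlgorithm X} {ω : Tape X} {s : MState X}

@[simp] lemma charge_num (n : ℕ) : (s.charge n).num = s.num := rfl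
@[simp] lemma charge_pt (n : ℕ) : (s.charge n).pt = s.pt := rfl
@[simp] lemma charge_hyp (n : ℕ) : (s.charge n).hyp = s.hyp := rfl
@[simp] lemma charge_seed (n : ℕ) : (s.charge n).seed = s.seed := rfl
@[simp] lemma setNum_pt (a i v : ℕ) : (s.setNum a i v).pt = s.pt := rfl

@[simp] lemma setNum_num (a i v b k : ℕ) :
    (s.setNum a i v).num b k = if b = a ∧ k = i then v else s.num b k := by
  by_cases h : b = a
  · subst h; by_cases hk : k = i <;> simp [MState.setNum, hk]
  · simp [MState.setNum, h]

lemma MState.Clock.charge {N : ℕ} (h : s.Clock N) (n : ℕ) : (s.charge n).Clock N := h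
lemma MState.Clock.setNum {N : ℕ} (h : s.Clock N) (a i v : ℕ) : (s.setNum a i v).Clock N := h

@[simp] lemma run_seq (c c' : Cmd) : (c.seq c').run A ω s = c'.run A ω (c.run A ω s) := rfl

@[simp] lemma run_assign_num (a : ℕ) (i e : RExpr) (b k : ℕ) :
    ((Cmd.assign a i e).run A ω s).num b k =
      if b = a ∧ k = i.val s.num then e.val s.num else s.num b k := setNum_num _ _ _ _ _
@[simp] lemma run_assign_pt (a : ℕ) (i e : RExpr) : ((Cmd.assign a i e).run A ω s).pt = s.pt := rfl
@[simp] lemma run_assign_hyp (a : ℕ) (i e : RExpr) :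
    ((Cmd.assign a i e).run A ω s).hyp = s.hyp := rfl
@[simp] lemma run_assign_seed (a : ℕ) (i e : RExpr) :
    ((Cmd.assign a i e).run A ω s).seed = s.seed := rfl

@[simp] lemma run_copy_num (a : ℕ) (i : RExpr) (b : ℕ) (j : RExpr) :
    ((Cmd.copy a i b j).run A ω s).num = s.num := rfl
@[simp] lemma run_copy_pt (a : ℕ) (i : RExpr) (b : ℕ) (j : RExpr) (c k : ℕ) :
    ((Cmd.copy a i b j).run A ω s).pt c k =
      if c = a ∧ k = i.val s.num then s.pt b (j.val s.num) else s.pt c k := by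
  by_cases h : c = a
  · subst h; by_cases hk : k = i.val s.num <;> simp [Cmd.run, MState.setPt, MState.charge, hk]
  · simp [Cmd.run, MState.setPt, MState.charge, h]
@[simp] lemma run_copy_seed (a : ℕ) (i : RExpr) (b : ℕ) (j : RExpr) :
    ((Cmd.copy a i b j).run A ω s).seed = s.seed := rfl

lemma run_callTDS_flag (a b c : ℕ) (t i : RExpr) (d : ℕ) :
    ((Cmd.callTDS a b c t i d).run A ω s).num d (i.val s.num) =
      (A.run (fun k => (s.pt a k, decide (s.num b k ≠ 0))) (fun k => s.pt c k)
        (s.seed (t.val s.num))).isSome.toNat := by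
  simp only [Cmd.run]
  split <;> rename_i h <;> rw [h] <;> simp

lemma run_callTDS_pt (a b c : ℕ) (t i : RExpr) (d : ℕ) :
    ((Cmd.callTDS a b c t i d).run A ω s).pt = s.pt := by
  simp only [Cmd.run]
  split <;> rfl

lemma run_callTDS_hyp (a b c : ℕ) (t i : RExpr) (d : ℕ) :
    ((Cmd.callTDS a b c t i d).run A ω s).hyp (i.val s.num) =
      (A.run (fun k => (s.pt a k, decide (s.num b k ≠ 0))) (fun k => s.pt c k)
        (s.seed (t.val s.num))).getD (s.hyp (i.val s.num)) := by
  simp only [Cmd.run]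
  split <;> rename_i h <;> rw [h] <;> simp [MState.setHyp, MState.setNum]

lemma run_callTDS_hyp_ne (a b c : ℕ) (t i : RExpr) (d : ℕ) {k : ℕ} (hk : k ≠ i.val s.num) :
    ((Cmd.callTDS a b c t i d).run A ω s).hyp k = s.hyp k := by
  simp only [Cmd.run]
  split <;> simp [MState.setHyp, MState.setNum, hk]

lemma run_ite (e : RExpr) (c c' : Cmd) :
    (Cmd.ite e c c').run A ω s =
      if e.val s.num ≠ 0 then c.run A ω (s.charge (1 + e.cost s.num))
      else c'.run A ω (s.charge (1 + e.cost s.num)) := rfl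

@[simp] lemma run_skip : Cmd.skip.run A ω s = s := rfl

end steps

namespace Cmd

/-- Programs that leave the input parameters alone, all loops of which have a length that depends on
the input parameters only, and which write only numbers that are bounded in terms of the
parameters. -/
def Tame : Cmd → Prop
  | .skip => True
  | .assign a _ e => a ≠ 0 ∧ e.Capped
  | .copy _ _ _ _ => True
  | .drawTrain _ b _ => b ≠ 0
  | .drawTest _ _ => True
  | .uniform a _ e => a ≠ 0 ∧ e.Pure
  | .drawSeed _ => True
  | .callTDS _ _ _ _ _ d => d ≠ 0
  | .applyHyp _ _ _ d _ => d ≠ 0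
  | .seq c c' => c.Tame ∧ c'.Tame
  | .ite _ c c' => c.Tame ∧ c'.Tame
  | .loop a e c => a ≠ 0 ∧ e.Pure ∧ c.Tame

/-- An exponent such that a tame program takes at most `V ^ deg` steps, where `V` bounds the numbers
in the memory. -/
def deg : Cmd → ℕ
  | .skip => 1
  | .assign _ i e => i.deg + e.deg + 2
  | .copy _ i _ j => i.deg + j.deg + 2
  | .drawTrain _ _ i => i.deg + 2
  | .drawTest _ i => i.deg + 2
  | .uniform _ i e => i.deg + e.deg + 2
  | .drawSeed i => i.deg + 2
  | .callTDS _ _ _ t i _ => t.deg + i.deg + 7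
  | .applyHyp i _ j _ k => i.deg + j.deg + k.deg + 4
  | .seq c c' => c.deg + c'.deg + 1
  | .ite e c c' => e.deg + c.deg + c'.deg + 3
  | .loop _ e c => e.deg + c.deg + 8

/-- A bound for the number of operations of a program that involve the TDS algorithm. -/
def callBound (M : ℕ → ℕ → ℕ) : Cmd → ℕ
  | .drawSeed _ => 1
  | .callTDS _ _ _ _ _ _ => 1
  | .applyHyp _ _ _ _ _ => 1
  | .seq c c' => c.callBound M + c'.callBound M
  | .ite _ c c' => c.callBound M + c'.callBound M
  | .loop _ e c => e.val M * c.callBound M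
  | _ => 0

end Cmd

/-- What a run of a tame program does to the quantities that determine the cost. -/
structure CostSpec {X : Type*} (V d n : ℕ) (s r : MState X) : Prop where
  num_le : ∀ a i, r.num a i ≤ V
  params : r.num 0 = s.num 0
  steps : r.steps ≤ s.steps + V ^ d
  drawn : r.trainDrawn + r.testDrawn ≤ s.trainDrawn + s.testDrawn + V ^ d
  calls : r.calls ≤ s.calls + n

namespace Cmd

variable {X : Type*} [MeasurableSpace X] {A : TDSAlgorithm X} {ω : Tape X}

lemma setNum_le {s : MState X} {V a i v : ℕ} (h : ∀ a i, s.num a i ≤ V) (hv : v ≤ V) (b j : ℕ) :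
    (s.setNum a i v).num b j ≤ V := by
  simp only [MState.setNum, Function.update_apply]
  split_ifs
  · subst_vars; simp only [Function.update_apply]; split_ifs
    · exact hv
    · exact h _ _
  · exact h _ _

lemma Tame.callBound_congr {c : Cmd} (hc : c.Tame) {M M' : ℕ → ℕ → ℕ} (h : M 0 = M' 0) :
    c.callBound M = c.callBound M' := by
  induction c with
  | seq c c' ih ih' => simp only [callBound, ih hc.1, ih' hc.2]
  | ite e c c' ih ih' => simp only [callBound, ih hc.1, ih' hc.2]
  | loop a e c ih => simp only [callBound, ih hc.2.2, hc.2.1.val_congr h]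
  | _ => rfl

/-- The cost of a tame program.  Here `p` bounds the input parameters, and `p ^ W` the memory contents,
before the run and after it: what a tame program writes is bounded in terms of the parameters, so the
numbers do not grow with the number of the rounds of a loop. -/
lemma run_cost {p W : ℕ} (hp : 2 ≤ p) (hA : A.nTrain ≤ p ∧ A.nTest ≤ p) (c : Cmd) (hc : c.Tame)
    (hW : c.deg ≤ W) (s : MState X) (hs : ∀ a i, s.num a i ≤ p ^ W) (hs0 : ∀ i, s.num 0 i ≤ p) :
    CostSpec (p ^ W) c.deg (c.callBound s.num) s (c.run A ω s) := by
  have hdW : ∀ {d}, d ≤ W → p ^ d ≤ p ^ W := fun h => Nat.pow_le_pow_right (by omega) h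
  have hW1 : 1 ≤ W := le_trans (by cases c <;> simp only [deg] <;> omega) hW
  have hV : 2 ≤ p ^ W := hp.trans (by simpa using hdW hW1)
  have hpV : p ≤ p ^ W := by simpa using hdW hW1
  have h1 : 1 ≤ (p ^ W) ^ 0 := by simp
  have cost := fun (e : RExpr) => (RExpr.val_cost_le hV hs e).2
  have zero : ∀ d, 0 ≤ (p ^ W) ^ d := fun _ => Nat.zero_le _
  have one : ∀ d, 1 ≤ (p ^ W) ^ d := fun _ => Nat.one_le_pow _ _ (by omega)
  have mono : ∀ {x d d'}, x ≤ (p ^ W) ^ d → d ≤ d' → x ≤ (p ^ W) ^ d' := fun h h' =>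
    h.trans (Nat.pow_le_pow_right (by omega) h')
  have hV1 : ∀ {x}, x ≤ p ^ W → x ≤ (p ^ W) ^ 1 := fun h => by simpa using h
  induction c generalizing s with
  | skip => exact ⟨hs, rfl, Nat.le_add_right _ _, Nat.le_add_right _ _, Nat.le_add_right _ _⟩
  | assign a i e =>
    refine ⟨setNum_le hs ((hc.2.val_le hp hs0).trans (hdW ?_)), setNum_num_of_ne hc.1.symm,
      Nat.add_le_add_left ?_ _, Nat.le_add_right _ _, Nat.le_add_right _ _⟩
    · simp only [deg] at hW; omega
    · rw [add_assoc]
      exact mono (add_le_pow hV h1 (add_le_pow hV (cost i) (cost e))) (by simp only [deg]; omega)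
  | copy a i b j =>
    refine ⟨hs, rfl, Nat.add_le_add_left ?_ _, Nat.le_add_right _ _, Nat.le_add_right _ _⟩
    rw [add_assoc]
    exact mono (add_le_pow hV h1 (add_le_pow hV (cost i) (cost j))) (by simp only [deg]; omega)
  | drawTrain a b i =>
    refine ⟨setNum_le hs ((Bool.toNat_le _).trans (by omega)), setNum_num_of_ne hc.symm,
      Nat.add_le_add_left ?_ _, ?_, Nat.le_add_right _ _⟩
    · exact mono (add_le_pow hV h1 (cost i)) (by simp only [deg]; omega)
    · have := one (deg (.drawTrain a b i))
      simp only [run, MState.setPt, MState.setNum, MState.charge]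
      omega
  | drawTest a i =>
    refine ⟨hs, rfl, Nat.add_le_add_left ?_ _, ?_, Nat.le_add_right _ _⟩
    · exact mono (add_le_pow hV h1 (cost i)) (by simp only [deg]; omega)
    · have := one (deg (.drawTest a i))
      simp only [run, MState.setPt, MState.charge]
      omega
  | uniform a i e =>
    have he : e.val s.num ≤ p ^ W := (hc.2.val_le hp hs0).trans (hdW (by simp only [deg] at hW; omega))
    refine ⟨setNum_le hs ?_, setNum_num_of_ne hc.1.symm,
      Nat.add_le_add_left ?_ _, Nat.le_add_right _ _, Nat.le_add_right _ _⟩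
    · rcases Nat.eq_zero_or_pos (e.val s.num) with h | h
      · simp [h]
      · exact (Nat.mod_lt _ h).le.trans he
    · rw [add_assoc]
      exact mono (add_le_pow hV h1 (add_le_pow hV (cost i) (cost e))) (by simp only [deg]; omega)
  | drawSeed i =>
    refine ⟨hs, rfl, Nat.add_le_add_left ?_ _, Nat.le_add_right _ _, le_rfl⟩
    exact mono (add_le_pow hV h1 (cost i)) (by simp only [deg]; omega)
  | callTDS a b b' t i d =>
    have hcost : 1 + A.nTrain + A.nTest + t.cost s.num + i.cost s.num ≤
        (p ^ W) ^ (deg (.callTDS a b b' t i d)) := by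
      have := add_le_pow hV (add_le_pow hV h1 (add_le_pow hV (hV1 (hA.1.trans hpV))
        (hV1 (hA.2.trans hpV)))) (add_le_pow hV (cost t) (cost i))
      refine le_trans (by omega) (mono this (by simp only [deg]; omega))
    simp only [run]
    split
    · exact ⟨setNum_le hs (by omega), setNum_num_of_ne (Ne.symm hc), Nat.add_le_add_left hcost _,
        Nat.le_add_right _ _, le_rfl⟩
    · exact ⟨setNum_le hs (by omega), setNum_num_of_ne (Ne.symm hc), Nat.add_le_add_left hcost _,
        Nat.le_add_right _ _, le_rfl⟩
  | applyHyp i a j d k =>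
    refine ⟨setNum_le hs ((Bool.toNat_le _).trans (by omega)), setNum_num_of_ne (Ne.symm hc),
      Nat.add_le_add_left ?_ _, Nat.le_add_right _ _, le_rfl⟩
    have := add_le_pow hV (add_le_pow hV h1 (cost i)) (add_le_pow hV (cost j) (cost k))
    refine le_trans (by omega) (mono this (by simp only [deg]; omega))
  | seq c c' ih ih' =>
    simp only [deg] at hW
    have r1 := ih hc.1 (by omega) s hs hs0 cost
    have r2 := ih' hc.2 (by omega) (c.run A ω s) r1.num_le (fun i => r1.params ▸ hs0 i)
      fun e => (RExpr.val_cost_le hV r1.num_le e).2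
    have hcb := hc.2.callBound_congr r1.params
    have hsum := add_le_pow hV (le_refl ((p ^ W) ^ c.deg)) (le_refl ((p ^ W) ^ c'.deg))
    refine ⟨r2.num_le, r2.params.trans r1.params, ?_, ?_, ?_⟩
    · have a1 := r1.steps; have a2 := r2.steps
      simp only [run, deg]; omega
    · have a1 := r1.drawn; have a2 := r2.drawn
      simp only [run, deg]; omega
    · have a1 := r1.calls; have a2 := r2.calls
      rw [hcb] at a2
      simp only [run, callBound]; omega
  | ite e c c' ih ih' =>
    simp only [deg] at hW
    have hce := add_le_pow hV h1 (cost e)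
    simp only [run]
    split_ifs
    · have r1 := ih hc.1 (by omega) (s.charge (1 + e.cost s.num)) hs hs0 cost
      refine ⟨r1.num_le, r1.params, ?_, ?_, ?_⟩
      · have a1 := r1.steps
        have a2 := mono (add_le_pow hV hce (le_refl ((p ^ W) ^ c.deg)))
          (show _ ≤ deg (.ite e c c') by simp only [deg]; omega)
        simp only [MState.charge] at a1 ⊢
        omega
      · have a1 := r1.drawn
        have a2 := mono (le_refl ((p ^ W) ^ c.deg))
          (show _ ≤ deg (.ite e c c') by simp only [deg]; omega)
        simp only [MState.charge] at a1 ⊢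
        omega
      · have a1 := r1.calls
        simp only [MState.charge, callBound] at a1 ⊢
        omega
    · have r1 := ih' hc.2 (by omega) (s.charge (1 + e.cost s.num)) hs hs0 cost
      refine ⟨r1.num_le, r1.params, ?_, ?_, ?_⟩
      · have a1 := r1.steps
        have a2 := mono (add_le_pow hV hce (le_refl ((p ^ W) ^ c'.deg)))
          (show _ ≤ deg (.ite e c c') by simp only [deg]; omega)
        simp only [MState.charge] at a1 ⊢
        omega
      · have a1 := r1.drawn
        have a2 := mono (le_refl ((p ^ W) ^ c'.deg))
          (show _ ≤ deg (.ite e c c') by simp only [deg]; omega)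
        simp only [MState.charge] at a1 ⊢
        omega
      · have a1 := r1.calls
        simp only [MState.charge, callBound] at a1 ⊢
        omega
  | loop a e c ih =>
    simp only [deg] at hW
    have he : e.val s.num ≤ p ^ W := (hc.2.1.val_le hp hs0).trans (hdW (by omega))
    obtain ⟨b1, b2, b3, b4, b5⟩ := run_loop (A := A) (ω := ω) a e c s
      (fun k r => (∀ a i, r.num a i ≤ p ^ W) ∧ r.num 0 = s.num 0 ∧
        r.steps ≤ s.steps + (1 + e.cost s.num) + k * (p ^ W) ^ (c.deg + 3) ∧
        r.trainDrawn + r.testDrawn ≤ s.trainDrawn + s.testDrawn + k * (p ^ W) ^ c.deg ∧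
        r.calls ≤ s.calls + k * c.callBound s.num)
      ⟨hs, rfl, by simp [MState.charge], by simp [MState.charge], by simp [MState.charge]⟩
      (fun k hk r ⟨i1, i2, i3, i4, i5⟩ => by
        have hk' : k ≤ p ^ W := by omega
        have j1 : ∀ b i, ((r.setNum a 0 k).charge (1 + k.size)).num b i ≤ p ^ W :=
          setNum_le i1 hk'
        have j2 : ((r.setNum a 0 k).charge (1 + k.size)).num 0 = s.num 0 :=
          (setNum_num_of_ne hc.1.symm).trans i2
        have r1 := ih hc.2.2 (by omega) ((r.setNum a 0 k).charge (1 + k.size)) j1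
          (fun i => by rw [j2]; exact hs0 i) fun e => (RExpr.val_cost_le hV j1 e).2
        have hstep := mono (add_le_pow hV (one_add_size_le hV (hV1 hk')) (le_refl ((p ^ W) ^ c.deg)))
          (show _ ≤ c.deg + 3 by omega)
        refine ⟨r1.num_le, r1.params.trans j2, ?_, ?_, ?_⟩
        · have a1 := r1.steps
          simp only [MState.charge, MState.setNum] at a1 ⊢
          rw [add_mul, one_mul]
          omega
        · have a1 := r1.drawn
          simp only [MState.charge, MState.setNum] at a1 ⊢
          rw [add_mul, one_mul]
          omega
        · have a1 := r1.calls
          rw [hc.2.2.callBound_congr j2] at a1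
          simp only [MState.charge, MState.setNum] at a1 ⊢
          rw [add_mul, one_mul]
          omega)
    refine ⟨b1, b2, ?_, ?_, b5⟩
    · have h2 : e.val s.num * (p ^ W) ^ (c.deg + 3) ≤ (p ^ W) ^ (c.deg + 4) := by
        rw [pow_succ' _ (c.deg + 3)]
        exact Nat.mul_le_mul_right _ he
      have h3 := mono (add_le_pow hV (add_le_pow hV h1 (cost e)) h2)
        (show _ ≤ deg (.loop a e c) by simp only [deg]; omega)
      omega
    · have h2 : e.val s.num * (p ^ W) ^ c.deg ≤ (p ^ W) ^ (c.deg + 1) := by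
        rw [pow_succ' _ c.deg]
        exact Nat.mul_le_mul_right _ he
      have h3 := mono h2 (show _ ≤ deg (.loop a e c) by simp only [deg]; omega)
      omega

end Cmd


/-! ### The programs -/

/-!
The memory is laid out as follows.  A repetition consists of `eRounds` rounds and a final one; the
rounds of all repetitions are numbered consecutively, and the `k`-th sample of round `ρ` has the
address `ρ * eSlots + k`.

* Number array `0`: the parameters.  Arrays `1` and `2`: the labels and the numbers of tries of the
  samples.  Array `3`: the positions of the rounds.  Array `4`: the random times of the repetitions.
  Array `5`: the labels in the input buffer.
* Registers: `6` the answer of the TDS algorithm, `7` a prediction, `9` the time at which the score is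
  evaluated, `10` and `11` the positive and the negative part of the score, `12` the weight, `13`
  whether a sample has been accepted, `14` its number of tries, `15` its label, `16` and `17` the label
  and the coin of the current cell, `18` the mode of sampling (`0` for training), `19` and `21` the
  votes, `20` and `22` to `26` the variables of the loops.
* Point array `0`: the point at which the score is evaluated.  Array `1`: the points of the samples.
  Arrays `2` and `3`: the input buffers.  Arrays `4` and `5`: the points of the current cell.
* Seed cell `ρ + 1`: the seed of round `ρ`.  Hypothesis cell `i + 1`: the hypothesis of repetition
  `i`.  The cells `0` of both kinds hold values that are not used.
-/

namespace Boost

open RExpr (cap)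

/-- Number cell `a[0]`, used as a register. -/
def reg (a : ℕ) : RExpr := .cell a 0

/-- The number of training examples of the TDS algorithm.  This and the following expressions have a
value that depends on the input parameters only. -/
def eTr : RExpr := .cell 0 0
/-- The number of test points of the TDS algorithm. -/
def eTe : RExpr := .cell 0 1
/-- The parameter `⌈1 / ε⌉`. -/
def eE : RExpr := .cell 0 2
/-- A number that exceeds the sample size of the TDS algorithm. -/
def eM : RExpr := eTr + eTe + 1
/-- The field `last` of the tuning. -/
def eLast : RExpr := 20000 * (eE * eE) * eM
/-- The field `cap` of the tuning. -/
def eCap : RExpr := 10 * eE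
/-- The field `weight` of the tuning. -/
def eWeight : RExpr := 16 * (eE * eE)
/-- The field `ratio` of the tuning. -/
def eRatio : RExpr := cap eE (.cell 0 3)
/-- The field `res` of the tuning. -/
def eRes : RExpr := 2000000 * (eE * eE * eE * eE * eE * eE * eE) * eM
/-- The number of rounds of a repetition. -/
def eRounds : RExpr := 500 * eM * eRes
/-- The number of repetitions. -/
def eReps : RExpr := 12 * .cell 0 4
/-- The number of samples that a round draws and stores. -/
def eSlots : RExpr := eTr + eTe + 2
/-- A bound for the positive and for the negative part of the score. -/
def eBound : RExpr := eRounds * (eCap + eWeight * (1 + eRatio))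
/-- The number of the first round of the current repetition; register `20` counts the repetitions. -/
def eBase : RExpr := reg 20 * (eRounds + 1)

/-- Copy the stored samples of round `ρ` into the input buffers of the TDS algorithm. -/
def load (ρ : RExpr) : Cmd :=
  (Cmd.loop 26 eTr ((Cmd.copy 2 (reg 26) 1 (ρ * eSlots + 1 + reg 26)).seq
    (.assign 5 (reg 26) (cap 1 (.cell 1 (ρ * eSlots + 1 + reg 26)))))).seq
  (Cmd.loop 26 eTe (.copy 3 (reg 26) 1 (ρ * eSlots + 1 + eTr + reg 26)))

/-- Run the TDS algorithm on the buffers, where point `b[e]` takes the place of the test point at the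
position of round `ρ`. -/
def ask (ρ : RExpr) (b : ℕ) (e : RExpr) : Cmd :=
  (Cmd.copy 3 (.cell 3 ρ) b e).seq (.callTDS 2 5 3 (ρ + 1) 0 6)

/-- Add the positive and the negative part of the update of round `ρ`, at point `0[0]`, to the
registers `10` and `11`.  Here `2 - c`, for the number `c ≥ 1` of tries of a sample, tells whether the
first try has succeeded. -/
def probe (ρ : RExpr) : Cmd :=
  ((((load ρ).seq (ask ρ 0 0)).seq
    (.assign 11 0 (cap eBound (reg 11 + cap (.cell 2 (ρ * eSlots + eTr + eTe + 1)) eCap * reg 6 +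
      eWeight * eRatio * (2 - .cell 2 (ρ * eSlots)))))).seq
    (ask ρ 1 (ρ * eSlots))).seq
    (.assign 10 0 (cap eBound (reg 10 + cap (.cell 2 (ρ * eSlots + eTr + eTe + 1)) eCap * reg 6 +
      eWeight * (2 - .cell 2 (ρ * eSlots + eTr + eTe + 1)))))

/-- Compute the weight of point `0[0]` at the time in register `9`, and put it into register `12`.  The
score is not stored; it is computed from the data of the rounds. -/
def eval : Cmd :=
  (((Cmd.assign 10 0 0).seq (.assign 11 0 0)).seq
    (.loop 25 eRounds (.ite (reg 9 - reg 25) (probe (eBase + reg 25)) .skip))).seq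
    (.assign 12 0 (cap eRes (reg 10 - reg 11)))

/-- Draw one cell of the tape; the coin is uniform below `e`, the seed goes to cell `i`. -/
def tick (e i : RExpr) : Cmd :=
  (((Cmd.drawTrain 4 16 0).seq (.drawTest 5 0)).seq (.drawSeed i)).seq (.uniform 17 0 e)

/-- One try of a sample: unless a try has succeeded before (register `13`), take the new training
point or test point, as the mode in register `18` tells, and compare its weight with the coin. -/
def tryOnce : Cmd :=
  (tick eRes 0).seq (.ite (reg 13) .skip
    (((((Cmd.ite (reg 18) (.copy 0 0 5 0) (.copy 0 0 4 0)).seq eval).seq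
      (.assign 15 0 (cap 1 (reg 16)))).seq
      (.assign 14 0 (cap (eLast + 1) (reg 24 + 1)))).seq
      (.ite (reg 18) (.assign 13 0 (cap 1 (eRes - reg 12 - reg 17)))
        (.assign 13 0 (cap 1 (reg 12 - reg 17))))))

/-- Draw one sample: its point goes to `0[0]`, its label to register `15` and the number of tries to
register `14`. -/
def sample : Cmd := (Cmd.assign 13 0 0).seq (.loop 24 (eLast + 1) tryOnce)

/-- Draw and store the samples of round `ρ`. -/
def gather (ρ : RExpr) : Cmd :=
  .loop 23 eSlots
    ((((((Cmd.assign 18 0 (cap 1 (reg 23 + 1 - (1 + eTr + .cell 3 ρ)))).seq sample).seq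
      (.copy 1 (ρ * eSlots + reg 23) 0 0)).seq
      (.assign 1 (ρ * eSlots + reg 23) (cap 1 (reg 15)))).seq
      (.assign 2 (ρ * eSlots + reg 23) (cap (eLast + 1) (reg 14)))))

/-- One round of the boosting process. -/
def round : Cmd :=
  (((Cmd.assign 9 0 (cap eRounds (reg 22))).seq
    (tick (eTe + 1) (eBase + reg 22 + 1))).seq
    (.assign 3 (eBase + reg 22) (cap eTe (reg 17)))).seq (gather (eBase + reg 22))

/-- The final round of a repetition: choose a random time and run the TDS algorithm on samples from
the two distributions at this time.  The position is `0`, so that all test points come from the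
reweighted test distribution. -/
def final : Cmd :=
  ((((((tick eRounds (eBase + eRounds + 1)).seq
    (.assign 4 (reg 20) (cap eRounds (reg 17)))).seq
    (.assign 9 0 (cap eRounds (reg 17)))).seq
    (.assign 3 (eBase + eRounds) 0)).seq
    (gather (eBase + eRounds))).seq
    (load (eBase + eRounds))).seq
    (.callTDS 2 5 3 (eBase + eRounds + 1) (reg 20 + 1) 6)

/-- The learning program. -/
def learner : Cmd := .loop 20 eReps ((Cmd.loop 22 eRounds round).seq final)

/-- The votes of the repetitions on point `0[0]`: register `19` counts the selectors that accept it,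
and register `21` those of them the hypothesis of which is positive. -/
def votes : Cmd :=
  ((Cmd.assign 19 0 0).seq (.assign 21 0 0)).seq
  (.loop 20 eReps
    (((((Cmd.assign 9 0 (cap eRounds (.cell 4 (reg 20)))).seq eval).seq
      (.applyHyp (reg 20 + 1) 0 0 7 0)).seq
      (.assign 19 0 (cap eReps (reg 19 + cap 1 (eRes - 2 * reg 12))))).seq
      (.assign 21 0 (cap eReps (reg 21 + cap 1 (eRes - 2 * reg 12) * reg 7)))))

/-- The program that evaluates the learned hypothesis and selector: `0[1]` becomes nonzero if at least
two thirds of the selectors accept the point, and `0[0]` if more than half of those hypotheses vote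
for `true`.  The parameters in array `0` are overwritten only here. -/
def predictor : Cmd :=
  (votes.seq (.assign 0 1 (3 * reg 19 + 1 - 2 * eReps))).seq (.assign 0 0 (2 * reg 21 - reg 19))

/-! ### Evaluation of the score -/

/-- The contents of array `0`. -/
def paramRow {X : Type*} [MeasurableSpace X] (A : TDSAlgorithm X) (E H L : ℕ) (i : ℕ) : ℕ :=
  ([A.nTrain, A.nTest, E, H, L] : List ℕ).getD i 0

section values

variable {X : Type*} [MeasurableSpace X] {A : TDSAlgorithm X} {E H L : ℕ} {M : ℕ → ℕ → ℕ}

@[simp] lemma val_reg (a : ℕ) : (reg a).val M = M a 0 := rfl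

/-- The tuning that the programs use. -/
abbrev tun (A : TDSAlgorithm X) (E H : ℕ) : Tuning := stdTuning (A.nTrain + A.nTest + 1) E H

/-- The number of rounds that the programs use. -/
abbrev rnds (A : TDSAlgorithm X) (E : ℕ) : ℕ := stdRounds (A.nTrain + A.nTest + 1) E

variable (h : M 0 = paramRow A E H L)
include h

lemma val_eTr : eTr.val M = A.nTrain := by simp [eTr, h, paramRow]
lemma val_eTe : eTe.val M = A.nTest := by simp [eTe, h, paramRow]
lemma val_eE : eE.val M = E := by simp [eE, h, paramRow]
lemma val_eM : eM.val M = A.nTrain + A.nTest + 1 := by simp [eM, val_eTr h, val_eTe h]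
lemma val_eLast : eLast.val M = (tun A E H).last := by
  simp [eLast, val_eM h, val_eE h, stdTuning]; ring
lemma val_eCap : eCap.val M = (tun A E H).cap := by simp [eCap, val_eE h, stdTuning]
lemma val_eWeight : eWeight.val M = (tun A E H).weight := by
  simp [eWeight, val_eE h, stdTuning]; ring
lemma val_eRatio : eRatio.val M = (tun A E H).ratio := by
  simp [eRatio, val_eE h, stdTuning, h, paramRow]
lemma val_eRes : eRes.val M = (tun A E H).res := by
  simp [eRes, val_eM h, val_eE h, stdTuning]; ring
lemma val_eRounds : eRounds.val M = rnds A E := by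
  simp [eRounds, val_eM h, val_eRes h, stdRounds, stdTuning]
lemma val_eReps : eReps.val M = 12 * L := by simp [eReps, h, paramRow]
lemma val_eSlots : eSlots.val M = A.nTrain + A.nTest + 2 := by simp [eSlots, val_eTr h, val_eTe h]
lemma val_eBound : eBound.val M = rnds A E * (tun A E H).maxUpdate := by
  simp [eBound, val_eRounds h, val_eCap h, val_eWeight h, val_eRatio h, Tuning.maxUpdate]
lemma val_eBase : eBase.val M = M 20 0 * (rnds A E + 1) := by simp [eBase, val_eRounds h]

end values

section eval

variable {X : Type*} [MeasurableSpace X] {A : TDSAlgorithm X} {ω : Tape X} {E H L : ℕ}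

/-- The memory holds the samples `tr` and `te` of round `p`, its position `j`, seed `u` and
reference point `z`, and the numbers of tries of the first and of the last sample. -/
structure Stored (A : TDSAlgorithm X) (s : MState X) (p : ℕ) (tr : Fin A.nTrain → X × Bool)
    (te : Fin A.nTest → X) (j : ℕ) (u : unitInterval) (z : X) (cz cl : ℕ) : Prop where
  seed : s.seed (p + 1) = u
  pos : s.num 3 p = j
  ref : s.pt 1 (p * (A.nTrain + A.nTest + 2)) = z
  refTries : s.num 2 (p * (A.nTrain + A.nTest + 2)) = cz
  train : ∀ k : Fin A.nTrain, s.pt 1 (p * (A.nTrain + A.nTest + 2) + 1 + k) = (tr k).1 ∧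
    s.num 1 (p * (A.nTrain + A.nTest + 2) + 1 + k) = (tr k).2.toNat
  test : ∀ k : Fin A.nTest, s.pt 1 (p * (A.nTrain + A.nTest + 2) + 1 + A.nTrain + k) = te k
  lastTries : s.num 2 (p * (A.nTrain + A.nTest + 2) + A.nTrain + A.nTest + 1) = cl

/-- The data of round `p` lie below the address `(p + 1) * (A.nTrain + A.nTest + 2)`. -/
lemma Stored.congr_of_lt {s r : MState X} {p tr te j u z cz cl}
    (h : Stored A s p tr te j u z cz cl)
    (h1 : ∀ l < (p + 1) * (A.nTrain + A.nTest + 2),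
      r.num 1 l = s.num 1 l ∧ r.num 2 l = s.num 2 l ∧ r.pt 1 l = s.pt 1 l)
    (h3 : r.num 3 p = s.num 3 p) (h5 : r.seed (p + 1) = s.seed (p + 1)) :
    Stored A r p tr te j u z cz cl := by
  have e : (p + 1) * (A.nTrain + A.nTest + 2) = p * (A.nTrain + A.nTest + 2) +
    (A.nTrain + A.nTest + 2) := by ring
  constructor
  · rw [h5, h.seed]
  · rw [h3, h.pos]
  · rw [(h1 _ (by omega)).2.2, h.ref]
  · rw [(h1 _ (by omega)).2.1, h.refTries]
  · intro k
    rw [(h1 _ (by have := k.2; omega)).2.2, (h1 _ (by have := k.2; omega)).1]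
    exact h.train k
  · intro k
    rw [(h1 _ (by have := k.2; omega)).2.2]
    exact h.test k
  · rw [(h1 _ (by omega)).2.1, h.lastTries]

lemma Stored.congr {s r : MState X} {p tr te j u z cz cl}
    (h : Stored A s p tr te j u z cz cl) (h1 : r.num 1 = s.num 1) (h2 : r.num 2 = s.num 2)
    (h3 : r.num 3 = s.num 3) (h4 : r.pt 1 = s.pt 1) (h5 : r.seed (p + 1) = s.seed (p + 1)) :
    Stored A r p tr te j u z cz cl :=
  h.congr_of_lt (fun l _ => ⟨by rw [h1], by rw [h2], by rw [h4]⟩) (by rw [h3]) h5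

lemma load_numWrites (ρ : RExpr) : (load ρ).numWrites = [26, 5, 26] := rfl
lemma load_ptWrites (ρ : RExpr) : (load ρ).ptWrites = [2, 3] := rfl

/-- The buffers hold the samples `tr` and `te`. -/
structure Buffered (A : TDSAlgorithm X) (s : MState X) (tr : Fin A.nTrain → X × Bool)
    (te : Fin A.nTest → X) : Prop where
  train : ∀ k : Fin A.nTrain, s.pt 2 k = (tr k).1 ∧ s.num 5 k = (tr k).2.toNat
  test : ∀ k : Fin A.nTest, s.pt 3 k = te k

/-- The result of `load`.  The address `ρ` may depend on registers, but not on those that `load`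
changes; this is what the hypothesis on `ρ` says, here and below. -/
lemma load_spec {ρ : RExpr} {s : MState X} {p : ℕ} {tr te j u z cz cl}
    (hs0 : s.num 0 = paramRow A E H L) (hs : Stored A s p tr te j u z cz cl)
    (hρ : ∀ M : ℕ → ℕ → ℕ, (∀ a, a ∉ [26, 5] → M a = s.num a) → ρ.val M = p) :
    Buffered A ((load ρ).run A ω s) tr te := by
  -- the training examples
  obtain ⟨h1, h1', h2⟩ := Cmd.run_loop (A := A) (ω := ω) 26 eTr
    ((Cmd.copy 2 (reg 26) 1 (ρ * eSlots + 1 + reg 26)).seq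
    (.assign 5 (reg 26) (cap 1 (.cell 1 (ρ * eSlots + 1 + reg 26))))) s
    (fun n r => (∀ a, a ∉ [26, 5] → r.num a = s.num a) ∧ r.pt 1 = s.pt 1 ∧
      ∀ k : Fin A.nTrain, (k : ℕ) < n → r.pt 2 k = (tr k).1 ∧ r.num 5 k = (tr k).2.toNat)
    ⟨fun _ _ => rfl, rfl, fun k hk => absurd hk (Nat.not_lt_zero _)⟩
    (fun n hn r ⟨i1, i2, i3⟩ => by
      rw [val_eTr hs0] at hn
      have e0 : ∀ a, a ∉ [26, 5] → (r.setNum 26 0 n).num a = s.num a := fun a ha => by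
        rw [Cmd.setNum_num_of_ne (by rintro rfl; simp at ha), i1 a ha]
      have hρ' : ρ.val (r.setNum 26 0 n).num = p := hρ _ e0
      have hsl : eSlots.val (r.setNum 26 0 n).num = A.nTrain + A.nTest + 2 :=
        val_eSlots (E := E) (H := H) (L := L) ((e0 0 (by simp)).trans hs0)
      have hreg : (r.setNum 26 0 n).num 26 0 = n := Cmd.setNum_num_self
      have ht := hs.train ⟨n, hn⟩
      dsimp only at ht
      have haddr : (ρ * eSlots + 1 + reg 26).val (r.setNum 26 0 n).num =
          p * (A.nTrain + A.nTest + 2) + 1 + n := by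
        simp [hρ', hsl]
      have v1 : r.pt 1 (p * (A.nTrain + A.nTest + 2) + 1 + n) = (tr ⟨n, hn⟩).1 := by
        rw [← ht.1, ← i2]
      have v2 : (r.setNum 26 0 n).num 1 (p * (A.nTrain + A.nTest + 2) + 1 + n) =
          (tr ⟨n, hn⟩).2.toNat := by rw [← ht.2, e0 1 (by simp)]
      refine ⟨fun a ha => ?_, ?_, fun k hk => ?_⟩
      · rw [Cmd.run_num_of_notMem _ (by simp [Cmd.numWrites] at ha ⊢; exact ha.2)]
        exact e0 a ha
      · rw [Cmd.run_pt_of_notMem _ (by simp [Cmd.ptWrites])]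
        exact i2
      · have c1 : ((Cmd.copy 2 (reg 26) 1 (ρ * eSlots + 1 + reg 26)).run A ω
            ((r.setNum 26 0 n).charge (1 + n.size))).num = (r.setNum 26 0 n).num := rfl
        rw [run_seq, run_assign_num, run_assign_pt, run_copy_pt, c1, charge_num, haddr, val_reg,
          hreg, RExpr.val_cap, RExpr.val_cell, haddr, v2]
        rcases Nat.lt_succ_iff_lt_or_eq.1 hk with hk' | hk'
        · rw [if_neg (by omega), if_neg (by omega)]
          simpa using i3 k hk'
        · have hk2 : k = ⟨n, hn⟩ := Fin.ext hk'
          subst hk2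
          rw [if_pos (by simp), if_pos (by simp)]
          exact ⟨v1, min_eq_right (Bool.toNat_le _)⟩)
  rw [val_eTr hs0] at h2 
  set s1 := (Cmd.loop 26 eTr ((Cmd.copy 2 (reg 26) 1 (ρ * eSlots + 1 + reg 26)).seq
    (.assign 5 (reg 26) (cap 1 (.cell 1 (ρ * eSlots + 1 + reg 26)))))).run A ω s with hs1
  have hs10 : s1.num 0 = paramRow A E H L := (h1 0 (by simp)).trans hs0
  -- the test points
  have hloop := Cmd.run_loop (A := A) (ω := ω) 26 eTe
    (.copy 3 (reg 26) 1 (ρ * eSlots + 1 + eTr + reg 26)) s1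
    (fun n r => (∀ a, a ≠ 26 → r.num a = s1.num a) ∧ r.pt 1 = s1.pt 1 ∧ r.pt 2 = s1.pt 2 ∧
      ∀ k : Fin A.nTest, (k : ℕ) < n → r.pt 3 k = te k)
    ⟨fun _ _ => rfl, rfl, rfl, fun k hk => absurd hk (Nat.not_lt_zero _)⟩
    (fun n hn r ⟨i1, i2, i3, i4⟩ => by
      rw [val_eTe hs10] at hn
      have e0 : ∀ a, a ≠ 26 → (r.setNum 26 0 n).num a = s1.num a := fun a ha => by
        rw [Cmd.setNum_num_of_ne ha, i1 a ha]
      have hρ' : ρ.val (r.setNum 26 0 n).num = p := hρ _ fun a ha => by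
        rw [e0 a (by rintro rfl; simp at ha), h1 a ha]
      have h00 := (e0 0 (by simp)).trans hs10
      have hreg : (r.setNum 26 0 n).num 26 0 = n := Cmd.setNum_num_self
      have haddr : (ρ * eSlots + 1 + eTr + reg 26).val (r.setNum 26 0 n).num =
          p * (A.nTrain + A.nTest + 2) + 1 + A.nTrain + n := by
        simp [hρ', val_eSlots h00, val_eTr h00]
      refine ⟨fun a ha => ?_, ?_, ?_, fun k hk => ?_⟩
      · exact e0 a ha
      · exact i2
      · exact i3
      · rw [run_copy_pt, charge_num, haddr, val_reg, hreg]
        rcases Nat.lt_succ_iff_lt_or_eq.1 hk with hk' | hk'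
        · rw [if_neg (by omega)]
          exact i4 k hk'
        · have hk2 : k = ⟨n, hn⟩ := Fin.ext hk'
          subst hk2
          rw [if_pos (by simp), ← hs.test ⟨n, hn⟩, ← h1', ← i2]
          rfl)
  rw [val_eTe hs10] at hloop
  obtain ⟨g1, g2, g3, g4⟩ := hloop
  change Buffered A ((Cmd.loop 26 eTe (.copy 3 (reg 26) 1 (ρ * eSlots + 1 + eTr + reg 26))).run
    A ω s1) tr te
  refine ⟨fun k => ?_, fun k => g4 k k.2⟩
  rw [g3, g1 5 (by simp)]
  exact h2 k k.2

end eval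
end Boost


namespace Boost

open RExpr (cap)

section evaluation

variable {X : Type*} [MeasurableSpace X] {A : TDSAlgorithm X} {ω : Tape X} {E H L : ℕ}

/-- The result of `ask`: the flag tells whether the algorithm accepts when the point that has been
copied takes the place of the `j`-th test point.  Only that entry of the buffer changes, so that
`ask` may be repeated. -/
lemma ask_spec {ρ e : RExpr} {b : ℕ} {s : MState X} {p j : ℕ} {tr : Fin A.nTrain → X × Bool}
    {te : Fin A.nTest → X} {u : unitInterval}
    (htr : ∀ k : Fin A.nTrain, s.pt 2 k = (tr k).1 ∧ s.num 5 k = (tr k).2.toNat)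
    (hte : ∀ k : Fin A.nTest, (k : ℕ) ≠ j → s.pt 3 k = te k)
    (hρ : ρ.val s.num = p) (hj : s.num 3 p = j) (hu : s.seed (p + 1) = u) :
    ((ask ρ b e).run A ω s).num 6 0 = acceptsAt A tr te j u (s.pt b (e.val s.num)) ∧
      ∀ k : Fin A.nTest, (k : ℕ) ≠ j → ((ask ρ b e).run A ω s).pt 3 k = te k := by
  have hpt : ∀ k : Fin A.nTest, ((Cmd.copy 3 (.cell 3 ρ) b e).run A ω s).pt 3 k =
      if (k : ℕ) = j then s.pt b (e.val s.num) else te k := fun k => by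
    rw [run_copy_pt, RExpr.val_cell, hρ, hj]
    by_cases hk : (k : ℕ) = j
    · simp [hk]
    · simp [hk, hte k hk]
  refine ⟨?_, fun k hk => ?_⟩
  · rw [ask, run_seq]
    have h := run_callTDS_flag (A := A) (ω := ω) (s := (Cmd.copy 3 (.cell 3 ρ) b e).run A ω s)
      2 5 3 (ρ + 1) 0 6
    refine h.trans ?_
    have h1 : (fun k : Fin A.nTrain => (((Cmd.copy 3 (.cell 3 ρ) b e).run A ω s).pt 2 k,
        decide (((Cmd.copy 3 (.cell 3 ρ) b e).run A ω s).num 5 k ≠ 0))) = tr := by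
      funext k
      rw [run_copy_pt, run_copy_num, if_neg (by simp), (htr k).1, (htr k).2]
      ext
      · rfl
      · cases (tr k).2 <;> simp
    rw [h1, funext hpt, run_copy_seed, run_copy_num, RExpr.val_add, hρ]
    change (A.run tr _ (s.seed (p + 1))).isSome.toNat = _
    rw [hu]
    rfl
  · rw [ask, run_seq, run_callTDS_pt, hpt, if_neg hk]

lemma ask_numWrites (ρ : RExpr) (b : ℕ) (e : RExpr) : (ask ρ b e).numWrites = [6] := rfl
lemma ask_ptWrites (ρ : RExpr) (b : ℕ) (e : RExpr) : (ask ρ b e).ptWrites = [3] := rfl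

lemma load_deterministic (ρ : RExpr) : (load ρ).Deterministic := by simp [load, Cmd.Deterministic]
lemma ask_deterministic (ρ : RExpr) (b : ℕ) (e : RExpr) : (ask ρ b e).Deterministic := by
  simp [ask, Cmd.Deterministic]

/-- What a round adds to the score: the multiplicity times the acceptance of the reference point and
the correction for short waiting times of the test sampler. -/
def plusPart (A : TDSAlgorithm X) (P : Tuning) (tr : Fin A.nTrain → X × Bool)
    (te : Fin A.nTest → X) (j : ℕ) (u : unitInterval) (z : X) (cl : ℕ) : ℕ :=
  min cl P.cap * acceptsAt A tr te j u z + P.weight * (2 - cl)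

/-- What a round subtracts from the score at `x`. -/
def minusPart (A : TDSAlgorithm X) (P : Tuning) (tr : Fin A.nTrain → X × Bool)
    (te : Fin A.nTest → X) (j : ℕ) (u : unitInterval) (cz cl : ℕ) (x : X) : ℕ :=
  min cl P.cap * acceptsAt A tr te j u x + P.weight * P.ratio * (2 - cz)

lemma probe_numWrites (ρ : RExpr) : (probe ρ).numWrites = [26, 5, 26, 6, 11, 6, 10] := rfl
lemma probe_ptWrites (ρ : RExpr) : (probe ρ).ptWrites = [2, 3, 3, 3] := rfl

/-- The result of `probe`: the two registers grow by the two parts of the update.  The caps are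
never effective for the scores of the process; they are there to bound the numbers for a syntactic
reason. -/
lemma probe_spec {ρ : RExpr} {s : MState X} {p : ℕ} {tr te j u z cz cl}
    (hs0 : s.num 0 = paramRow A E H L) (hs : Stored A s p tr te j u z cz cl)
    (hρ : ∀ M : ℕ → ℕ → ℕ, (∀ a, a ∉ [26, 5, 6, 11, 10] → M a = s.num a) → ρ.val M = p) :
    ((probe ρ).run A ω s).num 10 0 = min (rnds A E * (tun A E H).maxUpdate)
        (s.num 10 0 + plusPart A (tun A E H) tr te j u z cl) ∧
      ((probe ρ).run A ω s).num 11 0 = min (rnds A E * (tun A E H).maxUpdate)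
        (s.num 11 0 + minusPart A (tun A E H) tr te j u cz cl (s.pt 0 0)) := by
  obtain ⟨b1, b2⟩ := load_spec (ω := ω) hs0 hs fun M hM => hρ M fun a ha => hM a (by
    simp at ha ⊢; exact ⟨ha.1, ha.2.1⟩)
  set s1 := (load ρ).run A ω s with hs1
  have n1 : ∀ a, a ∉ [26, 5] → s1.num a = s.num a := fun a ha =>
    Cmd.run_num_of_notMem _ (by rw [load_numWrites]; simp at ha ⊢; omega) _
  have p1 : ∀ a, a ∉ [2, 3] → s1.pt a = s.pt a := fun a ha =>
    Cmd.run_pt_of_notMem _ (by rw [load_ptWrites]; exact ha) _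
  have u1 : s1.seed = s.seed := (Cmd.run_deterministic (load_deterministic ρ) s).2
  have r1 : ρ.val s1.num = p := hρ _ fun a ha => n1 a (by simp at ha ⊢; exact ⟨ha.1, ha.2.1⟩)
  obtain ⟨c1, c2⟩ := ask_spec (ω := ω) (b := 0) (e := 0) b1 (fun k _ => b2 k) r1
    (by rw [n1 3 (by simp), hs.pos]) (by rw [u1, hs.seed])
  set s2 := (ask ρ 0 0).run A ω s1 with hs2
  have n2 : ∀ a, a ∉ [26, 5, 6] → s2.num a = s.num a := fun a ha => by
    rw [hs2, Cmd.run_num_of_notMem _ (by rw [ask_numWrites]; simp at ha ⊢; exact ha.2.2),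
      n1 a (by simp at ha ⊢; exact ⟨ha.1, ha.2.1⟩)]
  have p2 : ∀ a, a ≠ 3 → s2.pt a = s1.pt a := fun a ha =>
    Cmd.run_pt_of_notMem _ (by rw [ask_ptWrites]; simpa using ha) _
  have u2 : s2.seed = s.seed := (Cmd.run_deterministic (ask_deterministic _ _ _) s1).2.trans u1
  have f2 : s2.num 5 = s1.num 5 := Cmd.run_num_of_notMem _ (by rw [ask_numWrites]; simp) _
  have r2 : ρ.val s2.num = p := hρ _ fun a ha => n2 a (by simp at ha ⊢; omega)
  have h02 : s2.num 0 = paramRow A E H L := (n2 0 (by simp)).trans hs0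
  set e11 := cap eBound (reg 11 + cap (.cell 2 (ρ * eSlots + eTr + eTe + 1)) eCap * reg 6 +
      eWeight * eRatio * (2 - .cell 2 (ρ * eSlots))) with he11
  have v11 : e11.val s2.num = min (rnds A E * (tun A E H).maxUpdate)
        (s.num 11 0 + minusPart A (tun A E H) tr te j u cz cl (s.pt 0 0)) := by
    rw [he11]
    simp only [RExpr.val_cap, RExpr.val_add, RExpr.val_mul, RExpr.val_sub, RExpr.val_cell, r2,
      val_reg, val_eBound h02, val_eSlots h02, val_eTr h02, val_eTe h02, val_eCap h02,
      val_eWeight h02, val_eRatio h02, RExpr.val_ofNat]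
    rw [c1, n2 2 (by simp), n2 11 (by simp), hs.refTries, hs.lastTries, p1 0 (by simp), minusPart,
      ← add_assoc]
    rfl
  set s3 := (Cmd.assign 11 0 e11).run A ω s2 with hs3
  have n3 : ∀ a, a ≠ 11 → s3.num a = s2.num a := fun a ha =>
    Cmd.run_num_of_notMem _ (by simpa [Cmd.numWrites] using ha) _
  have g3 : s3.num 11 0 = e11.val s2.num := by rw [hs3, run_assign_num, if_pos ⟨rfl, rfl⟩]
  have r3 : ρ.val s3.num = p := hρ _ fun a ha => by
    rw [n3 a (by simp at ha; omega), n2 a (by simp at ha ⊢; omega)]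
  have h03 : s3.num 0 = paramRow A E H L := (n3 0 (by simp)).trans h02
  obtain ⟨d1, -⟩ := ask_spec (A := A) (ω := ω) (s := s3) (b := 1) (e := ρ * eSlots) (p := p) (j := j)
    (u := u) (tr := tr) (te := te)
    (fun k => by
      rw [n3 5 (by simp), f2]
      change s2.pt 2 k = _ ∧ _
      rw [p2 2 (by simp)]
      exact b1 k)
    (fun k hk => c2 k hk) r3
    (by rw [n3 3 (by simp), n2 3 (by simp), hs.pos])
    (by rw [hs3, run_assign_seed, u2, hs.seed])
  set s4 := (ask ρ 1 (ρ * eSlots)).run A ω s3 with hs4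
  have n4 : ∀ a, a ≠ 6 → s4.num a = s3.num a := fun a ha =>
    Cmd.run_num_of_notMem _ (by rw [ask_numWrites]; simpa using ha) _
  have h04 : s4.num 0 = paramRow A E H L := (n4 0 (by simp)).trans h03
  have r4 : ρ.val s4.num = p := hρ _ fun a ha => by
    rw [n4 a (by simp at ha; omega), n3 a (by simp at ha; omega), n2 a (by simp at ha ⊢; omega)]
  set e10 := cap eBound (reg 10 + cap (.cell 2 (ρ * eSlots + eTr + eTe + 1)) eCap * reg 6 +
      eWeight * (2 - .cell 2 (ρ * eSlots + eTr + eTe + 1))) with he10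
  have hz : s3.pt 1 ((ρ * eSlots).val s3.num) = z := by
    rw [RExpr.val_mul, r3, val_eSlots h03]
    change s2.pt 1 _ = z
    rw [p2 1 (by simp), p1 1 (by simp), hs.ref]
  have v10 : e10.val s4.num = min (rnds A E * (tun A E H).maxUpdate)
        (s.num 10 0 + plusPart A (tun A E H) tr te j u z cl) := by
    rw [he10]
    simp only [RExpr.val_cap, RExpr.val_add, RExpr.val_mul, RExpr.val_sub, RExpr.val_cell, r4,
      val_reg, val_eBound h04, val_eSlots h04, val_eTr h04, val_eTe h04, val_eCap h04,
      val_eWeight h04, RExpr.val_ofNat]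
    rw [d1, hz, n4 2 (by simp), n3 2 (by simp), n2 2 (by simp), n4 10 (by simp), n3 10 (by simp),
      n2 10 (by simp), plusPart, ← add_assoc]
    have hl : s.num 2 (p * (A.nTrain + A.nTest + 2) + A.nTrain + A.nTest + 1) = cl := hs.lastTries
    rw [hl]
  have hrun : (probe ρ).run A ω s = (Cmd.assign 10 0 e10).run A ω s4 := rfl
  rw [hrun, run_assign_num, run_assign_num, if_pos ⟨rfl, rfl⟩, if_neg (by simp), v10]
  exact ⟨rfl, by rw [n4 11 (by simp), g3, v11]⟩

lemma probe_deterministic (ρ : RExpr) : (probe ρ).Deterministic := by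
  simp [probe, load, ask, Cmd.Deterministic]

/-- The memory holds the data of round `p`, the cells of which are `c` and before which the score is
`V`. -/
def Holds (A : TDSAlgorithm X) (P : Tuning) (s : MState X) (p : ℕ) (V : X → ℤ)
    (c : Round X A.nTrain A.nTest P.last) : Prop :=
  Stored A s p (fun k => trainSample P.res (units P.res V) (c.2.2.1 k))
    (hybridSample P.res (units P.res V) (coinVal c.1.2.2.1 (A.nTest + 1)) c.2.2.2.1)
    (coinVal c.1.2.2.1 (A.nTest + 1)) c.1.2.2.2 (trainSample P.res (units P.res V) c.2.1).1
    (trainPick P.res (units P.res V) c.2.1 + 1) (testPick P.res (units P.res V) c.2.2.2.2 + 1)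

lemma acceptsAt_le_one (A : TDSAlgorithm X) (tr : Fin A.nTrain → X × Bool) (te : Fin A.nTest → X)
    (j : ℕ) (u : unitInterval) (x : X) : acceptsAt A tr te j u x ≤ 1 := Bool.toNat_le _

lemma plusPart_le (A : TDSAlgorithm X) (P : Tuning) (tr te j u z) {cl : ℕ} (h : 1 ≤ cl) :
    plusPart A P tr te j u z cl ≤ P.maxUpdate := by
  have h1 : min cl P.cap * acceptsAt A tr te j u z ≤ P.cap * 1 :=
    Nat.mul_le_mul (min_le_right _ _) (acceptsAt_le_one A tr te j u z)
  have h2 : P.weight * (2 - cl) ≤ P.weight * (1 + P.ratio) := Nat.mul_le_mul_left _ (by omega)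
  rw [plusPart, Tuning.maxUpdate]
  omega

lemma minusPart_le (A : TDSAlgorithm X) (P : Tuning) (tr te j u) {cz cl : ℕ} (h : 1 ≤ cz) (x : X) :
    minusPart A P tr te j u cz cl x ≤ P.maxUpdate := by
  have h1 : min cl P.cap * acceptsAt A tr te j u x ≤ P.cap * 1 :=
    Nat.mul_le_mul (min_le_right _ _) (acceptsAt_le_one A tr te j u x)
  have h2 : P.weight * P.ratio * (2 - cz) ≤ P.weight * P.ratio * 1 :=
    Nat.mul_le_mul_left _ (by omega)
  rw [minusPart, Tuning.maxUpdate, mul_add]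
  omega

lemma roundUpdate_eq (P : Tuning) (V : X → ℤ) (c : Round X A.nTrain A.nTest P.last) (x : X) :
    roundUpdate A P V c x =
      (plusPart A P (fun k => trainSample P.res (units P.res V) (c.2.2.1 k))
        (hybridSample P.res (units P.res V) (coinVal c.1.2.2.1 (A.nTest + 1)) c.2.2.2.1)
        (coinVal c.1.2.2.1 (A.nTest + 1)) c.1.2.2.2 (trainSample P.res (units P.res V) c.2.1).1
        (testPick P.res (units P.res V) c.2.2.2.2 + 1) : ℕ) -
      (minusPart A P (fun k => trainSample P.res (units P.res V) (c.2.2.1 k))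
        (hybridSample P.res (units P.res V) (coinVal c.1.2.2.1 (A.nTest + 1)) c.2.2.2.1)
        (coinVal c.1.2.2.1 (A.nTest + 1)) c.1.2.2.2
        (trainPick P.res (units P.res V) c.2.1 + 1)
        (testPick P.res (units P.res V) c.2.2.2.2 + 1) x : ℕ) := by
  have h : ∀ k : ℕ, 2 - (k + 1) = 1 - k := fun k => by omega
  simp only [roundUpdate, plusPart, minusPart, h]
  push_cast
  ring

lemma eval_numWrites : eval.numWrites = [10, 11, 25, 26, 5, 26, 6, 11, 6, 10, 12] := rfl
lemma eval_ptWrites : eval.ptWrites = [2, 3, 3, 3] := rfl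
lemma eval_deterministic : eval.Deterministic := by
  simp [eval, probe, load, ask, Cmd.Deterministic]
lemma eval_scratch : eval.Scratch := by
  simp only [eval, probe, load, ask, Cmd.Scratch, true_and, and_true]
  exact ⟨rfl, rfl⟩

/-- If the rounds before the current time are stored, then `eval` computes the weight of the point
in the cell `0[0]` at this time. -/
lemma eval_spec {s : MState X} (hs0 : s.num 0 = paramRow A E H L)
    {b : ℕ → Round X A.nTrain A.nTest (tun A E H).last}
    (hb : ∀ t < s.num 9 0, Holds A (tun A E H) s (s.num 20 0 * (rnds A E + 1) + t)
      (scoreAt A (tun A E H) b t) (b t))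
    (hcur : s.num 9 0 ≤ rnds A E) :
    (eval.run A ω s).num 12 0 =
      units (tun A E H).res (scoreAt A (tun A E H) b (s.num 9 0)) (s.pt 0 0) := by
  set s0 := ((Cmd.assign 10 0 0).seq (.assign 11 0 0)).run A ω s with hs0'
  have n0 : ∀ a, a ∉ [10, 11] → s0.num a = s.num a := fun a ha =>
    Cmd.run_num_of_notMem _ (by simpa [Cmd.numWrites] using ha) _
  have h00 : s0.num 0 = paramRow A E H L := (n0 0 (by simp)).trans hs0
  have key := Cmd.run_loop (A := A) (ω := ω) 25 eRounds
    (.ite (reg 9 - reg 25) (probe (eBase + reg 25)) .skip) s0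
    (fun k r => (∀ a, a ∉ [10, 11, 25, 26, 5, 6] → r.num a = s.num a) ∧
      (∀ a, a ∉ [2, 3] → r.pt a = s.pt a) ∧ r.seed = s.seed ∧
      ((r.num 10 0 : ℤ) - r.num 11 0 = scoreAt A (tun A E H) b (min k (s.num 9 0)) (s.pt 0 0)) ∧
      r.num 10 0 ≤ k * (tun A E H).maxUpdate ∧ r.num 11 0 ≤ k * (tun A E H).maxUpdate)
    ⟨fun a ha => n0 a (by simp at ha ⊢; omega), fun _ _ => rfl, rfl, by
      simp [hs0', scoreAt], by simp [hs0'], by simp [hs0']⟩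
    (fun k hk r ⟨i1, i2, i3, i4, i5, i6⟩ => by
      rw [val_eRounds h00] at hk
      set r' := (r.setNum 25 0 k).charge (1 + k.size) with hr'
      have n' : ∀ a, a ≠ 25 → r'.num a = r.num a := fun a ha => Cmd.setNum_num_of_ne ha
      have n25 : r'.num 25 0 = k := by simp [hr']
      have m' : ∀ a, a ∉ [10, 11, 25, 26, 5, 6] → r'.num a = s.num a := fun a ha => by
        rw [n' a (by simp at ha; omega), i1 a ha]
      rw [run_ite]
      by_cases hlt : k < s.num 9 0
      · rw [if_pos (by simp [n25, m']; omega)]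
        set r'' := r'.charge (1 + (reg 9 - reg 25).cost r'.num) with hr''
        have hold := hb k hlt
        have hold' : Holds A (tun A E H) r'' (s.num 20 0 * (rnds A E + 1) + k) (scoreAt A (tun A E H) b k) (b k) :=
          hold.congr (m' 1 (by simp)) (m' 2 (by simp)) (m' 3 (by simp)) (i2 1 (by simp))
            (congrFun i3 _)
        have h0'' : r''.num 0 = paramRow A E H L := (m' 0 (by simp)).trans hs0
        obtain ⟨q1, q2⟩ := probe_spec (ω := ω) (ρ := eBase + reg 25) h0'' hold' fun M hM => by
          have hM0 : M 0 = paramRow A E H L := by rw [hM 0 (by simp), h0'']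
          rw [RExpr.val_add, val_eBase hM0, val_reg, hM 20 (by simp), hM 25 (by simp)]
          change r'.num 20 0 * _ + r'.num 25 0 = _
          rw [n25, m' 20 (by simp)]
        set f := (probe (eBase + reg 25)).run A ω r'' with hf
        have hx : r''.pt 0 0 = s.pt 0 0 := by
          change r.pt 0 0 = _
          rw [i2 0 (by simp)]
        have a10 : r''.num 10 0 = r.num 10 0 := by
          change r'.num 10 0 = _
          rw [n' 10 (by simp)]
        have a11 : r''.num 11 0 = r.num 11 0 := by
          change r'.num 11 0 = _
          rw [n' 11 (by simp)]
        have hkm : (k + 1) * (tun A E H).maxUpdate ≤ rnds A E * (tun A E H).maxUpdate :=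
          Nat.mul_le_mul_right _ (by omega)
        have e1 := add_mul k 1 (tun A E H).maxUpdate
        rw [hx, a11, min_eq_right (by
          have := minusPart_le A (tun A E H) (fun k' => trainSample (tun A E H).res (units (tun A E H).res (scoreAt A (tun A E H) b k))
              ((b k).2.2.1 k')) (hybridSample (tun A E H).res (units (tun A E H).res (scoreAt A (tun A E H) b k))
              (coinVal (b k).1.2.2.1 (A.nTest + 1)) (b k).2.2.2.1)
              (coinVal (b k).1.2.2.1 (A.nTest + 1)) (b k).1.2.2.2
            (cz := trainPick (tun A E H).res (units (tun A E H).res (scoreAt A (tun A E H) b k)) (b k).2.1 + 1)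
            (cl := testPick (tun A E H).res (units (tun A E H).res (scoreAt A (tun A E H) b k)) (b k).2.2.2.2 + 1)
            (by omega) (s.pt 0 0)
          omega)] at q2
        rw [a10, min_eq_right (by
          have := plusPart_le A (tun A E H) (fun k' => trainSample (tun A E H).res (units (tun A E H).res (scoreAt A (tun A E H) b k))
              ((b k).2.2.1 k')) (hybridSample (tun A E H).res (units (tun A E H).res (scoreAt A (tun A E H) b k))
              (coinVal (b k).1.2.2.1 (A.nTest + 1)) (b k).2.2.2.1)
              (coinVal (b k).1.2.2.1 (A.nTest + 1)) (b k).1.2.2.2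
              (trainSample (tun A E H).res (units (tun A E H).res (scoreAt A (tun A E H) b k)) (b k).2.1).1
            (cl := testPick (tun A E H).res (units (tun A E H).res (scoreAt A (tun A E H) b k)) (b k).2.2.2.2 + 1) (by omega)
          omega)] at q1
        refine ⟨fun a ha => ?_, fun a ha => ?_, ?_, ?_, ?_, ?_⟩
        · rw [hf, Cmd.run_num_of_notMem _ (by rw [probe_numWrites]; simp at ha ⊢; omega)]
          exact m' a ha
        · rw [hf, Cmd.run_pt_of_notMem _ (by rw [probe_ptWrites]; simp at ha ⊢; omega)]
          exact i2 a ha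
        · exact (Cmd.run_deterministic (probe_deterministic _) _).2.trans i3
        · rw [min_eq_left (by omega)] at i4
          rw [min_eq_left (by omega), q1, q2]
          simp only [scoreAt]
          rw [← i4, roundUpdate_eq]
          push_cast
          ring
        · rw [q1, e1, one_mul]
          exact Nat.add_le_add i5 (plusPart_le _ _ _ _ _ _ _ (by omega))
        · rw [q2, e1, one_mul]
          exact Nat.add_le_add i6 (minusPart_le _ _ _ _ _ _ (by omega) _)
      · rw [if_neg (by simp [n25, m']; omega), run_skip]
        refine ⟨m', i2, i3, ?_, ?_, ?_⟩
        · change (r'.num 10 0 : ℤ) - r'.num 11 0 = _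
          rw [n' 10 (by simp), n' 11 (by simp), i4, min_eq_right (by omega), min_eq_right (by omega)]
        · change r'.num 10 0 ≤ _
          rw [n' 10 (by simp), add_mul]; omega
        · change r'.num 11 0 ≤ _
          rw [n' 11 (by simp), add_mul]; omega)
  rw [val_eRounds h00, min_eq_right hcur] at key
  obtain ⟨k1, -, -, k4, -, -⟩ := key
  set s1 := (Cmd.loop 25 eRounds (.ite (reg 9 - reg 25) (probe (eBase + reg 25)) .skip)).run A ω s0
    with hs1
  have hrun : eval.run A ω s = (Cmd.assign 12 0 (cap eRes (reg 10 - reg 11))).run A ω s1 := rfl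
  rw [hrun, run_assign_num, if_pos ⟨rfl, rfl⟩, RExpr.val_cap,
    val_eRes (H := H) ((k1 0 (by simp)).trans hs0), RExpr.val_sub, val_reg, val_reg, units, ← k4]
  congr 1
  omega

end evaluation
end Boost


/-! ### Sampling -/

namespace Boost

open RExpr (cap)

section sampling

variable {X : Type*} [MeasurableSpace X] {A : TDSAlgorithm X} {ω : Tape X} {E H L : ℕ}

lemma tick_numWrites (e i : RExpr) : (tick e i).numWrites = [16, 17] := rfl
lemma tick_ptWrites (e i : RExpr) : (tick e i).ptWrites = [4, 5] := rfl

/-- A tick reads the next cell of the tape. -/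
lemma tick_spec {e i : RExpr} {s : MState X} {N v k : ℕ} (hs : s.Clock N)
    (he : ∀ M : ℕ → ℕ → ℕ, (∀ a, a ≠ 16 → M a = s.num a) → e.val M = v)
    (hi : ∀ M : ℕ → ℕ → ℕ, (∀ a, a ≠ 16 → M a = s.num a) → i.val M = k) :
    ((tick e i).run A ω s).Clock (N + 1) ∧
      ((tick e i).run A ω s).pt 4 0 = (tapeCell ω N).1.1 ∧
      ((tick e i).run A ω s).num 16 0 = (tapeCell ω N).1.2.toNat ∧
      ((tick e i).run A ω s).pt 5 0 = (tapeCell ω N).2.1 ∧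
      ((tick e i).run A ω s).num 17 0 = coinVal (tapeCell ω N).2.2.1 v ∧
      ((tick e i).run A ω s).hyp = s.hyp ∧
      ((tick e i).run A ω s).seed k = (tapeCell ω N).2.2.2 ∧
      ∀ l, l ≠ k → ((tick e i).run A ω s).seed l = s.seed l := by
  obtain ⟨h1, h2, h3, h4⟩ := hs
  have hM : ∀ a, a ≠ 16 → (s.setNum 16 0 (ω.1 N).2.toNat).num a = s.num a := fun a ha =>
    Cmd.setNum_num_of_ne ha
  have he' := he _ hM
  have hi' := hi _ hM
  have hrun : (tick e i).run A ω s =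
      { ((((((s.setPt 4 0 (ω.1 N).1).setNum 16 0 (ω.1 N).2.toNat).setPt 5 0 (ω.2.1 N)).setSeed k
        (ω.2.2.2 N)).setNum 17 0 (coinVal (ω.2.2.1 N) v))) with
        trainDrawn := N + 1, testDrawn := N + 1, coinsDrawn := N + 1, seedsDrawn := N + 1,
        steps := ((tick e i).run A ω s).steps, calls := s.calls + 1 } := by
    subst h1
    simp only [tick, run_seq, Cmd.run, MState.setPt, MState.setNum, MState.setSeed, MState.charge,
      h2, h3, h4, coinVal] at *
    have z : ∀ M, RExpr.val M 0 = 0 := fun _ => rfl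
    simp only [z]
    rw [hi', he']
  rw [hrun]
  refine ⟨⟨rfl, rfl, rfl, rfl⟩, ?_, ?_, ?_, ?_, rfl, ?_, fun l hl => ?_⟩ <;>
    simp [MState.setPt, MState.setNum, MState.setSeed, tapeCell]
  simp [hl]

lemma tryOnce_numWrites : tryOnce.numWrites =
    [16, 17, 10, 11, 25, 26, 5, 26, 6, 11, 6, 10, 12, 15, 14, 13, 13] := rfl
lemma tryOnce_ptWrites : tryOnce.ptWrites = [4, 5, 0, 0, 2, 3, 3, 3] := rfl
lemma tryOnce_scratch : tryOnce.Scratch := by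
  simp only [tryOnce, tick, Cmd.Scratch, eval_scratch, true_and, and_true]
  rfl

/-- The point that a cell offers to the sampler. -/
def offer (mode : ℕ) (c : Cell X) : X := if mode = 0 then c.1.1 else c.2.1

/-- Whether the sampler accepts a cell. -/
def Accepts (mode q : ℕ) (t : X → ℕ) (c : Cell X) : Prop :=
  coinVal c.2.2.1 q < if mode = 0 then t c.1.1 else q - t c.2.1

lemma min_one_sub_ne_zero {x y : ℕ} : min 1 (x - y) ≠ 0 ↔ y < x := by omega

/-- The result of one try.  It reads a cell in any case, so that the number of cells that a sample
reads does not depend on its outcome. -/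
lemma tryOnce_spec {s : MState X} (hs0 : s.num 0 = paramRow A E H L) {N : ℕ} (hN : s.Clock N)
    {b : ℕ → Round X A.nTrain A.nTest (tun A E H).last}
    (hb : ∀ t < s.num 9 0, Holds A (tun A E H) s (s.num 20 0 * (rnds A E + 1) + t)
      (scoreAt A (tun A E H) b t) (b t))
    (hcur : s.num 9 0 ≤ rnds A E) :
    (tryOnce.run A ω s).Clock (N + 1) ∧
    (s.num 13 0 ≠ 0 → (tryOnce.run A ω s).pt 0 0 = s.pt 0 0 ∧
      ∀ a ∈ [13, 14, 15], (tryOnce.run A ω s).num a 0 = s.num a 0) ∧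
    (s.num 13 0 = 0 → (tryOnce.run A ω s).pt 0 0 = offer (s.num 18 0) (tapeCell ω N) ∧
      (tryOnce.run A ω s).num 15 0 = (tapeCell ω N).1.2.toNat ∧
      (tryOnce.run A ω s).num 14 0 = min ((tun A E H).last + 1) (s.num 24 0 + 1) ∧
      ((tryOnce.run A ω s).num 13 0 ≠ 0 ↔ Accepts (s.num 18 0) (tun A E H).res
        (units (tun A E H).res (scoreAt A (tun A E H) b (s.num 9 0))) (tapeCell ω N))) := by
  obtain ⟨c1, c2, c3, c4, c5, -, -, c7⟩ := tick_spec (A := A) (ω := ω) (e := eRes) (i := 0) (k := 0)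
    (v := (tun A E H).res) hN (fun M hM => val_eRes (L := L) ((hM 0 (by simp)).trans hs0))
    (fun M _ => rfl)
  set s1 := (tick eRes 0).run A ω s with hs1
  clear_value s1
  have n1 : ∀ a, a ∉ [16, 17] → s1.num a = s.num a := fun a ha => by
    rw [hs1]; exact Cmd.run_num_of_notMem _ (by rw [tick_numWrites]; exact ha) _
  have p1 : ∀ a, a ∉ [4, 5] → s1.pt a = s.pt a := fun a ha => by
    rw [hs1]; exact Cmd.run_pt_of_notMem _ (by rw [tick_ptWrites]; exact ha) _
  have h13 : (reg 13).val s1.num = s.num 13 0 := by rw [val_reg, n1 13 (by simp)]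
  rw [tryOnce, run_seq, run_ite, ← hs1, h13]
  by_cases hflag : s.num 13 0 = 0
  swap
  · rw [if_pos hflag, run_skip]
    refine ⟨c1, fun _ => ⟨?_, fun a ha => ?_⟩, fun h => absurd h hflag⟩
    · rw [charge_pt, p1 0 (by simp)]
    · rw [charge_num, n1 a (by simp at ha ⊢; omega)]
  rw [if_neg (not_not.2 hflag)]
  set s2 := s1.charge (1 + (reg 13).cost s1.num) with hs2
  have n2 : s2.num = s1.num := charge_num _
  have q2 : s2.pt = s1.pt := charge_pt _
  have u2 : s2.seed = s1.seed := charge_seed _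
  have k2 : s2.Clock (N + 1) := c1.charge _
  clear_value s2
  simp only [run_seq]
  -- the point that is offered
  set cp := Cmd.ite (reg 18) (.copy 0 0 5 0) (.copy 0 0 4 0) with hcp
  set s3 := cp.run A ω s2 with hs3
  have n3 : s3.num = s1.num := by
    rw [hs3, hcp, run_ite]; split_ifs <;> rw [run_copy_num, charge_num, n2]
  have p3 : ∀ a, a ∉ [0, 4, 5] → s3.pt a = s.pt a := fun a ha => by
    rw [hs3, Cmd.run_pt_of_notMem _ (by simp [hcp, Cmd.ptWrites] at ha ⊢; omega), q2,
      p1 a (by simp at ha ⊢; omega)]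
  have x3 : s3.pt 0 0 = offer (s.num 18 0) (tapeCell ω N) := by
    have h18 : (reg 18).val s2.num = s.num 18 0 := by rw [val_reg, n2, n1 18 (by simp)]
    rw [hs3, hcp, run_ite, h18, offer]
    by_cases hm : s.num 18 0 = 0
    · rw [if_neg (not_not.2 hm), if_pos hm, run_copy_pt, if_pos ⟨rfl, rfl⟩, charge_pt, q2, ← c2]
      rfl
    · rw [if_pos hm, if_neg hm, run_copy_pt, if_pos ⟨rfl, rfl⟩, charge_pt, q2, ← c4]
      rfl
  have k3 : s3.Clock (N + 1) := by
    rw [hs3]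
    exact (Cmd.run_deterministic (by simp [hcp, Cmd.Deterministic]) s2).1 _ k2
  have u3 : s3.seed = s1.seed := by
    rw [hs3]
    exact (Cmd.run_deterministic (by simp [hcp, Cmd.Deterministic]) s2).2.trans u2
  clear_value s3
  have h30 : s3.num 0 = paramRow A E H L := by rw [n3, n1 0 (by simp), hs0]
  have e9 : s3.num 9 = s.num 9 := by rw [n3, n1 9 (by simp)]
  have e20 : s3.num 20 = s.num 20 := by rw [n3, n1 20 (by simp)]
  -- its weight
  have hev := eval_spec (ω := ω) (b := b) h30
    (by
      rw [e9, e20]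
      exact fun t ht => (hb t ht).congr (by rw [n3, n1 1 (by simp)]) (by rw [n3, n1 2 (by simp)])
        (by rw [n3, n1 3 (by simp)]) (p3 1 (by simp)) (by rw [u3, c7 _ (by omega)]))
    (by rw [e9]; exact hcur)
  rw [e9, x3] at hev
  set s4 := eval.run A ω s3 with hs4
  have n4 : ∀ a, a ∉ [10, 11, 25, 26, 5, 6, 12] → s4.num a = s1.num a := fun a ha => by
    rw [hs4, Cmd.run_num_of_notMem _ (by rw [eval_numWrites]; simp at ha ⊢; omega), n3]
  have p4 : s4.pt 0 0 = s3.pt 0 0 := by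
    rw [hs4, Cmd.run_pt_of_notMem _ (by rw [eval_ptWrites]; simp)]
  have k4 : s4.Clock (N + 1) := by
    rw [hs4]; exact (Cmd.run_deterministic eval_deterministic s3).1 _ k3
  clear_value s4
  set s5 := (Cmd.assign 14 0 (cap (eLast + 1) (reg 24 + 1))).run A ω
    ((Cmd.assign 15 0 (cap 1 (reg 16))).run A ω s4) with hs5
  have n5 : ∀ a, a ∉ [14, 15] → s5.num a = s4.num a := fun a ha => by
    funext j
    simp only [List.mem_cons, List.not_mem_nil, or_false, not_or] at ha
    rw [hs5, run_assign_num, if_neg (by tauto), run_assign_num, if_neg (by tauto)]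
  have h50 : s5.num 0 = paramRow A E H L := by
    rw [n5 0 (by simp), n4 0 (by simp), n1 0 (by simp), hs0]
  have k5 : s5.Clock (N + 1) := by
    rw [hs5]
    exact (Cmd.run_deterministic (c := .assign _ _ _) trivial _).1 _
      ((Cmd.run_deterministic (c := .assign _ _ _) trivial _).1 _ k4)
  have a15 : s5.num 15 0 = (tapeCell ω N).1.2.toNat := by
    rw [hs5, run_assign_num, if_neg (by simp), run_assign_num, if_pos ⟨rfl, rfl⟩, RExpr.val_cap,
      val_reg, n4 16 (by simp), c3]
    exact min_eq_right (Bool.toNat_le _)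
  have a14 : s5.num 14 0 = min ((tun A E H).last + 1) (s.num 24 0 + 1) := by
    set s45 := (Cmd.assign 15 0 (cap 1 (reg 16))).run A ω s4 with hs45
    have n45 : ∀ a, a ≠ 15 → s45.num a = s4.num a := fun a ha =>
      Cmd.run_num_of_notMem _ (by simpa [Cmd.numWrites] using ha) _
    rw [hs5, run_assign_num, if_pos ⟨rfl, rfl⟩, RExpr.val_cap, RExpr.val_add, RExpr.val_add,
      val_reg, val_eLast (E := E) (H := H) (L := L) (by
        rw [n45 0 (by simp), n4 0 (by simp), n1 0 (by simp), hs0]),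
      n45 24 (by simp), n4 24 (by simp), n1 24 (by simp), RExpr.val_ofNat]
  have p5 : s5.pt 0 0 = s4.pt 0 0 := by rw [hs5, run_assign_pt, run_assign_pt]
  clear_value s5
  have v18 : (reg 18).val s5.num = s.num 18 0 := by
    rw [val_reg, n5 18 (by simp), n4 18 (by simp), n1 18 (by simp)]
  have v12 : (reg 12).val s5.num = units (tun A E H).res
      (scoreAt A (tun A E H) b (s.num 9 0)) (offer (s.num 18 0) (tapeCell ω N)) := by
    rw [val_reg, n5 12 (by simp), hev]
  have v17 : (reg 17).val s5.num = coinVal (tapeCell ω N).2.2.1 (tun A E H).res := by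
    rw [val_reg, n5 17 (by simp), n4 17 (by simp), c5]
  set fin := Cmd.ite (reg 18) (.assign 13 0 (cap 1 (eRes - reg 12 - reg 17)))
        (.assign 13 0 (cap 1 (reg 12 - reg 17))) with hfin
  have n6 : ∀ a, a ≠ 13 → (fin.run A ω s5).num a = s5.num a := fun a ha =>
    Cmd.run_num_of_notMem _ (by simpa [hfin, Cmd.numWrites] using ha) _
  refine ⟨(Cmd.run_deterministic (by simp [hfin, Cmd.Deterministic]) s5).1 _ k5,
    fun h => absurd hflag h, fun _ => ⟨?_, ?_, ?_, ?_⟩⟩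
  · rw [Cmd.run_pt_of_notMem _ (by simp [hfin, Cmd.ptWrites]), ← x3, ← p4, p5]
  · rw [n6 15 (by simp), a15]
  · rw [n6 14 (by simp), a14]
  · rw [hfin, run_ite, v18, Accepts]
    by_cases hm : s.num 18 0 = 0
    · rw [if_neg (not_not.2 hm), if_pos hm, run_assign_num, if_pos ⟨rfl, rfl⟩, RExpr.val_cap,
        RExpr.val_sub, charge_num, v12, v17, RExpr.val_ofNat, offer, if_pos hm]
      exact min_one_sub_ne_zero
    · rw [if_pos hm, if_neg hm, run_assign_num, if_pos ⟨rfl, rfl⟩, RExpr.val_cap,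
        RExpr.val_sub, RExpr.val_sub, charge_num, v12, v17, RExpr.val_ofNat,
        val_eRes (E := E) (H := H) h50, offer, if_neg hm]
      exact min_one_sub_ne_zero

lemma sample_numWrites : sample.numWrites =
    [13, 24, 16, 17, 10, 11, 25, 26, 5, 26, 6, 11, 6, 10, 12, 15, 14, 13, 13] := rfl
lemma sample_ptWrites : sample.ptWrites = [4, 5, 0, 0, 2, 3, 3, 3] := rfl
lemma sample_scratch : sample.Scratch := by
  simp only [sample, Cmd.Scratch, tryOnce_scratch, and_self]

/-- A sample is the first cell of the slot that is accepted, and the last cell if there is none. -/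
lemma sample_spec {s : MState X} (hs0 : s.num 0 = paramRow A E H L) {N : ℕ} (hN : s.Clock N)
    {b : ℕ → Round X A.nTrain A.nTest (tun A E H).last}
    (hb : ∀ t < s.num 9 0, Holds A (tun A E H) s (s.num 20 0 * (rnds A E + 1) + t)
      (scoreAt A (tun A E H) b t) (b t))
    (hcur : s.num 9 0 ≤ rnds A E) {c : Slot X (tun A E H).last}
    (hc : ∀ k : Fin ((tun A E H).last + 1), c k = tapeCell ω (N + k)) :
    (sample.run A ω s).Clock (N + ((tun A E H).last + 1)) ∧
    ∃ i : Fin ((tun A E H).last + 1),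
      i = pick (fun k => Accepts (s.num 18 0) (tun A E H).res
        (units (tun A E H).res (scoreAt A (tun A E H) b (s.num 9 0))) (c k)) ∧
      (sample.run A ω s).pt 0 0 = offer (s.num 18 0) (c i) ∧
      (sample.run A ω s).num 15 0 = (c i).1.2.toNat ∧
      (sample.run A ω s).num 14 0 = i + 1 := by
  set s0 := (Cmd.assign 13 0 0).run A ω s with hs0'
  have n0 : ∀ a, a ≠ 13 → s0.num a = s.num a := fun a ha =>
    Cmd.run_num_of_notMem _ (by simpa [Cmd.numWrites] using ha) _
  have h00 : s0.num 0 = paramRow A E H L := (n0 0 (by simp)).trans hs0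
  set acc : Fin ((tun A E H).last + 1) → Prop := fun k => Accepts (s.num 18 0) (tun A E H).res
    (units (tun A E H).res (scoreAt A (tun A E H) b (s.num 9 0))) (c k) with hacc
  have hval : (eLast + 1).val s0.num = (tun A E H).last + 1 := by
    rw [RExpr.val_add, val_eLast h00]; rfl
  have key := Cmd.run_loop (A := A) (ω := ω) 24 (eLast + 1) tryOnce s0
    (fun k r => (∀ a, a ∉ [13, 24, 16, 17, 10, 11, 25, 26, 5, 6, 12, 15, 14] → r.num a = s.num a) ∧
      (∀ a, a ∉ [4, 5, 0, 2, 3] → r.pt a = s.pt a) ∧ (∀ i, i ≠ 0 → r.seed i = s.seed i) ∧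
      r.Clock (N + k) ∧ ((k = 0 ∧ r.num 13 0 = 0) ∨ ∃ i : Fin ((tun A E H).last + 1),
        (i : ℕ) < k ∧ (∀ j < i, ¬ acc j) ∧
        ((r.num 13 0 ≠ 0 ∧ acc i) ∨ (r.num 13 0 = 0 ∧ ¬ acc i ∧ (i : ℕ) + 1 = k)) ∧
        r.pt 0 0 = offer (s.num 18 0) (c i) ∧ r.num 15 0 = (c i).1.2.toNat ∧
        r.num 14 0 = i + 1))
    ⟨fun a ha => n0 a (by simp at ha; omega), fun _ _ => rfl, fun _ _ => rfl, hN,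
      Or.inl ⟨rfl, by simp [hs0']⟩⟩
    (fun k hk r ⟨i1, i2, i3, i4, i5⟩ => by
      rw [hval] at hk
      set r' := (r.setNum 24 0 k).charge (1 + k.size) with hr'
      have n' : ∀ a, a ≠ 24 → r'.num a = r.num a := fun a ha => Cmd.setNum_num_of_ne ha
      have n24 : r'.num 24 0 = k := by simp [hr']
      have m' : ∀ a, a ∉ [13, 24, 16, 17, 10, 11, 25, 26, 5, 6, 12, 15, 14] →
        r'.num a = s.num a := fun a ha => by rw [n' a (by simp at ha; omega), i1 a ha]
      have m9 := m' 9 (by simp)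
      have m18 := m' 18 (by simp)
      obtain ⟨q1, q2, q3⟩ := tryOnce_spec (ω := ω) (s := r') (N := N + k) (b := b)
        ((m' 0 (by simp)).trans hs0) i4
        (by
          rw [m9, m' 20 (by simp)]
          exact fun t ht => (hb t ht).congr (m' 1 (by simp)) (m' 2 (by simp)) (m' 3 (by simp))
            (i2 1 (by simp)) (i3 _ (by omega)))
        (by rw [m9]; exact hcur)
      rw [m9, m18, n24, ← hc ⟨k, hk⟩, n' 13 (by simp)] at q3
      rw [n' 13 (by simp)] at q2
      set f := tryOnce.run A ω r' with hf
      refine ⟨fun a ha => ?_, fun a ha => ?_, fun a ha => ?_, q1, Or.inr ?_⟩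
      · rw [hf, Cmd.run_num_of_notMem _ (by rw [tryOnce_numWrites]; simp at ha ⊢; omega)]
        exact m' a ha
      · rw [hf, Cmd.run_pt_of_notMem _ (by rw [tryOnce_ptWrites]; simp at ha ⊢; omega)]
        exact i2 a ha
      · exact ((Cmd.run_scratch _ tryOnce_scratch r' ha).2).trans (i3 a ha)
      · by_cases hflag : r.num 13 0 = 0
        · obtain ⟨w1, w2, w3, w4⟩ := q3 hflag
          refine ⟨⟨k, hk⟩, Nat.lt_succ_self k, fun j hj => ?_, ?_, w1, w2, ?_⟩
          · rcases i5 with ⟨rfl, -⟩ | ⟨i, j1, j2, j3, -⟩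
            · exact absurd hj (Nat.not_lt_zero _)
            · obtain ⟨-, j4, j5⟩ := j3.resolve_left fun h => h.1 hflag
              rcases lt_or_eq_of_le (show j ≤ i by
                rw [Fin.le_def]; rw [Fin.lt_def] at hj; simp only at hj; omega) with h | h
              · exact j2 j h
              · rwa [h]
          · by_cases ha : acc ⟨k, hk⟩
            · exact Or.inl ⟨w4.2 ha, ha⟩
            · exact Or.inr ⟨not_not.1 fun h => ha (w4.1 h), ha, rfl⟩
          · rw [w3]; exact min_eq_right (by omega)
        · obtain ⟨w1, w2⟩ := q2 hflag
          rcases i5 with ⟨-, h⟩ | ⟨i, j1, j2, j3, j4, j5, j6⟩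
          · exact absurd h hflag
          · have e13 := w2 13 (by simp)
            have e14 := w2 14 (by simp)
            have e15 := w2 15 (by simp)
            rw [n' 13 (by simp)] at e13
            rw [n' 14 (by simp)] at e14
            rw [n' 15 (by simp)] at e15
            refine ⟨i, by omega, j2, Or.inl ⟨by rw [e13]; exact hflag, ?_⟩, ?_, ?_, ?_⟩
            · exact (j3.resolve_right fun h => hflag h.1).2
            · rw [w1]; exact j4
            · rw [e15, j5]
            · rw [e14, j6])
  rw [hval] at key
  obtain ⟨-, -, -, k4, k5⟩ := key
  refine ⟨k4, ?_⟩
  rcases k5 with ⟨h, -⟩ | ⟨i, j1, j2, j3, j4, j5, j6⟩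
  · omega
  · refine ⟨i, ?_, j4, j5, j6⟩
    symm
    rw [pick_eq_iff]
    refine ⟨j2, ?_⟩
    rcases j3 with h | h
    · exact Or.inl h.2
    · right
      ext
      simp only [Fin.val_last]
      omega

end sampling
end Boost


namespace Boost

open RExpr (cap)

/-! ### Rounds -/

section gathering

variable {X : Type*} [MeasurableSpace X] {A : TDSAlgorithm X} {ω : Tape X} {E H L : ℕ}

/-- The cells of the tape from number `N` on, as a slot. -/
def slotAt {X : Type*} (n : ℕ) (ω : Tape X) (N : ℕ) : Slot X n := fun l => tapeCell ω (N + l)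

/-- The memory holds, at the address `a`, the sample that the slot `c` provides. -/
def SlotStored {n : ℕ} (s : MState X) (a mode q : ℕ) (t : X → ℕ) (c : Slot X n) : Prop :=
  ∃ i, i = pick (fun k => Accepts mode q t (c k)) ∧ s.pt 1 a = offer mode (c i) ∧
    s.num 1 a = (c i).1.2.toNat ∧ s.num 2 a = i + 1

lemma SlotStored.train {n : ℕ} {s : MState X} {a mode q : ℕ} {t : X → ℕ} {c : Slot X n}
    (h : SlotStored s a mode q t c) (hm : mode = 0) :
    s.pt 1 a = (trainSample q t c).1 ∧ s.num 1 a = (trainSample q t c).2.toNat ∧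
      s.num 2 a = trainPick q t c + 1 := by
  subst hm
  obtain ⟨i, hi, h1, h2, h3⟩ := h
  have : i = trainPick q t c := hi.trans (by simp only [Accepts, if_pos, trainPick])
  subst this
  exact ⟨h1, h2, h3⟩

lemma SlotStored.test {n : ℕ} {s : MState X} {a mode q : ℕ} {t : X → ℕ} {c : Slot X n}
    (h : SlotStored s a mode q t c) (hm : mode ≠ 0) :
    s.pt 1 a = testSample q t c ∧ s.num 2 a = testPick q t c + 1 := by
  obtain ⟨i, hi, h1, h2, h3⟩ := h
  have : i = testPick q t c := hi.trans (by simp only [Accepts, if_neg hm, testPick])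
  subst this
  exact ⟨h1.trans (by rw [offer, if_neg hm]; rfl), h3⟩

lemma gather_numWrites (ρ : RExpr) : (gather ρ).numWrites = [23, 18, 13, 24, 16, 17, 10, 11, 25,
    26, 5, 26, 6, 11, 6, 10, 12, 15, 14, 13, 13, 1, 2] := rfl
lemma gather_scratch (ρ : RExpr) : (gather ρ).Scratch := by
  simp only [gather, Cmd.Scratch, sample_scratch, and_self]

/-- The program that stores a sample which has just been drawn at the address `e`. -/
lemma store_spec {e : RExpr} {s : MState X} {a : ℕ} (hs0 : s.num 0 = paramRow A E H L)
    (he : ∀ M : ℕ → ℕ → ℕ, (∀ a, a ∉ [1, 2] → M a = s.num a) → e.val M = a)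
    (h15 : s.num 15 0 ≤ 1) (h14 : s.num 14 0 ≤ (tun A E H).last + 1) :
    let r := (((Cmd.copy 1 e 0 0).seq (.assign 1 e (cap 1 (reg 15)))).seq
      (.assign 2 e (cap (eLast + 1) (reg 14)))).run A ω s
    (∀ b, b ∉ [1, 2] → r.num b = s.num b) ∧ (∀ b, b ≠ 1 → r.pt b = s.pt b) ∧
    (∀ l, l ≠ a → r.num 1 l = s.num 1 l ∧ r.num 2 l = s.num 2 l ∧ r.pt 1 l = s.pt 1 l) ∧
    r.pt 1 a = s.pt 0 0 ∧ r.num 1 a = s.num 15 0 ∧ r.num 2 a = s.num 14 0 := by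
  intro r
  have r' : r = (Cmd.assign 2 e (cap (eLast + 1) (reg 14))).run A ω
      ((Cmd.assign 1 e (cap 1 (reg 15))).run A ω ((Cmd.copy 1 e 0 0).run A ω s)) := rfl
  clear_value r
  set s1 := (Cmd.copy 1 e 0 0).run A ω s with hs1
  have n1 : s1.num = s.num := by rw [hs1, run_copy_num]
  have p1 : ∀ b k, s1.pt b k = if b = 1 ∧ k = a then s.pt 0 0 else s.pt b k := fun b k => by
    rw [hs1, run_copy_pt, he _ fun _ _ => rfl]; rfl
  clear_value s1
  set s2 := (Cmd.assign 1 e (cap 1 (reg 15))).run A ω s1 with hs2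
  have n2 : ∀ b k, s2.num b k = if b = 1 ∧ k = a then s.num 15 0 else s.num b k := fun b k => by
    rw [hs2, run_assign_num, n1, he _ fun _ _ => rfl, RExpr.val_cap, val_reg, RExpr.val_ofNat,
      min_eq_right h15]
  have p2 : s2.pt = s1.pt := by rw [hs2, run_assign_pt]
  clear_value s2
  have f2 : ∀ b, b ≠ 1 → s2.num b = s.num b := fun b hb => by
    funext k; rw [n2, if_neg (by tauto)]
  have n3 : ∀ b k, r.num b k = if b = 2 ∧ k = a then s.num 14 0 else s2.num b k := fun b k => by
    rw [r', run_assign_num, he s2.num fun b hb => f2 b (by simp at hb; omega), RExpr.val_cap,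
      val_reg, f2 14 (by simp), RExpr.val_add,
      val_eLast (E := E) (H := H) (L := L) (by rw [f2 0 (by simp), hs0]), RExpr.val_ofNat,
      min_eq_right h14]
  have p3 : r.pt = s1.pt := by rw [r', run_assign_pt, p2]
  refine ⟨fun b hb => ?_, fun b hb => ?_, fun l hl => ⟨?_, ?_, ?_⟩, ?_, ?_, ?_⟩
  · funext k
    simp only [List.mem_cons, List.not_mem_nil, or_false, not_or] at hb
    rw [n3, if_neg (by tauto), n2, if_neg (by tauto)]
  · funext k; rw [p3, p1, if_neg (by tauto)]
  · rw [n3, if_neg (by tauto), n2, if_neg (by tauto)]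
  · rw [n3, if_neg (by tauto), n2, if_neg (by tauto)]
  · rw [p3, p1, if_neg (by tauto)]
  · rw [p3, p1, if_pos ⟨rfl, rfl⟩]
  · rw [n3, if_neg (by simp), n2, if_pos ⟨rfl, rfl⟩]
  · rw [n3, if_pos ⟨rfl, rfl⟩]

/-- The sampling mode of slot `k` in a round with position `j`: the reference point, the `a` training
examples and the first `j` test points have mode `0`. -/
def slotMode (a j k : ℕ) : ℕ := min 1 (k + 1 - (1 + a + j))

/-- The result of `gather`, slot by slot.  The data of the earlier rounds, on which the weights
depend, are preserved. -/
lemma gather_slots {ρ : RExpr} {s : MState X} {p j N : ℕ} (hs0 : s.num 0 = paramRow A E H L)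
    (hN : s.Clock N) (hj : s.num 3 p = j)
    (hρ : ∀ M : ℕ → ℕ → ℕ, (∀ a, a ∉ [23, 18, 13, 24, 16, 17, 10, 11, 25,
      26, 5, 6, 12, 15, 14, 1, 2] → M a = s.num a) → ρ.val M = p)
    {b : ℕ → Round X A.nTrain A.nTest (tun A E H).last}
    (hb : ∀ t < s.num 9 0, Holds A (tun A E H) s (s.num 20 0 * (rnds A E + 1) + t)
      (scoreAt A (tun A E H) b t) (b t))
    (hcur : s.num 9 0 ≤ rnds A E) (hp : s.num 20 0 * (rnds A E + 1) + s.num 9 0 ≤ p) :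
    ((gather ρ).run A ω s).Clock (N + (A.nTrain + A.nTest + 2) * ((tun A E H).last + 1)) ∧
    (∀ l < p * (A.nTrain + A.nTest + 2), ((gather ρ).run A ω s).num 1 l = s.num 1 l ∧
      ((gather ρ).run A ω s).num 2 l = s.num 2 l ∧ ((gather ρ).run A ω s).pt 1 l = s.pt 1 l) ∧
    ∀ k < A.nTrain + A.nTest + 2,
      SlotStored ((gather ρ).run A ω s) (p * (A.nTrain + A.nTest + 2) + k) (slotMode A.nTrain j k)
        (tun A E H).res
        (units (tun A E H).res (scoreAt A (tun A E H) b (s.num 9 0)))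
        (slotAt (tun A E H).last ω (N + k * ((tun A E H).last + 1))) := by
  set body := ((((Cmd.assign 18 0 (cap 1 (reg 23 + 1 - (1 + eTr + .cell 3 ρ)))).seq sample).seq
      (.copy 1 (ρ * eSlots + reg 23) 0 0)).seq
      (.assign 1 (ρ * eSlots + reg 23) (cap 1 (reg 15)))).seq
      (.assign 2 (ρ * eSlots + reg 23) (cap (eLast + 1) (reg 14))) with hbody
  have key := Cmd.run_loop (A := A) (ω := ω) 23 eSlots body s
    (fun k r => (∀ a, a ∉ [23, 18, 13, 24, 16, 17, 10, 11, 25, 26, 5, 6, 12, 15, 14, 1, 2] →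
        r.num a = s.num a) ∧ (∀ i, i ≠ 0 → r.seed i = s.seed i) ∧
      r.Clock (N + k * ((tun A E H).last + 1)) ∧
      (∀ l < p * (A.nTrain + A.nTest + 2), r.num 1 l = s.num 1 l ∧ r.num 2 l = s.num 2 l ∧
        r.pt 1 l = s.pt 1 l) ∧
      ∀ k' < k, SlotStored r (p * (A.nTrain + A.nTest + 2) + k') (slotMode A.nTrain j k')
        (tun A E H).res (units (tun A E H).res (scoreAt A (tun A E H) b (s.num 9 0)))
        (slotAt (tun A E H).last ω (N + k' * ((tun A E H).last + 1))))
    ⟨fun _ _ => rfl, fun _ _ => rfl, by simpa using hN.charge _, fun _ _ => ⟨rfl, rfl, rfl⟩,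
      fun k hk => absurd hk (Nat.not_lt_zero _)⟩
    (fun k hk r ⟨i1, i2, i3, i4, i5⟩ => by
      rw [val_eSlots hs0] at hk
      set r1 := (r.setNum 23 0 k).charge (1 + k.size) with hr1
      have n1 : ∀ a, a ≠ 23 → r1.num a = r.num a := fun a ha => Cmd.setNum_num_of_ne ha
      have n1k : r1.num 23 0 = k := by simp [hr1]
      have p1 : r1.pt = r.pt := rfl
      have u1 : r1.seed = r.seed := rfl
      have c1 : r1.Clock (N + k * ((tun A E H).last + 1)) := (i3.setNum _ _ _).charge _
      clear_value r1
      have m1 : ∀ a, a ∉ [23, 18, 13, 24, 16, 17, 10, 11, 25, 26, 5, 6, 12, 15, 14, 1, 2] →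
        r1.num a = s.num a := fun a ha => by rw [n1 a (by simp at ha; omega), i1 a ha]
      have h10 : r1.num 0 = paramRow A E H L := (m1 0 (by simp)).trans hs0
      have hrun : body.run A ω r1 =
        (((Cmd.copy 1 (ρ * eSlots + reg 23) 0 0).seq
          (.assign 1 (ρ * eSlots + reg 23) (cap 1 (reg 15)))).seq
          (.assign 2 (ρ * eSlots + reg 23) (cap (eLast + 1) (reg 14)))).run A ω
        (sample.run A ω ((Cmd.assign 18 0 (cap 1 (reg 23 + 1 - (1 + eTr + .cell 3 ρ)))).run A ω r1)) :=
        rfl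
      set r2 := (Cmd.assign 18 0 (cap 1 (reg 23 + 1 - (1 + eTr + .cell 3 ρ)))).run A ω r1 with hr2
      have n2 : ∀ a, a ≠ 18 → r2.num a = r1.num a := fun a ha => by
        rw [hr2]; exact Cmd.run_num_of_notMem _ (by simpa [Cmd.numWrites] using ha) _
      have n2m : r2.num 18 0 = slotMode A.nTrain j k := by
        rw [hr2, run_assign_num, if_pos ⟨rfl, rfl⟩]
        simp only [RExpr.val_cap, RExpr.val_sub, RExpr.val_add, RExpr.val_cell, val_reg,
          RExpr.val_ofNat, val_eTr h10, n1k, hρ _ m1]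
        rw [m1 3 (by simp), hj, slotMode]
      have p2 : r2.pt = r.pt := by rw [hr2, run_assign_pt, p1]
      have u2 : r2.seed = r.seed := by rw [hr2, run_assign_seed, u1]
      have c2 : r2.Clock (N + k * ((tun A E H).last + 1)) := by
        rw [hr2]; exact (Cmd.run_deterministic (c := .assign _ _ _) trivial _).1 _ c1
      clear_value r2
      have m2 : ∀ a, a ∉ [23, 18, 13, 24, 16, 17, 10, 11, 25, 26, 5, 6, 12, 15, 14, 1, 2] →
        r2.num a = s.num a := fun a ha => by rw [n2 a (by simp at ha; omega), m1 a ha]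
      have m9 := m2 9 (by simp)
      obtain ⟨d1, i, d2, d3, d4, d5⟩ := sample_spec (ω := ω) (s := r2) (b := b)
        (c := slotAt (tun A E H).last ω (N + k * ((tun A E H).last + 1)))
        ((m2 0 (by simp)).trans hs0) c2
        (by
          rw [m9, m2 20 (by simp)]
          intro t ht
          refine (hb t ht).congr_of_lt (fun l hl => ?_) ?_ ?_
          · have hl' : l < p * (A.nTrain + A.nTest + 2) :=
              lt_of_lt_of_le hl (Nat.mul_le_mul_right _ (by omega))
            rw [n2 1 (by simp), n1 1 (by simp), n2 2 (by simp), n1 2 (by simp), p2]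
            exact i4 l hl'
          · rw [m2 3 (by simp)]
          · rw [u2, i2 _ (by omega)])
        (by rw [m9]; exact hcur) (fun _ => rfl)
      rw [n2m, m9] at d2
      rw [n2m] at d3
      set r3 := sample.run A ω r2 with hr3
      have n3 : ∀ a, a ∉ [13, 24, 16, 17, 10, 11, 25, 26, 5, 6, 12, 15, 14] →
          r3.num a = r2.num a := fun a ha => by
        rw [hr3, Cmd.run_num_of_notMem _ (by rw [sample_numWrites]; simp at ha ⊢; omega)]
      have p3 : r3.pt 1 = r2.pt 1 := by
        rw [hr3, Cmd.run_pt_of_notMem _ (by rw [sample_ptWrites]; simp)]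
      have u3 : ∀ i, i ≠ 0 → r3.seed i = r2.seed i := fun i hi => by
        rw [hr3]; exact (Cmd.run_scratch _ sample_scratch r2 hi).2
      clear_value r3
      have m3 : ∀ a, a ∉ [23, 18, 13, 24, 16, 17, 10, 11, 25, 26, 5, 6, 12, 15, 14, 1, 2] →
        r3.num a = s.num a := fun a ha => by rw [n3 a (by simp at ha ⊢; omega), m2 a ha]
      have n33 : ∀ a, a = 1 ∨ a = 2 → r3.num a = r.num a := fun a ha => by
        rw [n3 a (by rcases ha with rfl | rfl <;> simp), n2 a (by omega), n1 a (by omega)]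
      obtain ⟨g1, g2, g3, g4, g5, g6⟩ := store_spec (A := A) (ω := ω) (s := r3)
        (e := ρ * eSlots + reg 23) (a := p * (A.nTrain + A.nTest + 2) + k)
        ((m3 0 (by simp)).trans hs0)
        (fun M hM => by
          rw [RExpr.val_add, RExpr.val_mul, val_reg, hM 23 (by simp), n3 23 (by simp),
            n2 23 (by simp), n1k,
            val_eSlots (by rw [hM 0 (by simp), m3 0 (by simp), hs0]),
            hρ M fun a ha => by rw [hM a (by simp at ha ⊢; omega), m3 a ha]])
        (by rw [d4]; exact Bool.toNat_le _) (by rw [d5]; omega)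
      rw [hrun]
      set f := (((Cmd.copy 1 (ρ * eSlots + reg 23) 0 0).seq
          (.assign 1 (ρ * eSlots + reg 23) (cap 1 (reg 15)))).seq
          (.assign 2 (ρ * eSlots + reg 23) (cap (eLast + 1) (reg 14)))).run A ω r3 with hf
      have cf : f.Clock (N + k * ((tun A E H).last + 1) + ((tun A E H).last + 1)) := by
        rw [hf]; exact (Cmd.run_deterministic (by simp [Cmd.Deterministic]) r3).1 _ d1
      have uf : f.seed = r3.seed := by
        rw [hf]; exact (Cmd.run_deterministic (by simp [Cmd.Deterministic]) r3).2
      clear_value f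
      have old : ∀ l, l ≠ p * (A.nTrain + A.nTest + 2) + k → f.num 1 l = r.num 1 l ∧
          f.num 2 l = r.num 2 l ∧ f.pt 1 l = r.pt 1 l := fun l hl => by
        obtain ⟨o1, o2, o3⟩ := g3 l hl
        rw [o1, o2, o3, n33 1 (by simp), n33 2 (by simp), p3, p2]
        exact ⟨rfl, rfl, rfl⟩
      refine ⟨fun a ha => ?_, fun a ha => ?_, ?_, fun l hl => ?_, fun k' hk' => ?_⟩
      · rw [g1 a (by simp at ha ⊢; omega), m3 a ha]
      · rw [uf, u3 a ha, u2, i2 a ha]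
      · rw [add_mul, one_mul, ← add_assoc]; exact cf
      · obtain ⟨o1, o2, o3⟩ := old l (by omega)
        rw [o1, o2, o3]; exact i4 l hl
      · rcases Nat.lt_succ_iff_lt_or_eq.1 hk' with h | rfl
        · obtain ⟨o1, o2, o3⟩ := old (p * (A.nTrain + A.nTest + 2) + k') (by omega)
          obtain ⟨i', j1, j2, j3, j4⟩ := i5 k' h
          exact ⟨i', j1, by rw [o3, j2], by rw [o1, j3], by rw [o2, j4]⟩
        · exact ⟨i, d2, by rw [g4, d3], by rw [g5, d4], by rw [g6, d5]⟩)
  rw [val_eSlots hs0] at key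
  exact ⟨key.2.2.1, key.2.2.2.1, key.2.2.2.2⟩

/-- The cells of the tape from number `N` on, as the cells of a round. -/
def roundAt {X : Type*} (a b n : ℕ) (ω : Tape X) (N : ℕ) : Round X a b n :=
  (tapeCell ω N, slotAt n ω (N + 1), fun k => slotAt n ω (N + 1 + (1 + k) * (n + 1)),
    fun k => slotAt n ω (N + 1 + (1 + a + k) * (n + 1)),
    slotAt n ω (N + 1 + (1 + a + b) * (n + 1)))

/-- Everything that belongs to the rounds before round `q` is the same in `s` and in `r`. -/
structure Keeps (A : TDSAlgorithm X) (q : ℕ) (s r : MState X) : Prop where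
  samples : ∀ l < q * (A.nTrain + A.nTest + 2),
    r.num 1 l = s.num 1 l ∧ r.num 2 l = s.num 2 l ∧ r.pt 1 l = s.pt 1 l
  pos : ∀ l < q, r.num 3 l = s.num 3 l
  seed : ∀ l, l ≠ 0 → l ≤ q → r.seed l = s.seed l

lemma Keeps.trans {q q' : ℕ} {s r v : MState X} (h : Keeps A q s r) (h' : Keeps A q' r v)
    (hq : q ≤ q') : Keeps A q s v where
  samples l hl := by
    obtain ⟨a1, a2, a3⟩ := h.samples l hl
    obtain ⟨b1, b2, b3⟩ := h'.samples l (lt_of_lt_of_le hl (Nat.mul_le_mul_right _ hq))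
    exact ⟨b1.trans a1, b2.trans a2, b3.trans a3⟩
  pos l hl := (h'.pos l (by omega)).trans (h.pos l hl)
  seed l hl hl' := (h'.seed l hl (by omega)).trans (h.seed l hl hl')

lemma Keeps.holds {q p : ℕ} {s r : MState X} (h : Keeps A q s r) (hp : p < q) {P : Tuning}
    {V : X → ℤ} {c : Round X A.nTrain A.nTest P.last} (hs : Holds A P s p V c) :
    Holds A P r p V c :=
  hs.congr_of_lt (fun l hl => h.samples l (lt_of_lt_of_le hl (Nat.mul_le_mul_right _ (by omega))))
    (h.pos p hp) (h.seed _ (by omega) (by omega))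

/-- The result of `gather` in terms of the data of a round. -/
lemma gather_spec {ρ : RExpr} {s : MState X} {p j N : ℕ} (hs0 : s.num 0 = paramRow A E H L)
    (hN : s.Clock (N + 1)) (hj : s.num 3 p = j) (hjb : j ≤ A.nTest)
    (hρ : ∀ M : ℕ → ℕ → ℕ, (∀ a, a ∉ [23, 18, 13, 24, 16, 17, 10, 11, 25,
      26, 5, 6, 12, 15, 14, 1, 2] → M a = s.num a) → ρ.val M = p)
    {b : ℕ → Round X A.nTrain A.nTest (tun A E H).last}
    (hb : ∀ t < s.num 9 0, Holds A (tun A E H) s (s.num 20 0 * (rnds A E + 1) + t)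
      (scoreAt A (tun A E H) b t) (b t))
    (hcur : s.num 9 0 ≤ rnds A E) (hp : s.num 20 0 * (rnds A E + 1) + s.num 9 0 ≤ p)
    {c : Round X A.nTrain A.nTest (tun A E H).last} {V : X → ℤ}
    (hc : c = roundAt A.nTrain A.nTest (tun A E H).last ω N)
    (hV : V = scoreAt A (tun A E H) b (s.num 9 0)) :
    ((gather ρ).run A ω s).Clock
        (N + (1 + (A.nTrain + A.nTest + 2) * ((tun A E H).last + 1))) ∧
      Keeps A p s ((gather ρ).run A ω s) ∧
      Stored A ((gather ρ).run A ω s) p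
        (fun k => trainSample (tun A E H).res (units (tun A E H).res V) (c.2.2.1 k))
        (hybridSample (tun A E H).res (units (tun A E H).res V) j c.2.2.2.1) j (s.seed (p + 1))
        (trainSample (tun A E H).res (units (tun A E H).res V) c.2.1).1
        (trainPick (tun A E H).res (units (tun A E H).res V) c.2.1 + 1)
        (testPick (tun A E H).res (units (tun A E H).res V) c.2.2.2.2 + 1) := by
  obtain ⟨h1, h2, h3⟩ := gather_slots (ω := ω) hs0 hN hj hρ hb hcur hp
  rw [← hV] at h3
  set r := (gather ρ).run A ω s with hr
  have n3 : r.num 3 = s.num 3 := by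
    rw [hr, Cmd.run_num_of_notMem _ (by rw [gather_numWrites]; simp)]
  have u : ∀ i, i ≠ 0 → r.seed i = s.seed i := fun i hi => by
    rw [hr, (Cmd.run_scratch _ (gather_scratch ρ) s hi).2]
  clear_value r
  subst hc
  refine ⟨by rw [← add_assoc]; exact h1, ⟨h2, fun l _ => by rw [n3], fun l hl _ => u l hl⟩, ?_⟩
  constructor
  · exact u _ (by omega)
  · rw [n3, hj]
  · have := ((h3 0 (by omega)).train (by simp only [slotMode]; omega)).1
    simp only [zero_mul, add_zero] at this
    exact this
  · have := ((h3 0 (by omega)).train (by simp only [slotMode]; omega)).2.2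
    simp only [zero_mul, add_zero] at this
    exact this
  · intro k
    have := (h3 (1 + k) (by have := k.2; omega)).train (by simp only [slotMode]; omega)
    rw [add_assoc]
    exact ⟨this.1, this.2.1⟩
  · intro k
    have hk := h3 (1 + A.nTrain + k) (by have := k.2; omega)
    rw [hybridSample, add_assoc, add_assoc, ← add_assoc 1]
    split_ifs with hkj
    · exact (hk.train (by simp only [slotMode]; omega)).1
    · exact (hk.test (by simp only [slotMode]; omega)).1
  · have := (h3 (1 + A.nTrain + A.nTest) (by omega)).test (by simp only [slotMode]; omega)
    have e : p * (A.nTrain + A.nTest + 2) + A.nTrain + A.nTest + 1 =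
      p * (A.nTrain + A.nTest + 2) + (1 + A.nTrain + A.nTest) := by omega
    rw [e]
    exact this.2

/-- The number of cells that a round reads; it does not depend on the ratio of the tuning. -/
def roundLen (A : TDSAlgorithm X) (E : ℕ) : ℕ :=
  1 + (A.nTrain + A.nTest + 2) * ((tun A E 0).last + 1)

lemma round_numWrites : round.numWrites = [9, 16, 17, 3, 23, 18, 13, 24, 16, 17, 10, 11, 25,
    26, 5, 26, 6, 11, 6, 10, 12, 15, 14, 13, 13, 1, 2] := rfl

/-- A round reads the next cells of the tape and stores the data of the round. -/
lemma round_spec {s : MState X} {t i N : ℕ} (hs0 : s.num 0 = paramRow A E H L)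
    (h22 : s.num 22 0 = t) (h20 : s.num 20 0 = i) (ht : t < rnds A E) (hN : s.Clock N)
    {b : ℕ → Round X A.nTrain A.nTest (tun A E H).last}
    (hb : ∀ t' < t, Holds A (tun A E H) s (i * (rnds A E + 1) + t')
      (scoreAt A (tun A E H) b t') (b t'))
    (hbt : b t = roundAt A.nTrain A.nTest (tun A E H).last ω N) :
    (round.run A ω s).Clock (N + roundLen A E) ∧
      Keeps A (i * (rnds A E + 1) + t) s (round.run A ω s) ∧
      Holds A (tun A E H) (round.run A ω s) (i * (rnds A E + 1) + t)
        (scoreAt A (tun A E H) b t) (b t) ∧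
      ∀ k, k ≠ 0 → (round.run A ω s).hyp k = s.hyp k := by
  set p := i * (rnds A E + 1) + t with hp
  have hrun : round.run A ω s = (gather (eBase + reg 22)).run A ω
    ((Cmd.assign 3 (eBase + reg 22) (cap eTe (reg 17))).run A ω
      ((tick (eTe + 1) (eBase + reg 22 + 1)).run A ω
        ((Cmd.assign 9 0 (cap eRounds (reg 22))).run A ω s))) := rfl
  rw [hrun]
  set s1 := (Cmd.assign 9 0 (cap eRounds (reg 22))).run A ω s with hs1
  have n1 : ∀ a, a ≠ 9 → s1.num a = s.num a := fun a ha => by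
    rw [hs1]; exact Cmd.run_num_of_notMem _ (by simpa [Cmd.numWrites] using ha) _
  have n19 : s1.num 9 0 = t := by
    rw [hs1, run_assign_num, if_pos ⟨rfl, rfl⟩, RExpr.val_cap, val_eRounds hs0, val_reg, h22]
    exact min_eq_right ht.le
  have p1 : s1.pt = s.pt := by rw [hs1, run_assign_pt]
  have u1 : s1.seed = s.seed := by rw [hs1, run_assign_seed]
  have y1 : s1.hyp = s.hyp := by rw [hs1, run_assign_hyp]
  have c1 : s1.Clock N := by
    rw [hs1]; exact (Cmd.run_deterministic (c := .assign _ _ _) trivial _).1 _ hN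
  clear_value s1
  have addr : ∀ M : ℕ → ℕ → ℕ, M 0 = paramRow A E H L → M 20 = s.num 20 → M 22 = s.num 22 →
      (eBase + reg 22).val M = p := fun M h0 h1 h2 => by
    rw [RExpr.val_add, val_eBase h0, val_reg, h1, h2, h22, h20]
  have h10 : s1.num 0 = paramRow A E H L := (n1 0 (by simp)).trans hs0
  obtain ⟨c2, -, -, -, v2, y2, w2, u2⟩ := tick_spec (A := A) (ω := ω) (e := eTe + 1)
    (i := eBase + reg 22 + 1) (v := A.nTest + 1) (k := p + 1) c1
    (fun M hM => by rw [RExpr.val_add, val_eTe ((hM 0 (by simp)).trans h10)]; rfl)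
    (fun M hM => by
      rw [RExpr.val_add, addr M ((hM 0 (by simp)).trans h10)
        ((hM 20 (by simp)).trans (n1 20 (by simp))) ((hM 22 (by simp)).trans (n1 22 (by simp)))]
      rfl)
  set s2 := (tick (eTe + 1) (eBase + reg 22 + 1)).run A ω s1 with hs2
  have n2 : ∀ a, a ∉ [16, 17] → s2.num a = s1.num a := fun a ha => by
    rw [hs2]; exact Cmd.run_num_of_notMem _ (by rw [tick_numWrites]; exact ha) _
  have p2 : s2.pt 1 = s1.pt 1 := by
    rw [hs2]; exact Cmd.run_pt_of_notMem _ (by rw [tick_ptWrites]; simp) _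
  clear_value s2
  have h20' : s2.num 0 = paramRow A E H L := (n2 0 (by simp)).trans h10
  have hpv : (eBase + reg 22).val s2.num = p := addr _ h20' (by rw [n2 20 (by simp), n1 20 (by simp)])
    (by rw [n2 22 (by simp), n1 22 (by simp)])
  set s3 := (Cmd.assign 3 (eBase + reg 22) (cap eTe (reg 17))).run A ω s2 with hs3
  have n3 : ∀ a, a ≠ 3 → s3.num a = s2.num a := fun a ha => by
    rw [hs3]; exact Cmd.run_num_of_notMem _ (by simpa [Cmd.numWrites] using ha) _
  have hjle : coinVal (tapeCell ω N).2.2.1 (A.nTest + 1) ≤ A.nTest :=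
    Nat.lt_succ_iff.1 (Nat.mod_lt _ (Nat.succ_pos _))
  have j3 : ∀ l, s3.num 3 l = if l = p then coinVal (tapeCell ω N).2.2.1 (A.nTest + 1)
      else s2.num 3 l := fun l => by
    rw [hs3, run_assign_num, hpv, RExpr.val_cap, val_eTe h20', val_reg, v2, min_eq_right hjle]
    simp
  have p3 : s3.pt = s2.pt := by rw [hs3, run_assign_pt]
  have u3 : s3.seed = s2.seed := by rw [hs3, run_assign_seed]
  have y3 : s3.hyp = s2.hyp := by rw [hs3, run_assign_hyp]
  have c3 : s3.Clock (N + 1) := by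
    rw [hs3]; exact (Cmd.run_deterministic (c := .assign _ _ _) trivial _).1 _ c2
  clear_value s3
  have m3 : ∀ a, a ∉ [9, 16, 17, 3] → s3.num a = s.num a := fun a ha => by
    rw [n3 a (by simp at ha; omega), n2 a (by simp at ha ⊢; omega), n1 a (by simp at ha; omega)]
  have h30 : s3.num 0 = paramRow A E H L := (m3 0 (by simp)).trans hs0
  have k3 : Keeps A p s s3 :=
    ⟨fun l _ => by
      rw [m3 1 (by simp), m3 2 (by simp), p3, p2, p1]; exact ⟨rfl, rfl, rfl⟩,
    fun l hl => by
      rw [j3, if_neg hl.ne, n2 3 (by simp), n1 3 (by simp)],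
    fun l hl hl' => by rw [u3, u2 l (by omega), u1]⟩
  have e9 : s3.num 9 0 = t := by rw [n3 9 (by simp), n2 9 (by simp), n19]
  have e20 : s3.num 20 0 = i := by rw [m3 20 (by simp), h20]
  obtain ⟨g1, g2, g3⟩ := gather_spec (ω := ω) (s := s3) (ρ := eBase + reg 22) (b := b)
    (V := scoreAt A (tun A E H) b t) h30 c3
    (by rw [j3, if_pos rfl]) hjle
    (fun M hM => addr M ((hM 0 (by simp)).trans h30) ((hM 20 (by simp)).trans (m3 20 (by simp)))
      ((hM 22 (by simp)).trans (m3 22 (by simp))))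
    (by rw [e9, e20]; exact fun t' ht' => k3.holds (by omega) (hb t' ht'))
    (by rw [e9]; exact ht.le) (by rw [e9, e20]) hbt (by rw [e9])
  refine ⟨g1, k3.trans g2 le_rfl, ?_, fun k hk => ?_⟩
  · have hcell : (b t).1 = tapeCell ω N := by rw [hbt]; rfl
    unfold Holds
    rw [hcell]
    rw [u3, w2] at g3
    exact g3
  · rw [(Cmd.run_scratch _ (gather_scratch _) s3 hk).1, y3, y2, y1]

lemma final_numWrites : final.numWrites = [16, 17, 4, 9, 3, 23, 18, 13, 24, 16, 17, 10, 11, 25,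
    26, 5, 26, 6, 11, 6, 10, 12, 15, 14, 13, 13, 1, 2, 26, 5, 26, 6] := rfl

/-- The final round of repetition `i` stores a random time, and the hypothesis that the algorithm
returns on samples from the distributions at this time. -/
lemma final_spec {s : MState X} {i N : ℕ} (hs0 : s.num 0 = paramRow A E H L)
    (h20 : s.num 20 0 = i) (hT : 0 < rnds A E) (hN : s.Clock N)
    (hh : s.hyp (i + 1) = fun _ => true)
    {b : ℕ → Round X A.nTrain A.nTest (tun A E H).last}
    (hb : ∀ t < rnds A E, Holds A (tun A E H) s (i * (rnds A E + 1) + t)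
      (scoreAt A (tun A E H) b t) (b t))
    {c : Round X A.nTrain A.nTest (tun A E H).last}
    (hc : c = roundAt A.nTrain A.nTest (tun A E H).last ω N) :
    (final.run A ω s).Clock (N + roundLen A E) ∧
      Keeps A (i * (rnds A E + 1) + rnds A E) s (final.run A ω s) ∧
      (∀ l, (final.run A ω s).num 4 l =
        if l = i then coinVal c.1.2.2.1 (rnds A E) else s.num 4 l) ∧
      (final.run A ω s).hyp (i + 1) = finalHyp A (tun A E H).res
        (scoreAt A (tun A E H) b (coinVal c.1.2.2.1 (rnds A E)))
        ((c.1.2.2.1, c.2.2.1, c.2.2.2.1, c.1.2.2.2) : Probe X A.nTrain A.nTest (tun A E H).last) ∧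
      ∀ k, k ≠ 0 → k ≠ i + 1 → (final.run A ω s).hyp k = s.hyp k := by
  set p := i * (rnds A E + 1) + rnds A E with hp
  set τ := coinVal (tapeCell ω N).2.2.1 (rnds A E) with hτ
  have hτT : τ < rnds A E := Nat.mod_lt _ hT
  have hcell : c.1 = tapeCell ω N := by rw [hc]; rfl
  have hrun : final.run A ω s = (Cmd.callTDS 2 5 3 (eBase + eRounds + 1) (reg 20 + 1) 6).run A ω
    ((load (eBase + eRounds)).run A ω ((gather (eBase + eRounds)).run A ω
    ((Cmd.assign 3 (eBase + eRounds) 0).run A ω ((Cmd.assign 9 0 (cap eRounds (reg 17))).run A ω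
      ((Cmd.assign 4 (reg 20) (cap eRounds (reg 17))).run A ω
      ((tick eRounds (eBase + eRounds + 1)).run A ω s)))))) := rfl
  rw [hrun]
  have addr : ∀ M : ℕ → ℕ → ℕ, M 0 = paramRow A E H L → M 20 = s.num 20 →
      (eBase + eRounds).val M = p := fun M h0 h1 => by
    rw [RExpr.val_add, val_eBase h0, val_eRounds h0, h1, h20]
  obtain ⟨c1, -, -, -, v1, y1, w1, u1⟩ := tick_spec (A := A) (ω := ω) (e := eRounds)
    (i := eBase + eRounds + 1) (v := rnds A E) (k := p + 1) hN
    (fun M hM => val_eRounds ((hM 0 (by simp)).trans hs0))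
    (fun M hM => by
      rw [RExpr.val_add, addr M ((hM 0 (by simp)).trans hs0) (hM 20 (by simp))]
      rfl)
  set s1 := (tick eRounds (eBase + eRounds + 1)).run A ω s with hs1
  have n1 : ∀ a, a ∉ [16, 17] → s1.num a = s.num a := fun a ha => by
    rw [hs1]; exact Cmd.run_num_of_notMem _ (by rw [tick_numWrites]; exact ha) _
  have p1 : s1.pt 1 = s.pt 1 := by
    rw [hs1]; exact Cmd.run_pt_of_notMem _ (by rw [tick_ptWrites]; simp) _
  clear_value s1
  have h10 : s1.num 0 = paramRow A E H L := (n1 0 (by simp)).trans hs0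
  have e17 : (cap eRounds (reg 17)).val s1.num = τ := by
    rw [RExpr.val_cap, val_eRounds h10, val_reg, v1]
    exact min_eq_right hτT.le
  set s2 := (Cmd.assign 4 (reg 20) (cap eRounds (reg 17))).run A ω s1 with hs2
  have n2 : ∀ a, a ≠ 4 → s2.num a = s1.num a := fun a ha => by
    rw [hs2]; exact Cmd.run_num_of_notMem _ (by simpa [Cmd.numWrites] using ha) _
  have t2 : ∀ l, s2.num 4 l = if l = i then τ else s.num 4 l := fun l => by
    rw [hs2, run_assign_num, e17, val_reg, n1 20 (by simp), h20, n1 4 (by simp)]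
    simp
  have p2 : s2.pt = s1.pt := by rw [hs2, run_assign_pt]
  have u2 : s2.seed = s1.seed := by rw [hs2, run_assign_seed]
  have y2 : s2.hyp = s1.hyp := by rw [hs2, run_assign_hyp]
  have c2 : s2.Clock (N + 1) := by
    rw [hs2]; exact (Cmd.run_deterministic (c := .assign _ _ _) trivial _).1 _ c1
  clear_value s2
  have h20' : s2.num 0 = paramRow A E H L := (n2 0 (by simp)).trans h10
  set s3 := (Cmd.assign 9 0 (cap eRounds (reg 17))).run A ω s2 with hs3
  have n3 : ∀ a, a ≠ 9 → s3.num a = s2.num a := fun a ha => by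
    rw [hs3]; exact Cmd.run_num_of_notMem _ (by simpa [Cmd.numWrites] using ha) _
  have t3 : s3.num 9 0 = τ := by
    rw [hs3, run_assign_num, if_pos ⟨rfl, rfl⟩, RExpr.val_cap, val_eRounds h20', val_reg,
      n2 17 (by simp), v1]
    exact min_eq_right hτT.le
  have p3 : s3.pt = s2.pt := by rw [hs3, run_assign_pt]
  have u3 : s3.seed = s2.seed := by rw [hs3, run_assign_seed]
  have y3 : s3.hyp = s2.hyp := by rw [hs3, run_assign_hyp]
  have c3 : s3.Clock (N + 1) := by
    rw [hs3]; exact (Cmd.run_deterministic (c := .assign _ _ _) trivial _).1 _ c2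
  clear_value s3
  have m3 : ∀ a, a ∉ [16, 17, 4, 9] → s3.num a = s.num a := fun a ha => by
    rw [n3 a (by simp at ha; omega), n2 a (by simp at ha ⊢; omega), n1 a (by simp at ha ⊢; omega)]
  have hpv : (eBase + eRounds).val s3.num = p :=
    addr _ ((m3 0 (by simp)).trans hs0) (m3 20 (by simp))
  set s4 := (Cmd.assign 3 (eBase + eRounds) 0).run A ω s3 with hs4
  have n4 : ∀ a, a ≠ 3 → s4.num a = s3.num a := fun a ha => by
    rw [hs4]; exact Cmd.run_num_of_notMem _ (by simpa [Cmd.numWrites] using ha) _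
  have j4 : ∀ l, s4.num 3 l = if l = p then 0 else s3.num 3 l := fun l => by
    rw [hs4, run_assign_num, hpv]
    simp
  have p4 : s4.pt = s3.pt := by rw [hs4, run_assign_pt]
  have u4 : s4.seed = s3.seed := by rw [hs4, run_assign_seed]
  have y4 : s4.hyp = s3.hyp := by rw [hs4, run_assign_hyp]
  have c4 : s4.Clock (N + 1) := by
    rw [hs4]; exact (Cmd.run_deterministic (c := .assign _ _ _) trivial _).1 _ c3
  clear_value s4
  have m4 : ∀ a, a ∉ [16, 17, 4, 9, 3] → s4.num a = s.num a := fun a ha => by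
    rw [n4 a (by simp at ha; omega), m3 a (by simp at ha ⊢; omega)]
  have h40 : s4.num 0 = paramRow A E H L := (m4 0 (by simp)).trans hs0
  have k4 : Keeps A p s s4 :=
    ⟨fun l _ => by
      rw [m4 1 (by simp), m4 2 (by simp), p4, p3, p2, p1]; exact ⟨rfl, rfl, rfl⟩,
    fun l hl => by
      rw [j4, if_neg hl.ne, m3 3 (by simp)],
    fun l hl hl' => by rw [u4, u3, u2, u1 l (by omega)]⟩
  have e9 : s4.num 9 0 = τ := by rw [n4 9 (by simp), t3]
  have e20 : s4.num 20 0 = i := by rw [m4 20 (by simp), h20]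
  obtain ⟨g1, g2, g3⟩ := gather_spec (ω := ω) (s := s4) (ρ := eBase + eRounds) (b := b)
    (V := scoreAt A (tun A E H) b τ) h40 c4
    (by rw [j4, if_pos rfl]) (Nat.zero_le _)
    (fun M hM => addr M ((hM 0 (by simp)).trans h40) ((hM 20 (by simp)).trans (m4 20 (by simp))))
    (by rw [e9, e20]; exact fun t' ht' => k4.holds (by omega) (hb t' (by omega)))
    (by rw [e9]; exact hτT.le) (by rw [e9, e20]; omega) hc (by rw [e9])
  set s5 := (gather (eBase + eRounds)).run A ω s4 with hs5
  have n5 : ∀ a, a ∉ [23, 18, 13, 24, 16, 17, 10, 11, 25, 26, 5, 6, 12, 15, 14, 1, 2] →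
      s5.num a = s4.num a := fun a ha => by
    rw [hs5, Cmd.run_num_of_notMem _ (by rw [gather_numWrites]; simp at ha ⊢; omega)]
  have y5 : ∀ k, k ≠ 0 → s5.hyp k = s4.hyp k := fun k hk => by
    rw [hs5, (Cmd.run_scratch _ (gather_scratch _) s4 hk).1]
  clear_value s5
  have h50 : s5.num 0 = paramRow A E H L := (n5 0 (by simp)).trans h40
  have e520 : s5.num 20 = s.num 20 := by rw [n5 20 (by simp), m4 20 (by simp)]
  have l6 := load_spec (ω := ω) (ρ := eBase + eRounds) h50 g3 fun M hM =>
    addr M ((hM 0 (by simp)).trans h50) ((hM 20 (by simp)).trans e520)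
  set s6 := (load (eBase + eRounds)).run A ω s5 with hs6
  have n6 : ∀ a, a ∉ [26, 5] → s6.num a = s5.num a := fun a ha => by
    rw [hs6]; exact Cmd.run_num_of_notMem _ (by rw [load_numWrites]; simp at ha ⊢; omega) _
  have p6 : s6.pt 1 = s5.pt 1 := by
    rw [hs6]; exact Cmd.run_pt_of_notMem _ (by rw [load_ptWrites]; simp) _
  have u6 : s6.seed = s5.seed := by
    rw [hs6]; exact (Cmd.run_deterministic (load_deterministic _) s5).2
  have c6 : s6.Clock (N + roundLen A E) := by
    rw [hs6]; exact (Cmd.run_deterministic (load_deterministic _) s5).1 _ g1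
  have y6 : ∀ k, k ≠ 0 → s6.hyp k = s5.hyp k := fun k hk => by
    rw [hs6, (Cmd.run_scratch _ (by simp [load, Cmd.Scratch]) s5 hk).1]
  clear_value s6
  have h60 : s6.num 0 = paramRow A E H L := (n6 0 (by simp)).trans h50
  have k6 : Keeps A p s5 s6 :=
    ⟨fun l _ => by
      rw [n6 1 (by simp), n6 2 (by simp), p6]; exact ⟨rfl, rfl, rfl⟩,
    fun l _ => by rw [n6 3 (by simp)], fun l _ _ => by rw [u6]⟩
  have e620 : s6.num 20 = s.num 20 := by rw [n6 20 (by simp), e520]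
  have hi : (reg 20 + 1).val s6.num = i + 1 := by
    rw [RExpr.val_add, val_reg, e620, h20]; rfl
  have hsd : (eBase + eRounds + 1).val s6.num = p + 1 := by
    rw [RExpr.val_add, addr _ h60 e620]; rfl
  have hypk : ∀ k, k ≠ 0 → s6.hyp k = s.hyp k := fun k hk => by
    rw [y6 k hk, y5 k hk, y4, y3, y2, y1]
  have n7 : ∀ a, a ≠ 6 → ((Cmd.callTDS 2 5 3 (eBase + eRounds + 1) (reg 20 + 1) 6).run A ω
      s6).num a = s6.num a := fun a ha =>
    Cmd.run_num_of_notMem _ (by simpa [Cmd.numWrites] using ha) _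
  have d7 := Cmd.run_deterministic (A := A) (ω := ω)
    (c := Cmd.callTDS 2 5 3 (eBase + eRounds + 1) (reg 20 + 1) 6) trivial s6
  refine ⟨d7.1 _ c6, (k4.trans (g2.trans k6 le_rfl) le_rfl).trans (q' := p) ?_ le_rfl,
    fun l => ?_, ?_, fun k hk hk' => ?_⟩
  · refine ⟨fun l _ => ?_, fun l _ => ?_, fun l _ _ => ?_⟩
    · rw [n7 1 (by simp), n7 2 (by simp), run_callTDS_pt]; exact ⟨rfl, rfl, rfl⟩
    · rw [n7 3 (by simp)]
    · rw [d7.2]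
  · rw [n7 4 (by simp), n6 4 (by simp), n5 4 (by simp), n4 4 (by simp), n3 4 (by simp), t2, hcell]
  · have hcall := run_callTDS_hyp (A := A) (ω := ω) (s := s6) 2 5 3 (eBase + eRounds + 1)
      (reg 20 + 1) 6
    rw [hi, hsd, hypk _ (by omega), hh, u6] at hcall
    have hu : s5.seed (p + 1) = c.1.2.2.2 := by
      rw [g3.seed, u4, u3, u2, w1, hcell]
    rw [hcall, finalHyp, hu]
    have h1 : (fun k : Fin A.nTrain => (s6.pt 2 k, decide (s6.num 5 k ≠ 0))) =
        fun k => trainSample (tun A E H).res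
          (units (tun A E H).res (scoreAt A (tun A E H) b τ)) (c.2.2.1 k) := by
      funext k
      rw [(l6.train k).1, (l6.train k).2]
      ext
      · rfl
      · cases (trainSample (tun A E H).res
          (units (tun A E H).res (scoreAt A (tun A E H) b τ)) (c.2.2.1 k)).2 <;> simp
    rw [h1, funext l6.test, hcell]
  · rw [run_callTDS_hyp_ne _ _ _ _ _ _ (by rw [hi]; exact hk'), hypk k hk]

end gathering
end Boost


/-! ### The learned pair -/

namespace Boost

open RExpr (cap)

section learning

variable {X : Type*} [MeasurableSpace X] {A : TDSAlgorithm X} {ω : Tape X} {E H L : ℕ}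

/-- The number of cells that a repetition reads. -/
def repLen (A : TDSAlgorithm X) (E : ℕ) : ℕ := (rnds A E + 1) * roundLen A E

/-- The cells of the `i`-th repetition: those of its boosting rounds and those of its final round. -/
def repAt (A : TDSAlgorithm X) (E H : ℕ) (ω : Tape X) (i : ℕ) :
    (Fin (rnds A E) → Round X A.nTrain A.nTest (tun A E H).last) ×
      Round X A.nTrain A.nTest (tun A E H).last :=
  (fun t => roundAt _ _ _ ω (i * repLen A E + t * roundLen A E),
    roundAt _ _ _ ω (i * repLen A E + rnds A E * roundLen A E))

/-- The score of the `i`-th repetition at its random time. -/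
def repScore (A : TDSAlgorithm X) (E H : ℕ) [NeZero (rnds A E)] (ω : Tape X) (i : ℕ) : X → ℤ :=
  scoreAt A (tun A E H) (cyclic (repAt A E H ω i).1)
    (coinVal (repAt A E H ω i).2.1.2.2.1 (rnds A E))

/-- The hypothesis of the `i`-th repetition. -/
def repHyp (A : TDSAlgorithm X) (E H : ℕ) [NeZero (rnds A E)] (ω : Tape X) (i : ℕ) : X → Bool :=
  finalHyp A (tun A E H).res (repScore A E H ω i)
    (((repAt A E H ω i).2.1.2.2.1, (repAt A E H ω i).2.2.2.1, (repAt A E H ω i).2.2.2.2.1,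
      (repAt A E H ω i).2.1.2.2.2) : Probe X A.nTrain A.nTest (tun A E H).last)

/-- The selector of the `i`-th repetition. -/
def repSel (A : TDSAlgorithm X) (E H : ℕ) [NeZero (rnds A E)] (ω : Tape X) (i : ℕ) (x : X) : Bool :=
  decide (2 * units (tun A E H).res (repScore A E H ω i) x < (tun A E H).res)

variable [NeZero (rnds A E)]

/-- The memory holds the outcome of the `i`-th repetition. -/
structure RepStored (A : TDSAlgorithm X) (E H : ℕ) [NeZero (rnds A E)] (ω : Tape X) (s : MState X)
    (i : ℕ) : Prop where
  rounds : ∀ t < rnds A E, Holds A (tun A E H) s (i * (rnds A E + 1) + t)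
    (scoreAt A (tun A E H) (cyclic (repAt A E H ω i).1) t) (cyclic (repAt A E H ω i).1 t)
  time : s.num 4 i = coinVal (repAt A E H ω i).2.1.2.2.1 (rnds A E)
  hyp : s.hyp (i + 1) = repHyp A E H ω i

lemma RepStored.congr {s r : MState X} {i q : ℕ} (h : RepStored A E H ω s i) (hk : Keeps A q s r)
    (hq : (i + 1) * (rnds A E + 1) ≤ q) (h4 : r.num 4 i = s.num 4 i)
    (hh : r.hyp (i + 1) = s.hyp (i + 1)) : RepStored A E H ω r i where
  rounds t ht := hk.holds (by rw [add_mul] at hq; omega) (h.rounds t ht)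
  time := h4.trans h.time
  hyp := hh.trans h.hyp

/-- A repetition stores its outcome and preserves the outcomes of the earlier ones. -/
lemma rep_spec {s : MState X} {i : ℕ} (hs0 : s.num 0 = paramRow A E H L)
    (h20 : s.num 20 0 = i) (hN : s.Clock (i * repLen A E)) (hh : s.hyp (i + 1) = fun _ => true) :
    let r := ((Cmd.loop 22 eRounds round).seq final).run A ω s
    r.num 0 = paramRow A E H L ∧ r.Clock ((i + 1) * repLen A E) ∧
      Keeps A (i * (rnds A E + 1)) s r ∧ RepStored A E H ω r i ∧
      (∀ l, l ≠ i → r.num 4 l = s.num 4 l) ∧ ∀ k, k ≠ 0 → k ≠ i + 1 → r.hyp k = s.hyp k := by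
  intro r
  set ξ := repAt A E H ω i with hξ
  have key := Cmd.run_loop (A := A) (ω := ω) 22 eRounds round s
    (fun t r => (r.num 0 = paramRow A E H L ∧ r.num 20 0 = i ∧ r.num 4 = s.num 4) ∧
      r.Clock (i * repLen A E + t * roundLen A E) ∧ Keeps A (i * (rnds A E + 1)) s r ∧
      (∀ t' < t, Holds A (tun A E H) r (i * (rnds A E + 1) + t')
        (scoreAt A (tun A E H) (cyclic ξ.1) t') (cyclic ξ.1 t')) ∧
      ∀ k, k ≠ 0 → r.hyp k = s.hyp k)
    ⟨⟨hs0, h20, rfl⟩, by simpa using hN.charge _,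
      ⟨fun _ _ => ⟨rfl, rfl, rfl⟩, fun _ _ => rfl, fun _ _ _ => rfl⟩,
      fun k hk => absurd hk (Nat.not_lt_zero _), fun _ _ => rfl⟩
    (fun t ht v ⟨⟨i0, i1, i2⟩, i3, i4, i5, i6⟩ => by
      rw [val_eRounds hs0] at ht
      set v1 := (v.setNum 22 0 t).charge (1 + t.size) with hv1
      have n1 : ∀ a, a ≠ 22 → v1.num a = v.num a := fun a ha => Cmd.setNum_num_of_ne ha
      have n1k : v1.num 22 0 = t := by simp [hv1]
      have p1 : v1.pt = v.pt := rfl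
      have u1 : v1.seed = v.seed := rfl
      have y1 : v1.hyp = v.hyp := rfl
      have c1 : v1.Clock (i * repLen A E + t * roundLen A E) := (i3.setNum _ _ _).charge _
      clear_value v1
      have k1 : ∀ q, Keeps A q v v1 := fun q => ⟨fun l _ => by
        rw [n1 1 (by simp), n1 2 (by simp), p1]; exact ⟨rfl, rfl, rfl⟩,
        fun l _ => by rw [n1 3 (by simp)], fun l _ _ => by rw [u1]⟩
      obtain ⟨g1, g2, g3, g4⟩ := round_spec (ω := ω) (s := v1) (b := cyclic ξ.1)
        (by rw [n1 0 (by simp), i0]) n1k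
        (by rw [n1 20 (by simp), i1]) ht c1
        (fun t' ht' => (k1 (i * (rnds A E + 1) + t)).holds (by omega) (i5 t' ht'))
        (by
          simp only [cyclic, hξ, repAt, Fin.ofNat, Nat.mod_eq_of_lt ht])
      have m : ∀ a, a ∉ [9, 16, 17, 3, 23, 18, 13, 24, 10, 11, 25, 26, 5, 6, 12, 15, 14, 1, 2, 22] →
          (round.run A ω v1).num a = v.num a := fun a ha => by
        rw [Cmd.run_num_of_notMem _ (by rw [round_numWrites]; simp at ha ⊢; omega),
          n1 a (by simp at ha; omega)]
      refine ⟨⟨?_, ?_, ?_⟩, ?_, ?_, fun t' ht' => ?_, fun k hk => ?_⟩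
      · rw [m 0 (by simp), i0]
      · rw [m 20 (by simp), i1]
      · rw [m 4 (by simp), i2]
      · rw [add_mul, one_mul, ← add_assoc]; exact g1
      · exact (i4.trans (k1 _) le_rfl).trans g2 (by omega)
      · rcases Nat.lt_succ_iff_lt_or_eq.1 ht' with h | rfl
        · exact ((k1 (i * (rnds A E + 1) + t)).trans g2 le_rfl).holds (by omega) (i5 t' h)
        · exact g3
      · rw [g4 k hk, y1, i6 k hk])
  rw [val_eRounds hs0] at key
  have hr : r = final.run A ω ((Cmd.loop 22 eRounds round).run A ω s) := rfl
  clear_value r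
  set v := (Cmd.loop 22 eRounds round).run A ω s with hv
  clear_value v
  obtain ⟨⟨i0, i1, i2⟩, i3, i4, i5, i6⟩ := key
  obtain ⟨f1, f2, f3, f4, f5⟩ := final_spec (ω := ω) (s := v) (b := cyclic ξ.1) (c := ξ.2) i0 i1
    (Nat.pos_of_ne_zero (NeZero.ne _)) i3 (by rw [i6 _ (by omega), hh]) i5 rfl
  rw [← hr] at f1 f2 f3 f4 f5
  refine ⟨?_, ?_, i4.trans f2 (by omega), ⟨fun t ht => f2.holds (by omega) (i5 t ht), ?_, ?_⟩,
    fun l hl => ?_, fun k hk hk' => ?_⟩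
  · rw [hr, Cmd.run_num_of_notMem _ (by rw [final_numWrites]; simp), i0]
  · rw [add_mul, one_mul]
    nth_rewrite 2 [repLen]
    rw [add_mul, one_mul, ← add_assoc]
    exact f1
  · rw [f3, if_pos rfl]
  · rw [f4]; rfl
  · rw [f3, if_neg hl, i2]
  · rw [f5 k hk hk', i6 k hk]

/-- The learning program stores the outcomes of all repetitions. -/
lemma learner_spec {s : MState X} (hs0 : s.num 0 = paramRow A E H L) (hN : s.Clock 0)
    (hh : ∀ k, s.hyp k = fun _ => true) :
    (learner.run A ω s).num 0 = paramRow A E H L ∧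
      ∀ i < 12 * L, RepStored A E H ω (learner.run A ω s) i := by
  have key := Cmd.run_loop (A := A) (ω := ω) 20 eReps ((Cmd.loop 22 eRounds round).seq final) s
    (fun k r => r.num 0 = paramRow A E H L ∧ r.Clock (k * repLen A E) ∧
      (∀ j, k < j → r.hyp j = fun _ => true) ∧ ∀ i < k, RepStored A E H ω r i)
    ⟨hs0, by simpa using hN.charge _, fun j _ => hh j, fun i hi => absurd hi (Nat.not_lt_zero _)⟩
    (fun k hk r ⟨i1, i2, i3, i4⟩ => by
      set v := (r.setNum 20 0 k).charge (1 + k.size) with hv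
      have n : ∀ a, a ≠ 20 → v.num a = r.num a := fun a ha => Cmd.setNum_num_of_ne ha
      have nk : v.num 20 0 = k := by simp [hv]
      have p : v.pt = r.pt := rfl
      have u : v.seed = r.seed := rfl
      have y : v.hyp = r.hyp := rfl
      have c : v.Clock (k * repLen A E) := (i2.setNum _ _ _).charge _
      clear_value v
      have kv : ∀ q, Keeps A q r v := fun q => ⟨fun l _ => by
        rw [n 1 (by simp), n 2 (by simp), p]; exact ⟨rfl, rfl, rfl⟩,
        fun l _ => by rw [n 3 (by simp)], fun l _ _ => by rw [u]⟩
      obtain ⟨g1, g2, g3, g4, g5, g6⟩ := rep_spec (ω := ω) (s := v) (H := H) (L := L)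
        ((n 0 (by simp)).trans i1) nk c (by rw [y, i3 _ (by omega)])
      refine ⟨g1, g2, fun j hj => ?_, fun i hi => ?_⟩
      · rw [g6 j (by omega) (by omega), y, i3 j (by omega)]
      · rcases Nat.lt_succ_iff_lt_or_eq.1 hi with h | rfl
        · refine (i4 i h).congr ((kv (k * (rnds A E + 1))).trans g3 le_rfl)
            (Nat.mul_le_mul_right _ h) ?_ ?_
          · rw [g5 i (by omega), n 4 (by simp)]
          · rw [g6 (i + 1) (by omega) (by omega), y]
        · exact g4)
  rw [val_eReps hs0] at key
  exact ⟨key.1, key.2.2.2⟩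

lemma votes_numWrites : votes.numWrites =
    [19, 21, 20, 9, 10, 11, 25, 26, 5, 26, 6, 11, 6, 10, 12, 7, 19, 21] := rfl

/-- The two counts of votes. -/
lemma votes_spec {s : MState X} (hs0 : s.num 0 = paramRow A E H L)
    (hs : ∀ i < 12 * L, RepStored A E H ω s i) :
    (votes.run A ω s).num 19 0 =
        ∑ i ∈ Finset.range (12 * L), (repSel A E H ω i (s.pt 0 0)).toNat ∧
      (votes.run A ω s).num 21 0 = ∑ i ∈ Finset.range (12 * L),
        (repSel A E H ω i (s.pt 0 0) && repHyp A E H ω i (s.pt 0 0)).toNat := by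
  set x := s.pt 0 0 with hx
  set s0 := ((Cmd.assign 19 0 0).seq (.assign 21 0 0)).run A ω s with hs0'
  have n0 : ∀ a, a ∉ [19, 21] → s0.num a = s.num a := fun a ha => by
    rw [hs0']; exact Cmd.run_num_of_notMem _ (by simpa [Cmd.numWrites] using ha) _
  have a19 : s0.num 19 0 = 0 := by simp [hs0']
  have a21 : s0.num 21 0 = 0 := by simp [hs0']
  have p0 : s0.pt = s.pt := by rw [hs0', run_seq, run_assign_pt, run_assign_pt]
  have u0 : s0.seed = s.seed := by rw [hs0', run_seq, run_assign_seed, run_assign_seed]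
  have y0 : s0.hyp = s.hyp := by rw [hs0', run_seq, run_assign_hyp, run_assign_hyp]
  set body := ((((Cmd.assign 9 0 (cap eRounds (.cell 4 (reg 20)))).seq eval).seq
      (.applyHyp (reg 20 + 1) 0 0 7 0)).seq
      (.assign 19 0 (cap eReps (reg 19 + cap 1 (eRes - 2 * reg 12))))).seq
      (.assign 21 0 (cap eReps (reg 21 + cap 1 (eRes - 2 * reg 12) * reg 7))) with hbody
  have hrun : votes.run A ω s = (Cmd.loop 20 eReps body).run A ω s0 := rfl
  rw [hrun]
  clear_value s0
  have h00 : s0.num 0 = paramRow A E H L := (n0 0 (by simp)).trans hs0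
  have key := Cmd.run_loop (A := A) (ω := ω) 20 eReps body s0
    (fun k r => (∀ a, a ∉ [19, 21, 20, 9, 10, 11, 25, 26, 5, 6, 12, 7] → r.num a = s.num a) ∧
      (∀ a, a ∉ [2, 3] → r.pt a = s.pt a) ∧ r.seed = s.seed ∧ (∀ i, i ≠ 0 → r.hyp i = s.hyp i) ∧
      r.num 19 0 = ∑ i ∈ Finset.range k, (repSel A E H ω i x).toNat ∧
      r.num 21 0 = ∑ i ∈ Finset.range k, (repSel A E H ω i x && repHyp A E H ω i x).toNat)
    ⟨fun a ha => n0 a (by simp at ha ⊢; omega), fun a _ => by rw [charge_pt, p0],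
      by rw [charge_seed, u0], fun i _ => by rw [charge_hyp, y0], by simpa using a19,
      by simpa using a21⟩
    (fun k hk r ⟨i1, i2, i3, i4, i5, i6⟩ => by
      rw [val_eReps h00] at hk
      set v := (r.setNum 20 0 k).charge (1 + k.size) with hv
      have n : ∀ a, a ≠ 20 → v.num a = r.num a := fun a ha => Cmd.setNum_num_of_ne ha
      have nk : v.num 20 0 = k := by simp [hv]
      have p : v.pt = r.pt := rfl
      have u : v.seed = r.seed := rfl
      have y : v.hyp = r.hyp := rfl
      clear_value v
      have m : ∀ a, a ∉ [19, 21, 20, 9, 10, 11, 25, 26, 5, 6, 12, 7] → v.num a = s.num a :=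
        fun a ha => by rw [n a (by simp at ha; omega), i1 a ha]
      have hv0 : v.num 0 = paramRow A E H L := (m 0 (by simp)).trans hs0
      have hst := hs k hk
      have hτ : s.num 4 k < rnds A E := by
        rw [hst.time]; exact Nat.mod_lt _ (Nat.pos_of_ne_zero (NeZero.ne _))
      have hbr : body.run A ω v =
        (Cmd.assign 21 0 (cap eReps (reg 21 + cap 1 (eRes - 2 * reg 12) * reg 7))).run A ω
        ((Cmd.assign 19 0 (cap eReps (reg 19 + cap 1 (eRes - 2 * reg 12)))).run A ω
        ((Cmd.applyHyp (reg 20 + 1) 0 0 7 0).run A ω (eval.run A ω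
        ((Cmd.assign 9 0 (cap eRounds (.cell 4 (reg 20)))).run A ω v)))) := rfl
      rw [hbr]
      set v1 := (Cmd.assign 9 0 (cap eRounds (.cell 4 (reg 20)))).run A ω v with hv1
      have n1 : ∀ a, a ≠ 9 → v1.num a = v.num a := fun a ha => by
        rw [hv1]; exact Cmd.run_num_of_notMem _ (by simpa [Cmd.numWrites] using ha) _
      have n19 : v1.num 9 0 = s.num 4 k := by
        rw [hv1, run_assign_num, if_pos ⟨rfl, rfl⟩, RExpr.val_cap, val_eRounds hv0, RExpr.val_cell,
          val_reg, nk, m 4 (by simp)]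
        exact min_eq_right hτ.le
      have p1 : v1.pt = v.pt := by rw [hv1, run_assign_pt]
      have u1 : v1.seed = v.seed := by rw [hv1, run_assign_seed]
      have y1 : v1.hyp = v.hyp := by rw [hv1, run_assign_hyp]
      clear_value v1
      have m1 : ∀ a, a ∉ [19, 21, 20, 9, 10, 11, 25, 26, 5, 6, 12, 7] → v1.num a = s.num a :=
        fun a ha => by rw [n1 a (by simp at ha; omega), m a ha]
      have hx1 : v1.pt 0 0 = x := by rw [p1, p, i2 0 (by simp)]
      have hev := eval_spec (ω := ω) (s := v1) (H := H) (L := L)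
        (b := cyclic (repAt A E H ω k).1) ((m1 0 (by simp)).trans hs0)
        (by
          rw [n19, n1 20 (by simp), nk]
          exact fun t ht => (hst.rounds t (by omega)).congr (m1 1 (by simp)) (m1 2 (by simp))
            (m1 3 (by simp)) (by rw [p1, p, i2 1 (by simp)]) (by rw [u1, u, i3]))
        (by rw [n19]; exact hτ.le)
      rw [n19, hst.time, hx1] at hev
      change _ = units (tun A E H).res (repScore A E H ω k) x at hev
      set v2 := eval.run A ω v1 with hv2
      have n2 : ∀ a, a ∉ [10, 11, 25, 26, 5, 6, 12] → v2.num a = v1.num a := fun a ha => by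
        rw [hv2, Cmd.run_num_of_notMem _ (by rw [eval_numWrites]; simp at ha ⊢; omega)]
      have p2 : ∀ a, a ∉ [2, 3] → v2.pt a = v1.pt a := fun a ha => by
        rw [hv2, Cmd.run_pt_of_notMem _ (by rw [eval_ptWrites]; simp at ha ⊢; omega)]
      have u2 : v2.seed = v1.seed := by rw [hv2, (Cmd.run_deterministic eval_deterministic v1).2]
      have y2 : ∀ i, i ≠ 0 → v2.hyp i = v1.hyp i := fun i hi => by
        rw [hv2]; exact (Cmd.run_scratch _ eval_scratch v1 hi).1
      clear_value v2
      set v3 := (Cmd.applyHyp (reg 20 + 1) 0 0 7 0).run A ω v2 with hv3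
      have n3 : ∀ a, a ≠ 7 → v3.num a = v2.num a := fun a ha => by
        rw [hv3]; exact Cmd.run_num_of_notMem _ (by simpa [Cmd.numWrites] using ha) _
      have n37 : v3.num 7 0 = (repHyp A E H ω k x).toNat := by
        have h1 : v3.num 7 0 =
            (v2.hyp ((reg 20 + 1).val v2.num) (v2.pt 0 0)).toNat := by
          rw [hv3]; exact Cmd.setNum_num_self (s := v2) (a := 7) (i := 0)
            (v := (v2.hyp ((reg 20 + 1).val v2.num) (v2.pt 0 0)).toNat)
        have h2 : (reg 20 + 1).val v2.num = k + 1 := by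
          rw [RExpr.val_add, val_reg, n2 20 (by simp), n1 20 (by simp), nk]; rfl
        rw [h1, h2, y2 _ (by omega), y1, y, i4 _ (by omega), hst.hyp, p2 0 (by simp), hx1]
      have p3 : v3.pt = v2.pt := by rw [hv3]; rfl
      have u3 : v3.seed = v2.seed := by rw [hv3]; rfl
      have y3 : v3.hyp = v2.hyp := by rw [hv3]; rfl
      clear_value v3
      have m3 : ∀ a, a ∉ [19, 21, 20, 9, 10, 11, 25, 26, 5, 6, 12, 7] → v3.num a = s.num a :=
        fun a ha => by
          rw [n3 a (by simp at ha; omega), n2 a (by simp at ha ⊢; omega), m1 a ha]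
      have h30 : v3.num 0 = paramRow A E H L := (m3 0 (by simp)).trans hs0
      have a12 : v3.num 12 0 = units (tun A E H).res (repScore A E H ω k) x := by
        rw [n3 12 (by simp), hev]
      have sel : min 1 ((tun A E H).res - 2 * units (tun A E H).res (repScore A E H ω k) x) =
          (repSel A E H ω k x).toNat := by
        rw [repSel]
        by_cases h : 2 * units (tun A E H).res (repScore A E H ω k) x < (tun A E H).res
        · rw [decide_eq_true h, Bool.toNat_true]; omega
        · rw [decide_eq_false h, Bool.toNat_false]; omega
      have b19 : v3.num 19 0 = ∑ i ∈ Finset.range k, (repSel A E H ω i x).toNat := by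
        rw [n3 19 (by simp), n2 19 (by simp), n1 19 (by simp), n 19 (by simp), i5]
      have b21 : v3.num 21 0 =
          ∑ i ∈ Finset.range k, (repSel A E H ω i x && repHyp A E H ω i x).toNat := by
        rw [n3 21 (by simp), n2 21 (by simp), n1 21 (by simp), n 21 (by simp), i6]
      have bound : ∀ f : ℕ → Bool, ∑ i ∈ Finset.range k, (f i).toNat ≤ k := fun f => by
        simpa using Finset.sum_le_sum (s := Finset.range k) fun i _ => Bool.toNat_le (f i)
      set v4 := (Cmd.assign 19 0 (cap eReps (reg 19 + cap 1 (eRes - 2 * reg 12)))).run A ω v3 with hv4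
      have n4 : ∀ a, a ≠ 19 → v4.num a = v3.num a := fun a ha => by
        rw [hv4]; exact Cmd.run_num_of_notMem _ (by simpa [Cmd.numWrites] using ha) _
      have e4 : v4.num 19 0 = ∑ i ∈ Finset.range (k + 1), (repSel A E H ω i x).toNat := by
        rw [hv4, run_assign_num, if_pos ⟨rfl, rfl⟩]
        simp only [RExpr.val_cap, RExpr.val_add, RExpr.val_sub, RExpr.val_mul, val_reg,
          RExpr.val_ofNat, val_eReps h30, val_eRes (H := H) h30, a12, b19]
        rw [sel, ← Finset.sum_range_succ, min_eq_right]
        have h1 := bound fun i => repSel A E H ω i x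
        have h2 := Bool.toNat_le (repSel A E H ω k x)
        rw [Finset.sum_range_succ]
        omega
      have p4 : v4.pt = v3.pt := by rw [hv4, run_assign_pt]
      have u4 : v4.seed = v3.seed := by rw [hv4, run_assign_seed]
      have y4 : v4.hyp = v3.hyp := by rw [hv4, run_assign_hyp]
      clear_value v4
      have h40 : v4.num 0 = paramRow A E H L := (n4 0 (by simp)).trans h30
      refine ⟨fun a ha => ?_, fun a ha => ?_, ?_, fun i hi => ?_, ?_, ?_⟩
      · rw [Cmd.run_num_of_notMem _ (by simp [Cmd.numWrites] at ha ⊢; omega),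
          n4 a (by simp at ha; omega), m3 a ha]
      · rw [run_assign_pt, p4, p3, p2 a ha, p1, p, i2 a ha]
      · rw [run_assign_seed, u4, u3, u2, u1, u, i3]
      · rw [run_assign_hyp, y4, y3, y2 i hi, y1, y, i4 i hi]
      · rw [run_assign_num, if_neg (by simp), e4]
      · rw [run_assign_num, if_pos ⟨rfl, rfl⟩]
        simp only [RExpr.val_cap, RExpr.val_add, RExpr.val_sub, RExpr.val_mul, val_reg,
          RExpr.val_ofNat, val_eReps h40, val_eRes (H := H) h40, n4 12 (by simp), n4 21 (by simp),
          n4 7 (by simp), a12, b21, n37]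
        have hand : (repSel A E H ω k x).toNat * (repHyp A E H ω k x).toNat =
            (repSel A E H ω k x && repHyp A E H ω k x).toNat := by
          cases repSel A E H ω k x <;> simp
        rw [sel, hand, ← Finset.sum_range_succ
          (fun i => (repSel A E H ω i x && repHyp A E H ω i x).toNat), min_eq_right]
        have h1 := bound fun i => repSel A E H ω i x && repHyp A E H ω i x
        have h2 := Bool.toNat_le (repSel A E H ω k x && repHyp A E H ω k x)
        rw [Finset.sum_range_succ]
        omega)
  rw [val_eReps h00] at key
  exact ⟨key.2.2.2.2.1, key.2.2.2.2.2⟩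

/-- The evaluation program computes the majority vote of the stored repetitions. -/
lemma predictor_spec {s : MState X} (hs0 : s.num 0 = paramRow A E H L)
    (hs : ∀ i < 12 * L, RepStored A E H ω s i) :
    decide ((predictor.run A ω s).num 0 0 ≠ 0) =
        voteHyp (fun i : Fin (12 * L) => repHyp A E H ω i) (fun i => repSel A E H ω i) (s.pt 0 0) ∧
      decide ((predictor.run A ω s).num 0 1 ≠ 0) =
        voteSel (fun i : Fin (12 * L) => repSel A E H ω i) (s.pt 0 0) := by
  obtain ⟨h1, h2⟩ := votes_spec (ω := ω) hs0 hs
  have hr : predictor.run A ω s = (Cmd.assign 0 0 (2 * reg 21 - reg 19)).run A ω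
    ((Cmd.assign 0 1 (3 * reg 19 + 1 - 2 * eReps)).run A ω (votes.run A ω s)) := rfl
  rw [hr]
  set x := s.pt 0 0 with hx
  set v := votes.run A ω s with hv
  have hv0 : v.num 0 = paramRow A E H L := by
    rw [hv, Cmd.run_num_of_notMem _ (by rw [votes_numWrites]; simp), hs0]
  clear_value v
  have card : ∀ f : ℕ → Bool, ∑ i ∈ Finset.range (12 * L), (f i).toNat =
      (Finset.univ.filter fun i : Fin (12 * L) => f i = true).card := fun f => by
    rw [← Fin.sum_univ_eq_sum_range (fun i => (f i).toNat), Finset.card_filter]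
    refine Finset.sum_congr rfl fun i _ => ?_
    cases f i <;> rfl
  rw [card fun i => repSel A E H ω i x] at h1
  rw [card fun i => repSel A E H ω i x && repHyp A E H ω i x] at h2
  simp only [Bool.and_eq_true] at h2
  simp only [run_assign_num, RExpr.val_sub, RExpr.val_add, RExpr.val_mul, RExpr.val_ofNat, val_reg,
    val_eReps hv0, voteHyp, voteSel, h1, h2]
  constructor
  · rw [if_pos (by simp), if_neg (by simp), if_neg (by simp), decide_eq_decide]
    exact ⟨fun h => by omega, fun h => by omega⟩
  · rw [if_neg (by simp), if_pos (by simp), decide_eq_decide]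
    exact ⟨fun h => by omega, fun h => by omega⟩

end learning
end Boost


/-! ### The law of the data of the repetitions -/

namespace Boost

section reading

variable {X : Type*} [MeasurableSpace X] {Dtrain Dtest : Measure (X × Bool)}
  [IsProbabilityMeasure Dtrain] [IsProbabilityMeasure Dtest]

omit [MeasurableSpace X] in
lemma slotAt_shiftTape (n : ℕ) (ω : Tape X) (l N : ℕ) :
    slotAt n (shiftTape l ω) N = slotAt n ω (l + N) := by
  funext k
  simp only [slotAt, tapeCell_shiftTape, add_assoc]

omit [MeasurableSpace X] in
lemma roundAt_shiftTape (a b n : ℕ) (ω : Tape X) (l N : ℕ) :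
    roundAt a b n (shiftTape l ω) N = roundAt a b n ω (l + N) := by
  simp only [roundAt, slotAt_shiftTape, tapeCell_shiftTape, add_assoc]

lemma isReader_slotAt (n : ℕ) :
    IsReader (tapeLaw Dtrain Dtest) (fun ω => slotAt n ω 0) (n + 1) (slotLaw Dtrain Dtest n) := by
  have h := (isReader_tapeCell (Dtrain := Dtrain) (Dtest := Dtest)).iterate (n + 1)
  simp only [tapeCell_shiftTape, mul_one, add_zero] at h
  have e : (fun ω : Tape X => slotAt n ω 0) = fun ω (k : Fin (n + 1)) => tapeCell ω k := by
    funext ω k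
    simp only [slotAt, zero_add]
  rw [e]
  exact h

lemma isReader_roundAt (a b n : ℕ) :
    IsReader (tapeLaw Dtrain Dtest) (fun ω => roundAt a b n ω 0) (1 + (a + b + 2) * (n + 1))
      (roundLaw Dtrain Dtest a b n) := by
  have hs := isReader_slotAt (Dtrain := Dtrain) (Dtest := Dtest) n
  have h := isReader_tapeCell.pair (hs.pair ((hs.iterate a).pair ((hs.iterate b).pair hs)))
  have e : (fun ω : Tape X => roundAt a b n ω 0) = fun ω =>
      (tapeCell ω 0, slotAt n (shiftTape 1 ω) 0,
        (fun k : Fin a => slotAt n (shiftTape (k * (n + 1)) (shiftTape (n + 1) (shiftTape 1 ω))) 0),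
        (fun k : Fin b => slotAt n (shiftTape (k * (n + 1)) (shiftTape (a * (n + 1))
          (shiftTape (n + 1) (shiftTape 1 ω)))) 0),
        slotAt n (shiftTape (b * (n + 1)) (shiftTape (a * (n + 1))
          (shiftTape (n + 1) (shiftTape 1 ω)))) 0) := by
    funext ω
    simp only [roundAt, slotAt_shiftTape, add_zero, zero_add]
    congr 3
    · funext k; congr 1; ring
    · congr 1
      · funext k; congr 1; ring
      · congr 1; ring
  have el : 1 + (a + b + 2) * (n + 1) =
      1 + ((n + 1) + (a * (n + 1) + (b * (n + 1) + (n + 1)))) := by ring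
  rw [e, el]
  exact h

/-- The data of the repetitions are independent, and each of them has the law that the analysis of a
single repetition assumes. -/
lemma map_repAt (A : TDSAlgorithm X) (E H R : ℕ) :
    Measurable (fun ω (i : Fin R) => repAt A E H ω i) ∧
      (tapeLaw Dtrain Dtest).map (fun ω (i : Fin R) => repAt A E H ω i) =
        Measure.pi fun _ => repLaw Dtrain Dtest A.nTrain A.nTest (tun A E H).last (rnds A E) := by
  have hr := isReader_roundAt (Dtrain := Dtrain) (Dtest := Dtest) A.nTrain A.nTest (tun A E H).last
  have h := ((hr.iterate (rnds A E)).pair hr).iterate R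
  have e : (fun (ω : Tape X) (i : Fin R) => repAt A E H ω i) = fun ω (i : Fin R) =>
      ((fun t : Fin (rnds A E) => roundAt A.nTrain A.nTest (tun A E H).last
          (shiftTape (t * (1 + (A.nTrain + A.nTest + 2) * ((tun A E H).last + 1)))
            (shiftTape (i * (rnds A E * (1 + (A.nTrain + A.nTest + 2) * ((tun A E H).last + 1)) +
              (1 + (A.nTrain + A.nTest + 2) * ((tun A E H).last + 1)))) ω)) 0),
        roundAt A.nTrain A.nTest (tun A E H).last
          (shiftTape (rnds A E * (1 + (A.nTrain + A.nTest + 2) * ((tun A E H).last + 1)))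
            (shiftTape (i * (rnds A E * (1 + (A.nTrain + A.nTest + 2) * ((tun A E H).last + 1)) +
              (1 + (A.nTrain + A.nTest + 2) * ((tun A E H).last + 1)))) ω)) 0) := by
    have el : ∀ i, i * repLen A E =
        i * (rnds A E * (1 + (A.nTrain + A.nTest + 2) * ((tun A E H).last + 1)) +
              (1 + (A.nTrain + A.nTest + 2) * ((tun A E H).last + 1))) := fun i => by
      simp only [repLen, roundLen, tun, stdTuning]; ring
    funext ω i
    simp only [repAt, roundAt_shiftTape, add_zero, el]
    rfl
  rw [e]
  exact ⟨h.measurable, h.map_eq⟩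

end reading

end Boost


/-! ### The cost of the programs -/

namespace RExpr

lemma pure_add {e f : RExpr} : (e + f).Pure ↔ e.Pure ∧ f.Pure := Iff.rfl
lemma pure_mul {e f : RExpr} : (e * f).Pure ↔ e.Pure ∧ f.Pure := Iff.rfl
lemma pure_ofNat (n : ℕ) : (no_index (OfNat.ofNat n) : RExpr).Pure := trivial
lemma pure_cell {a : ℕ} {i : RExpr} : (RExpr.cell a i).Pure ↔ a = 0 ∧ i.Pure := Iff.rfl
lemma capped_cap {p e : RExpr} : (cap p e).Capped ↔ p.Pure := Iff.rfl
lemma pure_cap {p e : RExpr} : (cap p e).Pure ↔ p.Pure ∧ p.Pure ∧ e.Pure := Iff.rfl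
lemma capped_ofNat (n : ℕ) : (no_index (OfNat.ofNat n) : RExpr).Capped := trivial

end RExpr

namespace Boost

open RExpr (cap)

section cost

lemma eval_tame : eval.Tame := by
  simp [eval, probe, load, ask, Cmd.Tame, RExpr.pure_add, RExpr.pure_mul, RExpr.pure_cell,
    RExpr.capped_cap, RExpr.pure_cap, RExpr.pure_ofNat, RExpr.capped_ofNat, eTr, eTe, eE, eM, eCap,
    eWeight, eRatio, eRes, eRounds, eBound]

lemma gather_tame (ρ : RExpr) : (gather ρ).Tame := by
  simp [gather, sample, tryOnce, tick, Cmd.Tame, RExpr.pure_add, RExpr.pure_mul, RExpr.pure_cell,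
    RExpr.capped_cap, RExpr.pure_ofNat, RExpr.capped_ofNat, eTr, eTe, eE, eM,
    eRes, eLast, eSlots, eval_tame]

lemma learner_tame : learner.Tame := by
  simp [learner, round, final, tick, load, gather_tame, Cmd.Tame, RExpr.pure_add, RExpr.pure_mul,
    RExpr.pure_cell, RExpr.capped_cap, RExpr.pure_ofNat, RExpr.capped_ofNat, eTr, eTe, eE, eM,
    eRes, eRounds, eReps]

lemma votes_tame : votes.Tame := by
  simp [votes, eval_tame, Cmd.Tame, RExpr.pure_add, RExpr.pure_mul,
    RExpr.pure_cell, RExpr.capped_cap, RExpr.pure_ofNat, RExpr.capped_ofNat, eTr, eTe, eE, eM,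
    eRes, eRounds, eReps]

variable {X : Type*} [MeasurableSpace X] {A : TDSAlgorithm X} {ω : Tape X} {E H L : ℕ}

/-- A bound for the number of operations that involve the TDS algorithm.  A repetition has of the order
of `m ^ 2` rounds, a round draws `m` samples with `m` tries each, and each try evaluates a score, which
takes two runs of the algorithm for each earlier round; this makes `m ^ 6`. -/
def callTotal (A : TDSAlgorithm X) (E L : ℕ) : ℕ :=
  2 * 10 ^ 24 * L * E ^ 16 * (A.nTrain + A.nTest + 1) ^ 6

variable {M : ℕ → ℕ → ℕ}

lemma callBound_eval (h : M 0 = paramRow A E H L) : eval.callBound M = rnds A E * 2 := by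
  simp [eval, probe, load, ask, Cmd.callBound, val_eRounds h]

lemma callBound_gather (h : M 0 = paramRow A E H L) (ρ : RExpr) : (gather ρ).callBound M =
    (A.nTrain + A.nTest + 2) * (((tun A E H).last + 1) * (1 + rnds A E * 2)) := by
  simp [gather, sample, tryOnce, tick, Cmd.callBound, callBound_eval h, val_eSlots h, val_eLast h]

lemma callBound_learner_le (h : M 0 = paramRow A E H L) (hE : 0 < E) :
    learner.callBound M ≤ callTotal A E L := by
  have e : learner.callBound M = 12 * L * (rnds A E * (1 + (A.nTrain + A.nTest + 2) *
      (((tun A E H).last + 1) * (1 + rnds A E * 2))) + (1 + (A.nTrain + A.nTest + 2) *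
      (((tun A E H).last + 1) * (1 + rnds A E * 2)) + 1)) := by
    simp [learner, round, final, load, tick, Cmd.callBound, callBound_gather h, val_eRounds h,
      val_eReps h]
  rw [e, callTotal]
  simp only [tun, stdTuning, rnds, stdRounds]
  obtain ⟨m, hm⟩ : ∃ m, m = A.nTrain + A.nTest + 1 := ⟨_, rfl⟩
  rw [show A.nTrain + A.nTest + 2 = m + 1 by omega, ← hm]
  have hm1 : 1 ≤ m := by omega
  have pos : ∀ a b, 1 ≤ E ^ a * m ^ b := fun a b => Nat.mul_pos (Nat.pow_pos hE) (Nat.pow_pos hm1)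
  have hT : 500 * m * (2000000 * E ^ 7 * m) = 10 ^ 9 * (E ^ 7 * m ^ 2) := by ring
  rw [hT]
  have h1 : 1 + 10 ^ 9 * (E ^ 7 * m ^ 2) * 2 ≤ 3 * 10 ^ 9 * (E ^ 7 * m ^ 2) := by
    have := pos 7 2; omega
  have h2 : 20000 * E ^ 2 * m + 1 ≤ 20001 * (E ^ 2 * m ^ 1) := by
    have := pos 2 1; rw [pow_one, mul_assoc] at *; omega
  have h3 : (m + 1) * ((20000 * E ^ 2 * m + 1) * (1 + 10 ^ 9 * (E ^ 7 * m ^ 2) * 2)) ≤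
      13 * 10 ^ 13 * (E ^ 9 * m ^ 4) := by
    calc _ ≤ (2 * m) * (20001 * (E ^ 2 * m ^ 1) * (3 * 10 ^ 9 * (E ^ 7 * m ^ 2))) :=
          Nat.mul_le_mul (by omega) (Nat.mul_le_mul h2 h1)
      _ = 120006000000000 * (E ^ 9 * m ^ 4) := by ring
      _ ≤ _ := Nat.mul_le_mul_right _ (by norm_num)
  generalize (m + 1) * ((20000 * E ^ 2 * m + 1) * (1 + 10 ^ 9 * (E ^ 7 * m ^ 2) * 2)) = g at h3
  have h4 : 10 ^ 9 * (E ^ 7 * m ^ 2) * (1 + g) ≤ 131 * 10 ^ 21 * (E ^ 16 * m ^ 6) := by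
    calc _ ≤ 10 ^ 9 * (E ^ 7 * m ^ 2) * (131 * 10 ^ 12 * (E ^ 9 * m ^ 4)) := by
          refine Nat.mul_le_mul_left _ ?_
          have := pos 9 4; omega
      _ = _ := by ring
  have h5 : E ^ 9 * m ^ 4 ≤ E ^ 16 * m ^ 6 :=
    Nat.mul_le_mul (Nat.pow_le_pow_right hE (by norm_num)) (Nat.pow_le_pow_right hm1 (by norm_num))
  have h6 := pos 9 4
  calc _ ≤ 12 * L * (132 * 10 ^ 21 * (E ^ 16 * m ^ 6)) := by
        refine Nat.mul_le_mul_left _ ?_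
        omega
    _ = 1584 * 10 ^ 21 * (L * (E ^ 16 * m ^ 6)) := by ring
    _ ≤ 2 * 10 ^ 24 * (L * (E ^ 16 * m ^ 6)) := Nat.mul_le_mul_right _ (by norm_num)
    _ = _ := by ring

lemma callBound_votes_le (h : M 0 = paramRow A E H L) (hE : 0 < E) :
    votes.callBound M ≤ callTotal A E L := by
  have e : votes.callBound M = 12 * L * (rnds A E * 2 + 1) := by
    simp [votes, Cmd.callBound, callBound_eval h, val_eReps h]
  rw [e, callTotal]
  simp only [rnds, stdRounds]
  generalize hm : A.nTrain + A.nTest + 1 = m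
  have hm1 : 1 ≤ m := by omega
  have h1 : 1 ≤ E ^ 16 * m ^ 6 := Nat.mul_pos (Nat.pow_pos hE) (Nat.pow_pos hm1)
  have h2 : 500 * m * (2000000 * E ^ 7 * m) ≤ 10 ^ 9 * (E ^ 16 * m ^ 6) := by
    calc _ = 10 ^ 9 * (E ^ 7 * m ^ 2) := by ring
      _ ≤ _ := Nat.mul_le_mul_left _ (Nat.mul_le_mul (Nat.pow_le_pow_right hE (by norm_num))
        (Nat.pow_le_pow_right hm1 (by norm_num)))
  calc _ ≤ 12 * L * (3 * 10 ^ 9 * (E ^ 16 * m ^ 6)) := by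
        refine Nat.mul_le_mul_left _ ?_
        omega
    _ = 36 * 10 ^ 9 * (L * (E ^ 16 * m ^ 6)) := by ring
    _ ≤ 2 * 10 ^ 24 * (L * (E ^ 16 * m ^ 6)) := Nat.mul_le_mul_right _ (by norm_num)
    _ = _ := by ring

/-- The exponent of the bound for the memory contents; it is an absolute constant. -/
def memDeg : ℕ := learner.deg + votes.deg

/-- The exponent of the bounds for the numbers of steps; it is an absolute constant. -/
def stepDeg : ℕ := memDeg * (learner.deg + votes.deg + (3 * reg 19 + 1 - 2 * eReps).deg +
  (2 * reg 21 - reg 19).deg + 20)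

/-- The cost of the learning program. -/
lemma learner_cost {s : MState X} (hs0 : s.num 0 = paramRow A E H L) (hs : ∀ a, a ≠ 0 → s.num a = 0)
    (hE : 0 < E) {p : ℕ} (hp : A.nTrain + A.nTest + E + H + L + 2 ≤ p) :
    (∀ a i, (learner.run A ω s).num a i ≤ p ^ memDeg) ∧
    (learner.run A ω s).steps ≤ s.steps + p ^ stepDeg ∧
    (learner.run A ω s).trainDrawn + (learner.run A ω s).testDrawn ≤
      s.trainDrawn + s.testDrawn + p ^ stepDeg ∧
    (learner.run A ω s).calls ≤ s.calls + callTotal A E L := by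
  have hrow : ∀ i, s.num 0 i ≤ p := fun i => by
    rw [hs0, paramRow]
    rcases i with _ | _ | _ | _ | _ | i <;> simp <;> omega
  have hdeg : 1 ≤ memDeg := by
    have : 1 ≤ learner.deg := by simp only [learner, Cmd.deg]; omega
    rw [memDeg]; omega
  have hmem : ∀ a i, s.num a i ≤ p ^ memDeg := fun a i => by
    by_cases ha : a = 0
    · rw [ha]; exact (hrow i).trans (Nat.le_self_pow (by omega) p)
    · rw [hs a ha]; exact Nat.zero_le _
  obtain ⟨h1, -, h3, h4, h5⟩ := Cmd.run_cost (A := A) (ω := ω) (p := p) (W := memDeg) (by omega)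
    ⟨by omega, by omega⟩ learner learner_tame (Nat.le_add_right _ _) s hmem hrow
  have hle : (p ^ memDeg) ^ learner.deg ≤ p ^ stepDeg := by
    rw [← pow_mul]
    exact Nat.pow_le_pow_right (by omega) (Nat.mul_le_mul_left _ (by omega))
  exact ⟨h1, by omega, by omega, h5.trans (Nat.add_le_add_left (callBound_learner_le hs0 hE) _)⟩

/-- The cost of the evaluation of the learned pair.  The last two assignments write into the array of
the parameters, so they are counted separately. -/
lemma predictor_cost {s : MState X} (hs0 : s.num 0 = paramRow A E H L)
    (hE : 0 < E) {p : ℕ} (hp : A.nTrain + A.nTest + E + H + L + 2 ≤ p)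
    (hmem : ∀ a i, s.num a i ≤ p ^ memDeg) :
    (predictor.run A ω s).steps ≤ s.steps + p ^ stepDeg ∧
    (predictor.run A ω s).calls ≤ s.calls + callTotal A E L := by
  have hrow : ∀ i, s.num 0 i ≤ p := fun i => by
    rw [hs0, paramRow]
    rcases i with _ | _ | _ | _ | _ | i <;> simp <;> omega
  obtain ⟨h1, -, h3, -, h5⟩ := Cmd.run_cost (A := A) (ω := ω) (p := p) (W := memDeg) (by omega)
    ⟨by omega, by omega⟩ votes votes_tame (Nat.le_add_left _ _) s hmem hrow
  have hr : predictor.run A ω s = (Cmd.assign 0 0 (2 * reg 21 - reg 19)).run A ω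
    ((Cmd.assign 0 1 (3 * reg 19 + 1 - 2 * eReps)).run A ω (votes.run A ω s)) := rfl
  rw [hr]
  set v := votes.run A ω s with hv
  clear_value v
  have hdeg : 1 ≤ memDeg := by
    have : 1 ≤ learner.deg := by simp only [learner, Cmd.deg]; omega
    rw [memDeg]; omega
  have hV : 2 ≤ p ^ memDeg := le_trans (by omega) (Nat.le_self_pow (by omega) p)
  have c1 := (RExpr.val_cost_le hV h1 (3 * reg 19 + 1 - 2 * eReps)).2
  have c2 := (RExpr.val_cost_le hV h1 (2 * reg 21 - reg 19)).2
  set w := (Cmd.assign 0 1 (3 * reg 19 + 1 - 2 * eReps)).run A ω v with hw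
  have s1 : w.steps = v.steps + (1 + (1 : RExpr).cost v.num +
    (3 * reg 19 + 1 - 2 * eReps).cost v.num) := rfl
  have k1 : w.calls = v.calls := rfl
  have n : ∀ a, a ≠ 0 → w.num a = v.num a := fun a ha => by
    rw [hw]; exact Cmd.run_num_of_notMem _ (by simpa [Cmd.numWrites] using ha) _
  clear_value w
  set f := (Cmd.assign 0 0 (2 * reg 21 - reg 19)).run A ω w with hf
  have s2 : f.steps = w.steps + (1 + (0 : RExpr).cost w.num + (2 * reg 21 - reg 19).cost w.num) :=
    rfl
  have k2 : f.calls = w.calls := rfl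
  clear_value f
  have e2 : (2 * reg 21 - reg 19).cost w.num = (2 * reg 21 - reg 19).cost v.num := by
    change 1 + (2 * w.num 21 0 - w.num 19 0).size +
        (1 + (2 * w.num 21 0).size + _ + (1 + (w.num 21 0).size + _)) + (1 + (w.num 19 0).size + _) =
      1 + (2 * v.num 21 0 - v.num 19 0).size +
        (1 + (2 * v.num 21 0).size + _ + (1 + (v.num 21 0).size + _)) + (1 + (v.num 19 0).size + _)
    rw [n 21 (by simp), n 19 (by simp)]
    rfl
  have z0 : (0 : RExpr).cost w.num = 1 := rfl
  have z1 : (1 : RExpr).cost v.num = 2 := rfl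
  rw [z1] at s1
  rw [z0, e2] at s2
  refine ⟨?_, ?_⟩
  · have hsum := add_le_pow hV (add_le_pow hV (le_refl ((p ^ memDeg) ^ votes.deg)) c1)
      (add_le_pow hV c2 (show 5 ≤ (p ^ memDeg) ^ 3 from le_trans (by norm_num)
        (Nat.pow_le_pow_left hV 3)))
    have hle : (p ^ memDeg) ^ (votes.deg + (3 * reg 19 + 1 - 2 * eReps).deg + 1 +
        ((2 * reg 21 - reg 19).deg + 3 + 1) + 1) ≤ p ^ stepDeg := by
      rw [← pow_mul]
      exact Nat.pow_le_pow_right (by omega) (Nat.mul_le_mul_left _ (by omega))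
    have := hsum.trans hle
    omega
  · have := callBound_votes_le (A := A) (M := s.num) hs0 hE
    omega

end cost
end Boost


/-! ### Correctness and cost in terms of the accuracy parameters -/

namespace Boost

section guarantee

variable {X : Type*} [MeasurableSpace X] {A : TDSAlgorithm X}

lemma measurable_repScore (E H : ℕ) [NeZero (rnds A E)] (ω : Tape X) (i : ℕ) :
    Measurable (repScore A E H ω i) := measurable_scoreAt_right _ _

lemma measurable_repHyp (E H : ℕ) [NeZero (rnds A E)] (ω : Tape X) (i : ℕ) :
    Measurable (repHyp A E H ω i) :=
  measurable_finalHyp (Ω := X) (V := fun _ => repScore A E H ω i)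
    ((measurable_repScore E H ω i).comp measurable_snd) measurable_const measurable_id

lemma measurable_repSel (E H : ℕ) [NeZero (rnds A E)] (ω : Tape X) (i : ℕ) :
    Measurable (repSel A E H ω i) := by
  have h : Measurable fun x => units (tun A E H).res (repScore A E H ω i) x :=
    measurable_units_comp (V := fun _ : X => repScore A E H ω i)
      ((measurable_repScore E H ω i).comp measurable_snd) measurable_id
  exact (measurable_of_countable fun k : ℕ => decide (2 * k < (tun A E H).res)).comp h

/-- The vote fails only if more than a quarter of the repetitions fail. -/
lemma tapeLaw_vote_bad_le (Dtrain Dtest : Measure (X × Bool)) [IsProbabilityMeasure Dtrain]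
    [IsProbabilityMeasure Dtest] {C : Set (X → Bool)} (hC : C.Nonempty) {B ε η : ℝ} (hB : 1 ≤ B)
    (hA : IsAgnosticTDSLearner A C B ε (1 / 100)) {E H L : ℕ} [NeZero E] (hL : 0 < L)
    (hε : 0 ≤ ε) (hη : 0 ≤ η) (hEε : 1 / (E : ℝ) ≤ ε) (hH : 1 ≤ H) (hHη : 1 / (H : ℝ) ≤ η) :
    tapeLaw Dtrain Dtest
      {ω | ¬ (Dtest.real {p | p.2 ≠ voteHyp (fun i : Fin (12 * L) => repHyp A E H ω i)
                  (fun i => repSel A E H ω i) p.1 ∧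
                voteSel (fun i : Fin (12 * L) => repSel A E H ω i) p.1 = true} ≤
                12 * (20 * B * H * jointError C Dtrain Dtest + 5 * ε) ∧
              Dtrain.fst.real {x | voteSel (fun i : Fin (12 * L) => repSel A E H ω i) x = false} ≤
                12 * (6 * (η + ε)))} ≤ ENNReal.ofReal (Real.exp (-L)) := by
  set b := 20 * B * H * jointError C Dtrain Dtest + 5 * ε with hb
  have hb0 : 0 ≤ b := by
    have := jointError_nonneg C Dtrain Dtest
    positivity
  have hr0 : 0 ≤ 6 * (η + ε) := by positivity
  set bad := {ξ | ¬ RepGood Dtrain Dtest A (tun A E H) (rnds A E) b (6 * (η + ε)) ξ} with hbad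
  obtain ⟨hm, hmap⟩ := map_repAt (Dtrain := Dtrain) (Dtest := Dtest) A E H (12 * L)
  have hlaw := pi_many_bad_le (repLaw Dtrain Dtest A.nTrain A.nTest (tun A E H).last (rnds A E))
    (bad := bad)
    (repLaw_std_not_repGood_le Dtrain Dtest hC hB hA (m := A.nTrain + A.nTest + 1) (E := E) (H := H)
      (by omega) hEε hH hHη) L
  rw [← hmap] at hlaw
  refine le_trans (measure_mono fun ω hω => ?_)
    ((Measure.le_map_apply (μ := tapeLaw Dtrain Dtest) hm.aemeasurable _).trans hlaw)
  intro S hS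
  by_contra! hcard
  refine hω (vote_good Dtrain Dtest hL (fun i => measurable_repHyp E H ω i)
    (fun i => measurable_repSel E H ω i) hb0 hr0 hcard fun i hi => ?_)
  have hgood : RepGood Dtrain Dtest A (tun A E H) (rnds A E) b (6 * (η + ε)) (repAt A E H ω i) :=
    not_not.1 (hS i hi)
  obtain ⟨h1, h2⟩ := hgood
  refine ⟨le_trans (le_of_eq ?_) h1, le_trans (le_of_eq ?_) h2⟩
  · simp only [repSel, decide_eq_true_eq]
    rfl
  · simp only [repSel, decide_eq_false_iff_not]
    rfl

end guarantee

section parameters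

variable {ε η δ : ℝ}

lemma ceil_one_div_le (hε : ε ∈ Ioo (0 : ℝ) 1) : (⌈1 / ε⌉₊ : ℝ) ≤ 2 * (1 / ε) := by
  have h1 : 1 ≤ 1 / ε := by rw [le_div_iff₀ hε.1]; linarith [hε.2]
  have := Nat.ceil_lt_add_one (zero_le_one.trans h1)
  linarith

lemma one_div_ceil_le (hε : 0 < ε) : 1 / (⌈1 / ε⌉₊ : ℝ) ≤ ε :=
  (one_div_le (by have := Nat.ceil_pos.2 (one_div_pos.2 hε); exact_mod_cast this) hε).2
    (Nat.le_ceil _)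

lemma log_one_div_pos (hδ : δ ∈ Ioo (0 : ℝ) 1) : 0 < Real.log (1 / δ) :=
  Real.log_pos (by rw [lt_div_iff₀ hδ.1]; linarith [hδ.2])

lemma exp_neg_ceil_log_le (hδ : 0 < δ) : Real.exp (-(⌈Real.log (1 / δ)⌉₊ : ℝ)) ≤ δ := by
  have h := Nat.le_ceil (Real.log (1 / δ))
  rw [one_div, Real.log_inv] at h
  calc _ ≤ Real.exp (Real.log δ) := Real.exp_le_exp.2 (by rw [one_div, Real.log_inv]; linarith)
    _ = δ := Real.exp_log hδ

lemma ceil_log_le (hδ : δ ∈ Ioo (0 : ℝ) 1) :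
    (⌈Real.log (1 / δ)⌉₊ : ℝ) ≤ 1 + Real.log (1 / δ) := by
  have := Nat.ceil_lt_add_one (log_one_div_pos hδ).le
  linarith

variable {X : Type*} [MeasurableSpace X] {A : TDSAlgorithm X}

/-- The number of calls is of the form `Õ(m ^ 6)`; it does not depend on `η`.  The constant
`10 ^ 31` is at least `2 ^ 23 * 10 ^ 24`. -/
lemma callTotal_le (hε : ε ∈ Ioo (0 : ℝ) 1) (hδ : δ ∈ Ioo (0 : ℝ) 1) {K : ℕ} (hK : 10 ^ 31 ≤ K) :
    (callTotal A ⌈1 / ε⌉₊ ⌈Real.log (1 / δ)⌉₊ : ℝ) ≤ softSixth K A.sampleSize ε δ := by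
  have hE := ceil_one_div_le hε
  have hL := ceil_log_le hδ
  have hl := log_one_div_pos hδ
  have hm : ((A.nTrain + A.nTest + 1 : ℕ) : ℝ) ≤ 2 * A.sampleSize := by
    have : A.nTrain + A.nTest + 1 ≤ 2 * A.sampleSize := by rw [TDSAlgorithm.sampleSize]; omega
    exact_mod_cast this
  have hs1 : (1 : ℝ) ≤ A.sampleSize := by exact_mod_cast le_max_left 1 _
  have h1 : 1 ≤ 1 / ε := by rw [le_div_iff₀ hε.1]; linarith [hε.2]
  have ha : 1 ≤ 1 / ε * (1 + Real.log (1 / δ)) := one_le_mul_of_one_le_of_one_le h1 (by linarith)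
  have hKr : (10 : ℝ) ^ 31 ≤ K := by exact_mod_cast hK
  set l := Real.log (1 / δ)
  set e := 1 / ε
  set s : ℝ := (A.sampleSize : ℝ)
  have hlog : (1 : ℝ) ≤ (1 + Real.log s) ^ K :=
    one_le_pow₀ (by linarith [Real.log_nonneg hs1])
  calc (callTotal A ⌈e⌉₊ ⌈l⌉₊ : ℝ)
      = 2 * 10 ^ 24 * ⌈l⌉₊ * (⌈e⌉₊ : ℝ) ^ 16 * ((A.nTrain + A.nTest + 1 : ℕ) : ℝ) ^ 6 := by
        rw [callTotal]; push_cast; ring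
    _ ≤ 2 * 10 ^ 24 * (1 + l) * (2 * e) ^ 16 * (2 * s) ^ 6 := by gcongr
    _ = 2 ^ 23 * 10 ^ 24 * (e ^ 16 * (1 + l) ^ 1) * s ^ 6 := by ring
    _ ≤ 2 ^ 23 * 10 ^ 24 * (e ^ 16 * (1 + l) ^ 16) * s ^ 6 := by
        gcongr
        · linarith
        · norm_num
    _ ≤ K * ((e * (1 + l)) ^ K * (1 + Real.log s) ^ K) * s ^ 6 := by
        gcongr ?_ * ?_ * s ^ 6
        · exact le_trans (by norm_num) hKr
        · rw [← mul_pow]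
          calc (e * (1 + l)) ^ 16 ≤ (e * (1 + l)) ^ K :=
                pow_le_pow_right₀ ha (le_trans (by norm_num) hK)
            _ ≤ _ := le_mul_of_one_le_right (by positivity) hlog
    _ = softSixth K A.sampleSize ε δ := by rw [softSixth]; ring

/-- An upper bound for all input parameters, of which the cost of the programs is a power. -/
def paramTotal (A : TDSAlgorithm X) (ε η δ : ℝ) : ℕ :=
  A.nTrain + A.nTest + ⌈1 / ε⌉₊ + ⌈1 / η⌉₊ + ⌈Real.log (1 / δ)⌉₊ + 2

lemma paramTotal_pow_le (hε : ε ∈ Ioo (0 : ℝ) 1) (hη : η ∈ Ioo (0 : ℝ) 1) (hδ : δ ∈ Ioo (0 : ℝ) 1)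
    {K D : ℕ} (hK : 8 ^ D ≤ K) :
    ((paramTotal A ε η δ ^ D : ℕ) : ℝ) ≤ polyBound K A.sampleSize ε η δ := by
  have hE := ceil_one_div_le hε
  have hH := ceil_one_div_le hη
  have hL := ceil_log_le hδ
  have hl := log_one_div_pos hδ
  have hm : ((A.nTrain + A.nTest : ℕ) : ℝ) ≤ A.sampleSize := by exact_mod_cast le_max_right 1 _
  have hs1 : (1 : ℝ) ≤ A.sampleSize := by exact_mod_cast le_max_left 1 _
  have he : 1 ≤ 1 / ε := by rw [le_div_iff₀ hε.1]; linarith [hε.2]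
  have hh : 1 ≤ 1 / η := by rw [le_div_iff₀ hη.1]; linarith [hη.2]
  have hKr : (8 : ℝ) ^ D ≤ K := by exact_mod_cast hK
  have hDK : D ≤ K := (Nat.lt_pow_self (by norm_num)).le.trans hK
  have hp : (paramTotal A ε η δ : ℝ) = ((A.nTrain + A.nTest : ℕ) : ℝ) + ⌈1 / ε⌉₊ + ⌈1 / η⌉₊ +
      ⌈Real.log (1 / δ)⌉₊ + 2 := by rw [paramTotal]; push_cast; ring
  have hl1 : 1 ≤ 1 + Real.log (1 / δ) := by linarith
  rw [polyBound]
  set l := 1 + Real.log (1 / δ)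
  set e := 1 / ε
  set h := 1 / η
  set s : ℝ := (A.sampleSize : ℝ)
  have q1 : 1 ≤ s * e := one_le_mul_of_one_le_of_one_le hs1 he
  have q2 : 1 ≤ s * e * h := one_le_mul_of_one_le_of_one_le q1 hh
  have q3 : 1 ≤ s * e * h * l := one_le_mul_of_one_le_of_one_le q2 hl1
  have b1 : s * e * h ≤ s * e * h * l := le_mul_of_one_le_right (by linarith) hl1
  have b2 : s * e ≤ s * e * h := le_mul_of_one_le_right (by linarith) hh
  have b3 : s ≤ s * e := le_mul_of_one_le_right (by linarith) he
  have b4 : e ≤ s * e := le_mul_of_one_le_left (by linarith) hs1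
  have b5 : h ≤ s * e * h := le_mul_of_one_le_left (by linarith) q1
  have b6 : l ≤ s * e * h * l := le_mul_of_one_le_left (by linarith) q2
  have hp8 : (paramTotal A ε η δ : ℝ) ≤ 8 * (s * e * h * l) := by
    rw [hp]; linarith
  push_cast
  calc (paramTotal A ε η δ : ℝ) ^ D ≤ (8 * (s * e * h * l)) ^ D := by gcongr
    _ = 8 ^ D * (s * e * h * l) ^ D := mul_pow _ _ _
    _ ≤ K * (s * e * h * l) ^ K := by gcongr

end parameters

lemma rnds_ne_zero {X : Type*} [MeasurableSpace X] {A : TDSAlgorithm X} {ε : ℝ}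
    (hε : ε ∈ Ioo (0 : ℝ) 1) : NeZero (rnds A ⌈1 / ε⌉₊) := by
  have : NeZero ⌈1 / ε⌉₊ := ⟨(Nat.ceil_pos.2 (one_div_pos.2 hε.1)).ne'⟩
  infer_instance

section states

variable {X : Type*} [MeasurableSpace X] [Nonempty X] {A : TDSAlgorithm X} {ε η δ : ℝ}
  {ω : Tape X}

lemma startState_num_zero : (startState A ε η δ).num 0 =
    paramRow A ⌈1 / ε⌉₊ ⌈1 / η⌉₊ ⌈Real.log (1 / δ)⌉₊ := by
  funext i
  simp [startState, paramRow]

lemma startState_num_of_ne {a : ℕ} (ha : a ≠ 0) : (startState A ε η δ).num a = 0 := by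
  funext i
  simp [startState, ha]

lemma learnedState_spec [NeZero (rnds A ⌈1 / ε⌉₊)] :
    (learnedState learner A ε η δ ω).num 0 =
        paramRow A ⌈1 / ε⌉₊ ⌈1 / η⌉₊ ⌈Real.log (1 / δ)⌉₊ ∧
      ∀ i < 12 * ⌈Real.log (1 / δ)⌉₊,
        RepStored A ⌈1 / ε⌉₊ ⌈1 / η⌉₊ ω (learnedState learner A ε η δ ω) i :=
  learner_spec startState_num_zero ⟨rfl, rfl, rfl, rfl⟩ fun _ => rfl

/-- The learned pair is the vote of the repetitions. -/
lemma out_eq_vote [NeZero (rnds A ⌈1 / ε⌉₊)] (x : X) :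
    outHyp learner predictor A ε η δ ω x =
        voteHyp (fun i : Fin (12 * ⌈Real.log (1 / δ)⌉₊) => repHyp A ⌈1 / ε⌉₊ ⌈1 / η⌉₊ ω i)
          (fun i => repSel A ⌈1 / ε⌉₊ ⌈1 / η⌉₊ ω i) x ∧
      outSel learner predictor A ε η δ ω x =
        voteSel (fun i : Fin (12 * ⌈Real.log (1 / δ)⌉₊) => repSel A ⌈1 / ε⌉₊ ⌈1 / η⌉₊ ω i) x := by
  obtain ⟨h1, h2⟩ := learnedState_spec (A := A) (ε := ε) (η := η) (δ := δ) (ω := ω)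
  rw [outHyp, outSel, predictedState]
  set s := learnedState learner A ε η δ ω with hs
  clear_value s
  have h := predictor_spec (A := A) (ω := ω)
    (s := { s.setPt 0 0 x with steps := 0, calls := 0 }) h1 fun i hi =>
      (h2 i hi).congr (q := (i + 1) * (rnds A ⌈1 / ε⌉₊ + 1))
        ⟨fun l _ => ⟨rfl, rfl, rfl⟩, fun _ _ => rfl, fun _ _ _ => rfl⟩ le_rfl rfl rfl
  have hx : ({ s.setPt 0 0 x with steps := 0, calls := 0 } : MState X).pt 0 0 = x := by
    simp [MState.setPt]
  rw [hx] at h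
  exact h

lemma learnedState_cost (hε : ε ∈ Ioo (0 : ℝ) 1) :
    (∀ a i, (learnedState learner A ε η δ ω).num a i ≤ paramTotal A ε η δ ^ memDeg) ∧
    (learnedState learner A ε η δ ω).steps ≤ paramTotal A ε η δ ^ stepDeg ∧
    (learnedState learner A ε η δ ω).trainDrawn + (learnedState learner A ε η δ ω).testDrawn ≤
      paramTotal A ε η δ ^ stepDeg ∧
    (learnedState learner A ε η δ ω).calls ≤ callTotal A ⌈1 / ε⌉₊ ⌈Real.log (1 / δ)⌉₊ := by
  have h := learner_cost (A := A) (ω := ω) (s := startState A ε η δ) startState_num_zero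
    (fun a ha => startState_num_of_ne ha) (Nat.ceil_pos.2 (one_div_pos.2 hε.1))
    (p := paramTotal A ε η δ) le_rfl
  obtain ⟨h1, h2, h3, h4⟩ := h
  rw [show (startState A ε η δ).steps = 0 from rfl, zero_add] at h2
  rw [show (startState A ε η δ).trainDrawn = 0 from rfl,
    show (startState A ε η δ).testDrawn = 0 from rfl, zero_add, zero_add] at h3
  rw [show (startState A ε η δ).calls = 0 from rfl, zero_add] at h4
  exact ⟨h1, h2, h3, h4⟩

lemma predictedState_cost (hε : ε ∈ Ioo (0 : ℝ) 1) (x : X) :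
    (predictedState learner predictor A ε η δ ω x).steps ≤ paramTotal A ε η δ ^ stepDeg ∧
    (predictedState learner predictor A ε η δ ω x).calls ≤
      callTotal A ⌈1 / ε⌉₊ ⌈Real.log (1 / δ)⌉₊ := by
  have := rnds_ne_zero (A := A) hε
  have h := predictor_cost (A := A) (ω := ω)
    (s := { (learnedState learner A ε η δ ω).setPt 0 0 x with steps := 0, calls := 0 })
    (learnedState_spec (η := η) (δ := δ)).1 (Nat.ceil_pos.2 (one_div_pos.2 hε.1))
    (p := paramTotal A ε η δ) le_rfl (learnedState_cost hε).1
  simpa [predictedState] using h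

end states

lemma predictor_deterministic : predictor.Deterministic := by
  simp [predictor, votes, eval_deterministic, Cmd.Deterministic]

/-- The total time, from bounds for its two parts. -/
lemma totalTime_le {X : Type*} [MeasurableSpace X] (A : TDSAlgorithm X) {s : MState X} {a b : ℝ}
    (hc : (s.calls : ℝ) ≤ a) (hs : (s.steps : ℝ) ≤ b) :
    (s.totalTime A : ℝ) ≤ A.time * a + b := by
  rw [MState.totalTime]
  push_cast
  gcongr

end Boost

end

theorem theoremC3 :
    ∃ learner predictor : Cmd, predictor.Deterministic ∧
      ∀ B : ℝ, 1 ≤ B → ∃ K : ℕ,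
        ∀ (X : Type u) [MeasurableSpace X] [Nonempty X] (C : Set (X → Bool)),
          C.Nonempty → (∀ f ∈ C, Measurable f) →
        ∀ A : ℝ → TDSAlgorithm X,
          (∀ ε ∈ Ioo (0 : ℝ) 1, IsAgnosticTDSLearner (A ε) C B ε (1 / 100)) →
        ∀ ε ∈ Ioo (0 : ℝ) 1, ∀ η ∈ Ioo (0 : ℝ) 1, ∀ δ ∈ Ioo (0 : ℝ) 1,
          IsAgnosticPQLearner learner predictor (A ε) ε η δ C (K / η) (K * ε) (K * (η + ε)) ∧
          (∀ ω : Tape X,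
            ((learnedState learner (A ε) ε η δ ω).totalTime (A ε) : ℝ) ≤
              (A ε).time * softSixth K (A ε).sampleSize ε δ +
                polyBound K (A ε).sampleSize ε η δ) ∧
          (∀ (ω : Tape X) (x : X),
            ((predictedState learner predictor (A ε) ε η δ ω x).totalTime (A ε) : ℝ) ≤
              (A ε).time * softSixth K (A ε).sampleSize ε δ +
                polyBound K (A ε).sampleSize ε η δ) ∧
          (∀ ω : Tape X,
            ((learnedState learner (A ε) ε η δ ω).trainDrawn +
              (learnedState learner (A ε) ε η δ ω).testDrawn : ℝ) ≤
                polyBound K (A ε).sampleSize ε η δ) := by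
  open Boost in
  refine ⟨learner, predictor, predictor_deterministic, fun B hB => ?_⟩
  -- `8 ^ stepDeg` serves the polynomial bounds, `10 ^ 31` the soft bound, `480 * B` the test error
  obtain ⟨K, hK1, hK2, hK3⟩ : ∃ K : ℕ, 8 ^ stepDeg ≤ K ∧ 10 ^ 31 ≤ K ∧ 480 * B ≤ K := by
    refine ⟨max (8 ^ stepDeg) (max (10 ^ 31) ⌈480 * B⌉₊), le_max_left _ _,
      (le_max_left _ _).trans (le_max_right _ _), (Nat.le_ceil _).trans ?_⟩
    exact_mod_cast (le_max_right (10 ^ 31) ⌈480 * B⌉₊).trans (le_max_right _ _)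
  refine ⟨K, fun X _ _ C hC _ A hA ε hε η hη δ hδ => ⟨?_, fun ω => ?_, fun ω x => ?_, fun ω => ?_⟩⟩
  · intro Dtrain Dtest _ _
    have hE : NeZero ⌈1 / ε⌉₊ := ⟨(Nat.ceil_pos.2 (one_div_pos.2 hε.1)).ne'⟩
    have hr := rnds_ne_zero (A := A ε) hε
    have key := tapeLaw_vote_bad_le Dtrain Dtest hC hB (hA ε hε) (E := ⌈1 / ε⌉₊) (H := ⌈1 / η⌉₊)
      (L := ⌈Real.log (1 / δ)⌉₊) (η := η) (Nat.ceil_pos.2 (log_one_div_pos hδ)) hε.1.le hη.1.le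
      (one_div_ceil_le hε.1) (Nat.ceil_pos.2 (one_div_pos.2 hη.1)) (one_div_ceil_le hη.1)
    refine (measure_mono fun ω hω => ?_).trans
      (key.trans (ENNReal.ofReal_le_ofReal (exp_neg_ceil_log_le hδ.1)))
    intro ⟨h1, h2⟩
    refine hω ?_
    have e := fun x => out_eq_vote (A := A ε) (ε := ε) (η := η) (δ := δ) (ω := ω) x
    simp only [(e _).1, (e _).2]
    rw [← ofReal_measureReal, ← ofReal_measureReal]
    have hl := jointError_nonneg C Dtrain Dtest
    have hK4 : (10 : ℝ) ^ 31 ≤ K := by exact_mod_cast hK2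
    refine ⟨ENNReal.ofReal_le_ofReal (h1.trans ?_), ENNReal.ofReal_le_ofReal (h2.trans ?_)⟩
    · have hH := ceil_one_div_le hη
      calc 12 * (20 * B * ⌈1 / η⌉₊ * jointError C Dtrain Dtest + 5 * ε)
          ≤ 12 * (20 * B * (2 * (1 / η)) * jointError C Dtrain Dtest + 5 * ε) := by gcongr
        _ = 480 * B / η * jointError C Dtrain Dtest + 60 * ε := by ring
        _ ≤ K / η * jointError C Dtrain Dtest + K * ε := by
          have := hη.1
          have := hε.1
          gcongr
          linarith
    · have : 0 ≤ η + ε := add_nonneg hη.1.le hε.1.le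
      calc 12 * (6 * (η + ε)) = 72 * (η + ε) := by ring
        _ ≤ K * (η + ε) := by gcongr; linarith
  · obtain ⟨-, h2, -, h4⟩ := learnedState_cost (A := A ε) (η := η) (δ := δ) (ω := ω) hε
    exact totalTime_le _ (le_trans (by exact_mod_cast h4) (callTotal_le hε hδ hK2))
      (le_trans (by exact_mod_cast h2) (paramTotal_pow_le hε hη hδ hK1))
  · obtain ⟨h2, h4⟩ := predictedState_cost (A := A ε) (η := η) (δ := δ) (ω := ω) hε x
    exact totalTime_le _ (le_trans (by exact_mod_cast h4) (callTotal_le hε hδ hK2))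
      (le_trans (by exact_mod_cast h2) (paramTotal_pow_le hε hη hδ hK1))
  · obtain ⟨-, -, h3, -⟩ := learnedState_cost (A := A ε) (η := η) (δ := δ) (ω := ω) hε
    exact le_trans (by exact_mod_cast h3) (paramTotal_pow_le hε hη hδ hK1)
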